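/- A convex polygon is represented by the array $v_1,\dots,v_n$ of its vertices (corners) in counterclockwise order; $Q$ denotes the closed region it bounds. Degenerate polygons are allowed: a single point ($n=1$) and a segment, given by its two endpoints ($n=2$). The perimeter of a convex polygon is the sum of the lengths of its edges $v_1v_2,\dots,v_{n-1}v_n,v_nv_1$ (so it is twice the length for a segment, and $0$ for a point). For a vertex $v_i$, let $\operatorname{per}_Q(v_1,v_i)=\sum_{j<i}|v_jv_{j+1}|$ be the length of the part of the boundary of $Q$ from $v_1$ to $v_i$ in counterclockwise order. The model of computation is the real RAM with square roots: memory consists of integer cells and real cells, addressable by computed integers; addition, subtraction and halving of integers, the field operations and square roots of reals, comparisons, memory accesses and assignments each take one unit of time; there is no rounding or other conversion between reals and integers. There are a single real RAM program and a constant $C$ such that the following holds. Let $\mathcal Q$ be a collection of $k$ pairwise disjoint convex polygons with $m\ge 2$ vertices in total. Suppose that the memory contains $k$ and, for each $Q\in\mathcal Q$, the number of its vertices and the address of an array that stores its vertices $v_1,v_2,\dots$ (by their coordinates) in counterclockwise order together with the value $\operatorname{per}_Q(v_1,v_i)$ for each vertex $v_i$; the rest of the memory may have arbitrary contents. Then the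 program halts after at most $C\,k\log m$ time units and outputs the perimeter of the convex hull of $\bigcup_{Q\in\mathcal Q}Q$. In short: the perimeter of the convex hull of the union can be computed in $O(k\log m)$ time. -/

import Mathlib

/-- The Euclidean plane. -/
abbrev Plane := EuclideanSpace ℝ (Fin 2)

/-- Twice the signed area of the triangle `a b c`; positive iff `a, b, c` make a left turn. -/
def orient (a b c : Plane) : ℝ :=
  (b 0 - a 0) * (c 1 - a 1) - (b 1 - a 1) * (c 0 - a 0)

/-- `v 0, v 1, …, v (n - 1)` are the vertices (corners) of a convex polygon, listed in
counterclockwise order.  Besides proper polygons (`n ≥ 3`) this admits the degenerate ones: a single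
point (`n = 1`) and a segment given by its two endpoints (`n = 2`). -/
structure IsConvexPolygon {n : ℕ} (v : Fin n → Plane) : Prop where
  pos : 0 < n
  injective : Function.Injective v
  ccw : ∀ i j l : Fin n, i < j → j < l → 0 < orient (v i) (v j) (v l)

/-- The region (boundary and interior) of the convex polygon with vertices `v`. -/
def region {n : ℕ} (v : Fin n → Plane) : Set Plane := convexHull ℝ (Set.range v)

/-- The length of the edge that leaves vertex `j` in the cyclic order of the vertices. -/
noncomputable def edgeLength {n : ℕ} (v : Fin n → Plane) (j : Fin n) : ℝ :=
  dist (v j) (v (finRotate n j))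

/-- The length of the boundary from the first vertex to vertex `i`, in the order of the array. -/
noncomputable def prefixLength {n : ℕ} (v : Fin n → Plane) (i : Fin n) : ℝ :=
  ∑ j ∈ Finset.Iio i, edgeLength v j

/-- `L` is the perimeter of `S`, that is, `S` is the region of a convex polygon and `L` is
the sum of the lengths of the edges of that polygon.  As usual, a segment counts as a polygon
with two coinciding edges (perimeter twice its length), and a point has perimeter `0`. -/
def IsPerimeter (S : Set Plane) (L : ℝ) : Prop :=
  ∃ (n : ℕ) (w : Fin n → Plane),
    IsConvexPolygon w ∧ region w = S ∧ L = ∑ j, edgeLength w j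

/-! ## The real RAM

A real RAM with square roots.  There are integer cells and real cells, organised as variables and
arrays.  A program is a fixed finite text and so names only finitely many variables and arrays;
each array is unbounded and is addressed by a computed integer.  Integers
support addition, truncated subtraction and halving; reals support the field operations
and the square root.  A real number can influence integers and the flow of control only through
comparisons: there is no rounding and no conversion between reals and integers.
Every constant, memory access, operation, comparison and assignment costs one time unit. -/

namespace RealRAM

/-- The contents of the memory. -/
structure State where
  natVar : ℕ → ℕ
  realVar : ℕ → ℝ
  natArr : ℕ → ℕ → ℕ
  realArr : ℕ → ℕ → ℝ

/-- Integer expressions. -/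
inductive NExp where
  | const (c : ℕ)
  | var (x : ℕ)
  | arr (a : ℕ) (i : NExp)
  | add (e f : NExp)
  | sub (e f : NExp)
  | half (e : NExp)

/-- Real expressions. -/
inductive RExp where
  | const (c : ℚ)
  | var (x : ℕ)
  | arr (a : ℕ) (i : NExp)
  | add (e f : RExp)
  | sub (e f : RExp)
  | mul (e f : RExp)
  | div (e f : RExp)
  | sqrt (e : RExp)

/-- Conditions. -/
inductive BExp where
  | natLe (e f : NExp)
  | realLe (e f : RExp)
  | not (b : BExp)
  | and (b c : BExp)

/-- Programs. -/
inductive Prog where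
  | skip
  | setNat (x : ℕ) (e : NExp)
  | setReal (x : ℕ) (e : RExp)
  | storeNat (a : ℕ) (i e : NExp)
  | storeReal (a : ℕ) (i : NExp) (e : RExp)
  | seq (p q : Prog)
  | ite (b : BExp) (p q : Prog)
  | loop (b : BExp) (p : Prog)

/-- Value of an integer expression. -/
def NExp.eval (s : State) : NExp → ℕ
  | .const c => c
  | .var x => s.natVar x
  | .arr a i => s.natArr a (i.eval s)
  | .add e f => e.eval s + f.eval s
  | .sub e f => e.eval s - f.eval s
  | .half e => e.eval s / 2

/-- Time to evaluate an integer expression. -/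
def NExp.cost : NExp → ℕ
  | .const _ => 1
  | .var _ => 1
  | .arr _ i => i.cost + 1
  | .add e f => e.cost + f.cost + 1
  | .sub e f => e.cost + f.cost + 1
  | .half e => e.cost + 1

/-- Value of a real expression. -/
noncomputable def RExp.eval (s : State) : RExp → ℝ
  | .const c => (c : ℝ)
  | .var x => s.realVar x
  | .arr a i => s.realArr a (i.eval s)
  | .add e f => e.eval s + f.eval s
  | .sub e f => e.eval s - f.eval s
  | .mul e f => e.eval s * f.eval s
  | .div e f => e.eval s / f.eval s
  | .sqrt e => Real.sqrt (e.eval s)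

/-- Time to evaluate a real expression. -/
def RExp.cost : RExp → ℕ
  | .const _ => 1
  | .var _ => 1
  | .arr _ i => i.cost + 1
  | .add e f => e.cost + f.cost + 1
  | .sub e f => e.cost + f.cost + 1
  | .mul e f => e.cost + f.cost + 1
  | .div e f => e.cost + f.cost + 1
  | .sqrt e => e.cost + 1

/-- Truth of a condition. -/
def BExp.eval (s : State) : BExp → Prop
  | .natLe e f => e.eval s ≤ f.eval s
  | .realLe e f => e.eval s ≤ f.eval s
  | .not b => ¬ b.eval s
  | .and b c => b.eval s ∧ c.eval s

/-- Time to evaluate a condition. -/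
def BExp.cost : BExp → ℕ
  | .natLe e f => e.cost + f.cost + 1
  | .realLe e f => e.cost + f.cost + 1
  | .not b => b.cost + 1
  | .and b c => b.cost + c.cost + 1

/-- Write `c` to the integer variable `x`. -/
def State.setNat (s : State) (x c : ℕ) : State :=
  { s with natVar := Function.update s.natVar x c }

/-- Write `c` to the real variable `x`. -/
noncomputable def State.setReal (s : State) (x : ℕ) (c : ℝ) : State :=
  { s with realVar := Function.update s.realVar x c }

/-- Write `c` to cell `i` of the integer array `a`. -/
def State.storeNat (s : State) (a i c : ℕ) : State :=
  { s with natArr := Function.update s.natArr a (Function.update (s.natArr a) i c) }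

/-- Write `c` to cell `i` of the real array `a`. -/
noncomputable def State.storeReal (s : State) (a i : ℕ) (c : ℝ) : State :=
  { s with realArr := Function.update s.realArr a (Function.update (s.realArr a) i c) }

/-- `Exec p s t s'`: started in state `s`, the program `p` halts after exactly `t` time units, in
state `s'`. -/
inductive Exec : Prog → State → ℕ → State → Prop
  | skip (s : State) : Exec .skip s 1 s
  | setNat (s : State) (x : ℕ) (e : NExp) :
      Exec (.setNat x e) s (e.cost + 1) (s.setNat x (e.eval s))
  | setReal (s : State) (x : ℕ) (e : RExp) :
      Exec (.setReal x e) s (e.cost + 1) (s.setReal x (e.eval s))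
  | storeNat (s : State) (a : ℕ) (i e : NExp) :
      Exec (.storeNat a i e) s (i.cost + e.cost + 1) (s.storeNat a (i.eval s) (e.eval s))
  | storeReal (s : State) (a : ℕ) (i : NExp) (e : RExp) :
      Exec (.storeReal a i e) s (i.cost + e.cost + 1) (s.storeReal a (i.eval s) (e.eval s))
  | seq {p q : Prog} {s s' s'' : State} {t t' : ℕ} :
      Exec p s t s' → Exec q s' t' s'' → Exec (.seq p q) s (t + t') s''
  | iteTrue {b : BExp} {p : Prog} (q : Prog) {s s' : State} {t : ℕ} :
      b.eval s → Exec p s t s' → Exec (.ite b p q) s (b.cost + t) s'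
  | iteFalse {b : BExp} (p : Prog) {q : Prog} {s s' : State} {t : ℕ} :
      ¬ b.eval s → Exec q s t s' → Exec (.ite b p q) s (b.cost + t) s'
  | loopFalse {b : BExp} (p : Prog) {s : State} :
      ¬ b.eval s → Exec (.loop b p) s b.cost s
  | loopTrue {b : BExp} {p : Prog} {s s' s'' : State} {t t' : ℕ} :
      b.eval s → Exec p s t s' → Exec (.loop b p) s' t' s'' →
        Exec (.loop b p) s (b.cost + t + t') s''

end RealRAM

/-- The memory `s` stores the `k` polygons `v 0, …, v (k - 1)`.  Integer variable `0` holds `k`;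
integer arrays `0` and `1` hold, for each polygon, its number of vertices and the address at which its
vertex array begins; from this address on, real arrays `0`, `1` and `2` hold the
`x`-coordinates and the `y`-coordinates of the vertices, in order, and the lengths of the boundary
from the first vertex to each vertex.
The contents of all other cells are arbitrary. -/
structure Stores (s : RealRAM.State) {k : ℕ} {n : Fin k → ℕ}
    (v : (i : Fin k) → Fin (n i) → Plane) : Prop where
  count : s.natVar 0 = k
  size : ∀ i : Fin k, s.natArr 0 i = n i
  xCoord : ∀ (i : Fin k) (j : Fin (n i)), s.realArr 0 (s.natArr 1 i + j) = v i j 0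
  yCoord : ∀ (i : Fin k) (j : Fin (n i)), s.realArr 1 (s.natArr 1 i + j) = v i j 1
  boundary : ∀ (i : Fin k) (j : Fin (n i)),
    s.realArr 2 (s.natArr 1 i + j) = prefixLength (v i) j

/-! The leftmost and the rightmost point split the boundary of the hull into a lower and an upper
part. The reflection `x ↦ -x` turns the upper part into a lower one and preserves orientations and
lengths, so a single procedure with a scale `σ = ±1` computes both. "Left of" always means
lexicographically smaller (`key`), so vertical lines mostly need no separate treatment.

For each polygon, binary search finds the leftmost and the rightmost vertex, since the keys are
unimodal along a convex cycle (`ConvexCycle.before_min_iff`). These `2 * k` end points are the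
events of a sweep. A point of a polygon `A` can matter for the lower hull only if it is essential,
that is, not above the chord joining the extremes of another polygon `B`. For disjoint convex sets
this forces the constant-time relation `Below` between `A` and `B`, which inspects the two chords
only (`orient_pos_of_disjoint`, `Scene.below_of_essential`). The active polygons therefore need not
be kept in sorted order: in a tournament tree, an entry that beats every other one is at the root,
whatever the relation does elsewhere (`IsTree.root_eq`). Between two successive events only the arc
of the root polygon has to be considered. If the root is not what it should be, there is no
essential point to miss, and adding its arc does no harm, because the arc consists of vertices
(`Scene.sweep_step`).

The arcs arrive from left to right and go onto a stack, as in Graham's scan. The bridge from the top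
arc to the new arc is found by a simultaneous binary search on both (`BridgeRange.isBridge`). If it
starts at the first point of the top arc and makes no left turn with the entry before, the top arc
is removed. Every removal is paid for by the insertion of that arc, so there are `O(k)` bridge
searches of `O(log m)` time each (`pushLoop_spec`). Discarded points stay above the remaining chain.

In every direction a lowest vertex is essential, hence in the end all vertices lie above the stack
(`Scene.above_of_sweep`). A separating functional then shows that the lower and the upper chain
together bound the convex hull (`isPerimeter_of_arcs`). The stored prefix lengths yield the length
of each arc in constant time, and the bridges are measured by square roots. -/

/-! ## Reasoning about programs of the real RAM -/

namespace RealRAM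

attribute [simp] NExp.eval RExp.eval BExp.eval

/-! ### Reading after writing. -/

section Memory

variable (s : State)

@[simp] theorem setNat_natVar (x c y : ℕ) :
    (s.setNat x c).natVar y = if y = x then c else s.natVar y := by
  simp [State.setNat, Function.update_apply]

@[simp] theorem setNat_realVar (x c : ℕ) : (s.setNat x c).realVar = s.realVar := rfl

@[simp] theorem setNat_natArr (x c : ℕ) : (s.setNat x c).natArr = s.natArr := rfl

@[simp] theorem setNat_realArr (x c : ℕ) : (s.setNat x c).realArr = s.realArr := rfl

@[simp] theorem setReal_realVar (x : ℕ) (c : ℝ) (y : ℕ) :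
    (s.setReal x c).realVar y = if y = x then c else s.realVar y := by
  simp [State.setReal, Function.update_apply]

@[simp] theorem setReal_natVar (x : ℕ) (c : ℝ) : (s.setReal x c).natVar = s.natVar := rfl

@[simp] theorem setReal_natArr (x : ℕ) (c : ℝ) : (s.setReal x c).natArr = s.natArr := rfl

@[simp] theorem setReal_realArr (x : ℕ) (c : ℝ) : (s.setReal x c).realArr = s.realArr := rfl

@[simp] theorem storeNat_natArr (a i c b : ℕ) :
    (s.storeNat a i c).natArr b =
      if b = a then Function.update (s.natArr a) i c else s.natArr b := by
  by_cases h : b = a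
  · subst h; simp [State.storeNat]
  · simp [State.storeNat, h]

@[simp] theorem storeNat_natVar (a i c : ℕ) : (s.storeNat a i c).natVar = s.natVar := rfl

@[simp] theorem storeNat_realVar (a i c : ℕ) : (s.storeNat a i c).realVar = s.realVar := rfl

@[simp] theorem storeNat_realArr (a i c : ℕ) : (s.storeNat a i c).realArr = s.realArr := rfl

@[simp] theorem storeReal_realArr (a i : ℕ) (c : ℝ) (b : ℕ) :
    (s.storeReal a i c).realArr b =
      if b = a then Function.update (s.realArr a) i c else s.realArr b := by
  by_cases h : b = a
  · subst h; simp [State.storeReal]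
  · simp [State.storeReal, h]

@[simp] theorem storeReal_natVar (a i : ℕ) (c : ℝ) : (s.storeReal a i c).natVar = s.natVar := rfl

@[simp] theorem storeReal_realVar (a i : ℕ) (c : ℝ) :
    (s.storeReal a i c).realVar = s.realVar := rfl

@[simp] theorem storeReal_natArr (a i : ℕ) (c : ℝ) : (s.storeReal a i c).natArr = s.natArr := rfl

end Memory

/-! ### Footprints, time bounds and weakest preconditions of programs. -/

namespace Prog

/-- Sequential composition of a list of programs. -/
def block : List Prog → Prog
  | [] => .skip
  | p :: l => .seq p (block l)

/-- The integer variables that a program may write. -/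
def natVars : Prog → List ℕ
  | .setNat x _ => [x]
  | .seq p q => p.natVars ++ q.natVars
  | .ite _ p q => p.natVars ++ q.natVars
  | .loop _ p => p.natVars
  | _ => []

/-- The real variables that a program may write. -/
def realVars : Prog → List ℕ
  | .setReal x _ => [x]
  | .seq p q => p.realVars ++ q.realVars
  | .ite _ p q => p.realVars ++ q.realVars
  | .loop _ p => p.realVars
  | _ => []

/-- The integer arrays that a program may write. -/
def natArrs : Prog → List ℕ
  | .storeNat a _ _ => [a]
  | .seq p q => p.natArrs ++ q.natArrs
  | .ite _ p q => p.natArrs ++ q.natArrs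
  | .loop _ p => p.natArrs
  | _ => []

/-- The real arrays that a program may write. -/
def realArrs : Prog → List ℕ
  | .storeReal a _ _ => [a]
  | .seq p q => p.realArrs ++ q.realArrs
  | .ite _ p q => p.realArrs ++ q.realArrs
  | .loop _ p => p.realArrs
  | _ => []

/-- A bound for the running time of a program without loops. -/
def time : Prog → ℕ
  | .skip => 1
  | .setNat _ e => e.cost + 1
  | .setReal _ e => e.cost + 1
  | .storeNat _ i e => i.cost + e.cost + 1
  | .storeReal _ i e => i.cost + e.cost + 1
  | .seq p q => p.time + q.time
  | .ite b p q => b.cost + max p.time q.time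
  -- A dummy value: `vc` is `False` for loops, so `Within.of_vc` never relies on it.
  | .loop _ _ => 0

/-- A condition on the initial state under which a program without loops establishes `Q`. -/
def vc : Prog → (State → Prop) → State → Prop
  | .skip, Q, s => Q s
  | .setNat x e, Q, s => Q (s.setNat x (e.eval s))
  | .setReal x e, Q, s => Q (s.setReal x (e.eval s))
  | .storeNat a i e, Q, s => Q (s.storeNat a (i.eval s) (e.eval s))
  | .storeReal a i e, Q, s => Q (s.storeReal a (i.eval s) (e.eval s))
  | .seq p q, Q, s => p.vc (q.vc Q) s
  | .ite b p q, Q, s => (b.eval s → p.vc Q s) ∧ (¬ b.eval s → q.vc Q s)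
  | .loop _ _, _, _ => False

end Prog

/-- `s'` differs from `s` only in variables and arrays that `p` may write. -/
structure Agree (p : Prog) (s s' : State) : Prop where
  natVar : ∀ x, x ∉ p.natVars → s'.natVar x = s.natVar x
  realVar : ∀ x, x ∉ p.realVars → s'.realVar x = s.realVar x
  natArr : ∀ a, a ∉ p.natArrs → s'.natArr a = s.natArr a
  realArr : ∀ a, a ∉ p.realArrs → s'.realArr a = s.realArr a

namespace Agree

theorem refl (p : Prog) (s : State) : Agree p s s :=
  ⟨fun _ _ => rfl, fun _ _ => rfl, fun _ _ => rfl, fun _ _ => rfl⟩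

theorem trans {p : Prog} {s s' s'' : State} (h : Agree p s s') (h' : Agree p s' s'') :
    Agree p s s'' :=
  ⟨fun x hx => (h'.natVar x hx).trans (h.natVar x hx),
    fun x hx => (h'.realVar x hx).trans (h.realVar x hx),
    fun x hx => (h'.natArr x hx).trans (h.natArr x hx),
    fun x hx => (h'.realArr x hx).trans (h.realArr x hx)⟩

theorem mono {p q : Prog} {s s' : State} (h : Agree p s s') (h₁ : p.natVars ⊆ q.natVars)
    (h₂ : p.realVars ⊆ q.realVars) (h₃ : p.natArrs ⊆ q.natArrs) (h₄ : p.realArrs ⊆ q.realArrs) :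
    Agree q s s' :=
  ⟨fun x hx => h.natVar x fun h' => hx (h₁ h'), fun x hx => h.realVar x fun h' => hx (h₂ h'),
    fun x hx => h.natArr x fun h' => hx (h₃ h'), fun x hx => h.realArr x fun h' => hx (h₄ h')⟩

theorem seq_left {p q : Prog} {s s' : State} (h : Agree p s s') : Agree (.seq p q) s s' :=
  h.mono (by simp [Prog.natVars]) (by simp [Prog.realVars]) (by simp [Prog.natArrs])
    (by simp [Prog.realArrs])

theorem seq_right {p q : Prog} {s s' : State} (h : Agree q s s') : Agree (.seq p q) s s' :=
  h.mono (by simp [Prog.natVars]) (by simp [Prog.realVars]) (by simp [Prog.natArrs])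
    (by simp [Prog.realArrs])

end Agree

/-- The frame rule. The footprint is syntactic, and an array counts as a whole, so preservation of a
cell reduces to a membership question that `simp` decides. -/
theorem Exec.agree {p : Prog} {s s' : State} {t : ℕ} (h : Exec p s t s') : Agree p s s' := by
  induction h with
  | skip s => exact .refl _ _
  | setNat s x e =>
    exact ⟨fun y hy => by simp_all [Prog.natVars], fun _ _ => rfl, fun _ _ => rfl, fun _ _ => rfl⟩
  | setReal s x e =>
    exact ⟨fun _ _ => rfl, fun y hy => by simp_all [Prog.realVars], fun _ _ => rfl, fun _ _ => rfl⟩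
  | storeNat s a i e =>
    exact ⟨fun _ _ => rfl, fun _ _ => rfl, fun y hy => by simp_all [Prog.natArrs], fun _ _ => rfl⟩
  | storeReal s a i e =>
    exact ⟨fun _ _ => rfl, fun _ _ => rfl, fun _ _ => rfl, fun y hy => by simp_all [Prog.realArrs]⟩
  | seq _ _ ih ih' => exact ih.seq_left.trans ih'.seq_right
  | iteTrue q _ _ ih =>
    exact ih.mono (by simp [Prog.natVars]) (by simp [Prog.realVars]) (by simp [Prog.natArrs])
      (by simp [Prog.realArrs])
  | iteFalse q _ _ ih =>
    exact ih.mono (by simp [Prog.natVars]) (by simp [Prog.realVars]) (by simp [Prog.natArrs])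
      (by simp [Prog.realArrs])
  | loopFalse p _ => exact .refl _ _
  | loopTrue _ _ _ ih ih' =>
    exact (ih.mono (by simp [Prog.natVars]) (by simp [Prog.realVars]) (by simp [Prog.natArrs])
      (by simp [Prog.realArrs])).trans ih'

/-- Started in state `s`, the program `p` halts after at most `T` time units in a state that
satisfies `Q`. -/
def Within (p : Prog) (T : ℕ) (s : State) (Q : State → Prop) : Prop :=
  ∃ t s', Exec p s t s' ∧ t ≤ T ∧ Q s'

namespace Within

variable {p q : Prog} {T T' : ℕ} {s : State} {Q Q' : State → Prop}

/-- The new postcondition may use `Agree p s s'`. Specifications therefore state only what a program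
changes; everything else is recovered from the footprint when programs are composed. -/
theorem mono (h : Within p T s Q) (hT : T ≤ T') (hQ : ∀ s', Agree p s s' → Q s' → Q' s') :
    Within p T' s Q' := by
  obtain ⟨t, s', he, ht, hq⟩ := h
  exact ⟨t, s', he, ht.trans hT, hQ s' he.agree hq⟩

theorem imp (h : Within p T s Q) (hQ : ∀ s', Agree p s s' → Q s' → Q' s') : Within p T s Q' :=
  h.mono le_rfl hQ

theorem seq (h : Within p T s fun s' => Within q T' s' Q) : Within (.seq p q) (T + T') s Q := by
  obtain ⟨t, s', he, ht, t', s'', he', ht', hq⟩ := h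
  exact ⟨_, s'', .seq he he', add_le_add ht ht', hq⟩

theorem ite {b : BExp} (h : b.eval s → Within p T s Q) (h' : ¬ b.eval s → Within q T s Q) :
    Within (.ite b p q) (b.cost + T) s Q := by
  by_cases hb : b.eval s
  · obtain ⟨t, s', he, ht, hq⟩ := h hb
    exact ⟨_, s', .iteTrue q hb he, by omega, hq⟩
  · obtain ⟨t, s', he, ht, hq⟩ := h' hb
    exact ⟨_, s', .iteFalse p hb he, by omega, hq⟩

/-- Reduces a block without loops to a symbolic evaluation by `simp`. The `max` in `time` makes one
bound valid for both branches of a conditional. -/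
theorem of_vc : ∀ {p : Prog} {s : State} {Q : State → Prop}, p.vc Q s → Within p p.time s Q
  | .skip, s, _, h => ⟨_, _, .skip s, le_rfl, h⟩
  | .setNat x e, s, _, h => ⟨_, _, .setNat s x e, le_rfl, h⟩
  | .setReal x e, s, _, h => ⟨_, _, .setReal s x e, le_rfl, h⟩
  | .storeNat a i e, s, _, h => ⟨_, _, .storeNat s a i e, le_rfl, h⟩
  | .storeReal a i e, s, _, h => ⟨_, _, .storeReal s a i e, le_rfl, h⟩
  | .seq p q, _, _, h =>
    seq ((of_vc (p := p) h).imp fun _ _ h' => of_vc (p := q) h')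
  | .ite _ _ _, _, _, h =>
    ite (fun hb => (of_vc (h.1 hb)).mono (le_max_left _ _) fun _ _ h' => h')
      (fun hb => (of_vc (h.2 hb)).mono (le_max_right _ _) fun _ _ h' => h')

/-- A loop whose body pays for itself by lowering the potential `Φ`. -/
theorem loop {b : BExp} (I : State → Prop) (Φ : State → ℕ) (hI : I s)
    (hcost : ∀ s, I s → b.cost ≤ Φ s)
    (hbody : ∀ s, I s → b.eval s →
      ∃ T, Within p T s fun s' => I s' ∧ b.cost + T + Φ s' ≤ Φ s) :
    Within (.loop b p) (Φ s) s fun s' => I s' ∧ ¬ b.eval s' := by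
  suffices H : ∀ N, ∀ s, I s → Φ s ≤ N →
      Within (.loop b p) (Φ s) s fun s' => I s' ∧ ¬ b.eval s' from H _ s hI le_rfl
  intro N
  induction N using Nat.strong_induction_on with
  | _ N ih =>
    intro s hs hN
    by_cases hb : b.eval s
    · obtain ⟨T, t, s', he, ht, hs', hΦ⟩ := hbody s hs hb
      -- Each test costs at least one unit, so the potential drops strictly; it serves as
      -- termination measure and as time bound at once.
      have hpos : 0 < b.cost := by cases b <;> simp [BExp.cost]
      obtain ⟨t', s'', he', ht', hq⟩ := ih (Φ s') (by omega) s' hs' le_rfl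
      exact ⟨_, s'', .loopTrue hb he he', by omega, hq⟩
    · exact ⟨_, s, .loopFalse p hb, hcost s hs, hs, hb⟩

/-- A loop with at most `f s` iterations, each of which takes at most `T` time units. -/
theorem loop_of_le {b : BExp} (I : State → Prop) (f : State → ℕ) (T : ℕ) (hI : I s)
    (hbody : ∀ s, I s → b.eval s → Within p T s fun s' => I s' ∧ f s' < f s) :
    Within (.loop b p) ((b.cost + T) * (f s + 1)) s fun s' => I s' ∧ ¬ b.eval s' := by
  -- The `+ 1` pays for the last test, the one that fails.
  refine loop I (fun s => (b.cost + T) * (f s + 1)) hI (fun s _ => ?_) fun s hs hb =>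
    ⟨T, (hbody s hs hb).imp fun s' _ h => ⟨h.1, ?_⟩⟩
  · exact (Nat.le_add_right _ _).trans (Nat.le_mul_of_pos_right _ (Nat.succ_pos _))
  · have : (b.cost + T) * (f s' + 1 + 1) ≤ (b.cost + T) * (f s + 1) :=
      Nat.mul_le_mul_left _ (by have := h.2; omega)
    rw [Nat.mul_succ] at this
    omega

end Within

end RealRAM


/-! ## Lexicographic order and orientation in the plane -/

/-- The coordinates of a point, to be compared lexicographically. -/
def key (p : Plane) : ℝ ×ₗ ℝ := toLex (p 0, p 1)

theorem key_lt_iff {p q : Plane} : key p < key q ↔ p 0 < q 0 ∨ p 0 = q 0 ∧ p 1 < q 1 := by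
  simp [key, Prod.Lex.toLex_lt_toLex]

theorem key_le_iff {p q : Plane} : key p ≤ key q ↔ p 0 < q 0 ∨ p 0 = q 0 ∧ p 1 ≤ q 1 := by
  simp [key, Prod.Lex.toLex_le_toLex]

theorem plane_ext {p q : Plane} (h₀ : p 0 = q 0) (h₁ : p 1 = q 1) : p = q := by
  ext i; fin_cases i <;> assumption

theorem key_injective : Function.Injective key := fun p q h => by
  have h₁ := key_le_iff.1 h.le
  have h₂ := key_le_iff.1 h.ge
  refine plane_ext ?_ ?_
  · rcases h₁ with h₁ | h₁ <;> rcases h₂ with h₂ | h₂ <;> linarith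
  · rcases h₁ with h₁ | h₁ <;> rcases h₂ with h₂ | h₂ <;> linarith

theorem key_neg_lt_neg {p q : Plane} : key (-p) < key (-q) ↔ key q < key p := by
  simp only [key_lt_iff, PiLp.neg_apply, neg_lt_neg_iff, neg_inj]
  rw [eq_comm]

theorem key_neg_le_neg {p q : Plane} : key (-p) ≤ key (-q) ↔ key q ≤ key p := by
  rw [← not_lt, ← not_lt, key_neg_lt_neg]

theorem fst_le_of_key_le {p q : Plane} (h : key p ≤ key q) : p 0 ≤ q 0 := by
  rcases key_le_iff.1 h with h | h
  exacts [h.le, h.1.le]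

theorem orient_neg (a b c : Plane) : orient (-a) (-b) (-c) = orient a b c := by
  simp only [orient, PiLp.neg_apply]; ring

theorem orient_rotate (a b c : Plane) : orient b c a = orient a b c := by
  simp only [orient]; ring

theorem orient_swap (a b c : Plane) : orient a c b = -orient a b c := by
  simp only [orient]; ring

theorem orient_swap' (a b c : Plane) : orient b a c = -orient a b c := by
  simp only [orient]; ring

theorem orient_self_left (a b : Plane) : orient a a b = 0 := by
  simp only [orient]; ring

theorem orient_self_right (a b : Plane) : orient a b b = 0 := by
  simp only [orient]; ring

theorem orient_self_outer (a b : Plane) : orient a b a = 0 := by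
  simp only [orient]; ring

/-! ### The order of directions by slope. -/

section CrossProduct

variable {a₀ a₁ b₀ b₁ c₀ c₁ : ℝ}

/-- Vectors pointing to the right, or straight up, are ordered by slope, and the cross product
compares slopes. The identity `e₀` writes `b₀` times the outer cross product as a combination of the
two given ones with nonnegative weights; a vertical `b` forces `c` to be vertical. -/
theorem cross_trans (ha : 0 < a₀ ∨ a₀ = 0 ∧ 0 < a₁) (hb : 0 < b₀ ∨ b₀ = 0 ∧ 0 < b₁)
    (hc : 0 < c₀ ∨ c₀ = 0 ∧ 0 < c₁) (h : 0 ≤ a₀ * b₁ - a₁ * b₀) (h' : 0 ≤ b₀ * c₁ - b₁ * c₀) :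
    0 ≤ a₀ * c₁ - a₁ * c₀ ∧
      ((0 < a₀ * b₁ - a₁ * b₀ ∨ 0 < b₀ * c₁ - b₁ * c₀) → 0 < a₀ * c₁ - a₁ * c₀) := by
  have e₀ : b₀ * (a₀ * c₁ - a₁ * c₀) = a₀ * (b₀ * c₁ - b₁ * c₀) + c₀ * (a₀ * b₁ - a₁ * b₀) := by
    ring
  have ha₀ : 0 ≤ a₀ := by rcases ha with h | h <;> linarith
  have hc₀ : 0 ≤ c₀ := by rcases hc with h | h <;> linarith
  rcases hb with hb | ⟨hb, hb'⟩
  · refine ⟨nonneg_of_mul_nonneg_right (by rw [e₀]; positivity) hb, fun hs =>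
      pos_of_mul_pos_right (a := b₀) ?_ hb.le⟩
    · rw [e₀]
      rcases ha with ha | ⟨ha, ha'⟩
      · rcases hc with hc | ⟨hc, hc'⟩
        · rcases hs with hs | hs
          · have := mul_pos hc hs; have := mul_nonneg ha₀ h'; linarith
          · have := mul_pos ha hs; have := mul_nonneg hc₀ h; linarith
        · have : 0 < b₀ * c₁ - b₁ * c₀ := by subst hc; have := mul_pos hb hc'; linarith
          have := mul_pos ha this; have := mul_nonneg hc₀ h; linarith
      · subst ha; have := mul_pos ha' hb; linarith
  · subst hb
    have hc₁ : c₀ = 0 := by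
      by_contra hne
      have : 0 < c₀ := lt_of_le_of_ne hc₀ (Ne.symm hne)
      have := mul_pos hb' this; linarith
    subst hc₁
    have hc' : 0 < c₁ := by simpa using hc
    refine ⟨by simpa using mul_nonneg ha₀ hc'.le, fun hs => ?_⟩
    rcases hs with hs | hs
    · have : 0 < a₀ := pos_of_mul_pos_left (by simpa using hs) hb'.le
      simpa using mul_pos this hc'
    · simp at hs

end CrossProduct

theorem sub_of_key_lt {p q : Plane} (h : key p < key q) :
    0 < q 0 - p 0 ∨ q 0 - p 0 = 0 ∧ 0 < q 1 - p 1 := by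
  rcases key_lt_iff.1 h with h | h
  · exact Or.inl (by linarith)
  · exact Or.inr ⟨by linarith, by linarith⟩

/-- Orientation is transitive around a point that precedes all others. -/
theorem orient_fan {o x y z : Plane} (hx : key o < key x) (hy : key o < key y) (hz : key o < key z)
    (h : 0 ≤ orient o x y) (h' : 0 ≤ orient o y z) :
    0 ≤ orient o x z ∧ ((0 < orient o x y ∨ 0 < orient o y z) → 0 < orient o x z) :=
  cross_trans (sub_of_key_lt hx) (sub_of_key_lt hy) (sub_of_key_lt hz) h h'

/-- Orientation is transitive around a point that succeeds all others. -/
theorem orient_fan' {o x y z : Plane} (hx : key x < key o) (hy : key y < key o) (hz : key z < key o)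
    (h : 0 ≤ orient o x y) (h' : 0 ≤ orient o y z) :
    0 ≤ orient o x z ∧ ((0 < orient o x y ∨ 0 < orient o y z) → 0 < orient o x z) := by
  have := orient_fan (key_neg_lt_neg.2 hx) (key_neg_lt_neg.2 hy) (key_neg_lt_neg.2 hz)
  simpa only [orient_neg, h, h', forall_const] using this

/-- Each turn is the cross product of two consecutive edges, and `cross_trans` compares the first
edge with the last. So two overlapping left turns entail left turns after leaving out `b` or `c`.
This is the tool for passing from local to global convexity. -/
theorem orient_four {a b c d : Plane} (hab : key a < key b) (hbc : key b < key c)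
    (hcd : key c < key d) (h : 0 ≤ orient a b c) (h' : 0 ≤ orient b c d) :
    (0 ≤ orient a b d ∧ 0 ≤ orient a c d) ∧
      ((0 < orient a b c ∨ 0 < orient b c d) → 0 < orient a b d ∧ 0 < orient a c d) := by
  have e₁ : orient a b c = (b 0 - a 0) * (c 1 - b 1) - (b 1 - a 1) * (c 0 - b 0) := by
    simp only [orient]; ring
  have e₂ : orient b c d = (c 0 - b 0) * (d 1 - c 1) - (c 1 - b 1) * (d 0 - c 0) := by
    simp only [orient]; ring
  have e₃ : orient a b d = orient a b c +
      ((b 0 - a 0) * (d 1 - c 1) - (b 1 - a 1) * (d 0 - c 0)) := by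
    simp only [orient]; ring
  have e₄ : orient a c d = orient b c d +
      ((b 0 - a 0) * (d 1 - c 1) - (b 1 - a 1) * (d 0 - c 0)) := by
    simp only [orient]; ring
  have := cross_trans (sub_of_key_lt hab) (sub_of_key_lt hbc) (sub_of_key_lt hcd)
    (by rw [← e₁]; exact h) (by rw [← e₂]; exact h')
  rw [← e₁, ← e₂] at this
  refine ⟨⟨by linarith, by linarith⟩, fun hs => ⟨?_, ?_⟩⟩ <;> linarith [this.2 hs]

theorem orient_four_left {a b c d : Plane} (hab : key a < key b) (hbc : key b < key c)
    (hcd : key c < key d) (h : 0 < orient a b c) (h' : 0 < orient b c d) : 0 < orient a b d :=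
  ((orient_four hab hbc hcd h.le h'.le).2 (Or.inl h)).1

theorem orient_four_right {a b c d : Plane} (hab : key a < key b) (hbc : key b < key c)
    (hcd : key c < key d) (h : 0 < orient a b c) (h' : 0 < orient b c d) : 0 < orient a c d :=
  ((orient_four hab hbc hcd h.le h'.le).2 (Or.inl h)).2

theorem orient_four_neg {a b c d : Plane} (hab : key a < key b) (hbc : key b < key c)
    (hcd : key c < key d) (h : orient a b c ≤ 0) (h' : orient b c d ≤ 0) :
    (orient a b d ≤ 0 ∧ orient a c d ≤ 0) ∧
      ((orient a b c < 0 ∨ orient b c d < 0) → orient a b d < 0 ∧ orient a c d < 0) := by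
  have e : ∀ x y z : Plane, orient (-z) (-y) (-x) = -orient x y z := fun x y z => by
    simp only [orient, PiLp.neg_apply]; ring
  have := orient_four (key_neg_lt_neg.2 hcd) (key_neg_lt_neg.2 hbc) (key_neg_lt_neg.2 hab)
  simp only [e, Left.nonneg_neg_iff, Left.neg_pos_iff] at this
  have := this h' h
  tauto

/-- The height of a point over the line of slope `a` through the origin. -/
def height (a : ℝ) (p : Plane) : ℝ := p 1 - a * p 0

/-- The height differences, weighted by the horizontal distances to the opposite ends, add up to
`-orient u w t`, so they cannot both be positive; the lexicographic hypotheses settle the vertical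
case. This justifies discarding points above a bridge. -/
theorem height_le_of_orient {u w t : Plane} (hu : key u ≤ key t) (hw : key t ≤ key w)
    (h : 0 ≤ orient u w t) (a : ℝ) : height a u ≤ height a t ∨ height a w ≤ height a t := by
  by_contra! hc
  have e : (w 0 - t 0) * (height a u - height a t) + (t 0 - u 0) * (height a w - height a t) =
      -orient u w t := by simp only [orient, height]; ring
  have h₁ := fst_le_of_key_le hu
  have h₂ := fst_le_of_key_le hw
  have h₃ := mul_nonneg (sub_nonneg.2 h₂) (sub_pos.2 hc.1).le
  have h₄ := mul_nonneg (sub_nonneg.2 h₁) (sub_pos.2 hc.2).le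
  rcases key_le_iff.1 hu with h₅ | h₅
  · have := mul_pos (sub_pos.2 h₅) (sub_pos.2 hc.2); linarith
  · have := hc.1; simp only [height, h₅.1] at this; linarith [h₅.2]

/-- The strict form shows that a vertex of least height for a given slope lies above no chord. -/
theorem height_lt_of_orient {u w t : Plane} (hu : key u ≤ key t) (hw : key t ≤ key w)
    (h : 0 < orient u w t) (a : ℝ) : height a u < height a t ∨ height a w < height a t := by
  by_contra! hc
  have e : (w 0 - t 0) * (height a u - height a t) + (t 0 - u 0) * (height a w - height a t) =
      -orient u w t := by simp only [orient, height]; ring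
  have h₃ := mul_nonneg (sub_nonneg.2 (fst_le_of_key_le hw)) (sub_nonneg.2 hc.1)
  have h₄ := mul_nonneg (sub_nonneg.2 (fst_le_of_key_le hu)) (sub_nonneg.2 hc.2)
  linarith

/-- In a strictly convex quadrilateral, one diagonal cannot precede the other. -/
theorem not_alternate {a b c d : Plane} (h₁ : 0 < orient a b c) (h₂ : 0 < orient a b d)
    (h₃ : 0 < orient a c d) (h₄ : 0 < orient b c d) (hab : key a < key b) (had : key a < key d)
    (hcb : key c < key b) (hcd : key c < key d) : False := by
  -- The diagonals `a c` and `b d` cross: up to a common factor, the crossing point is a positive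
  -- combination of `a, c` and also one of `b, d`. Both of `a, c` preceding both of `b, d`
  -- contradicts that.
  have e₀ : orient b c d * a 0 + orient a b d * c 0 = orient a c d * b 0 + orient a b c * d 0 := by
    simp only [orient]; ring
  have e₁ : orient b c d * a 1 + orient a b d * c 1 = orient a c d * b 1 + orient a b c * d 1 := by
    simp only [orient]; ring
  have es : orient b c d + orient a b d = orient a c d + orient a b c := by
    simp only [orient]; ring
  wlog hac : key a ≤ key c generalizing a b c d
  · refine this (a := c) (b := d) (c := a) (d := b) ?_ ?_ ?_ ?_ hcd hcb had hab ?_ ?_ ?_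
      (le_of_not_ge hac)
    · rwa [orient_rotate]
    · rwa [orient_rotate]
    · rwa [orient_rotate, orient_rotate]
    · rwa [orient_rotate, orient_rotate]
    all_goals simp only [orient]; ring
  have k₁ := key_le_iff.1 hac
  have k₂ := key_lt_iff.1 hcb
  have k₃ := key_lt_iff.1 hcd
  have m₁ : a 0 ≤ c 0 := fst_le_of_key_le hac
  have m₂ : c 0 ≤ b 0 := fst_le_of_key_le hcb.le
  have m₃ : c 0 ≤ d 0 := fst_le_of_key_le hcd.le
  have s₀ : orient b c d * (c 0 - a 0) + orient a c d * (b 0 - c 0) +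
      orient a b c * (d 0 - c 0) = 0 := by linear_combination (-1) * e₀ + c 0 * es
  have p₁ := mul_nonneg h₄.le (sub_nonneg.2 m₁)
  have p₂ := mul_nonneg h₃.le (sub_nonneg.2 m₂)
  have p₃ := mul_nonneg h₁.le (sub_nonneg.2 m₃)
  have q₁ : c 0 - a 0 = 0 := by
    rcases mul_eq_zero.1 (le_antisymm (by linarith) p₁) with h | h <;> linarith
  have q₂ : b 0 - c 0 = 0 := by
    rcases mul_eq_zero.1 (le_antisymm (by linarith) p₂) with h | h <;> linarith
  have : orient a b c = 0 := by
    simp only [orient, show b 0 = a 0 by linarith, show c 0 = a 0 by linarith]; ring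
  linarith

/-! ### Segments -/

theorem mem_segment_of_collinear {a b x : Plane} (ha : key a ≤ key x) (hb : key x ≤ key b)
    (h : orient a b x = 0) : x ∈ segment ℝ a b := by
  rcases eq_or_lt_of_le (ha.trans hb) with hab | hab
  · obtain rfl := key_injective hab
    obtain rfl := key_injective (le_antisymm ha hb)
    exact left_mem_segment ℝ _ _
  · rw [segment_eq_image]
    simp only [orient] at h
    rcases key_lt_iff.1 hab with h₀ | ⟨h₀, h₁⟩
    · have hne : b 0 - a 0 ≠ 0 := by linarith
      have m₁ := fst_le_of_key_le ha
      have m₂ := fst_le_of_key_le hb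
      refine ⟨(x 0 - a 0) / (b 0 - a 0), ⟨div_nonneg (by linarith) (by linarith),
        (div_le_one (by linarith)).2 (by linarith)⟩, plane_ext ?_ ?_⟩
      · simp only [PiLp.add_apply, PiLp.smul_apply, smul_eq_mul]; field_simp; ring
      · simp only [PiLp.add_apply, PiLp.smul_apply, smul_eq_mul]; field_simp
        linear_combination (-1) * h
    · have hne : b 1 - a 1 ≠ 0 := by linarith
      have hx : x 0 = a 0 := le_antisymm (h₀ ▸ fst_le_of_key_le hb) (fst_le_of_key_le ha)
      have k₁ : a 1 ≤ x 1 := by rcases key_le_iff.1 ha with h | h <;> linarith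
      have k₂ : x 1 ≤ b 1 := by rcases key_le_iff.1 hb with h | h <;> linarith
      refine ⟨(x 1 - a 1) / (b 1 - a 1), ⟨div_nonneg (by linarith) (by linarith),
        (div_le_one (by linarith)).2 (by linarith)⟩, plane_ext ?_ ?_⟩
      · simp only [PiLp.add_apply, PiLp.smul_apply, smul_eq_mul, ← h₀, hx]; ring
      · simp only [PiLp.add_apply, PiLp.smul_apply, smul_eq_mul]; field_simp; ring

/-- Two segments whose endpoints lie on different sides of each other intersect. -/
theorem segment_inter {a b c d : Plane} (h₁ : orient a b c < 0) (h₂ : 0 ≤ orient a b d)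
    (h₃ : 0 ≤ orient c d a) (h₄ : orient c d b ≤ 0) :
    ∃ x, x ∈ segment ℝ a b ∧ x ∈ segment ℝ c d := by
  -- The crossing point divides `a b` in the ratio of the signed areas over `c d`, and conversely;
  -- the identity gives both parameters the same denominator `D`.
  have e : orient c d a - orient c d b = orient a b d - orient a b c := by
    simp only [orient]; ring
  have hD : 0 < orient a b d - orient a b c := by linarith
  set D := orient a b d - orient a b c with hDdef
  have hD' : D ≠ 0 := hD.ne'
  refine ⟨(1 - orient c d a / D) • a + (orient c d a / D) • b, ?_, ?_⟩
  · rw [segment_eq_image]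
    exact ⟨_, ⟨div_nonneg h₃ hD.le, (div_le_one hD).2 (by linarith)⟩, rfl⟩
  · rw [segment_eq_image]
    refine ⟨-orient a b c / D, ⟨div_nonneg (by linarith) hD.le,
      (div_le_one hD).2 (by linarith)⟩, ?_⟩
    refine plane_ext ?_ ?_ <;>
    · simp only [PiLp.add_apply, PiLp.smul_apply, smul_eq_mul]
      field_simp
      rw [hDdef]
      simp only [orient]; ring

/-- A point between the lower and the upper sides of a triangle lies in the triangle. -/
theorem mem_convexHull_triangle {a b c x : Plane} (h₁ : 0 ≤ orient a b x) (h₂ : 0 ≤ orient b c x)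
    (h₃ : 0 ≤ orient c a x) (h : 0 < orient a b c) : x ∈ convexHull ℝ {a, b, c} := by
  have hs : orient a b c = orient a b x + orient b c x + orient c a x := by
    simp only [orient]; ring
  have hD : orient a b c ≠ 0 := h.ne'
  have hmem := (convex_convexHull ℝ {a, b, c}).sum_mem (t := Finset.univ)
    (w := ![orient b c x / orient a b c, orient c a x / orient a b c, orient a b x / orient a b c])
    (z := ![a, b, c])
    (fun i _ => by
      fin_cases i <;> exact div_nonneg ‹_› h.le)
    (by simp [Fin.sum_univ_three]; field_simp; rw [hs]; ring)
    (fun i _ => by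
      refine subset_convexHull ℝ _ ?_
      fin_cases i <;> simp)
  convert hmem using 1
  simp only [Fin.sum_univ_three, Matrix.cons_val]
  refine plane_ext ?_ ?_ <;>
  · simp only [PiLp.add_apply, PiLp.smul_apply, smul_eq_mul]
    field_simp
    simp only [orient]; ring

/-- Consider two disjoint convex sets, the first of which contains the segment `l r`, and the
second the triangle `l' r' p`. If the segment `l r` passes below (the left endpoint of) the
segment `l' r'`, then it passes below `p`. -/
theorem orient_pos_of_disjoint {S T : Set Plane} (hS : Convex ℝ S) (hT : Convex ℝ T)
    (hd : Disjoint S T) {l r l' r' p : Plane} (hl : l ∈ S) (hr : r ∈ S) (hl' : l' ∈ T)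
    (hr' : r' ∈ T) (hp : p ∈ T) (h₁ : key l ≤ key p) (h₂ : key p ≤ key r) (h₃ : key l' ≤ key p)
    (h₄ : key p ≤ key r')
    (h : key l ≤ key l' ∧ 0 ≤ orient l r l' ∨ key l' ≤ key l ∧ orient l' r' l ≤ 0) :
    0 < orient l r p := by
  have hne : ∀ {x y : Plane}, x ∈ S → y ∈ T → key x ≠ key y := fun {x y} hx hy hxy =>
    Set.disjoint_left.1 hd hx (key_injective hxy ▸ hy)
  have lt₁ := lt_of_le_of_ne h₁ (hne hl hp)
  have lt₂ := lt_of_le_of_ne h₂ (hne hr hp).symm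
  have hcross : ¬ ∃ x, x ∈ segment ℝ l' p ∧ x ∈ segment ℝ l r := fun ⟨x, hx, hx'⟩ =>
    Set.disjoint_left.1 hd (hS.segment_subset hl hr hx') (hT.segment_subset hl' hp hx)
  by_contra! hneg
  rcases h with ⟨hll, ho⟩ | ⟨hll, ho⟩
  -- Here `l` comes first. The point `l'` is strictly above the chord `l r`, since otherwise it
  -- would lie on it; if `p` is not above, the segment `l' p` crosses the chord.
  · have lt₃ := lt_of_le_of_ne hll (hne hl hl')
    have ho' : 0 < orient l r l' := lt_of_le_of_ne ho fun he =>
      Set.disjoint_left.1 hd (hS.segment_subset hl hr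
        (mem_segment_of_collinear hll (h₃.trans h₂) he.symm)) hl'
    have lt₄ : key l' < key p := lt_of_le_of_ne h₃ fun he => by
      rw [key_injective he] at ho'; linarith
    have f₁ := orient_fan lt₁ (lt₁.trans lt₂) lt₃ (by rw [orient_swap]; linarith) ho
    have f₂ := orient_fan' (o := r) (x := l') (y := l) (z := p) (lt₄.trans lt₂) (lt₁.trans lt₂) lt₂
      (by simp only [orient] at *; linarith) (by simp only [orient] at *; linarith)
    refine hcross (segment_inter ?_ ?_ ho hneg)
    · rw [orient_rotate, orient_swap]
      exact neg_neg_of_pos (f₁.2 (Or.inr ho'))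
    · rw [orient_rotate]; exact f₂.1
  -- Here `l'` comes first, and `l` is strictly below the chord `l' r'`.
  · have lt₃ := lt_of_le_of_ne hll (hne hl hl').symm
    have ho' : orient l' r' l < 0 := lt_of_le_of_ne ho fun he =>
      Set.disjoint_left.1 hd hl (hT.segment_subset hl' hr'
        (mem_segment_of_collinear hll (h₁.trans h₄) he))
    -- If `l` is not below `l' p`, it is caught in the triangle `l' p r'`, which lies in `T`. If it
    -- is below, then `l r` crosses `l' p`.
    rcases le_or_gt 0 (orient l' p l) with h₅ | h₅
    · have f := orient_fan (lt₃.trans lt₁) lt₃ (lt₃.trans_le (h₁.trans h₄)) h₅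
        (by rw [orient_swap]; linarith)
      refine Set.disjoint_left.1 hd hl (hT.convexHull_subset_iff.2 ?_ (mem_convexHull_triangle
        (a := l') (b := p) (c := r') h₅ ?_ ?_ (f.2 (Or.inr (by rw [orient_swap]; linarith)))))
      · rintro x (rfl | rfl | rfl) <;> assumption
      · rcases eq_or_lt_of_le h₄ with h₆ | h₆
        · rw [key_injective h₆, orient_self_left]
        · by_contra! h₇
          rw [orient_rotate] at h₇
          have := ((orient_four_neg lt₃ lt₁ h₆ (by rw [orient_swap]; linarith) h₇.le).2
            (Or.inr h₇)).1
          rw [orient_swap] at this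
          linarith
      · simp only [orient] at *; linarith
    · have f := orient_four lt₃ lt₁ lt₂ (by rw [orient_swap]; linarith)
        (by rw [orient_swap]; linarith)
      refine hcross (segment_inter h₅ f.1.2 ?_ hneg)
      rw [orient_rotate]; exact f.1.1


/-! ## Extreme vertices and lower chains of convex polygons -/

/-- `c 0, …, c (n - 1)` are the vertices of a convex polygon in counterclockwise order. -/
structure ConvexCycle (n : ℕ) (c : ℕ → Plane) : Prop where
  pos : 0 < n
  inj : ∀ {i j}, i < n → j < n → c i = c j → i = j
  ccw : ∀ {i j l}, i < j → j < l → l < n → 0 < orient (c i) (c j) (c l)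

namespace ConvexCycle

variable {n : ℕ} {c : ℕ → Plane} (h : ConvexCycle n c)

include h

theorem key_ne {i j : ℕ} (hi : i < n) (hj : j < n) (hij : i ≠ j) : key (c i) ≠ key (c j) :=
  fun he => hij (h.inj hi hj (key_injective he))

theorem rotate {L : ℕ} (hL : L < n) : ConvexCycle n fun s => c ((L + s) % n) where
  pos := h.pos
  inj {i j} hi hj he := by
    have := h.inj (Nat.mod_lt _ h.pos) (Nat.mod_lt _ h.pos) he
    exact Nat.ModEq.eq_of_lt_of_lt (Nat.ModEq.add_left_cancel' L this) hi hj
  ccw {i j l} hij hjl hl := by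
    have key : ∀ {s}, s < n → (L + s) % n = if L + s < n then L + s else L + s - n := by
      intro s hs
      split_ifs with hlt
      · exact Nat.mod_eq_of_lt hlt
      · rw [Nat.mod_eq_sub_mod (by omega), Nat.mod_eq_of_lt (by omega)]
    simp only [key (show i < n by omega), key (show j < n by omega), key hl]
    split_ifs with h₁ h₂ h₃
    all_goals first
      | omega
      | exact h.ccw (by omega) (by omega) (by omega)
      | (rw [← orient_rotate]; exact h.ccw (by omega) (by omega) (by omega))
      | (rw [orient_rotate]; exact h.ccw (by omega) (by omega) (by omega))

/-- Unimodality along the cycle in the form in which it is used: the keys of four vertices in cyclic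
order never follow the pattern low, high, low, high. The next lemma excludes the pattern that starts
high. -/
theorem not_alternate_odd {i j l m : ℕ} (hij : i < j) (hjl : j < l) (hlm : l < m) (hm : m < n)
    (h₁ : key (c i) < key (c j)) (h₂ : key (c i) < key (c m)) (h₃ : key (c l) < key (c j))
    (h₄ : key (c l) < key (c m)) : False :=
  not_alternate (h.ccw hij hjl (hlm.trans hm)) (h.ccw hij (hjl.trans hlm) hm)
    (h.ccw (hij.trans hjl) hlm hm) (h.ccw hjl hlm hm) h₁ h₂ h₃ h₄

theorem not_alternate_even {i j l m : ℕ} (hij : i < j) (hjl : j < l) (hlm : l < m) (hm : m < n)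
    (h₁ : key (c j) < key (c i)) (h₂ : key (c j) < key (c l)) (h₃ : key (c m) < key (c i))
    (h₄ : key (c m) < key (c l)) : False :=
  not_alternate (h.ccw hjl hlm hm)
    (by rw [orient_rotate]; exact h.ccw hij hjl (hlm.trans hm))
    (by rw [orient_rotate]; exact h.ccw hij (hjl.trans hlm) hm)
    (by rw [orient_rotate]; exact h.ccw (hij.trans hjl) hlm hm) h₂ h₁ h₄ h₃

/-- The criterion by which binary search finds the least vertex. -/
theorem before_min_iff {M : ℕ} (hM : M < n) (hmin : ∀ j < n, key (c M) ≤ key (c j)) {i : ℕ}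
    (hi : 0 < i) (hin : i < n) :
    (if key (c (1 % n)) < key (c 0) then
      key (c ((i + 1) % n)) < key (c i) ∧ key (c i) < key (c 0)
    else key (c ((i + 1) % n)) < key (c i) ∨ key (c 0) < key (c i)) ↔
      i < if M = 0 then n else M := by
  have hlt : ∀ j < n, j ≠ M → key (c M) < key (c j) := fun j hj hne =>
    lt_of_le_of_ne (hmin j hj) (h.key_ne hM hj hne.symm)
  have hM' : ∀ {j}, ¬ key (c j) < key (c M) ∨ n ≤ j := fun {j} => by
    by_cases hj : j < n
    · exact Or.inl (hmin j hj).not_gt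
    · exact Or.inr (by omega)
  rw [Nat.mod_eq_of_lt (show 1 < n by omega)]
  have hnext : (i + 1 < n ∧ (i + 1) % n = i + 1) ∨ (i + 1 = n ∧ (i + 1) % n = 0) := by
    rcases lt_or_ge (i + 1) n with h' | h'
    · exact Or.inl ⟨h', Nat.mod_eq_of_lt h'⟩
    · have : i + 1 = n := by omega
      exact Or.inr ⟨this, by rw [this, Nat.mod_self]⟩
  -- Past the minimum, as long as the keys are below that of vertex `0`, they cannot fall: otherwise
  -- `0, M, i, i + 1` alternate.
  have hafter : M < i → 0 < M → key (c ((i + 1) % n)) < key (c i) → key (c i) < key (c 0) →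
      False := by
    intro h₁ h₀ h₂ h₃
    rcases hnext with ⟨h₄, h₅⟩ | ⟨h₄, h₅⟩
    · rw [h₅] at h₂
      exact h.not_alternate_even (i := 0) (j := M) (l := i) (m := i + 1) h₀ h₁ (by omega) h₄
        (hlt _ (by omega) (by omega)) (hlt _ (by omega) (by omega)) (h₂.trans h₃) h₂
    · rw [h₅] at h₂; exact lt_asymm h₂ h₃
  -- Before the minimum and below vertex `0`, the keys must fall: otherwise `0, i, i + 1, M`
  -- alternate.
  have hbefore : i < M → key (c i) < key (c 0) → key (c ((i + 1) % n)) < key (c i) := by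
    intro h₁ h₂
    rcases hnext with ⟨h₄, h₅⟩ | ⟨h₄, h₅⟩
    · rw [h₅]
      by_contra! h₆
      have h₇ := lt_of_le_of_ne h₆ (h.key_ne hin h₄ (by omega))
      have h₈ : i + 1 ≠ M := by
        rintro rfl
        exact (hmin i hin).not_gt h₇
      exact h.not_alternate_even (i := 0) (j := i) (l := i + 1) (m := M) hi (by omega) (by omega) hM
        h₂ h₇ (hlt _ (by omega) (by omega)) (hlt _ (by omega) (by omega))
    · omega
  have hself : ¬ key (c ((i + 1) % n)) < key (c M) := (hmin _ (Nat.mod_lt _ h.pos)).not_gt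
  -- If the keys fall at the start, the vertices before the minimum are those below vertex `0` with
  -- a falling successor. If they rise at the start, they climb to the maximum first, and "before
  -- the minimum" means above vertex `0` or falling. For `M = 0` the minimum is met again as vertex
  -- number `n`.
  split_ifs with hF hM0 hM0
  · subst hM0; exact absurd hF (hmin 1 (by omega)).not_gt
  · constructor
    · rintro ⟨h₁, h₂⟩
      by_contra! h₃
      rcases eq_or_lt_of_le h₃ with rfl | h₃
      · exact hself h₁
      · exact hafter h₃ (by omega) h₁ h₂
    · intro h₁
      have h₂ : key (c i) < key (c 0) := by
        by_contra! h₂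
        have h₃ := lt_of_le_of_ne h₂ (h.key_ne h.pos hin (by omega))
        have h₄ : i ≠ 1 := by rintro rfl; exact lt_asymm hF h₃
        exact h.not_alternate_even (i := 0) (j := 1) (l := i) (m := M) (by omega) (by omega) h₁ hM
          hF (hF.trans h₃) (hlt _ (by omega) (by omega)) (hlt _ (by omega) (by omega))
      exact ⟨hbefore h₁ h₂, h₂⟩
  · subst hM0
    exact ⟨fun _ => hin, fun _ => Or.inr (hlt _ hin (by omega))⟩
  · have hF' := lt_of_le_of_ne (not_lt.1 hF) (h.key_ne h.pos (show 1 < n by omega) (by omega))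
    constructor
    · intro h₁
      by_contra! h₃
      rcases eq_or_lt_of_le h₃ with rfl | h₃
      · rcases h₁ with h₁ | h₁
        · exact hself h₁
        · exact (hmin 0 h.pos).not_gt h₁
      · have h₄ := hlt 0 h.pos (by omega)
        by_cases h₂ : key (c 0) < key (c i)
        · have h₅ : M ≠ 1 := by rintro rfl; exact lt_asymm hF' h₄
          exact h.not_alternate_odd (i := 0) (j := 1) (l := M) (m := i) (by omega) (by omega) h₃ hin
            hF' h₂ (h₄.trans hF') (h₄.trans h₂)
        · exact hafter h₃ (by omega) (h₁.resolve_right h₂)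
            (lt_of_le_of_ne (not_lt.1 h₂) (h.key_ne hin h.pos (by omega)))
    · intro h₁
      by_cases h₂ : key (c 0) < key (c i)
      · exact Or.inr h₂
      · exact Or.inl (hbefore h₁ (lt_of_le_of_ne (not_lt.1 h₂) (h.key_ne hin h.pos (by omega))))

theorem exists_min : ∃ M < n, ∀ j < n, key (c M) ≤ key (c j) := by
  obtain ⟨M, hM, hmin⟩ := Finset.exists_min_image (Finset.range n) (fun i => key (c i))
    ⟨0, Finset.mem_range.2 h.pos⟩
  exact ⟨M, Finset.mem_range.1 hM, fun j hj => hmin j (Finset.mem_range.2 hj)⟩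

theorem neg : ConvexCycle n fun i => -c i where
  pos := h.pos
  inj hi hj he := h.inj hi hj (neg_injective he)
  ccw hij hjl hl := by simpa only [orient_neg] using h.ccw hij hjl hl

end ConvexCycle

/-- The lower side of a convex polygon with vertices `c`: it leads from vertex number `L`, which is
the least one, to the greatest one in `N` steps. -/
structure LowerChain (n : ℕ) (c : ℕ → Plane) (L N : ℕ) : Prop where
  cycle : ConvexCycle n c
  left_lt : L < n
  length_lt : N < n
  left_le : ∀ j < n, key (c L) ≤ key (c j)
  le_right : ∀ j < n, key (c j) ≤ key (c ((L + N) % n))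

/-- Vertex number `s` of the lower side that begins at vertex number `L`. -/
def chainPoint (n : ℕ) (c : ℕ → Plane) (L s : ℕ) : Plane := c ((L + s) % n)

theorem add_mod_eq {n L s : ℕ} (hL : L < n) (hs : s < n) :
    (L + s) % n = if L + s < n then L + s else L + s - n := by
  split_ifs with hlt
  · exact Nat.mod_eq_of_lt hlt
  · rw [Nat.mod_eq_sub_mod (by omega), Nat.mod_eq_of_lt (by omega)]

namespace LowerChain

variable {n : ℕ} {c : ℕ → Plane} {L N : ℕ} (h : LowerChain n c L N)

include h

theorem rotated : ConvexCycle n (chainPoint n c L) := h.cycle.rotate h.left_lt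

theorem chain_zero : chainPoint n c L 0 = c L := by
  simp [chainPoint, Nat.mod_eq_of_lt h.left_lt]

theorem exists_chain {j : ℕ} (hj : j < n) : ∃ s < n, c j = chainPoint n c L s := by
  have hL := h.left_lt
  by_cases hLj : L ≤ j
  · refine ⟨j - L, by omega, ?_⟩
    rw [chainPoint, add_mod_eq hL (by omega), if_pos (by omega)]
    congr 1; omega
  · refine ⟨j + n - L, by omega, ?_⟩
    rw [chainPoint, add_mod_eq hL (by omega), if_neg (by omega)]
    congr 1; omega

theorem chain_left_le {s : ℕ} : key (chainPoint n c L 0) ≤ key (chainPoint n c L s) := by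
  rw [h.chain_zero]; exact h.left_le _ (Nat.mod_lt _ h.cycle.pos)

theorem chain_le_right {s : ℕ} : key (chainPoint n c L s) ≤ key (chainPoint n c L N) :=
  h.le_right _ (Nat.mod_lt _ h.cycle.pos)

/-- An inversion between `s` and `t` would make the positions `0, s, t, N` alternate, because `0` is
the minimum and `N` the maximum. -/
theorem key_lt {s t : ℕ} (hst : s < t) (ht : t ≤ N) :
    key (chainPoint n c L s) < key (chainPoint n c L t) := by
  have hN := h.length_lt
  by_contra! hle
  have hlt := lt_of_le_of_ne hle (h.rotated.key_ne (by omega) (by omega) (by omega))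
  have hs : s ≠ 0 := by rintro rfl; exact h.chain_left_le.not_gt hlt
  have htN : t ≠ N := by rintro rfl; exact h.chain_le_right.not_gt hlt
  exact h.rotated.not_alternate_odd (i := 0) (j := s) (l := t) (m := N) (by omega) hst (by omega) hN
    (lt_of_le_of_ne h.chain_left_le (h.rotated.key_ne (by omega) (by omega) (by omega)))
    (lt_of_le_of_ne h.chain_left_le (h.rotated.key_ne (by omega) (by omega) (by omega)))
    hlt (lt_of_le_of_ne h.chain_le_right (h.rotated.key_ne (by omega) (by omega) (by omega)))

theorem orient_pos {s t u : ℕ} (hst : s < t) (htu : t < u) (hu : u < n) :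
    0 < orient (chainPoint n c L s) (chainPoint n c L t) (chainPoint n c L u) :=
  h.rotated.ccw hst htu hu

/-- Vertices after position `N` make a left turn with the chord by convexity. For `N = 0` the least
and the greatest vertex coincide, and there is no other vertex. -/
theorem upper {j : ℕ} (hj : j < n) :
    (∃ s ≤ N, c j = chainPoint n c L s) ∨
      0 < orient (chainPoint n c L 0) (chainPoint n c L N) (c j) := by
  obtain ⟨s, hs, he⟩ := h.exists_chain hj
  rcases le_or_gt s N with hsN | hsN
  · exact Or.inl ⟨s, hsN, he⟩
  · rw [he]
    rcases Nat.eq_zero_or_pos N with rfl | hN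
    · have h₁ := h.chain_left_le (s := s)
      have h₂ := h.chain_le_right (s := s)
      exact absurd (h.rotated.inj (by omega) hs (key_injective (le_antisymm h₁ h₂))) (by omega)
    · exact Or.inr (h.orient_pos hN hsN hs)

omit h in
theorem of_extremes {R : ℕ} (hc : ConvexCycle n c) (hL : L < n) (hR : R < n)
    (hmin : ∀ j < n, key (c L) ≤ key (c j)) (hmax : ∀ j < n, key (c j) ≤ key (c R)) :
    LowerChain n c L (if L ≤ R then R - L else R + n - L) where
  cycle := hc
  left_lt := hL
  length_lt := by split_ifs <;> omega
  left_le := hmin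
  le_right := by
    have : (L + if L ≤ R then R - L else R + n - L) % n = R := by
      split_ifs with hle
      · rw [show L + (R - L) = R by omega, Nat.mod_eq_of_lt hR]
      · rw [show L + (R + n - L) = R + n by omega, Nat.add_mod_right, Nat.mod_eq_of_lt hR]
    rw [this]; exact hmax

end LowerChain

/-! ### Lengths along the boundary -/

/-- The length of the boundary from vertex `0` to vertex `j`. -/
noncomputable def boundaryLength (n : ℕ) (c : ℕ → Plane) (j : ℕ) : ℝ :=
  ∑ i ∈ Finset.range j, dist (c i) (c ((i + 1) % n))

/-- The length of the boundary from vertex `0` to position `s` of the lower side, where the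
boundary may have been passed beyond its end. -/
noncomputable def chainLength (n : ℕ) (c : ℕ → Plane) (L s : ℕ) : ℝ :=
  if L + s < n then boundaryLength n c (L + s)
  else boundaryLength n c (L + s - n) + (boundaryLength n c (n - 1) + dist (c (n - 1)) (c 0))

/-- Only differences of `chainLength` are ever used. Adding the full perimeter beyond the end of the
array makes it grow by exactly one edge also at the wrap-around. -/
theorem chainLength_succ {n : ℕ} {c : ℕ → Plane} {L s : ℕ} (hL : L < n) (hs : s + 1 < n) :
    chainLength n c L (s + 1) =
      chainLength n c L s + dist (chainPoint n c L s) (chainPoint n c L (s + 1)) := by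
  have hsucc : ∀ j, boundaryLength n c (j + 1) =
      boundaryLength n c j + dist (c j) (c ((j + 1) % n)) := fun j => Finset.sum_range_succ _ _
  unfold chainLength chainPoint
  rw [add_mod_eq hL hs, add_mod_eq hL (show s < n by omega)]
  rcases lt_trichotomy (L + s + 1) n with h | h | h
  · rw [if_pos (by omega), if_pos (by omega), if_pos (by omega), if_pos (by omega),
      show L + (s + 1) = L + s + 1 by omega, hsucc, Nat.mod_eq_of_lt h]
  · rw [if_neg (by omega), if_pos (by omega), if_pos (by omega), if_neg (by omega),
      show L + (s + 1) - n = 0 by omega, show L + s = n - 1 by omega]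
    simp [boundaryLength]
  · rw [if_neg (by omega), if_neg (by omega), if_neg (by omega), if_neg (by omega),
      show L + (s + 1) - n = L + s - n + 1 by omega, hsucc, Nat.mod_eq_of_lt (by omega)]
    ring


/-! ## Bridges between arcs -/

/-- The points `p lo, …, p hi` are sorted and make left turns. -/
structure IsArc (p : ℕ → Plane) (lo hi : ℕ) : Prop where
  lt : ∀ {s t}, lo ≤ s → s < t → t ≤ hi → key (p s) < key (p t)
  ccw : ∀ {s t u}, lo ≤ s → s < t → t < u → u ≤ hi → 0 < orient (p s) (p t) (p u)

namespace IsArc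

variable {p : ℕ → Plane} {lo hi : ℕ}

theorem mono (h : IsArc p lo hi) {lo' hi' : ℕ} (h₁ : lo ≤ lo') (h₂ : hi' ≤ hi) :
    IsArc p lo' hi' :=
  ⟨fun hs hst ht => h.lt (h₁.trans hs) hst (ht.trans h₂),
    fun hs hst htu hu => h.ccw (h₁.trans hs) hst htu (hu.trans h₂)⟩

theorem le (h : IsArc p lo hi) {s t : ℕ} (hs : lo ≤ s) (hst : s ≤ t) (ht : t ≤ hi) :
    key (p s) ≤ key (p t) := by
  rcases eq_or_lt_of_le hst with rfl | hst
  exacts [le_rfl, (h.lt hs hst ht).le]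

theorem lt_of_key_lt (h : IsArc p lo hi) {s t : ℕ} (hs : s ≤ hi) (ht : lo ≤ t)
    (hlt : key (p s) < key (p t)) : s < t := by
  by_contra! hle
  exact (h.le ht hle hs).not_gt hlt

/-- Every other point of an arc lies above the line through an edge. -/
theorem orient_edge (h : IsArc p lo hi) {s a : ℕ} (hs : lo ≤ s) (hs' : s < hi) (ha : lo ≤ a)
    (ha' : a ≤ hi) (h₁ : a ≠ s) (h₂ : a ≠ s + 1) : 0 < orient (p s) (p (s + 1)) (p a) := by
  rcases lt_or_ge a s with h₃ | h₃
  · rw [orient_rotate]; exact h.ccw ha h₃ (Nat.lt_succ_self s) hs'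
  · exact h.ccw hs (Nat.lt_succ_self s) (by omega) ha'

theorem orient_edge_nonneg (h : IsArc p lo hi) {s a : ℕ} (hs : lo ≤ s) (hs' : s < hi)
    (ha : lo ≤ a) (ha' : a ≤ hi) : 0 ≤ orient (p s) (p (s + 1)) (p a) := by
  by_cases h₁ : a = s
  · rw [h₁, orient_self_outer]
  by_cases h₂ : a = s + 1
  · rw [h₂, orient_self_right]
  exact (h.orient_edge hs hs' ha ha' h₁ h₂).le

end IsArc

/-- The line through `p u` and `q w` supports the arcs `p lo, …, p hi` and `q lo', …, q hi'`
from below, and it meets the parts that are kept only in these two points. -/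
structure IsBridge (p : ℕ → Plane) (lo hi : ℕ) (q : ℕ → Plane) (lo' hi' u w : ℕ) : Prop where
  le_u : lo ≤ u
  u_le : u ≤ hi
  le_w : lo' ≤ w
  w_le : w ≤ hi'
  before_u : ∀ a, lo ≤ a → a < u → 0 < orient (p a) (p u) (q w)
  after_u : ∀ a, u < a → a ≤ hi → 0 ≤ orient (p u) (q w) (p a)
  before_w : ∀ b, lo' ≤ b → b < w → 0 ≤ orient (p u) (q w) (q b)
  after_w : ∀ b, w < b → b ≤ hi' → 0 < orient (p u) (q w) (q b)

/-- The bridge between two arcs leads from one of `p l₁, …, p h₁` to one of `q l₂, …, q h₂`. -/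
structure BridgeRange (p : ℕ → Plane) (lo hi : ℕ) (q : ℕ → Plane) (lo' hi' l₁ h₁ l₂ h₂ : ℕ) :
    Prop where
  lo_le : lo ≤ l₁
  l_le : l₁ ≤ h₁
  le_hi : h₁ ≤ hi
  lo_le' : lo' ≤ l₂
  l_le' : l₂ ≤ h₂
  le_hi' : h₂ ≤ hi'
  -- Certificates for the discarded parts. `left` and `right'` speak about the remaining candidates
  -- of the other arc, so they survive any narrowing; `right` and `left'` ask for one witness
  -- anywhere on the other arc, even if that point has been discarded.
  left : lo < l₁ → ∀ b, l₂ ≤ b → b ≤ h₂ → 0 < orient (p (l₁ - 1)) (p l₁) (q b)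
  right : h₁ < hi → ∃ b, lo' ≤ b ∧ b ≤ hi' ∧ orient (p h₁) (p (h₁ + 1)) (q b) ≤ 0
  left' : lo' < l₂ → ∃ a, lo ≤ a ∧ a ≤ hi ∧ orient (q (l₂ - 1)) (q l₂) (p a) ≤ 0
  right' : h₂ < hi' → ∀ a, l₁ ≤ a → a ≤ h₁ → 0 < orient (q h₂) (q (h₂ + 1)) (p a)

namespace BridgeRange

variable {p : ℕ → Plane} {lo hi : ℕ} {q : ℕ → Plane} {lo' hi' l₁ h₁ l₂ h₂ : ℕ}

theorem full (h : lo ≤ hi) (h' : lo' ≤ hi') : BridgeRange p lo hi q lo' hi' lo hi lo' hi' where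
  lo_le := le_rfl
  l_le := h
  le_hi := le_rfl
  lo_le' := le_rfl
  l_le' := h'
  le_hi' := le_rfl
  left h := absurd h (lt_irrefl _)
  right h := absurd h (lt_irrefl _)
  left' h := absurd h (lt_irrefl _)
  right' h := absurd h (lt_irrefl _)

variable (h : BridgeRange p lo hi q lo' hi' l₁ h₁ l₂ h₂)

include h

theorem set_right {m : ℕ} (hm : l₁ ≤ m) (hm' : m < h₁)
    (he : ∃ b, lo' ≤ b ∧ b ≤ hi' ∧ orient (p m) (p (m + 1)) (q b) ≤ 0) :
    BridgeRange p lo hi q lo' hi' l₁ m l₂ h₂ :=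
  { h with
    l_le := hm
    le_hi := hm'.le.trans h.le_hi
    right := fun _ => he
    right' := fun hh a ha ha' => h.right' hh a ha (ha'.trans hm'.le) }

theorem set_left {m : ℕ} (hm : l₁ ≤ m) (hm' : m < h₁)
    (he : ∀ b, l₂ ≤ b → b ≤ h₂ → 0 < orient (p m) (p (m + 1)) (q b)) :
    BridgeRange p lo hi q lo' hi' (m + 1) h₁ l₂ h₂ :=
  { h with
    lo_le := by have := h.lo_le; omega
    l_le := hm'
    left := fun _ => he
    right' := fun hh a ha ha' => h.right' hh a (by omega) ha' }

theorem set_left' {m : ℕ} (hm : l₂ ≤ m) (hm' : m < h₂)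
    (he : ∃ a, lo ≤ a ∧ a ≤ hi ∧ orient (q m) (q (m + 1)) (p a) ≤ 0) :
    BridgeRange p lo hi q lo' hi' l₁ h₁ (m + 1) h₂ :=
  { h with
    lo_le' := by have := h.lo_le'; omega
    l_le' := hm'
    left' := fun _ => he
    left := fun hh b hb hb' => h.left hh b (by omega) hb' }

theorem set_right' {m : ℕ} (hm : l₂ ≤ m) (hm' : m < h₂)
    (he : ∀ a, l₁ ≤ a → a ≤ h₁ → 0 < orient (q m) (q (m + 1)) (p a)) :
    BridgeRange p lo hi q lo' hi' l₁ h₁ l₂ m :=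
  { h with
    l_le' := hm
    le_hi' := hm'.le.trans h.le_hi'
    right' := fun _ => he
    left := fun hh b hb hb' => h.left hh b hb (hb'.trans hm'.le) }

end BridgeRange

/-- With one candidate left on each side, `left` and `right'` give the strict conditions, by
convexity of the arcs. The weak conditions are clear unless the witnesses of `right` and `left'`
differ from `w` and `u`. By `AB` and `BA` a failure at one end entails a failure at the other and
puts the witnesses at `b < w` and `a > u`, which `key` refutes. -/
theorem BridgeRange.isBridge {p : ℕ → Plane} {lo hi : ℕ} {q : ℕ → Plane} {lo' hi' u w : ℕ}
    (h : BridgeRange p lo hi q lo' hi' u u w w) (hp : IsArc p lo hi) (hq : IsArc q lo' hi')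
    (hpq : key (p hi) < key (q lo')) : IsBridge p lo hi q lo' hi' u w := by
  have h₁ := h.lo_le
  have h₂ := h.le_hi
  have h₃ := h.lo_le'
  have h₄ := h.le_hi'
  have lt : ∀ {a b}, lo ≤ a → a ≤ hi → lo' ≤ b → b ≤ hi' → key (p a) < key (q b) :=
    fun ha ha' hb hb' => (hp.le ha ha' le_rfl).trans_lt (hpq.trans_le (hq.le le_rfl hb hb'))
  have huw := lt h₁ h₂ h₃ h₄
  have b₁ : ∀ a, lo ≤ a → a < u → 0 < orient (p a) (p u) (q w) := by
    intro a ha hau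
    have e := h.left (by omega) w le_rfl le_rfl
    rcases eq_or_lt_of_le (show a ≤ u - 1 by omega) with rfl | hlt
    · exact e
    · exact orient_four_right (hp.lt ha hlt (by omega)) (hp.lt (by omega) (by omega) h₂) huw
        (hp.ccw ha hlt (by omega) h₂) e
  have b₄ : ∀ b, w < b → b ≤ hi' → 0 < orient (p u) (q w) (q b) := by
    intro b hwb hb
    have e := h.right' (by omega) u le_rfl le_rfl
    rw [orient_rotate] at e
    rcases eq_or_lt_of_le (show w + 1 ≤ b by omega) with rfl | hlt
    · exact e
    · exact orient_four_left huw (hq.lt h₃ (by omega) (by omega)) (hq.lt (by omega) hlt hb) e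
        (hq.ccw h₃ (by omega) hlt hb)
  have A₂ : ∀ {a}, u < a → a ≤ hi → orient (p u) (p (u + 1)) (q w) ≤ 0 →
      0 ≤ orient (p u) (q w) (p a) := by
    intro a hua ha hA
    have hA' : 0 ≤ orient (p u) (q w) (p (u + 1)) := by rw [orient_swap]; linarith
    rcases eq_or_lt_of_le (show u + 1 ≤ a by omega) with rfl | hlt
    · exact hA'
    · exact (orient_fan huw (hp.lt h₁ (by omega) (by omega)) (hp.lt h₁ hua ha) hA'
        (hp.ccw h₁ (by omega) hlt ha).le).1
  have B₃ : ∀ {b}, lo' ≤ b → b < w → orient (q (w - 1)) (q w) (p u) ≤ 0 →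
      0 ≤ orient (p u) (q w) (q b) := by
    intro b hb hbw hB
    have hB' : 0 ≤ orient (q w) (q (w - 1)) (p u) := by rw [orient_swap']; linarith
    rcases eq_or_lt_of_le (show b ≤ w - 1 by omega) with rfl | hlt
    · rwa [← orient_rotate]
    · rw [← orient_rotate]
      refine (orient_fan' (hq.lt hb hbw h₄) (hq.lt (by omega) (by omega) h₄) huw ?_ hB').1
      rw [orient_rotate, orient_rotate]
      exact (hq.ccw hb hlt (by omega) h₄).le
  -- If the edge after `p u` passes below `q w`, a point `q b` on or below that edge must precede `q
  -- w`, and the edge before `q w` then passes below `p u`.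
  have AB : ∀ {b}, lo' ≤ b → b ≤ hi' → orient (p u) (p (u + 1)) (q b) ≤ 0 → u < hi →
      0 < orient (p u) (p (u + 1)) (q w) →
      b < w ∧ 0 < orient (q (w - 1)) (q w) (p u) := by
    intro b hb hb' ho hu hA
    have hu' := hp.lt h₁ (Nat.lt_succ_self u) hu
    have hfan : 0 ≤ orient (p u) (q w) (q b) → False := fun hh =>
      ho.not_gt ((orient_fan hu' huw (lt h₁ h₂ hb hb') hA.le hh).2 (Or.inl hA))
    rcases lt_trichotomy b w with hlt | rfl | hlt
    · refine ⟨hlt, ?_⟩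
      by_contra! hB
      exact hfan (B₃ hb hlt hB)
    · exact absurd hA ho.not_gt
    · exact (hfan (b₄ b hlt hb').le).elim
  have BA : ∀ {a}, lo ≤ a → a ≤ hi → orient (q (w - 1)) (q w) (p a) ≤ 0 → lo' < w →
      0 < orient (q (w - 1)) (q w) (p u) →
      u < a ∧ 0 < orient (p u) (p (u + 1)) (q w) := by
    intro a ha ha' ho hw hB
    have hw' : key (q (w - 1)) < key (q w) := hq.lt (by omega) (by omega) h₄
    have hfan : 0 ≤ orient (p u) (q w) (p a) → False := fun hh => by
      have := (orient_fan' (o := q w) (x := p a) (y := p u) (z := q (w - 1)) (lt ha ha' h₃ h₄) huw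
        hw' (by rwa [orient_rotate]) (by rw [orient_rotate]; exact hB.le)).2
        (Or.inr (by rwa [orient_rotate]))
      rw [orient_rotate] at this
      exact ho.not_gt this
    rcases lt_trichotomy a u with hlt | rfl | hlt
    · refine (hfan ?_).elim
      rw [orient_rotate]; exact (b₁ a ha hlt).le
    · exact absurd hB ho.not_gt
    · refine ⟨hlt, ?_⟩
      by_contra! hA
      exact hfan (A₂ hlt ha' hA)
  -- The points `p u, p a, q b, q w` would make no left turn at `p a` and none at `q b`, so `q w` is
  -- not above the line from `p u` to `q b`. Yet `q w` is strictly above the line of the edge after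
  -- `p u`, while `q b` is not.
  have key : ∀ {a b}, lo ≤ a → a ≤ hi → lo' ≤ b → b ≤ hi' → u < a → b < w →
      orient (p u) (p (u + 1)) (q b) ≤ 0 → orient (q (w - 1)) (q w) (p a) ≤ 0 →
      0 < orient (p u) (p (u + 1)) (q w) → False := by
    intro a b ha ha' hb hb' hua hbw ho ho' hA
    have hu' := hp.lt h₁ (Nat.lt_succ_self u) (by omega)
    have f₁ : 0 ≤ orient (p u) (q b) (p (u + 1)) := by rw [orient_swap]; linarith
    have f₂ := (orient_fan (lt h₁ h₂ hb hb') hu' (hp.lt h₁ hua ha') f₁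
      (hp.orient_edge_nonneg h₁ (by omega) ha ha')).1
    have f₃ : 0 ≤ orient (q w) (q b) (q (w - 1)) := by
      have := hq.orient_edge_nonneg (s := w - 1) (by omega) (by omega) hb hb'
      rw [Nat.sub_add_cancel (by omega)] at this
      rwa [orient_rotate]
    have f₄ := (orient_fan' (hq.lt hb hbw h₄) (hq.lt (by omega) (by omega) h₄) (lt ha ha' h₃ h₄) f₃
      (by rw [orient_swap']; linarith)).1
    have f₅ := (orient_four_neg (hp.lt h₁ hua ha') (lt ha ha' hb hb') (hq.lt hb hbw h₄)
      (by rw [orient_swap]; linarith)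
      (by rw [← orient_rotate, ← orient_rotate, orient_swap]; linarith)).1.2
    exact f₅.not_gt ((orient_fan (lt h₁ h₂ hb hb') hu' huw f₁ hA.le).2 (Or.inr hA))
  refine ⟨h₁, h₂, h₃, h₄, b₁, fun a hua ha => A₂ hua ha ?_, fun b hb hbw => B₃ hb hbw ?_, b₄⟩
  · by_contra! hA
    obtain ⟨b, hb, hb', ho⟩ := h.right (by omega)
    obtain ⟨hbw, hB⟩ := AB hb hb' ho (by omega) hA
    obtain ⟨a, ha, ha', ho'⟩ := h.left' (by omega)
    exact key ha ha' hb hb' (BA ha ha' ho' (by omega) hB).1 hbw ho ho' hA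
  · by_contra! hB
    obtain ⟨a, ha, ha', ho'⟩ := h.left' (by omega)
    obtain ⟨hua, hA⟩ := BA ha ha' ho' (by omega) hB
    obtain ⟨b, hb, hb', ho⟩ := h.right (by omega)
    exact key ha ha' hb hb' hua (AB hb hb' ho (by omega) hA).1 ho ho' hA

/-! ### Two edges, each above the line of the other. -/

section Separation

/-- With `x₀` between the two arcs, compares the heights over `x₀` of the lines through the edges
`p₁ p₂` and `q₁ q₂`. -/
def LineLE (p₁ p₂ q₁ q₂ : Plane) (x₀ : ℝ) : Prop :=
  (p₁ 1 * (p₂ 0 - p₁ 0) + (p₂ 1 - p₁ 1) * (x₀ - p₁ 0)) * (q₂ 0 - q₁ 0) ≤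
    (q₁ 1 * (q₂ 0 - q₁ 0) + (q₂ 1 - q₁ 1) * (x₀ - q₁ 0)) * (p₂ 0 - p₁ 0)

variable {p₁ p₂ q₁ q₂ : Plane} {x₀ : ℝ} (hp : key p₁ < key p₂) (hpq : key p₂ < key q₁)
  (hq : key q₁ < key q₂) (h₁ : 0 < orient p₁ p₂ q₁) (h₂ : 0 < orient q₁ q₂ p₂)

include hp hpq hq h₁ h₂

/-- The slopes of `p₁ p₂`, `p₂ q₁` and `q₁ q₂` increase, so the two lines meet and the right one is
steeper. The left edge cannot be vertical, since then no point to the right of it would make a left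
turn. -/
theorem cross_pos_of_facing :
    0 < (p₂ 0 - p₁ 0) * (q₂ 1 - q₁ 1) - (p₂ 1 - p₁ 1) * (q₂ 0 - q₁ 0) ∧ 0 < p₂ 0 - p₁ 0 := by
  have e₁ : orient p₁ p₂ q₁ =
      (p₂ 0 - p₁ 0) * (q₁ 1 - p₂ 1) - (p₂ 1 - p₁ 1) * (q₁ 0 - p₂ 0) := by
    simp only [orient]; ring
  have e₂ : orient q₁ q₂ p₂ =
      (q₁ 0 - p₂ 0) * (q₂ 1 - q₁ 1) - (q₁ 1 - p₂ 1) * (q₂ 0 - q₁ 0) := by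
    simp only [orient]; ring
  refine ⟨(cross_trans (sub_of_key_lt hp) (sub_of_key_lt hpq) (sub_of_key_lt hq) (e₁ ▸ h₁.le)
    (e₂ ▸ h₂.le)).2 (Or.inl (e₁ ▸ h₁)), ?_⟩
  rcases sub_of_key_lt hp with h | ⟨h, h'⟩
  · exact h
  · rw [e₁, h] at h₁
    have := mul_nonneg h'.le (sub_nonneg.2 (fst_le_of_key_le hpq.le))
    linarith

/-- The line of the right edge is steeper, so if it is not lower over `x₀`, it is not lower anywhere
to the right of `x₀`. Points above it there are above the left line too. This is the case in which
the binary search can discard the left part of the left arc. -/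
theorem orient_pos_of_lineLE (hle : LineLE p₁ p₂ q₁ q₂ x₀) {q : Plane}
    (hqx : x₀ ≤ q 0) (hoq : 0 < orient q₁ q₂ q) : 0 < orient p₁ p₂ q := by
  obtain ⟨hc, hp₀⟩ := cross_pos_of_facing hp hpq hq h₁ h₂
  have e : (q₂ 0 - q₁ 0) * orient p₁ p₂ q =
      ((q₁ 1 * (q₂ 0 - q₁ 0) + (q₂ 1 - q₁ 1) * (x₀ - q₁ 0)) * (p₂ 0 - p₁ 0) -
        (p₁ 1 * (p₂ 0 - p₁ 0) + (p₂ 1 - p₁ 1) * (x₀ - p₁ 0)) * (q₂ 0 - q₁ 0)) +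
      ((p₂ 0 - p₁ 0) * (q₂ 1 - q₁ 1) - (p₂ 1 - p₁ 1) * (q₂ 0 - q₁ 0)) * (q 0 - x₀) +
      (p₂ 0 - p₁ 0) * orient q₁ q₂ q := by
    simp only [orient]; ring
  unfold LineLE at hle
  rcases sub_of_key_lt hq with h | ⟨h, h'⟩
  · refine pos_of_mul_pos_right (a := q₂ 0 - q₁ 0) ?_ h.le
    have := mul_pos hp₀ hoq
    have := mul_nonneg hc.le (sub_nonneg.2 hqx)
    linarith
  · exfalso
    have h₃ : 0 < (q₂ 1 - q₁ 1) * (p₂ 0 - p₁ 0) := mul_pos h' hp₀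
    rw [h] at hle
    have h₄ : 0 ≤ x₀ - q₁ 0 :=
      nonneg_of_mul_nonneg_right (a := (q₂ 1 - q₁ 1) * (p₂ 0 - p₁ 0)) (by linarith) h₃
    simp only [orient, h] at hoq
    have := mul_nonneg h'.le (show 0 ≤ q 0 - q₁ 0 by linarith)
    linarith

/-- In the opposite case the left line is higher over `x₀` and, being less steep, also to the left
of it. The right part of the right arc can be discarded. -/
theorem orient_pos_of_not_lineLE (hle : ¬ LineLE p₁ p₂ q₁ q₂ x₀) {p : Plane}
    (hpx : p 0 ≤ x₀) (hop : 0 ≤ orient p₁ p₂ p) : 0 < orient q₁ q₂ p := by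
  obtain ⟨hc, hp₀⟩ := cross_pos_of_facing hp hpq hq h₁ h₂
  have e : (p₂ 0 - p₁ 0) * orient q₁ q₂ p =
      ((p₁ 1 * (p₂ 0 - p₁ 0) + (p₂ 1 - p₁ 1) * (x₀ - p₁ 0)) * (q₂ 0 - q₁ 0) -
        (q₁ 1 * (q₂ 0 - q₁ 0) + (q₂ 1 - q₁ 1) * (x₀ - q₁ 0)) * (p₂ 0 - p₁ 0)) +
      ((p₂ 0 - p₁ 0) * (q₂ 1 - q₁ 1) - (p₂ 1 - p₁ 1) * (q₂ 0 - q₁ 0)) * (x₀ - p 0) +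
      (q₂ 0 - q₁ 0) * orient p₁ p₂ p := by
    simp only [orient]; ring
  unfold LineLE at hle
  refine pos_of_mul_pos_right (a := p₂ 0 - p₁ 0) ?_ hp₀.le
  have := mul_nonneg (sub_nonneg.2 (fst_le_of_key_le hq.le)) hop
  have := mul_nonneg hc.le (sub_nonneg.2 hpx)
  linarith

end Separation


/-! ## Lower hulls as stacks of arcs -/

/-- Any three points of `U`, from left to right, make a left turn. -/
def ConvexChain (U : Set Plane) : Prop :=
  ∀ ⦃p⦄, p ∈ U → ∀ ⦃q⦄, q ∈ U → ∀ ⦃r⦄, r ∈ U → key p < key q → key q < key r → 0 < orient p q r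

/-- `p` lies in the region above the lower hull of `U`. -/
def Above (U : Set Plane) (p : Plane) : Prop :=
  (∀ a, ∃ u ∈ U, height a u ≤ height a p) ∧ (∃ u ∈ U, key u ≤ key p) ∧ ∃ u ∈ U, key p ≤ key u

namespace Above

variable {U U' : Set Plane} {p : Plane}

theorem of_mem (h : p ∈ U) : Above U p :=
  ⟨fun _ => ⟨p, h, le_rfl⟩, ⟨p, h, le_rfl⟩, ⟨p, h, le_rfl⟩⟩

theorem trans (h : Above U p) (hU : ∀ u ∈ U, Above U' u) : Above U' p := by
  refine ⟨fun a => ?_, ?_, ?_⟩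
  · obtain ⟨u, hu, hle⟩ := h.1 a
    obtain ⟨u', hu', hle'⟩ := (hU u hu).1 a
    exact ⟨u', hu', hle'.trans hle⟩
  · obtain ⟨u, hu, hle⟩ := h.2.1
    obtain ⟨u', hu', hle'⟩ := (hU u hu).2.1
    exact ⟨u', hu', hle'.trans hle⟩
  · obtain ⟨u, hu, hle⟩ := h.2.2
    obtain ⟨u', hu', hle'⟩ := (hU u hu).2.2
    exact ⟨u', hu', hle.trans hle'⟩

theorem of_orient {u w : Plane} (hu : u ∈ U) (hw : w ∈ U) (h₁ : key u ≤ key p)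
    (h₂ : key p ≤ key w) (h : 0 ≤ orient u w p) : Above U p := by
  refine ⟨fun a => ?_, ⟨u, hu, h₁⟩, ⟨w, hw, h₂⟩⟩
  rcases height_le_of_orient h₁ h₂ h a with h | h
  exacts [⟨u, hu, h⟩, ⟨w, hw, h⟩]

end Above

/-- Only turns that use the whole bridge `u w` are assumed. `f₁` and `f₂` extend them, by
`orient_four`, to turns with a single end of the bridge, and a second application reaches arbitrary
triples. -/
theorem ConvexChain.union {A B : Set Plane} (hA : ConvexChain A) (hB : ConvexChain B)
    {u w : Plane} (hu : u ∈ A) (hw : w ∈ B) (hAu : ∀ p ∈ A, key p ≤ key u)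
    (hBw : ∀ q ∈ B, key w ≤ key q) (huw : key u < key w)
    (h₁ : ∀ p ∈ A, key p < key u → 0 < orient p u w)
    (h₂ : ∀ q ∈ B, key w < key q → 0 < orient u w q) : ConvexChain (A ∪ B) := by
  have hAB : ∀ {p q}, p ∈ A → q ∈ B → key p < key q := fun hp hq =>
    (hAu _ hp).trans_lt (huw.trans_le (hBw _ hq))
  have f₁ : ∀ {p p'}, p ∈ A → p' ∈ A → key p < key p' → 0 < orient p p' w := by
    intro p p' hp hp' hlt
    rcases eq_or_lt_of_le (hAu p' hp') with he | hlt'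
    · rw [key_injective he] at hlt ⊢
      exact h₁ p hp hlt
    · exact orient_four_left hlt hlt' huw (hA hp hp' hu hlt hlt') (h₁ p' hp' hlt')
  have f₂ : ∀ {p q}, p ∈ A → q ∈ B → key w < key q → 0 < orient p w q := by
    intro p q hp hq hlt
    rcases eq_or_lt_of_le (hAu p hp) with he | hlt'
    · rw [key_injective he]
      exact h₂ q hq hlt
    · exact orient_four_right hlt' huw hlt (h₁ p hp hlt') (h₂ q hq hlt)
  rintro p (hp | hp) q (hq | hq) r (hr | hr) hpq hqr
  · exact hA hp hq hr hpq hqr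
  · rcases eq_or_lt_of_le (hBw r hr) with he | hlt
    · rw [← key_injective he]; exact f₁ hp hq hpq
    · exact orient_four_left hpq (hAB hq hw) hlt (f₁ hp hq hpq) (f₂ hq hr hlt)
  · exact absurd hqr (hAB hr hq).not_gt
  · rcases eq_or_lt_of_le (hBw q hq) with he | hlt
    · rw [← key_injective he]
      rw [← key_injective he] at hqr
      exact f₂ hp hr hqr
    · exact orient_four_right (hAB hp hw) hlt hqr (f₂ hp hq hlt) (hB hw hq hr hlt hqr)
  · exact absurd hpq (hAB hq hp).not_gt
  · exact absurd hpq (hAB hq hp).not_gt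
  · exact absurd (hpq.trans hqr) (hAB hr hp).not_gt
  · exact hB hp hq hr hpq hqr

/-- The points of the arcs on a stack: entry `j` consists of the points number `lo j, …, hi j` of
the chain `c (T j)`. -/
def stackPoints (c : ℕ → ℕ → Plane) (T lo hi : ℕ → ℕ) (sp : ℕ) : Set Plane :=
  {x | ∃ j < sp, ∃ a, lo j ≤ a ∧ a ≤ hi j ∧ x = c (T j) a}

/-- The points number `lo, …, hi` of a chain. -/
def arcPoints (c : ℕ → Plane) (lo hi : ℕ) : Set Plane := {x | ∃ a, lo ≤ a ∧ a ≤ hi ∧ x = c a}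

/-- The arcs on the stack follow each other from left to right and form a convex chain. -/
structure HullStack (k : ℕ) (N : ℕ → ℕ) (c : ℕ → ℕ → Plane) (T lo hi : ℕ → ℕ) (sp : ℕ) : Prop where
  poly_lt : ∀ j < sp, T j < k
  lo_le : ∀ j < sp, lo j ≤ hi j
  hi_le : ∀ j < sp, hi j ≤ N (T j)
  sorted : ∀ i j, i < j → j < sp → key (c (T i) (hi i)) < key (c (T j) (lo j))
  convex : ConvexChain (stackPoints c T lo hi sp)

theorem IsArc.convexChain {p : ℕ → Plane} {lo hi : ℕ} (h : IsArc p lo hi) :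
    ConvexChain (arcPoints p lo hi) := by
  rintro _ ⟨a, ha, ha', rfl⟩ _ ⟨b, hb, hb', rfl⟩ _ ⟨d, hd, hd', rfl⟩ hab hbd
  exact h.ccw ha (h.lt_of_key_lt ha' hb hab) (h.lt_of_key_lt hb' hd hbd) hd'

theorem ConvexChain.mono {U U' : Set Plane} (h : ConvexChain U) (hU : U' ⊆ U) : ConvexChain U' :=
  fun _ hp _ hq _ hr => h (hU hp) (hU hq) (hU hr)

theorem stackPoints_succ (c : ℕ → ℕ → Plane) (T lo hi : ℕ → ℕ) (sp : ℕ) :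
    stackPoints c T lo hi (sp + 1) =
      stackPoints c T lo hi sp ∪ arcPoints (c (T sp)) (lo sp) (hi sp) := by
  ext x
  simp only [stackPoints, arcPoints, Set.mem_union, Set.mem_ofPred_eq]
  constructor
  · rintro ⟨j, hj, h⟩
    rcases Nat.lt_succ_iff_lt_or_eq.1 hj with hj | rfl
    exacts [Or.inl ⟨j, hj, h⟩, Or.inr h]
  · rintro (⟨j, hj, h⟩ | h)
    exacts [⟨j, by omega, h⟩, ⟨sp, by omega, h⟩]

theorem stackPoints_congr {c : ℕ → ℕ → Plane} {T lo hi T' lo' hi' : ℕ → ℕ} {sp : ℕ}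
    (hT : ∀ j < sp, T' j = T j) (hlo : ∀ j < sp, lo' j = lo j) (hhi : ∀ j < sp, hi' j = hi j) :
    stackPoints c T' lo' hi' sp = stackPoints c T lo hi sp := by
  ext x
  simp only [stackPoints, Set.mem_ofPred_eq]
  refine exists_congr fun j => and_congr_right fun hj => ?_
  rw [hT j hj, hlo j hj, hhi j hj]

namespace HullStack

variable {k : ℕ} {N : ℕ → ℕ} {c : ℕ → ℕ → Plane} {T lo hi : ℕ → ℕ} {sp : ℕ}

theorem pop (h : HullStack k N c T lo hi (sp + 1)) : HullStack k N c T lo hi sp where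
  poly_lt j hj := h.poly_lt j (by omega)
  lo_le j hj := h.lo_le j (by omega)
  hi_le j hj := h.hi_le j (by omega)
  sorted i j hij hj := h.sorted i j hij (by omega)
  convex := h.convex.mono (by rw [stackPoints_succ]; exact Set.subset_union_left)

theorem isArc (h : HullStack k N c T lo hi sp) (hc : ∀ t < k, IsArc (c t) 0 (N t)) {j : ℕ}
    (hj : j < sp) : IsArc (c (T j)) (lo j) (hi j) :=
  (hc _ (h.poly_lt j hj)).mono (Nat.zero_le _) (h.hi_le j hj)

theorem key_le_of_mem (h : HullStack k N c T lo hi (sp + 1)) (hc : ∀ t < k, IsArc (c t) 0 (N t))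
    {x : Plane} (hx : x ∈ stackPoints c T lo hi (sp + 1)) : key x ≤ key (c (T sp) (hi sp)) := by
  obtain ⟨j, hj, a, ha, ha', rfl⟩ := hx
  refine ((h.isArc hc hj).le ha ha' le_rfl).trans ?_
  rcases Nat.lt_succ_iff_lt_or_eq.1 hj with hj' | rfl
  · exact ((h.sorted j sp hj' (by omega)).le).trans
      ((h.isArc hc (Nat.lt_succ_self sp)).le le_rfl (h.lo_le sp (by omega)) le_rfl)
  · exact le_rfl

theorem key_lt_of_mem (h : HullStack k N c T lo hi (sp + 1)) (hc : ∀ t < k, IsArc (c t) 0 (N t))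
    {x : Plane} (hx : x ∈ stackPoints c T lo hi sp) : key x < key (c (T sp) (lo sp)) := by
  obtain ⟨j, hj, a, ha, ha', rfl⟩ := hx
  exact ((h.isArc hc (Nat.lt_succ_of_lt hj)).le ha ha' le_rfl).trans_lt
    (h.sorted j sp hj (Nat.lt_succ_self sp))

theorem push_first {t l r : ℕ} (ht : t < k) (hlr : l ≤ r) (hr : r ≤ N t)
    (hc : ∀ t < k, IsArc (c t) 0 (N t)) (hT : T 0 = t) (hlo : lo 0 = l) (hhi : hi 0 = r) :
    HullStack k N c T lo hi 1 ∧ stackPoints c T lo hi 1 = arcPoints (c t) l r := by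
  have e : stackPoints c T lo hi 1 = arcPoints (c t) l r := by
    rw [stackPoints_succ, hT, hlo, hhi]
    simp [stackPoints]
  refine ⟨⟨?_, ?_, ?_, fun i j hij hj => by omega, ?_⟩, e⟩
  · intro j hj; obtain rfl : j = 0 := by omega
    rwa [hT]
  · intro j hj; obtain rfl : j = 0 := by omega
    rwa [hlo, hhi]
  · intro j hj; obtain rfl : j = 0 := by omega
    rwa [hhi, hT]
  · rw [e]; exact ((hc t ht).mono (Nat.zero_le _) hr).convexChain

/-- Removing an arc that lies above the line from the arc before it to the new arc. -/
theorem above_of_pop (h : HullStack k N c T lo hi (sp + 2)) (hc : ∀ t < k, IsArc (c t) 0 (N t))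
    {t l r u w : ℕ} (hb : IsBridge (c (T (sp + 1))) (lo (sp + 1)) (hi (sp + 1)) (c t) l r u w)
    (hlt : key (c (T (sp + 1)) (hi (sp + 1))) < key (c t l)) (ht : IsArc (c t) l r)
    (hu : u = lo (sp + 1))
    (ho : orient (c (T sp) (hi sp)) (c (T (sp + 1)) u) (c t w) ≤ 0) {x : Plane}
    (hx : x ∈ stackPoints c T lo hi (sp + 2)) :
    Above (stackPoints c T lo hi (sp + 1) ∪ arcPoints (c t) l r) x := by
  rw [stackPoints_succ] at hx
  rcases hx with hx | ⟨a, ha, ha', rfl⟩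
  · exact .of_mem (Or.inl hx)
  · have harc := h.isArc hc (show sp + 1 < sp + 2 by omega)
    have hsu := h.sorted sp (sp + 1) (by omega) (by omega)
    have hus := harc.le le_rfl ha ha'
    have hw : key (c t l) ≤ key (c t w) := ht.le le_rfl hb.le_w hb.w_le
    have haw : key (c (T (sp + 1)) a) < key (c t w) :=
      (harc.le ha ha' le_rfl).trans_lt (hlt.trans_le hw)
    -- All of the top arc lies above the segment from the entry before to `c t w`: its first point
    -- `u` by the failed turn, and the later points because they are above the bridge, by comparing
    -- directions around `c t w`.
    refine .of_orient (u := c (T sp) (hi sp)) (w := c t w)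
      (Or.inl ⟨sp, by omega, hi sp, h.lo_le sp (by omega), le_rfl, rfl⟩)
      (Or.inr ⟨w, hb.le_w, hb.w_le, rfl⟩) (hsu.le.trans hus) haw.le ?_
    rw [hu] at ho hb
    rcases eq_or_lt_of_le ha with rfl | hlt'
    · rw [orient_swap]; linarith
    · have f := (orient_fan' (o := c t w) haw (hus.trans_lt haw) (hsu.trans_le hus |>.trans haw)
        (by rw [orient_rotate]; exact hb.after_u a hlt' ha')
        (by rw [orient_rotate, orient_swap]; linarith)).1
      rwa [orient_rotate] at f

/-- Adding an arc on top of the stack, with the bridge from entry `sp` to it. -/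
theorem push (h : HullStack k N c T lo hi (sp + 1)) (hc : ∀ t < k, IsArc (c t) 0 (N t))
    {t l r u w : ℕ} (ht : t < k) (hr : r ≤ N t)
    (hb : IsBridge (c (T sp)) (lo sp) (hi sp) (c t) l r u w)
    (hlt : key (c (T sp) (hi sp)) < key (c t l))
    (ho : u = lo sp → 0 < sp →
      0 < orient (c (T (sp - 1)) (hi (sp - 1))) (c (T sp) u) (c t w))
    {T' lo' hi' : ℕ → ℕ} (hT : ∀ j ≤ sp, T' j = T j) (hlo : ∀ j ≤ sp, lo' j = lo j)
    (hhi : ∀ j < sp, hi' j = hi j) (hu : hi' sp = u) (hT' : T' (sp + 1) = t)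
    (hlo' : lo' (sp + 1) = w) (hhi' : hi' (sp + 1) = r) :
    HullStack k N c T' lo' hi' (sp + 2) ∧
      stackPoints c T' lo' hi' (sp + 2) ⊆ stackPoints c T lo hi (sp + 1) ∪ arcPoints (c t) l r ∧
      ∀ x ∈ stackPoints c T lo hi (sp + 1) ∪ arcPoints (c t) l r,
        Above (stackPoints c T' lo' hi' (sp + 2)) x := by
  have harc := h.isArc hc (Nat.lt_succ_self sp)
  have ht' : IsArc (c t) l r := (hc t ht).mono (Nat.zero_le _) hr
  have hu₁ := hb.le_u
  have hu₂ := hb.u_le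
  have hw₁ := hb.le_w
  have hw₂ := hb.w_le
  have huw : key (c (T sp) u) < key (c t w) :=
    (harc.le hu₁ hu₂ le_rfl).trans_lt (hlt.trans_le (ht'.le le_rfl hw₁ hw₂))
  have e : stackPoints c T' lo' hi' (sp + 2) =
      (stackPoints c T lo hi sp ∪ arcPoints (c (T sp)) (lo sp) u) ∪ arcPoints (c t) w r := by
    rw [stackPoints_succ, stackPoints_succ, hT', hlo', hhi', hu, hT sp le_rfl, hlo sp le_rfl,
      stackPoints_congr (fun j hj => hT j hj.le) (fun j hj => hlo j hj.le) hhi]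
  have hsub : stackPoints c T lo hi sp ∪ arcPoints (c (T sp)) (lo sp) u ⊆
      stackPoints c T lo hi (sp + 1) := by
    rw [stackPoints_succ]
    refine Set.union_subset_union_right _ ?_
    rintro _ ⟨a, ha, ha', rfl⟩
    exact ⟨a, ha, ha'.trans hu₂, rfl⟩
  have hsub' : arcPoints (c t) w r ⊆ arcPoints (c t) l r := by
    rintro _ ⟨a, ha, ha', rfl⟩
    exact ⟨a, hw₁.trans ha, ha', rfl⟩
  have hlow : ∀ x ∈ stackPoints c T lo hi sp, key x < key (c (T sp) u) := fun x hx =>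
    (h.key_lt_of_mem hc hx).trans_le (harc.le le_rfl hu₁ hu₂)
  refine ⟨⟨?_, ?_, ?_, ?_, ?_⟩, ?_, ?_⟩
  · intro j hj
    rcases Nat.lt_succ_iff_lt_or_eq.1 hj with hj | rfl
    · rw [hT j (by omega)]; exact h.poly_lt j hj
    · rwa [hT']
  · intro j hj
    rcases lt_trichotomy j sp with hj' | rfl | hj'
    · rw [hlo j hj'.le, hhi j hj']; exact h.lo_le j (by omega)
    · rw [hlo j le_rfl, hu]; exact hu₁
    · obtain rfl : j = sp + 1 := by omega
      rw [hlo', hhi']; exact hw₂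
  · intro j hj
    rcases lt_trichotomy j sp with hj' | rfl | hj'
    · rw [hT j hj'.le, hhi j hj']; exact h.hi_le j (by omega)
    · rw [hT j le_rfl, hu]; exact hu₂.trans (h.hi_le j (by omega))
    · obtain rfl : j = sp + 1 := by omega
      rw [hT', hhi']; exact hr
  · intro i j hij hj
    have hi₁ : ∀ i < sp, key (c (T' i) (hi' i)) < key (c (T sp) (lo sp)) := fun i hi' => by
      rw [hT i hi'.le, hhi i hi']; exact h.sorted i sp hi' (by omega)
    rcases lt_trichotomy j sp with hj' | rfl | hj'
    · rw [hT i (by omega), hhi i (by omega), hT j hj'.le, hlo j hj'.le]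
      exact h.sorted i j hij (by omega)
    · rw [hT j le_rfl, hlo j le_rfl]; exact hi₁ i hij
    · obtain rfl : j = sp + 1 := by omega
      rw [hT', hlo']
      rcases Nat.lt_succ_iff_lt_or_eq.1 hij with hi' | rfl
      · exact (hi₁ i hi').trans_le ((harc.le le_rfl hu₁ hu₂).trans huw.le)
      · rw [hT i le_rfl, hu]; exact huw
  · rw [e]
    refine (h.convex.mono hsub).union (ht'.mono hw₁ le_rfl).convexChain (u := c (T sp) u)
      (w := c t w) (Or.inr ⟨u, hu₁, le_rfl, rfl⟩) ⟨w, le_rfl, hw₂, rfl⟩ ?_ ?_ huw ?_ ?_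
    · rintro x (hx | ⟨a, ha, ha', rfl⟩)
      · exact (hlow x hx).le
      · exact harc.le ha ha' hu₂
    · rintro _ ⟨a, ha, ha', rfl⟩
      exact ht'.le hw₁ ha ha'
    · rintro x (hx | ⟨a, ha, ha', rfl⟩) hxu
      · have hxlo := h.key_lt_of_mem hc hx
        have hx' : x ∈ stackPoints c T lo hi (sp + 1) := hsub (Or.inl hx)
        have hmem : ∀ a, lo sp ≤ a → a ≤ hi sp → c (T sp) a ∈ stackPoints c T lo hi (sp + 1) :=
          fun a ha ha' => ⟨sp, by omega, a, ha, ha', rfl⟩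
        -- If the trimmed arc is the single point `u`, the turn at `u` comes from the previous entry
        -- and is what `ho` provides. Otherwise the arc has an earlier point, and the turn from
        -- there is part of the bridge property.
        rcases eq_or_lt_of_le hu₁ with hu' | hu'
        · have hsp : 0 < sp := by
            obtain ⟨j, hj, -⟩ := hx
            omega
          have ho' := ho hu'.symm hsp
          have hs := h.sorted (sp - 1) sp (by omega) (by omega)
          rw [hu'] at hs
          obtain ⟨s, rfl⟩ : ∃ s, sp = s + 1 := ⟨sp - 1, by omega⟩
          have hle := h.pop.key_le_of_mem hc hx
          rw [Nat.add_sub_cancel] at ho' hs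
          rcases eq_or_lt_of_le hle with he | hlt'
          · rw [key_injective he]; exact ho'
          · exact orient_four_right hlt' hs huw (h.convex hx' ⟨s, by omega, hi s,
              h.lo_le s (by omega), le_rfl, rfl⟩ (hmem u hu₁ hu₂) hlt' hs) ho'
        · have hs := harc.lt le_rfl hu' hu₂
          exact orient_four_right hxlo hs huw (h.convex hx' (hmem _ le_rfl (hu₁.trans hu₂))
            (hmem u hu₁ hu₂) hxlo hs) (hb.before_u _ le_rfl hu')
      · exact hb.before_u a ha (harc.lt_of_key_lt (ha'.trans hu₂) hu₁ hxu)
    · rintro _ ⟨a, ha, ha', rfl⟩ hwx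
      exact hb.after_w a (ht'.lt_of_key_lt hw₂ (hw₁.trans ha) hwx) ha'
  · rw [e]; exact Set.union_subset_union hsub hsub'
  · rw [e]
    have hmu : c (T sp) u ∈ stackPoints c T lo hi sp ∪ arcPoints (c (T sp)) (lo sp) u ∪
      arcPoints (c t) w r := Or.inl (Or.inr ⟨u, hu₁, le_rfl, rfl⟩)
    have hmw : c t w ∈ stackPoints c T lo hi sp ∪ arcPoints (c (T sp)) (lo sp) u ∪
      arcPoints (c t) w r := Or.inr ⟨w, le_rfl, hw₂, rfl⟩
    rw [stackPoints_succ]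
    rintro x ((hx | ⟨a, ha, ha', rfl⟩) | ⟨a, ha, ha', rfl⟩)
    · exact .of_mem (Or.inl (Or.inl hx))
    · rcases le_or_gt a u with hau | hau
      · exact .of_mem (Or.inl (Or.inr ⟨a, ha, hau, rfl⟩))
      · exact .of_orient hmu hmw (harc.lt hu₁ hau ha').le
          ((harc.le ha ha' le_rfl).trans (hlt.le.trans (ht'.le le_rfl hw₁ hw₂)))
          (hb.after_u a hau ha')
    · rcases le_or_gt w a with haw | haw
      · exact .of_mem (Or.inr ⟨a, haw, ha', rfl⟩)
      · exact .of_orient hmu hmw ((harc.le hu₁ hu₂ le_rfl).trans (hlt.le.trans (ht'.le le_rfl ha ha')))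
          (ht'.lt ha haw hw₂).le (hb.before_w a ha haw)

end HullStack


/-! ## Convex hulls composed of two lower hulls -/

theorem val_finRotate {n : ℕ} (j : Fin n) : ((finRotate n j : Fin n) : ℕ) = (j + 1) % n := by
  cases n with
  | zero => exact j.elim0
  | succ n =>
    rw [finRotate_apply, Fin.val_add]
    simp

theorem sum_edgeLength {n : ℕ} (W : ℕ → Plane) (hW : W n = W 0) :
    ∑ j, edgeLength (fun i : Fin n => W i) j = ∑ j ∈ Finset.range n, dist (W j) (W (j + 1)) := by
  rw [← Fin.sum_univ_eq_sum_range (fun j => dist (W j) (W (j + 1)))]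
  refine Finset.sum_congr rfl fun j _ => ?_
  rw [edgeLength, val_finRotate]
  rcases eq_or_lt_of_le (show (j : ℕ) + 1 ≤ n from j.2) with h | h
  · rw [h, Nat.mod_self, hW]
  · rw [Nat.mod_eq_of_lt h]

/-- A point above the chord of an arc lies above every line through two points of the arc. -/
theorem IsArc.orient_pos {a : ℕ → Plane} {p : ℕ} (h : IsArc a 0 p) {i j : ℕ} (hij : i < j)
    (hj : j < p) {z : Plane} (h₀ : key (a 0) ≤ key z) (h₁ : key z ≤ key (a p))
    (hz : 0 < orient (a 0) (a p) z) : 0 < orient (a i) (a j) z := by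
  -- Up to positive factors, the height of `z` over the line through `a i` and `a j` is the height
  -- of the chord there, interpolated between its ends, plus the height of `z` over the chord.
  have e : (a p 0 - a 0 0) * orient (a i) (a j) z =
      (a p 0 - z 0) * orient (a i) (a j) (a 0) + (z 0 - a 0 0) * orient (a i) (a j) (a p) +
      (a j 0 - a i 0) * orient (a 0) (a p) z := by
    simp only [orient]; ring
  have f₁ : 0 ≤ orient (a i) (a j) (a 0) := by
    rcases Nat.eq_zero_or_pos i with rfl | hi
    · rw [orient_self_outer]
    · rw [orient_rotate]; exact (h.ccw le_rfl hi hij hj.le).le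
  have f₂ := h.ccw (Nat.zero_le i) hij hj le_rfl
  have m₀ := fst_le_of_key_le h₀
  have m₁ := fst_le_of_key_le h₁
  have m₂ : 0 < a j 0 - a i 0 := by
    rcases sub_of_key_lt (h.lt (Nat.zero_le i) hij hj.le) with hh | ⟨hh, hh'⟩
    · exact hh
    · simp only [orient, hh] at f₂
      have := mul_nonneg hh'.le (show 0 ≤ a p 0 - a i 0 by
        have := fst_le_of_key_le (h.le (Nat.zero_le i) (hij.trans hj).le le_rfl); linarith)
      linarith
  refine pos_of_mul_pos_right (a := a p 0 - a 0 0) ?_ (by linarith)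
  have := mul_nonneg (sub_nonneg.2 m₁) f₁
  have := mul_nonneg (sub_nonneg.2 m₀) f₂.le
  have := mul_pos m₂ hz
  linarith

/-- If the points of `V` lie above the arc `a`, and their negatives above the arc `b`, then these
arcs make up the boundary of the convex hull of `V`. -/
theorem isPerimeter_of_arcs {V : Set Plane} (hV : V.Nontrivial) {a b : ℕ → Plane} {p q : ℕ}
    (ha : IsArc a 0 p) (hb : IsArc b 0 q) (haV : ∀ i ≤ p, a i ∈ V) (hbV : ∀ j ≤ q, -b j ∈ V)
    (hVa : ∀ x ∈ V, Above (arcPoints a 0 p) x) (hVb : ∀ x ∈ V, Above (arcPoints b 0 q) (-x)) :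
    IsPerimeter (convexHull ℝ V) (∑ i ∈ Finset.range p, dist (a i) (a (i + 1)) +
      ∑ j ∈ Finset.range q, dist (b j) (b (j + 1))) := by
  have ha₀ : ∀ x ∈ V, key (a 0) ≤ key x := fun x hx => by
    obtain ⟨_, ⟨i, -, hi, rfl⟩, h⟩ := (hVa x hx).2.1
    exact (ha.le le_rfl (Nat.zero_le i) hi).trans h
  have ha₁ : ∀ x ∈ V, key x ≤ key (a p) := fun x hx => by
    obtain ⟨_, ⟨i, -, hi, rfl⟩, h⟩ := (hVa x hx).2.2
    exact h.trans (ha.le (Nat.zero_le i) hi le_rfl)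
  have hb₀ : ∀ x ∈ V, key x ≤ key (-b 0) := fun x hx => by
    obtain ⟨_, ⟨i, -, hi, rfl⟩, h⟩ := (hVb x hx).2.1
    have := (hb.le le_rfl (Nat.zero_le i) hi).trans h
    rwa [← key_neg_le_neg, neg_neg] at this
  have hb₁ : ∀ x ∈ V, key (-b q) ≤ key x := fun x hx => by
    obtain ⟨_, ⟨i, -, hi, rfl⟩, h⟩ := (hVb x hx).2.2
    have := h.trans (hb.le (Nat.zero_le i) hi le_rfl)
    rwa [← key_neg_le_neg, neg_neg] at this
  -- The reflected arc `-b` starts where `a` ends, at the greatest point of `V`, and returns to the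
  -- least one.
  have e₀ : -b 0 = a p := key_injective
    (le_antisymm (ha₁ _ (hbV 0 (Nat.zero_le q))) (hb₀ _ (haV p le_rfl)))
  have e₁ : -b q = a 0 := key_injective
    (le_antisymm (hb₁ _ (haV 0 (Nat.zero_le p))) (ha₀ _ (hbV q le_rfl)))
  have hpos : 0 < p ∧ 0 < q := by
    have hne : a 0 ≠ a p := fun he => by
      obtain ⟨x, hx, y, hy, hxy⟩ := hV
      have : ∀ z ∈ V, z = a 0 := fun z hz =>
        key_injective (le_antisymm (he ▸ ha₁ z hz) (ha₀ z hz))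
      exact hxy ((this x hx).trans (this y hy).symm)
    refine ⟨Nat.pos_of_ne_zero fun h0 => hne (by rw [h0]), Nat.pos_of_ne_zero fun h0 => hne ?_⟩
    rw [← e₀, ← e₁, h0]
  have hbz : ∀ {j}, 0 < j → j < q → 0 < orient (a 0) (a p) (-b j) := fun {j} hj hjq => by
    rw [← e₀, ← e₁, orient_neg, orient_rotate, orient_rotate]
    exact hb.ccw le_rfl hj hjq le_rfl
  have haz : ∀ {i}, 0 < i → i < p → 0 < orient (b 0) (b q) (-a i) := fun {i} hi hip => by
    rw [← neg_neg (b 0), ← neg_neg (b q), e₀, e₁, orient_neg, orient_rotate, orient_rotate]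
    exact ha.ccw le_rfl hi hip le_rfl
  -- The closed polygon: `a` without its last point, followed by `-b` without its last point, so
  -- that both extremes occur exactly once.
  set W : ℕ → Plane := fun i => if i < p then a i else -b (i - p) with hW
  have W₁ : ∀ {i}, i ≤ p → W i = a i := fun {i} hi => by
    rcases eq_or_lt_of_le hi with rfl | hi
    · simp [hW, e₀]
    · simp [hW, hi]
  have W₂ : ∀ {j}, W (p + j) = -b j := fun {j} => by simp [hW]
  have hcases : ∀ i, i < p + q → i < p ∨ ∃ j < q, i = p + j := fun i hi => by
    rcases lt_or_ge i p with h | h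
    · exact Or.inl h
    · exact Or.inr ⟨i - p, by omega, by omega⟩
  have hWV : ∀ i < p + q, W i ∈ V := fun i hi => by
    rcases hcases i hi with h | ⟨j, hj, rfl⟩
    · rw [W₁ h.le]; exact haV i h.le
    · rw [W₂]; exact hbV j hj.le
  -- Inner points of `-b` are strictly above the common chord and inner points of `a` strictly below
  -- it.
  have hmix : ∀ {i j}, i < p → j < q → a i ≠ -b j := by
    intro i j hi hj he
    rcases Nat.eq_zero_or_pos j with rfl | hj'
    · rw [e₀] at he
      exact (ha.lt (Nat.zero_le i) hi le_rfl).ne (congrArg key he)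
    · have h₁ := hbz hj' hj
      rw [← he] at h₁
      rcases Nat.eq_zero_or_pos i with rfl | hi'
      · rw [orient_self_outer] at h₁; exact lt_irrefl _ h₁
      · have h₂ := ha.ccw le_rfl hi' hi le_rfl
        rw [orient_swap] at h₁; linarith
  refine ⟨p + q, fun i => W i, ⟨by omega, ?_, ?_⟩, ?_, ?_⟩
  · rintro ⟨i, hi⟩ ⟨j, hj⟩ hij
    simp only at hij
    rw [Fin.mk.injEq]
    have hinj : ∀ {c : ℕ → Plane} {r i j}, IsArc c 0 r → i < r → j < r → c i = c j → i = j := by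
      intro c r i j hc hi hj he
      rcases lt_trichotomy i j with h | h | h
      · exact absurd (congrArg key he) (hc.lt (Nat.zero_le i) h hj.le).ne
      · exact h
      · exact absurd (congrArg key he) (hc.lt (Nat.zero_le j) h hi.le).ne'
    rcases hcases i hi with hi' | ⟨i', hi', rfl⟩ <;> rcases hcases j hj with hj' | ⟨j', hj', rfl⟩
    · rw [W₁ hi'.le, W₁ hj'.le] at hij
      exact hinj ha hi' hj' hij
    · rw [W₁ hi'.le, W₂] at hij
      exact absurd hij (hmix hi' hj')
    · rw [W₂, W₁ hj'.le] at hij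
      exact absurd hij.symm (hmix hj' hi')
    · rw [W₂, W₂] at hij
      rw [hinj hb hi' hj' (neg_injective hij)]
  · rintro ⟨i, hi⟩ ⟨j, hj⟩ ⟨l, hl⟩ hij hjl
    simp only [Fin.mk_lt_mk] at hij hjl ⊢
    rcases hcases l hl with hl' | ⟨l', hl', rfl⟩
    · rw [W₁ (by omega), W₁ (by omega), W₁ (by omega)]
      exact ha.ccw (Nat.zero_le i) hij hjl hl'.le
    rcases hcases j hj with hj' | ⟨j', hj', rfl⟩
    · rw [W₁ (by omega), W₁ (by omega)]
      rcases Nat.eq_zero_or_pos l' with rfl | hl''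
      · rw [add_zero, W₁ le_rfl]
        exact ha.ccw (Nat.zero_le i) hij hj' le_rfl
      · have := hWV _ hl
        rw [W₂] at this ⊢
        exact ha.orient_pos hij hj' (ha₀ _ this) (ha₁ _ this) (hbz hl'' hl')
    have hjl' : j' < l' := by omega
    rcases hcases i hi with hi' | ⟨i', hi', rfl⟩
    · rw [W₁ hi'.le, W₂, W₂, ← neg_neg (a i), orient_neg, ← orient_rotate]
      rcases Nat.eq_zero_or_pos i with rfl | hi''
      · rw [← e₁, neg_neg]
        exact hb.ccw (Nat.zero_le j') hjl' hl' le_rfl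
      · refine hb.orient_pos hjl' hl' ?_ ?_ (haz hi'' hi')
        · rw [← neg_neg (b 0), key_neg_le_neg]; exact hb₀ _ (haV i hi'.le)
        · rw [← neg_neg (b q), key_neg_le_neg]; exact hb₁ _ (haV i hi'.le)
    · rw [W₂, W₂, W₂, orient_neg]
      exact hb.ccw (Nat.zero_le i') (by omega) hjl' hl'.le
  · have hmemW : ∀ i < p + q, W i ∈ region fun i : Fin (p + q) => W i := fun i hi =>
      subset_convexHull ℝ _ ⟨⟨i, hi⟩, rfl⟩
    have hmemA : ∀ i ≤ p, a i ∈ region fun i : Fin (p + q) => W i := fun i hi => by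
      rw [← W₁ hi]; exact hmemW i (by omega)
    have hmemB : ∀ j ≤ q, -b j ∈ region fun i : Fin (p + q) => W i := fun j hj => by
      rcases eq_or_lt_of_le hj with rfl | hj
      · rw [e₁]; exact hmemA 0 (Nat.zero_le p)
      · rw [← W₂]; exact hmemW _ (by omega)
    refine Set.Subset.antisymm (convexHull_mono ?_) (convexHull_min ?_ (convex_convexHull ℝ _))
    · rintro _ ⟨⟨i, hi⟩, rfl⟩
      exact hWV i hi
    intro x hx
    by_contra hnot
    -- A point of `V` outside the polygon would be separated from it by a linear functional. Unless
    -- that is horizontal, it is a multiple of a `height`.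
    obtain ⟨f, u, hf, hfx⟩ := geometric_hahn_banach_closed_point (convex_convexHull ℝ _)
      ((Set.finite_range fun i : Fin (p + q) => W i).isClosed_convexHull ℝ) hnot
    have hfd : ∀ y : Plane, f y = y 0 * f (EuclideanSpace.single 0 1) +
        y 1 * f (EuclideanSpace.single 1 1) := fun y => by
      have : y = y 0 • EuclideanSpace.single 0 1 + y 1 • EuclideanSpace.single 1 1 := by
        ext i; fin_cases i <;> simp
      conv_lhs => rw [this]
      simp
    set α := f (EuclideanSpace.single 0 1)
    set β := f (EuclideanSpace.single 1 1)
    have hno : ∀ y ∈ region fun i : Fin (p + q) => W i, f y < f x := fun y hy =>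
      (hf y hy).trans hfx
    have hfh : β ≠ 0 → ∀ y : Plane, f y = β * height (-(α / β)) y := fun hβ y => by
      rw [hfd, height]; field_simp; ring
    -- A downward functional contradicts `hVa`, an upward one contradicts `hVb`, and a horizontal
    -- one contradicts that `a 0` and `a p` are extreme.
    rcases lt_trichotomy β 0 with hβ | hβ | hβ
    · obtain ⟨_, ⟨i, -, hi, rfl⟩, h⟩ := (hVa x hx).1 (-(α / β))
      have h₁ := hno _ (hmemA i hi)
      rw [hfh hβ.ne, hfh hβ.ne] at h₁
      exact h₁.not_ge (mul_le_mul_of_nonpos_left h hβ.le)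
    · rw [hβ] at hfd
      rcases le_total 0 α with hα | hα
      · have h₁ := hno _ (hmemA p le_rfl)
        rw [hfd, hfd] at h₁
        have := mul_le_mul_of_nonneg_right (fst_le_of_key_le (ha₁ x hx)) hα
        linarith
      · have h₁ := hno _ (hmemA 0 (Nat.zero_le p))
        rw [hfd, hfd] at h₁
        have := mul_le_mul_of_nonpos_right (fst_le_of_key_le (ha₀ x hx)) hα
        linarith
    · obtain ⟨_, ⟨i, -, hi, rfl⟩, h⟩ := (hVb x hx).1 (-(α / β))
      have h₁ := hno _ (hmemB i hi)
      rw [map_neg, hfh hβ.ne'] at h₁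
      have h₂ := mul_le_mul_of_nonneg_left h hβ.le
      rw [← hfh hβ.ne', ← hfh hβ.ne', map_neg] at h₂
      rw [← hfh hβ.ne'] at h₁
      linarith
  · rw [sum_edgeLength W (by rw [W₂, W₁ (Nat.zero_le p), e₁]), Finset.sum_range_add]
    congr 1
    · refine Finset.sum_congr rfl fun i hi => ?_
      have := Finset.mem_range.1 hi
      rw [W₁ this.le, W₁ this]
    · refine Finset.sum_congr rfl fun j hj => ?_
      rw [W₂, add_assoc, W₂, dist_neg_neg]

/-! ### The length of a stack of arcs -/

/-- The length of the chain formed by the arcs on the stack; `len t s` is the length of the chain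
`c t` up to its point number `s`. -/
noncomputable def stackLength (c : ℕ → ℕ → Plane) (len : ℕ → ℕ → ℝ) (T lo hi : ℕ → ℕ) : ℕ → ℝ
  | 0 => 0
  | j + 1 => stackLength c len T lo hi j + (len (T j) (hi j) - len (T j) (lo j)) +
      if j = 0 then 0 else dist (c (T (j - 1)) (hi (j - 1))) (c (T j) (lo j))

/-- Concatenates the entries of the stack into one sequence. The induction only has to carry that
the keys increase, because all left turns come from `ConvexChain` once the points are known to be
those on the stack. -/
theorem HullStack.exists_arc {k : ℕ} {N : ℕ → ℕ} {c : ℕ → ℕ → Plane} {T lo hi : ℕ → ℕ} {sp : ℕ}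
    (h : HullStack k N c T lo hi (sp + 1)) (hc : ∀ t < k, IsArc (c t) 0 (N t))
    {len : ℕ → ℕ → ℝ}
    (hlen : ∀ t < k, ∀ s < N t, len t (s + 1) = len t s + dist (c t s) (c t (s + 1))) :
    ∃ (a : ℕ → Plane) (p : ℕ), IsArc a 0 p ∧ arcPoints a 0 p = stackPoints c T lo hi (sp + 1) ∧
      stackLength c len T lo hi (sp + 1) = ∑ i ∈ Finset.range p, dist (a i) (a (i + 1)) := by
  have harc : ∀ t < k, ∀ l d, l + d ≤ N t →
      len t (l + d) - len t l = ∑ i ∈ Finset.range d, dist (c t (l + i)) (c t (l + (i + 1))) := by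
    intro t ht l d
    induction d with
    | zero => simp
    | succ d ih =>
      intro hd
      rw [Finset.sum_range_succ, ← ih (by omega), ← add_assoc, hlen t ht _ (by omega)]
      ring
  suffices H : ∃ (a : ℕ → Plane) (p : ℕ), (∀ i j, i < j → j ≤ p → key (a i) < key (a j)) ∧
      arcPoints a 0 p = stackPoints c T lo hi (sp + 1) ∧ a p = c (T sp) (hi sp) ∧
      stackLength c len T lo hi (sp + 1) = ∑ i ∈ Finset.range p, dist (a i) (a (i + 1)) by
    obtain ⟨a, p, hlt, hpts, -, hsum⟩ := H
    refine ⟨a, p, ⟨fun _ hst ht => hlt _ _ hst ht, fun {s t u} hs hst htu hu => ?_⟩, hpts, hsum⟩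
    have hmem : ∀ i ≤ p, a i ∈ stackPoints c T lo hi (sp + 1) := fun i hi => by
      rw [← hpts]; exact ⟨i, Nat.zero_le i, hi, rfl⟩
    exact h.convex (hmem s (by omega)) (hmem t (by omega)) (hmem u hu) (hlt _ _ hst (by omega))
      (hlt _ _ htu hu)
  induction sp with
  | zero =>
    have h₁ := h.lo_le 0 (by omega)
    have h₂ := h.hi_le 0 (by omega)
    have h₃ := h.isArc hc (show 0 < 0 + 1 by omega)
    refine ⟨fun i => c (T 0) (lo 0 + i), hi 0 - lo 0, fun i j hij hj =>
      h₃.lt (by omega) (by omega) (by omega), ?_, ?_, ?_⟩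
    · rw [stackPoints_succ]
      ext x
      simp only [stackPoints, arcPoints, Set.mem_union, Set.mem_ofPred_eq]
      constructor
      · rintro ⟨i, -, hi', rfl⟩
        exact Or.inr ⟨lo 0 + i, by omega, by omega, rfl⟩
      · rintro (⟨j, hj, -⟩ | ⟨i, hi', hi'', rfl⟩)
        · omega
        · exact ⟨i - lo 0, by omega, by omega, by rw [Nat.add_sub_cancel' hi']⟩
    · simp [Nat.add_sub_cancel' h₁]
    · rw [← harc _ (h.poly_lt 0 (by omega)) _ _ (by omega), Nat.add_sub_cancel' h₁]
      simp [stackLength]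
  | succ sp ih =>
    obtain ⟨a, p, hlt, hpts, hap, hsum⟩ := ih h.pop
    have h₁ := h.lo_le (sp + 1) (by omega)
    have h₂ := h.hi_le (sp + 1) (by omega)
    have h₃ := h.isArc hc (show sp + 1 < sp + 1 + 1 by omega)
    have h₄ : ∀ i ≤ p, key (a i) < key (c (T (sp + 1)) (lo (sp + 1))) := fun i hi' =>
      h.key_lt_of_mem hc (hpts ▸ ⟨i, Nat.zero_le i, hi', rfl⟩)
    set d := hi (sp + 1) - lo (sp + 1) with hd
    set b : ℕ → Plane := fun i => if i ≤ p then a i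
      else c (T (sp + 1)) (lo (sp + 1) + (i - (p + 1))) with hb
    have b₁ : ∀ {i}, i ≤ p → b i = a i := fun {i} hi => by simp [hb, hi]
    have b₂ : ∀ {i}, b (p + 1 + i) = c (T (sp + 1)) (lo (sp + 1) + i) := fun {i} => by
      simp only [hb]
      rw [if_neg (by omega), show p + 1 + i - (p + 1) = i by omega]
    have hcases : ∀ i, i ≤ p + 1 + d → i ≤ p ∨ ∃ j ≤ d, i = p + 1 + j := fun i hi => by
      rcases le_or_gt i p with h | h
      · exact Or.inl h
      · exact Or.inr ⟨i - (p + 1), by omega, by omega⟩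
    refine ⟨b, p + 1 + d, ?_, ?_, ?_, ?_⟩
    · intro i j hij hj
      rcases hcases j hj with hj' | ⟨j', hj', rfl⟩
      · rw [b₁ hj', b₁ (by omega)]; exact hlt i j hij hj'
      rw [b₂]
      rcases hcases i (by omega) with hi' | ⟨i', hi', rfl⟩
      · rw [b₁ hi']
        exact (h₄ i hi').trans_le (h₃.le le_rfl (by omega) (by omega))
      · rw [b₂]; exact h₃.lt (by omega) (by omega) (by omega)
    · rw [stackPoints_succ, ← hpts]
      ext x
      constructor
      · rintro ⟨i, -, hi', rfl⟩
        rcases hcases i hi' with hi'' | ⟨j, hj, rfl⟩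
        · exact Or.inl ⟨i, Nat.zero_le i, hi'', b₁ hi''⟩
        · exact Or.inr ⟨lo (sp + 1) + j, by omega, by omega, b₂⟩
      · rintro (⟨i, -, hi', rfl⟩ | ⟨i, hi', hi'', rfl⟩)
        · exact ⟨i, Nat.zero_le i, by omega, (b₁ hi').symm⟩
        · refine ⟨p + 1 + (i - lo (sp + 1)), Nat.zero_le _, by omega, ?_⟩
          rw [b₂, Nat.add_sub_cancel' hi']
    · rw [b₂, hd, Nat.add_sub_cancel' h₁]
    · have e₁ := harc _ (h.poly_lt (sp + 1) (by omega)) (lo (sp + 1)) d (by omega)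
      rw [hd, Nat.add_sub_cancel' h₁, ← hd] at e₁
      rw [stackLength, hsum, e₁, if_neg (by omega), Nat.add_sub_cancel, ← hap, Finset.sum_range_add,
        Finset.sum_range_succ, b₁ le_rfl, show b (p + 1) = c (T (sp + 1)) (lo (sp + 1)) from b₂ (i := 0)]
      have e₂ : ∑ i ∈ Finset.range p, dist (a i) (a (i + 1)) =
          ∑ i ∈ Finset.range p, dist (b i) (b (i + 1)) :=
        Finset.sum_congr rfl fun i hi => by
          have := Finset.mem_range.1 hi
          rw [b₁ this.le, b₁ this]
      have e₃ : ∑ i ∈ Finset.range d,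
            dist (c (T (sp + 1)) (lo (sp + 1) + i)) (c (T (sp + 1)) (lo (sp + 1) + (i + 1))) =
          ∑ i ∈ Finset.range d, dist (b (p + 1 + i)) (b (p + 1 + i + 1)) :=
        Finset.sum_congr rfl fun i hi => by rw [b₂, add_assoc, b₂]
      rw [e₂, e₃]
      ring


/-! ## Binary search and tournament trees -/

/-- The binary length is the measure of all binary searches here: halving an interval lowers it by
at least one. -/
theorem Nat.size_lt_size_of_le_half {a b : ℕ} (h : a ≤ b / 2) (hb : 0 < b) :
    Nat.size a < Nat.size b := by
  have h₁ : 0 < Nat.size b := Nat.size_pos.2 hb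
  have h₂ : b < 2 ^ Nat.size b := Nat.lt_size_self b
  obtain ⟨n, hn⟩ : ∃ n, Nat.size b = n + 1 := ⟨Nat.size b - 1, by omega⟩
  rw [hn] at h₂ ⊢
  have h₃ : Nat.size a ≤ n := Nat.size_le.2 (by rw [pow_succ] at h₂; omega)
  omega

namespace RealRAM

open Prog

theorem Within.cons {p : Prog} {l : List Prog} {T T' : ℕ} {s : State} {Q : State → Prop}
    (h : Within p T s fun s' => Within (block l) T' s' Q) :
    Within (block (p :: l)) (T + T') s Q :=
  Within.seq h

theorem Within.nil {s : State} {Q : State → Prop} (h : Q s) : Within (block []) 1 s Q :=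
  ⟨1, s, .skip s, le_rfl, h⟩

/-- The `natVar 5` in the middle of the interval from `natVar 3` to `natVar 4` is computed, `pre` is
executed, and then `b` decides in which half to continue. -/
def bsearch (pre : Prog) (b : BExp) : Prog :=
  .loop (.not (.natLe (.var 4) (.var 3)))
    (block [.setNat 5 (.half (.add (.var 3) (.var 4))), pre,
      .ite b (.setNat 3 (.add (.var 5) (.const 1))) (.setNat 4 (.var 5))])

theorem bsearch_spec {pre : Prog} {b : BExp} {s : State} {R : ℕ → Prop} {m Tp : ℕ}
    (hfr : 3 ∉ pre.natVars ∧ 4 ∉ pre.natVars ∧ 5 ∉ pre.natVars)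
    (hpre : ∀ s', Agree (bsearch pre b) s s' → s.natVar 3 ≤ s'.natVar 5 →
      s'.natVar 5 < s.natVar 4 → Within pre Tp s' fun s'' => (b.eval s'' ↔ R (s'.natVar 5)))
    (hR : ∀ j, s.natVar 3 ≤ j → j < s.natVar 4 → (R j ↔ j < m)) (hm : s.natVar 3 ≤ m)
    (hm' : m ≤ s.natVar 4) :
    Within (bsearch pre b) ((b.cost + Tp + 20) * (Nat.size (s.natVar 4 - s.natVar 3) + 1)) s
      fun s' => s'.natVar 3 = m := by
  have key := Within.loop_of_le (s := s) (b := .not (.natLe (.var 4) (.var 3)))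
    (p := block [.setNat 5 (.half (.add (.var 3) (.var 4))), pre,
      .ite b (.setNat 3 (.add (.var 5) (.const 1))) (.setNat 4 (.var 5))])
    (fun s' => Agree (bsearch pre b) s s' ∧ s.natVar 3 ≤ s'.natVar 3 ∧ s'.natVar 3 ≤ m ∧
      m ≤ s'.natVar 4 ∧ s'.natVar 4 ≤ s.natVar 4)
    (fun s' => Nat.size (s'.natVar 4 - s'.natVar 3))
    (5 + (Tp + (b.cost + 4 + 1))) ⟨.refl _ _, le_rfl, hm, hm', le_rfl⟩ ?_
  · refine key.mono (Nat.mul_le_mul_right _ ?_) fun s' _ h => ?_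
    · simp only [BExp.cost, NExp.cost]; omega
    · obtain ⟨⟨-, h₁, h₂, h₃, h₄⟩, h₅⟩ := h
      simp only [BExp.eval, NExp.eval, not_not] at h₅
      omega
  · rintro s₁ ⟨hA, h₁, h₂, h₃, h₄⟩ hb
    simp only [BExp.eval, NExp.eval, not_le] at hb
    have hpost : Within (block [.setNat 5 (.half (.add (.var 3) (.var 4))), pre,
        .ite b (.setNat 3 (.add (.var 5) (.const 1))) (.setNat 4 (.var 5))])
        (5 + (Tp + (b.cost + 4 + 1))) s₁ fun s' =>
          (s.natVar 3 ≤ s'.natVar 3 ∧ s'.natVar 3 ≤ m ∧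
          m ≤ s'.natVar 4 ∧ s'.natVar 4 ≤ s.natVar 4) ∧
          Nat.size (s'.natVar 4 - s'.natVar 3) < Nat.size (s₁.natVar 4 - s₁.natVar 3) := by
      refine .cons ((Within.of_vc (p := .setNat 5 (.half (.add (.var 3) (.var 4))))
        (Q := fun s' => s' = s₁.setNat 5 ((s₁.natVar 3 + s₁.natVar 4) / 2)) rfl).mono (by simp [time, NExp.cost]) fun s₂ _ hs₂ => ?_)
      subst hs₂
      set mid := (s₁.natVar 3 + s₁.natVar 4) / 2 with hmid
      refine .cons ((hpre (s₁.setNat 5 mid) (hA.trans ⟨?_, fun _ _ => rfl, fun _ _ => rfl,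
        fun _ _ => rfl⟩) (by simp; omega) (by simp; omega)).imp fun s₃ hA₃ hs₃ => ?_)
      · intro x hx
        have : x ≠ 5 := by rintro rfl; simp [bsearch, block, natVars] at hx
        simp [this]
      · have e₃ := hA₃.natVar 3 hfr.1
        have e₄ := hA₃.natVar 4 hfr.2.1
        have e₅ := hA₃.natVar 5 hfr.2.2
        simp only [setNat_natVar] at e₃ e₄ e₅ hs₃
        norm_num at e₃ e₄ e₅ hs₃
        rw [hR mid (by omega) (by omega)] at hs₃
        refine .cons ((Within.ite (T := 4) (fun hb' => ?_) fun hb' => ?_).imp fun s₄ _ hs₄ =>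
          Within.nil hs₄)
        · refine (Within.of_vc ?_).mono (by simp [time, NExp.cost]) fun _ _ h => h
          rw [hs₃] at hb'
          simp [vc, e₄, e₅]
          exact ⟨⟨by omega, by omega, h₃, h₄⟩,
            Nat.size_lt_size_of_le_half (by omega) (by omega)⟩
        · refine (Within.of_vc ?_).mono (by simp [time, NExp.cost]) fun _ _ h => h
          rw [hs₃] at hb'
          simp [vc, e₃, e₅]
          exact ⟨⟨h₁, h₂, by omega, by omega⟩,
            Nat.size_lt_size_of_le_half (by omega) (by omega)⟩
    refine hpost.imp fun s' hA' h => ⟨⟨hA.trans (hA'.mono ?_ ?_ ?_ ?_), h.1⟩, h.2⟩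
    all_goals exact fun x hx => hx

/-- The winner of a match in a tournament; entries are stored with offset `1`, and `0` means that
there is no entry. -/
def pick (B : ℕ → ℕ → Prop) [DecidableRel B] (x y : ℕ) : ℕ :=
  if x = 0 then y else if y = 0 then x else if B (x - 1) (y - 1) then x else y

/-- `tr 1, …, tr (2 * N - 1)` is a tournament tree with leaves `0, …, N - 1`, of which those in
`live` take part. -/
structure IsTree (N : ℕ) (B : ℕ → ℕ → Prop) [DecidableRel B] (live : Set ℕ) (tr : ℕ → ℕ) : Prop where
  leaf : ∀ i < N, (i ∈ live → tr (N + i) = i + 1) ∧ (i ∉ live → tr (N + i) = 0)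
  node : ∀ q, 1 ≤ q → q < N → tr q = pick B (tr (q + q)) (tr (q + q + 1))

namespace IsTree

variable {N : ℕ} {B : ℕ → ℕ → Prop} [DecidableRel B] {live : Set ℕ} {tr : ℕ → ℕ}

theorem mem_live (h : IsTree N B live tr) {q : ℕ} (hq : 1 ≤ q) (hq' : q < 2 * N) :
    tr q = 0 ∨ ∃ i < N, i ∈ live ∧ tr q = i + 1 := by
  induction hd : 2 * N - q using Nat.strong_induction_on generalizing q with
  | _ d ih =>
    rcases lt_or_ge q N with hqN | hqN
    · rw [h.node q hq hqN, pick]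
      split_ifs
      · exact ih _ (by omega) (by omega) (by omega) rfl
      · exact ih _ (by omega) (by omega) (by omega) rfl
      · exact ih _ (by omega) (by omega) (by omega) rfl
      · exact ih _ (by omega) (by omega) (by omega) rfl
    · obtain ⟨i, rfl⟩ := Nat.exists_eq_add_of_le hqN
      by_cases hi : i ∈ live
      · exact Or.inr ⟨i, by omega, hi, (h.leaf i (by omega)).1 hi⟩
      · exact Or.inl ((h.leaf i (by omega)).2 hi)

theorem root_mem (h : IsTree N B live tr) (hN : 0 < N) :
    tr 1 = 0 ∨ ∃ i < N, i ∈ live ∧ tr 1 = i + 1 :=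
  h.mem_live le_rfl (by omega)

/-- No transitivity or totality of `B` is needed: an entry that beats all others wins each match on
its way up. Both `B i j` and `¬ B j i` are required, since it may appear as the left or as the right
child. -/
theorem root_eq (h : IsTree N B live tr) {i : ℕ} (hi : i < N) (hl : i ∈ live)
    (hB : ∀ j < N, j ∈ live → j ≠ i → B i j ∧ ¬ B j i) : tr 1 = i + 1 := by
  suffices H : ∀ q, 1 ≤ q → q < 2 * N → tr q = i + 1 → tr 1 = i + 1 from
    H (N + i) (by omega) (by omega) ((h.leaf i hi).1 hl)
  intro q
  induction q using Nat.strong_induction_on with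
  | _ q ih =>
    intro hq hq' he
    rcases eq_or_lt_of_le hq with rfl | hq₁
    · exact he
    refine ih (q / 2) (by omega) (by omega) (by omega) ?_
    rw [h.node (q / 2) (by omega) (by omega)]
    rcases Nat.even_or_odd' q with ⟨r, rfl | rfl⟩
    · rw [show 2 * r / 2 = r by omega, show r + r = 2 * r by omega, he]
      rcases h.mem_live (q := 2 * r + 1) (by omega) (by omega) with h₀ | ⟨j, hj, hjl, h₀⟩
      · simp [pick, h₀]
      · rw [h₀]
        by_cases hji : j = i
        · simp [pick, hji]
        · simp [pick, (hB j hj hjl hji).1]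
    · rw [show (2 * r + 1) / 2 = r by omega, show r + r = 2 * r by omega, he]
      rcases h.mem_live (q := 2 * r) (by omega) (by omega) with h₀ | ⟨j, hj, hjl, h₀⟩
      · simp [pick, h₀]
      · rw [h₀]
        by_cases hji : j = i
        · simp [pick, hji]
        · simp [pick, (hB j hj hjl hji).2]

end IsTree

/-- Recomputes the match of the tournament tree in array `A` at node `natVar 27` and moves to the
parent; `b` compares the entries in `natVar 20` and `natVar 21`. -/
def climbStep (A : ℕ) (b : BExp) : Prog :=
    block [.setNat 20 (.arr A (.add (.var 27) (.var 27))),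
      .setNat 21 (.arr A (.add (.add (.var 27) (.var 27)) (.const 1))),
      .ite (.natLe (.var 20) (.const 0)) (.setNat 26 (.var 21))
        (.ite (.natLe (.var 21) (.const 0)) (.setNat 26 (.var 20))
          (.ite b (.setNat 26 (.var 20)) (.setNat 26 (.var 21)))),
      .storeNat A (.var 27) (.var 26), .setNat 27 (.half (.var 27))]

/-- Recomputes the matches at node `natVar 27` and at all nodes above it. -/
def climb (A : ℕ) (b : BExp) : Prog :=
  .loop (.natLe (.const 1) (.var 27)) (climbStep A b)

/-- Writes `natVar 29` to leaf `natVar 28` of the tournament tree with `natVar 30` leaves in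
array `A`. -/
def setLeaf (A : ℕ) (b : BExp) : Prog :=
  block [.storeNat A (.add (.var 30) (.var 28)) (.var 29),
    .setNat 27 (.half (.add (.var 30) (.var 28))), climb A b]

/-- The invariant is that matches may be wrong only at the current node and its ancestors, the
numbers `natVar 27 / 2 ^ j`. The constant `K` is chosen before all data, so it depends only on the
program text. -/
theorem climb_spec (A : ℕ) (b : BExp) : ∃ K, ∀ (s : State) (N : ℕ) (B : ℕ → ℕ → Prop)
    [DecidableRel B] (live : Set ℕ),
    (∀ s', s'.realArr = s.realArr → (b.eval s' ↔ B (s'.natVar 20 - 1) (s'.natVar 21 - 1))) →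
    s.natVar 27 < N →
    (∀ i < N, (i ∈ live → s.natArr A (N + i) = i + 1) ∧ (i ∉ live → s.natArr A (N + i) = 0)) →
    (∀ q, 1 ≤ q → q < N → (∃ j, q = s.natVar 27 / 2 ^ j) ∨
      s.natArr A q = pick B (s.natArr A (q + q)) (s.natArr A (q + q + 1))) →
    Within (climb A b) (K * (Nat.size (s.natVar 27) + 1)) s
      fun s' => IsTree N B live (s'.natArr A) := by
  classical
  refine ⟨BExp.cost (.natLe (.const 1) (.var 27)) + (climbStep A b).time,
    fun s N B _ live hb hN hleaf hnode => ?_⟩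
  refine (Within.loop_of_le (s := s) (p := climbStep A b) (fun s' => s'.realArr = s.realArr ∧ s'.natVar 27 < N ∧
    (∀ i < N, (i ∈ live → s'.natArr A (N + i) = i + 1) ∧ (i ∉ live → s'.natArr A (N + i) = 0)) ∧
    (∀ q, 1 ≤ q → q < N → (∃ j, q = s'.natVar 27 / 2 ^ j) ∨
      s'.natArr A q = pick B (s'.natArr A (q + q)) (s'.natArr A (q + q + 1))))
    (fun s' => Nat.size (s'.natVar 27)) _ ⟨rfl, hN, hleaf, hnode⟩ ?_).imp fun s' _ h => ?_
  · rintro s₁ ⟨h₁, h₂, h₃, h₄⟩ hb₁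
    simp only [BExp.eval, NExp.eval] at hb₁
    refine Within.of_vc ?_
    have main : ∀ x, x = pick B (s₁.natArr A (s₁.natVar 27 + s₁.natVar 27))
        (s₁.natArr A (s₁.natVar 27 + s₁.natVar 27 + 1)) → ∀ s₂ : State, s₂.realArr = s₁.realArr →
        s₂.natArr = s₁.natArr → s₂.natVar 27 = s₁.natVar 27 → s₂.natVar 26 = x →
        (block [.storeNat A (.var 27) (.var 26), .setNat 27 (.half (.var 27))]).vc
          (fun s' => (s'.realArr = s.realArr ∧ s'.natVar 27 < N ∧
          (∀ i < N, (i ∈ live → s'.natArr A (N + i) = i + 1) ∧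
            (i ∉ live → s'.natArr A (N + i) = 0)) ∧
          (∀ q, 1 ≤ q → q < N → (∃ j, q = s'.natVar 27 / 2 ^ j) ∨
            s'.natArr A q = pick B (s'.natArr A (q + q)) (s'.natArr A (q + q + 1)))) ∧
          Nat.size (s'.natVar 27) < Nat.size (s₁.natVar 27)) s₂ := by
      intro x hx s₂ e₁ e₂ e₃ e₄
      simp only [block, vc, NExp.eval, setNat_natVar, storeNat_natVar, storeNat_natArr,
        setNat_natArr, setNat_realArr, storeNat_realArr, if_true, e₁, e₂, e₃, e₄]
      refine ⟨⟨h₁, by omega, fun i hi => ?_, fun q hq hq' => ?_⟩,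
        Nat.size_lt_size_of_le_half le_rfl (by omega)⟩
      · rw [Function.update_of_ne (by omega)]
        exact h₃ i hi
      · by_cases hq₁ : q = s₁.natVar 27
        · right
          rw [hq₁, Function.update_self, Function.update_of_ne (by omega),
            Function.update_of_ne (by omega), hx]
        -- An ancestor `j + 1` levels above the old node is `j` levels above its parent; `j = 0` is
        -- the node just repaired.
        rcases h₄ q hq hq' with ⟨j, hj⟩ | h₅
        · cases j with
          | zero => simp at hj; exact absurd hj hq₁
          | succ j =>
            exact Or.inl ⟨j, by rw [hj, Nat.div_div_eq_div_mul, pow_succ']⟩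
        · by_cases hq₂ : q = s₁.natVar 27 / 2
          · exact Or.inl ⟨0, by simpa using hq₂⟩
          · right
            rw [Function.update_of_ne hq₁, Function.update_of_ne (by omega),
              Function.update_of_ne (by omega), h₅]
    simp only [climbStep, block, vc, NExp.eval, BExp.eval]
    refine ⟨fun c₁ => ?_, fun c₁ => ⟨fun c₂ => ?_, fun c₂ => ⟨fun c₃ => ?_, fun c₃ => ?_⟩⟩⟩
    all_goals
      refine main _ ?_ _ ?_ ?_ ?_ rfl
      · try rw [hb _ (by simp [h₁])] at c₃
        simp at *
        simp [pick, *]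
      · simp
      · simp
      · simp
  · obtain ⟨⟨h₁, h₂, h₃, h₄⟩, h₅⟩ := h
    simp only [BExp.eval, NExp.eval, not_le, Nat.lt_one_iff] at h₅
    refine ⟨h₃, fun q hq hq' => (h₄ q hq hq').resolve_left ?_⟩
    rintro ⟨j, hj⟩
    rw [h₅, Nat.zero_div] at hj
    omega

theorem setLeaf_spec (A : ℕ) (b : BExp) : ∃ K, ∀ (s : State) (N i : ℕ) (B : ℕ → ℕ → Prop)
    [DecidableRel B] (live live' : Set ℕ),
    (∀ s', s'.realArr = s.realArr → (b.eval s' ↔ B (s'.natVar 20 - 1) (s'.natVar 21 - 1))) →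
    IsTree N B live (s.natArr A) → s.natVar 30 = N → s.natVar 28 = i → i < N →
    (∀ j, j ≠ i → (j ∈ live' ↔ j ∈ live)) → (i ∈ live' → s.natVar 29 = i + 1) →
    (i ∉ live' → s.natVar 29 = 0) →
    Within (setLeaf A b) (K * (Nat.size N + 1)) s fun s' => IsTree N B live' (s'.natArr A) := by
  obtain ⟨K, hK⟩ := climb_spec A b
  refine ⟨K + 20, fun s N i B _ live live' hb ht h30 h28 hi hl h₁ h₂ => ?_⟩
  have hstart : Within (.storeNat A (.add (.var 30) (.var 28)) (.var 29)) 5 s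
    fun s' => s' = s.storeNat A (N + i) (s.natVar 29) :=
    (Within.of_vc (by simp [vc, h30, h28])).mono (by simp [time, NExp.cost]) fun _ _ h => h
  refine Within.mono (T := 5 + (6 + (K * (Nat.size N + 1) + 1))) (.cons (hstart.imp fun s₁ _ e₁ => ?_)) (by
    have : 20 ≤ 20 * (Nat.size N + 1) := by omega
    rw [Nat.add_mul]; omega) fun s' _ h => h
  have hstep : Within (.setNat 27 (.half (.add (.var 30) (.var 28)))) 6 s₁
    fun s' => s' = s₁.setNat 27 ((N + i) / 2) :=
    (Within.of_vc (by simp [vc, h30, h28, e₁])).mono (by simp [time, NExp.cost]) fun _ _ h => h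
  refine .cons (hstep.imp fun s₂ _ e₂ => .cons ?_)
  have e27 : s₂.natVar 27 = (N + i) / 2 := by rw [e₂]; simp
  have eA : s₂.natArr A = Function.update (s.natArr A) (N + i) (s.natVar 29) := by
    rw [e₂, e₁]; simp
  refine (hK s₂ N B live' (fun s' hs' => hb s' (by rw [hs', e₂, e₁]; simp)) (by omega) ?_ ?_).mono
    (Nat.mul_le_mul_left _ (Nat.succ_le_succ (Nat.size_le_size (by omega)))) fun s' _ h => .nil h
  · intro j hj
    rw [eA]
    by_cases hji : j = i
    · subst hji
      rw [Function.update_self]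
      exact ⟨h₁, h₂⟩
    · rw [Function.update_of_ne (by omega), hl j hji]
      exact ht.leaf j hj
  · intro q hq hq'
    rw [eA, e27]
    by_cases hqp : q = (N + i) / 2
    · exact Or.inl ⟨0, by simpa using hqp⟩
    · right
      rw [Function.update_of_ne (by omega), Function.update_of_ne (by omega),
        Function.update_of_ne (by omega)]
      exact ht.node q hq hq'

end RealRAM


/-! ## The extreme vertices of a polygon, by binary search -/

namespace RealRAM

open Prog

/-- The memory holds `k` polygons whose vertices, scaled by `σ`, are given by `V`. -/
structure Input (σ : ℚ) (k : ℕ) (n : ℕ → ℕ) (V : ℕ → ℕ → Plane) (s : State) : Prop where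
  count : s.natVar 0 = k
  size : ∀ i < k, s.natArr 0 i = n i
  xCoord : ∀ i < k, ∀ j < n i, (σ : ℝ) * s.realArr 0 (s.natArr 1 i + j) = V i j 0
  yCoord : ∀ i < k, ∀ j < n i, (σ : ℝ) * s.realArr 1 (s.natArr 1 i + j) = V i j 1
  boundary : ∀ i < k, ∀ j < n i,
    s.realArr 2 (s.natArr 1 i + j) = boundaryLength (n i) (V i) j
  cycle : ∀ i < k, ConvexCycle (n i) (V i)

namespace Input

variable {σ : ℚ} {k : ℕ} {n : ℕ → ℕ} {V : ℕ → ℕ → Plane} {s s' : State}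

theorem congr (h : Input σ k n V s) (h₀ : s'.natVar 0 = s.natVar 0)
    (h₁ : s'.natArr 0 = s.natArr 0) (h₂ : s'.natArr 1 = s.natArr 1)
    (h₃ : s'.realArr 0 = s.realArr 0) (h₄ : s'.realArr 1 = s.realArr 1)
    (h₅ : s'.realArr 2 = s.realArr 2) : Input σ k n V s' where
  count := h₀ ▸ h.count
  size := h₁ ▸ h.size
  xCoord := h₂ ▸ h₃ ▸ h.xCoord
  yCoord := h₂ ▸ h₄ ▸ h.yCoord
  boundary := h₂ ▸ h₅ ▸ h.boundary
  cycle := h.cycle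

/-- The reflected polygons are read from the same arrays with the opposite scale, and their vertices
are still counterclockwise with the same boundary lengths. Greatest vertices thus become least ones,
and the upper hull becomes a lower hull. -/
theorem neg (h : Input σ k n V s) : Input (-σ) k n (fun i j => -V i j) s where
  count := h.count
  size := h.size
  xCoord i hi j hj := by simp [← h.xCoord i hi j hj]
  yCoord i hi j hj := by simp [← h.yCoord i hi j hj]
  boundary i hi j hj := by rw [h.boundary i hi j hj]; simp [boundaryLength, dist_neg_neg]
  cycle i hi := (h.cycle i hi).neg

end Input

/-- Comparison of points given by their coordinates in four real variables. -/
def BExp.keyLt (x y x' y' : ℕ) : BExp :=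
  .and (.realLe (.var x) (.var x'))
    (.not (.and (.realLe (.var x') (.var x)) (.realLe (.var y') (.var y))))

/-- Disjunction. -/
def BExp.or (b c : BExp) : BExp := .not (.and (.not b) (.not c))

@[simp] theorem BExp.or_eval (s : State) (b c : BExp) :
    (BExp.or b c).eval s ↔ b.eval s ∨ c.eval s := by
  simp [BExp.or]; tauto

theorem key_lt_iff_le {p q : Plane} :
    key p < key q ↔ p 0 ≤ q 0 ∧ ¬ (q 0 ≤ p 0 ∧ q 1 ≤ p 1) := by
  rw [key_lt_iff]
  constructor
  · rintro (h | ⟨h, h'⟩)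
    · exact ⟨h.le, fun hh => hh.1.not_gt h⟩
    · exact ⟨h.le, fun hh => hh.2.not_gt h'⟩
  · rintro ⟨h, h'⟩
    rcases eq_or_lt_of_le h with he | hl
    · exact Or.inr ⟨he, not_le.1 fun hh => h' ⟨he.ge, hh⟩⟩
    · exact Or.inl hl

theorem BExp.keyLt_eval {s : State} {x y x' y' : ℕ} {p q : Plane} (h₁ : s.realVar x = p 0)
    (h₂ : s.realVar y = p 1) (h₃ : s.realVar x' = q 0) (h₄ : s.realVar y' = q 1) :
    (BExp.keyLt x y x' y').eval s ↔ key p < key q := by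
  rw [key_lt_iff_le]
  simp only [BExp.keyLt, BExp.eval, RExp.eval, h₁, h₂, h₃, h₄]

/-- Reads the coordinates of vertex `natVar j` of polygon `natVar t`. -/
def readVertex (σ : ℚ) (t j x y : ℕ) : Prog :=
  block [.setNat 7 (.add (.arr 1 (.var t)) (.var j)),
    .setReal x (.mul (.const σ) (.arr 0 (.var 7))),
    .setReal y (.mul (.const σ) (.arr 1 (.var 7)))]

/-- The quantifier over `a` forgets the address that remains in the scratch variable `7`. -/
theorem readVertex_vc {σ : ℚ} {k : ℕ} {n : ℕ → ℕ} {V : ℕ → ℕ → Plane} {s : State}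
    (h : Input σ k n V s) {t j x y : ℕ} (ht : s.natVar t < k) (hj : s.natVar j < n (s.natVar t))
    {Q : State → Prop}
    (hQ : ∀ a, Q (((s.setNat 7 a).setReal x (V (s.natVar t) (s.natVar j) 0)).setReal y
      (V (s.natVar t) (s.natVar j) 1))) : (readVertex σ t j x y).vc Q s := by
  simp only [readVertex, block, vc, NExp.eval, RExp.eval, setNat_natVar, setNat_realArr,
    setReal_natVar, setReal_realArr, if_true, h.xCoord _ ht _ hj, h.yCoord _ ht _ hj]
  exact hQ _

/-- One comparison of the binary search for the least vertex. -/
def leastPre (σ : ℚ) : Prog :=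
  block [readVertex σ 1 5 3 4, .setNat 6 (.add (.var 5) (.const 1)),
    .ite (.natLe (.var 2) (.var 6)) (.setNat 6 (.const 0)) .skip, readVertex σ 1 6 5 6]

/-- Whether vertex `natVar 5` comes before the least one. -/
def leastCond : BExp :=
  .or (.and (.natLe (.const 1) (.var 8)) (.and (.keyLt 5 6 3 4) (.keyLt 3 4 1 2)))
    (.and (.natLe (.var 8) (.const 0)) (.or (.keyLt 5 6 3 4) (.keyLt 1 2 3 4)))

/-- Prepares the binary search for the least vertex of polygon `natVar 1`. -/
def leastInit (σ : ℚ) : Prog :=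
  block [.setNat 2 (.arr 0 (.var 1)), .setNat 6 (.const 0), readVertex σ 1 6 1 2,
    .ite (.natLe (.var 2) (.const 1)) (.setNat 6 (.const 0)) (.setNat 6 (.const 1)),
    readVertex σ 1 6 3 4,
    .ite (.keyLt 3 4 1 2) (.setNat 8 (.const 1)) (.setNat 8 (.const 0)),
    .setNat 3 (.const 1), .setNat 4 (.var 2)]

/-- Computes in `natVar 3` the number of the least vertex of polygon `natVar 1`. -/
def leastVertex (σ : ℚ) : Prog :=
  block [leastInit σ, bsearch (leastPre σ) leastCond,
    .ite (.natLe (.var 2) (.var 3)) (.setNat 3 (.const 0)) .skip]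

theorem leastVertex_frame {σ : ℚ} {s s' : State} (h : Agree (leastVertex σ) s s') :
    s'.natArr = s.natArr ∧ s'.realArr = s.realArr ∧
      ∀ x, x < 2 ∨ 9 < x → s'.natVar x = s.natVar x := by
  refine ⟨funext fun a => h.natArr a ?_, funext fun a => h.realArr a ?_,
    fun x hx => h.natVar x ?_⟩
  · simp [leastVertex, leastInit, leastPre, readVertex, bsearch, block, natArrs]
  · simp [leastVertex, leastInit, leastPre, readVertex, bsearch, block, realArrs]
  · simp [leastVertex, leastInit, leastPre, readVertex, bsearch, block, natVars]
    omega

theorem leastPre_spec {σ : ℚ} {k : ℕ} {n : ℕ → ℕ} {V : ℕ → ℕ → Plane} {s : State}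
    (h : Input σ k n V s) {i : ℕ} (h1 : s.natVar 1 = i) (hi : i < k) (h2 : s.natVar 2 = n i)
    (h5 : s.natVar 5 < n i) (hx : s.realVar 1 = V i 0 0) (hy : s.realVar 2 = V i 0 1) {F : Prop}
    [Decidable F] (h8 : s.natVar 8 = if F then 1 else 0) :
    Within (leastPre σ) (leastPre σ).time s fun s' => (leastCond.eval s' ↔
      if F then
        key (V i ((s.natVar 5 + 1) % n i)) < key (V i (s.natVar 5)) ∧
          key (V i (s.natVar 5)) < key (V i 0)
      else key (V i ((s.natVar 5 + 1) % n i)) < key (V i (s.natVar 5)) ∨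
        key (V i 0) < key (V i (s.natVar 5))) := by
  refine Within.of_vc ?_
  have hn : (s.natVar 5 + 1 < n i ∧ (s.natVar 5 + 1) % n i = s.natVar 5 + 1) ∨
      (s.natVar 5 + 1 = n i ∧ (s.natVar 5 + 1) % n i = 0) := by
    rcases lt_or_ge (s.natVar 5 + 1) (n i) with h' | h'
    · exact Or.inl ⟨h', Nat.mod_eq_of_lt h'⟩
    · have : s.natVar 5 + 1 = n i := by omega
      exact Or.inr ⟨this, by rw [this, Nat.mod_self]⟩
  have final : ∀ (s' : State) (j : ℕ), j = (s.natVar 5 + 1) % n i → Input σ k n V s' →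
      s'.natVar 1 = i → s'.natVar 6 = j → s'.natVar 8 = s.natVar 8 →
      s'.realVar 1 = V i 0 0 → s'.realVar 2 = V i 0 1 →
      s'.realVar 3 = V i (s.natVar 5) 0 → s'.realVar 4 = V i (s.natVar 5) 1 →
      (block [readVertex σ 1 6 5 6]).vc (fun s' => (leastCond.eval s' ↔
      if F then
        key (V i ((s.natVar 5 + 1) % n i)) < key (V i (s.natVar 5)) ∧
          key (V i (s.natVar 5)) < key (V i 0)
      else key (V i ((s.natVar 5 + 1) % n i)) < key (V i (s.natVar 5)) ∨
        key (V i 0) < key (V i (s.natVar 5)))) s' := by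
    intro s' j hj hI e₁ e₆ e₈ r₁ r₂ r₃ r₄
    refine readVertex_vc hI (by omega) (by rw [e₆, e₁, hj]; exact Nat.mod_lt _ (by omega))
      fun a => ?_
    rw [← hj]
    have d : ∀ s'' : State, s''.realVar 1 = V i 0 0 → s''.realVar 2 = V i 0 1 →
        s''.realVar 3 = V i (s.natVar 5) 0 → s''.realVar 4 = V i (s.natVar 5) 1 →
        s''.realVar 5 = V i j 0 → s''.realVar 6 = V i j 1 → s''.natVar 8 = s.natVar 8 →
        (leastCond.eval s'' ↔
      if F then key (V i j) < key (V i (s.natVar 5)) ∧ key (V i (s.natVar 5)) < key (V i 0)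
      else key (V i j) < key (V i (s.natVar 5)) ∨ key (V i 0) < key (V i (s.natVar 5))) := by
      intro s'' q₁ q₂ q₃ q₄ q₅ q₆ q₈
      rw [leastCond]
      simp only [BExp.or_eval, BExp.eval, NExp.eval, BExp.keyLt_eval q₅ q₆ q₃ q₄,
        BExp.keyLt_eval q₃ q₄ q₁ q₂, BExp.keyLt_eval q₁ q₂ q₃ q₄, q₈, h8]
      split_ifs <;> simp
    exact d _ (by simp [r₁]) (by simp [r₂]) (by simp [r₃]) (by simp [r₄]) (by simp [e₁, e₆])
      (by simp [e₁, e₆]) (by simp [e₈])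
  refine readVertex_vc h (by omega) (by rw [h1]; exact h5) fun a => ?_
  simp only [block, vc, NExp.eval, BExp.eval]
  constructor
  · intro hc
    simp [h2] at hc
    refine final _ 0 (by omega) (h.congr (by simp) (by simp) (by simp) (by simp) (by simp)
      (by simp)) ?_ ?_ ?_ ?_ ?_ ?_ ?_ <;> simp [h1, hx, hy]
  · intro hc
    simp [h2] at hc
    refine final _ (s.natVar 5 + 1) (by omega) (h.congr (by simp) (by simp) (by simp) (by simp)
      (by simp) (by simp)) ?_ ?_ ?_ ?_ ?_ ?_ ?_ <;> simp [h1, hx, hy]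

theorem leastInit_spec {σ : ℚ} {k : ℕ} {n : ℕ → ℕ} {V : ℕ → ℕ → Plane} {s : State}
    (h : Input σ k n V s) {i : ℕ} (h1 : s.natVar 1 = i) (hi : i < k)
    [Decidable (key (V i (1 % n i)) < key (V i 0))] :
    Within (leastInit σ) (leastInit σ).time s fun s' => s'.natVar 2 = n i ∧ s'.natVar 3 = 1 ∧
      s'.natVar 4 = n i ∧ s'.realVar 1 = V i 0 0 ∧ s'.realVar 2 = V i 0 1 ∧
      s'.natVar 8 = if key (V i (1 % n i)) < key (V i 0) then 1 else 0 := by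
  refine Within.of_vc ?_
  have hpos := (h.cycle i hi).pos
  have final : ∀ (s' : State) (j : ℕ), j = 1 % n i → Input σ k n V s' → s'.natVar 1 = i →
      s'.natVar 2 = n i → s'.natVar 6 = j → s'.realVar 1 = V i 0 0 → s'.realVar 2 = V i 0 1 →
      (block [readVertex σ 1 6 3 4,
        .ite (.keyLt 3 4 1 2) (.setNat 8 (.const 1)) (.setNat 8 (.const 0)),
        .setNat 3 (.const 1), .setNat 4 (.var 2)]).vc (fun s' => s'.natVar 2 = n i ∧
        s'.natVar 3 = 1 ∧ s'.natVar 4 = n i ∧ s'.realVar 1 = V i 0 0 ∧ s'.realVar 2 = V i 0 1 ∧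
        s'.natVar 8 = if key (V i (1 % n i)) < key (V i 0) then 1 else 0) s' := by
    intro s' j hj hI e₁ e₂ e₆ r₁ r₂
    refine readVertex_vc hI (by omega) (by rw [e₆, e₁, hj]; exact Nat.mod_lt _ hpos) fun a => ?_
    simp only [block, vc]
    rw [BExp.keyLt_eval (p := V i (1 % n i)) (q := V i 0) (by simp [e₁, e₆, hj])
      (by simp [e₁, e₆, hj]) (by simp [r₁]) (by simp [r₂])]
    refine ⟨fun hc => ?_, fun hc => ?_⟩ <;> simp [e₂, r₁, r₂, hc]
  simp only [leastInit, block, vc, NExp.eval, BExp.eval]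
  refine readVertex_vc (h.congr (by simp) (by simp) (by simp) (by simp) (by simp) (by simp))
    (by simp; omega) (by simp [h1]; exact hpos) fun a => ?_
  simp only
  constructor
  · intro hc
    simp [h1, h.size i hi] at hc
    refine final _ 0 (by rw [show n i = 1 by omega]) (h.congr (by simp) (by simp) (by simp)
      (by simp) (by simp) (by simp)) ?_ ?_ ?_ ?_ ?_ <;> simp [h1, h.size i hi]
  · intro hc
    simp [h1, h.size i hi] at hc
    refine final _ 1 (by rw [Nat.mod_eq_of_lt hc]) (h.congr (by simp) (by simp) (by simp)
      (by simp) (by simp) (by simp)) ?_ ?_ ?_ ?_ ?_ <;> simp [h1, h.size i hi]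

theorem leastVertex_spec (σ : ℚ) : ∃ K, ∀ (k : ℕ) (n : ℕ → ℕ) (V : ℕ → ℕ → Plane) (s : State),
    Input σ k n V s → ∀ i, s.natVar 1 = i → i < k →
    Within (leastVertex σ) (K * (Nat.size (n i) + 1)) s fun s' =>
      s'.natVar 3 < n i ∧ ∀ j < n i, key (V i (s'.natVar 3)) ≤ key (V i j) := by
  classical
  refine ⟨(leastInit σ).time + (leastCond.cost + (leastPre σ).time + 20) + 20,
    fun k n V s h i h1 hi => ?_⟩
  have hc := h.cycle i hi
  obtain ⟨M, hM, hmin⟩ := hc.exists_min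
  refine Within.mono (T := (leastInit σ).time + ((leastCond.cost + (leastPre σ).time + 20) *
    (Nat.size (n i) + 1) + (5 + 1))) ?_ ?_ fun s' _ h => h
  swap
  · simp only [Nat.add_mul]
    have := Nat.le_mul_of_pos_right (leastInit σ).time (Nat.succ_pos (Nat.size (n i)))
    simp only [Nat.succ_eq_add_one] at this
    omega
  refine .cons ((leastInit_spec h h1 hi).imp fun s₁ hA₁ e => ?_)
  obtain ⟨e₂, e₃, e₄, r₁, r₂, e₈⟩ := e
  have e₁ : s₁.natVar 1 = i :=
    (hA₁.natVar 1 (by simp [leastInit, readVertex, block, natVars])).trans h1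
  have hI₁ : Input σ k n V s₁ := h.congr
    (hA₁.natVar 0 (by simp [leastInit, readVertex, block, natVars]))
    (hA₁.natArr 0 (by simp [leastInit, readVertex, block, natArrs]))
    (hA₁.natArr 1 (by simp [leastInit, readVertex, block, natArrs]))
    (hA₁.realArr 0 (by simp [leastInit, readVertex, block, realArrs]))
    (hA₁.realArr 1 (by simp [leastInit, readVertex, block, realArrs]))
    (hA₁.realArr 2 (by simp [leastInit, readVertex, block, realArrs]))
  -- The criterion makes sense only for positive indices, so the search runs over `1, …, n i`; the
  -- outcome `n i` stands for vertex `0` and is replaced at the end.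
  have hm : 1 ≤ (if M = 0 then n i else M) ∧ (if M = 0 then n i else M) ≤ n i := by
    have := hc.pos
    split_ifs <;> omega
  have hsearch := bsearch_spec (pre := leastPre σ) (b := leastCond) (s := s₁)
    (m := if M = 0 then n i else M) (Tp := (leastPre σ).time)
    (by simp [leastPre, readVertex, block, natVars]) (fun s' hA h₃ h₄ => by
      have nv : ∀ x, x = 0 ∨ x = 1 ∨ x = 2 ∨ x = 8 → s'.natVar x = s₁.natVar x := fun x hx =>
        hA.natVar x (by simp [bsearch, leastPre, readVertex, block, natVars]; omega)
      have rv : ∀ x, x = 1 ∨ x = 2 → s'.realVar x = s₁.realVar x := fun x hx =>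
        hA.realVar x (by simp [bsearch, leastPre, readVertex, block, realVars]; omega)
      have na : s'.natArr = s₁.natArr := funext fun a =>
        hA.natArr a (by simp [bsearch, leastPre, readVertex, block, natArrs])
      have ra : s'.realArr = s₁.realArr := funext fun a =>
        hA.realArr a (by simp [bsearch, leastPre, readVertex, block, realArrs])
      exact leastPre_spec (hI₁.congr (nv 0 (by simp)) (by rw [na]) (by rw [na]) (by rw [ra])
        (by rw [ra]) (by rw [ra])) (by rw [nv 1 (by simp), e₁]) hi (by rw [nv 2 (by simp), e₂])
        (by omega) (by rw [rv 1 (by simp), r₁]) (by rw [rv 2 (by simp), r₂])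
        (by rw [nv 8 (by simp), e₈]))
    (R := fun j => if key (V i (1 % n i)) < key (V i 0) then
        key (V i ((j + 1) % n i)) < key (V i j) ∧ key (V i j) < key (V i 0)
      else key (V i ((j + 1) % n i)) < key (V i j) ∨ key (V i 0) < key (V i j))
    (fun j hj hj' => hc.before_min_iff hM hmin (by omega) (by omega)) (by omega) (by omega)
  refine .cons (hsearch.mono (Nat.mul_le_mul_left _ (Nat.succ_le_succ (Nat.size_le_size
    (by omega)))) fun s₂ hA₂ h3 => ?_)
  have e₂' : s₂.natVar 2 = n i :=
    (hA₂.natVar 2 (by simp [bsearch, leastPre, readVertex, block, natVars])).trans e₂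
  refine .cons ((Within.of_vc (p := .ite (.natLe (.var 2) (.var 3)) (.setNat 3 (.const 0)) .skip)
    ?_).mono (by simp [time, NExp.cost, BExp.cost]) fun s₃ _ h => .nil h)
  simp only [vc, BExp.eval, NExp.eval, e₂', h3]
  constructor
  · intro hle
    have hM0 : M = 0 := by by_contra hne; rw [if_neg hne] at hle; omega
    subst hM0
    simpa using ⟨hM, hmin⟩
  · intro hle
    have hM0 : M ≠ 0 := by rintro rfl; simp at hle
    rw [if_neg hM0]
    exact ⟨hM, hmin⟩

end RealRAM


/-! ## The sweep over disjoint convex polygons -/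

/-- Disjoint convex polygons with vertices `V i 0, …, V i (n i - 1)`; the lower side of polygon `i`
starts at its vertex number `L i` and has `N i` edges. -/
structure Scene (k : ℕ) (n : ℕ → ℕ) (V : ℕ → ℕ → Plane) (L N : ℕ → ℕ) : Prop where
  chain : ∀ i < k, LowerChain (n i) (V i) (L i) (N i)
  disjoint : ∀ i < k, ∀ j < k, i ≠ j →
    Disjoint (convexHull ℝ (V i '' Set.Iio (n i))) (convexHull ℝ (V j '' Set.Iio (n j)))

/-- Point number `s` of the lower side of polygon `i`. -/
def lowerPoint (n : ℕ → ℕ) (V : ℕ → ℕ → Plane) (L : ℕ → ℕ) (i s : ℕ) : Plane :=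
  chainPoint (n i) (V i) (L i) s

/-- The end points of the lower sides, in pairs. -/
def eventPoint (c : ℕ → ℕ → Plane) (N : ℕ → ℕ) (e : ℕ) : Plane :=
  if e % 2 = 0 then c (e / 2) 0 else c (e / 2) (N (e / 2))

/-- The order of the events. -/
def EventLT (c : ℕ → ℕ → Plane) (N : ℕ → ℕ) (e f : ℕ) : Prop :=
  key (eventPoint c N e) < key (eventPoint c N f) ∨
    key (eventPoint c N e) ≤ key (eventPoint c N f) ∧ e < f

/-- Polygon `i` passes below polygon `j`, judged by the leftmost points. -/
def Below (c : ℕ → ℕ → Plane) (N : ℕ → ℕ) (i j : ℕ) : Prop :=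
  key (c i 0) < key (c j 0) ∧ 0 < orient (c i 0) (c i (N i)) (c j 0) ∨
    key (c j 0) < key (c i 0) ∧ orient (c j 0) (c j (N j)) (c i 0) < 0

noncomputable instance (c : ℕ → ℕ → Plane) (N : ℕ → ℕ) : DecidableRel (EventLT c N) :=
  Classical.decRel _

noncomputable instance (c : ℕ → ℕ → Plane) (N : ℕ → ℕ) : DecidableRel (Below c N) :=
  Classical.decRel _

/-- The polygons whose first event has happened but not the second. -/
def active (R : Set ℕ) : Set ℕ := {i | 2 * i ∈ R ∧ 2 * i + 1 ∉ R}

/-- The point `p` of polygon `A` does not lie above the chord of another polygon. -/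
def Essential (k : ℕ) (c : ℕ → ℕ → Plane) (N : ℕ → ℕ) (A : ℕ) (p : Plane) : Prop :=
  ∀ B < k, B ≠ A → key (c B 0) ≤ key p → key p ≤ key (c B (N B)) →
    orient (c B 0) (c B (N B)) p ≤ 0

theorem eventPoint_even (c : ℕ → ℕ → Plane) (N : ℕ → ℕ) (i : ℕ) :
    eventPoint c N (2 * i) = c i 0 := by
  rw [eventPoint, if_pos (by omega), show 2 * i / 2 = i by omega]

theorem eventPoint_odd (c : ℕ → ℕ → Plane) (N : ℕ → ℕ) (i : ℕ) :
    eventPoint c N (2 * i + 1) = c i (N i) := by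
  rw [eventPoint, if_neg (by omega), show (2 * i + 1) / 2 = i by omega]

namespace EventLT

variable {c : ℕ → ℕ → Plane} {N : ℕ → ℕ} {e f : ℕ}

theorem key_le (h : EventLT c N e f) : key (eventPoint c N e) ≤ key (eventPoint c N f) := by
  rcases h with h | h
  exacts [h.le, h.1]

theorem not_lt (h : EventLT c N e f) : ¬ EventLT c N f e := by
  rintro (h' | h')
  · exact h.key_le.not_gt h'
  · rcases h with h | h
    · exact h'.1.not_gt h
    · omega

theorem of_ne (hne : e ≠ f) : EventLT c N e f ∨ EventLT c N f e := by
  unfold EventLT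
  rcases lt_trichotomy (key (eventPoint c N e)) (key (eventPoint c N f)) with h | h | h
  · exact Or.inl (Or.inl h)
  · rcases lt_or_gt_of_ne hne with h' | h'
    · exact Or.inl (Or.inr ⟨h.le, h'⟩)
    · exact Or.inr (Or.inr ⟨h.ge, h'⟩)
  · exact Or.inr (Or.inl h)

end EventLT

theorem Below.not_below {c : ℕ → ℕ → Plane} {N : ℕ → ℕ} {i j : ℕ} (h : Below c N i j) :
    ¬ Below c N j i := by
  rintro (h' | h') <;> rcases h with h | h
  · exact lt_asymm h.1 h'.1
  · exact lt_asymm h.2 h'.2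
  · exact lt_asymm h.2 h'.2
  · exact lt_asymm h.1 h'.1

/-- The state of the sweep after the events in `R`: the points `U` have been found to lie on the
lower hull so far. -/
structure Sweep (k : ℕ) (c : ℕ → ℕ → Plane) (N : ℕ → ℕ) (R : Set ℕ) (U : Set Plane) : Prop where
  lt : ∀ e ∈ R, e < 2 * k
  down : ∀ e ∈ R, ∀ f < 2 * k, EventLT c N f e → f ∈ R
  -- Only essential points have to be covered, and only those that no outstanding event precedes.
  -- `found` keeps `U` to the left of the outstanding events, so that new arcs can be appended on
  -- the right.
  covered : ∀ A < k, ∀ s ≤ N A, Essential k c N A (c A s) → 2 * A ∈ R →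
    (∀ f < 2 * k, f ∉ R → key (c A s) ≤ key (eventPoint c N f)) → Above U (c A s)
  found : ∀ x ∈ U, ∃ A < k, ∃ s ≤ N A, x = c A s ∧ 2 * A ∈ R ∧
    ∀ f < 2 * k, f ∉ R → key x ≤ key (eventPoint c N f)

theorem Sweep.empty (k : ℕ) (c : ℕ → ℕ → Plane) (N : ℕ → ℕ) : Sweep k c N ∅ ∅ where
  lt _ := False.elim
  down _ := False.elim
  covered _ _ _ _ _ := False.elim
  found _ := False.elim

namespace Scene

variable {k : ℕ} {n : ℕ → ℕ} {V : ℕ → ℕ → Plane} {L N : ℕ → ℕ}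

theorem isArc (h : Scene k n V L N) : ∀ t < k, IsArc (lowerPoint n V L t) 0 (N t) := fun t ht =>
  ⟨fun _ hst hn => (h.chain t ht).key_lt hst hn,
    fun _ hst htu hu => (h.chain t ht).orient_pos hst htu (hu.trans_lt (h.chain t ht).length_lt)⟩

theorem mem_hull (h : Scene k n V L N) {i : ℕ} (hi : i < k) (s : ℕ) :
    lowerPoint n V L i s ∈ convexHull ℝ (V i '' Set.Iio (n i)) :=
  subset_convexHull ℝ _ ⟨_, Nat.mod_lt _ (h.chain i hi).cycle.pos, rfl⟩

theorem poly_eq (h : Scene k n V L N) {i j : ℕ} (hi : i < k) (hj : j < k) {x : Plane}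
    (hx : x ∈ convexHull ℝ (V i '' Set.Iio (n i)))
    (hx' : x ∈ convexHull ℝ (V j '' Set.Iio (n j))) : i = j := by
  by_contra hne
  exact Set.disjoint_left.1 (h.disjoint i hi j hj hne) hx hx'

theorem left_le (h : Scene k n V L N) {i : ℕ} (hi : i < k) (s : ℕ) :
    key (lowerPoint n V L i 0) ≤ key (lowerPoint n V L i s) := (h.chain i hi).chain_left_le

theorem le_right (h : Scene k n V L N) {i : ℕ} (hi : i < k) (s : ℕ) :
    key (lowerPoint n V L i s) ≤ key (lowerPoint n V L i (N i)) := (h.chain i hi).chain_le_right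

theorem eventLT_pair (h : Scene k n V L N) {i : ℕ} (hi : i < k) :
    EventLT (lowerPoint n V L) N (2 * i) (2 * i + 1) := by
  refine Or.inr ⟨?_, by omega⟩
  rw [eventPoint_even, eventPoint_odd]
  exact h.left_le hi _

/-- If `A` did not pass below `B` at the left ends, then by `orient_pos_of_disjoint` the chord of
`B` would pass strictly below the given point of `A`, which is essential. Equal left ends are
excluded by disjointness. -/
theorem below_of_essential (h : Scene k n V L N) {A B s : ℕ} (hA : A < k) (hB : B < k)
    (hBA : B ≠ A) (he : Essential k (lowerPoint n V L) N A (lowerPoint n V L A s))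
    (h₁ : key (lowerPoint n V L B 0) ≤ key (lowerPoint n V L A s))
    (h₂ : key (lowerPoint n V L A s) ≤ key (lowerPoint n V L B (N B))) :
    Below (lowerPoint n V L) N A B := by
  have ho := he B hB hBA h₁ h₂
  have key' := orient_pos_of_disjoint (convex_convexHull ℝ _) (convex_convexHull ℝ _)
    (h.disjoint B hB A hA hBA) (h.mem_hull hB 0) (h.mem_hull hB (N B)) (h.mem_hull hA 0)
    (h.mem_hull hA (N A)) (h.mem_hull hA s) h₁ h₂ (h.left_le hA s) (h.le_right hA s)
  rcases lt_trichotomy (key (lowerPoint n V L A 0)) (key (lowerPoint n V L B 0)) with hlt | heq | hlt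
  · exact Or.inl ⟨hlt, not_le.1 fun hh => ho.not_gt (key' (Or.inr ⟨hlt.le, hh⟩))⟩
  · have hm := h.mem_hull hA 0
    rw [key_injective heq] at hm
    exact absurd (h.poly_eq hB hA (h.mem_hull hB 0) hm) hBA
  · exact Or.inr ⟨hlt, not_le.1 fun hh => ho.not_gt (key' (Or.inl ⟨hlt.le, hh⟩))⟩

/-! ### One event of the sweep. -/

section Step

variable {R : Set ℕ} {U : Set Plane} {e : ℕ} (h : Scene k n V L N)
  (hS : Sweep k (lowerPoint n V L) N R U) (he : e < 2 * k) (heR : e ∉ R)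
  (hmin : ∀ f < 2 * k, f ∉ R → f ≠ e → EventLT (lowerPoint n V L) N e f)

include hmin in
theorem le_of_not_mem {f : ℕ} (hf : f < 2 * k) (hfR : f ∉ R) :
    key (eventPoint (lowerPoint n V L) N e) ≤ key (eventPoint (lowerPoint n V L) N f) := by
  by_cases hfe : f = e
  · rw [hfe]
  · exact (hmin f hf hfR hfe).key_le

include hS he heR in
theorem le_of_mem {f : ℕ} (hfR : f ∈ R) :
    key (eventPoint (lowerPoint n V L) N f) ≤ key (eventPoint (lowerPoint n V L) N e) := by
  have hne : f ≠ e := fun hh => heR (hh ▸ hfR)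
  rcases EventLT.of_ne (c := lowerPoint n V L) (N := N) hne with hlt | hlt
  · exact hlt.key_le
  · exact absurd (hS.down f hfR e he hlt) heR

include hS he heR in
theorem le_of_mem_insert {f : ℕ} (hfR : f ∈ insert e R) :
    key (eventPoint (lowerPoint n V L) N f) ≤ key (eventPoint (lowerPoint n V L) N e) := by
  rcases hfR with rfl | hfR
  exacts [le_rfl, le_of_mem hS he heR hfR]

include hS he heR hmin in
theorem down_insert : ∀ f ∈ insert e R, ∀ g < 2 * k, EventLT (lowerPoint n V L) N g f →
    g ∈ insert e R := by
  rintro f (rfl | hf) g hg hgf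
  · by_contra hgR
    exact (hmin g hg (fun hh => hgR (Or.inr hh)) fun hh => hgR (Or.inl hh)).not_lt hgf
  · exact Or.inr (hS.down f hf g hg hgf)

include h hS he heR hmin in
/-- An essential point that is not yet covered when `e` happens comes after `e`, and its polygon
becomes active. -/
theorem covered_or_active {A s : ℕ} (hA : A < k) (hs : s ≤ N A)
    (hess : Essential k (lowerPoint n V L) N A (lowerPoint n V L A s)) (hAR : 2 * A ∈ insert e R) :
    Above U (lowerPoint n V L A s) ∨ (A ∈ active (insert e R) ∧
      key (eventPoint (lowerPoint n V L) N e) ≤ key (lowerPoint n V L A s)) := by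
  by_cases hc : 2 * A ∈ R ∧ key (lowerPoint n V L A s) ≤ key (eventPoint (lowerPoint n V L) N e)
  · exact Or.inl (hS.covered A hA s hs hess hc.1 fun f hf hfR =>
      hc.2.trans (le_of_not_mem hmin hf hfR))
  · right
    have hle : key (eventPoint (lowerPoint n V L) N e) ≤ key (lowerPoint n V L A s) := by
      rcases hAR with hAe | hAR
      · rw [← hAe, eventPoint_even]; exact h.left_le hA s
      · exact (not_le.1 fun hh => hc ⟨hAR, hh⟩).le
    refine ⟨⟨hAR, ?_⟩, hle⟩
    rintro (hr | hr)
    · have hAR' : 2 * A ∈ R := hAR.resolve_left (by omega)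
      exact hc ⟨hAR', by rw [← hr, eventPoint_odd]; exact h.le_right hA s⟩
    · have hAR' : 2 * A ∈ R := hS.down _ hr _ (by omega) (h.eventLT_pair hA)
      have := le_of_mem hS he heR hr
      rw [eventPoint_odd] at this
      exact hc ⟨hAR', (h.le_right hA s).trans this⟩

/-- The points of the lowest active polygon between two successive events. -/
def piece (c : ℕ → ℕ → Plane) (N : ℕ → ℕ) (root e e' : ℕ) : Set Plane :=
  {x | ∃ t s, root = t + 1 ∧ s ≤ N t ∧ x = c t s ∧ key (eventPoint c N e) ≤ key x ∧
    key x ≤ key (eventPoint c N e')}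

/-! ### The piece between an event and its successor. -/

section Next

variable {e' : ℕ} (he' : e' < 2 * k) (heR' : e' ∉ insert e R)
  (hmin' : ∀ f < 2 * k, f ∉ insert e R → f ≠ e' → EventLT (lowerPoint n V L) N e' f)
  {tr : ℕ → ℕ}
  (htr : RealRAM.IsTree k (Below (lowerPoint n V L) N) (active (insert e R)) tr)

-- The event `e` separates the two points weakly. In case of equality both are the event point
-- itself, so by disjointness they belong to the polygon `A` of `e`. Since `A` has already started,
-- `e` is its right end; but then `A` is no longer active and cannot be at the root.
include h hS he heR htr in
theorem lt_of_mem_piece {x y : Plane} (hx : x ∈ U)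
    (hy : y ∈ piece (lowerPoint n V L) N (tr 1) e e') : key x < key y := by
  obtain ⟨A, hA, s, hs, rfl, hAR, hAle⟩ := hS.found x hx
  obtain ⟨t, s', hroot, hs', rfl, hle, -⟩ := hy
  have hAe := hAle e he heR
  refine lt_of_le_of_ne (hAe.trans hle) fun heq => ?_
  have hk : 0 < k := by omega
  rcases htr.root_mem hk with h₀ | ⟨t', ht, htl, h₀⟩
  · omega
  obtain rfl : t' = t := by omega
  have hpt : eventPoint (lowerPoint n V L) N e = lowerPoint n V L A s :=
    key_injective (le_antisymm (hle.trans heq.ge) hAe)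
  have hAt : A = t' := h.poly_eq hA ht (h.mem_hull hA s)
    (key_injective heq ▸ h.mem_hull ht s')
  have heA : e / 2 = A := by
    refine h.poly_eq (by omega) hA (x := eventPoint (lowerPoint n V L) N e) ?_
      (hpt ▸ h.mem_hull hA s)
    rw [eventPoint]
    split_ifs <;> exact h.mem_hull (by omega) _
  subst hAt
  rcases Nat.even_or_odd' e with ⟨i, hi | hi⟩
  · exact heR (by rw [hi, show i = A by omega]; exact hAR)
  · exact htl.2 (Or.inl (by omega))

-- An essential point not covered before lies between `e` and `e'` on an active polygon `A`. Every
-- other active polygon extends over that point, so `A` is `Below` it by `below_of_essential`; hence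
-- `A` is at the root and the point belongs to the piece. If there is no such point, the root
-- polygon is irrelevant and its piece merely adds further points.
include h hS he heR hmin he' heR' hmin' htr in
theorem sweep_step {U' : Set Plane}
    (hU' : U' ⊆ U ∪ piece (lowerPoint n V L) N (tr 1) e e')
    (hU : ∀ x ∈ U ∪ piece (lowerPoint n V L) N (tr 1) e e', Above U' x) :
    Sweep k (lowerPoint n V L) N (insert e R) U' where
  lt := by
    rintro f (rfl | hf)
    exacts [he, hS.lt f hf]
  down := down_insert hS he heR hmin
  covered A hA s hs hess hAR hAle := by
    rcases covered_or_active h hS he heR hmin hA hs hess hAR with hab | ⟨hact, hle⟩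
    · exact hab.trans fun u hu => hU u (Or.inl hu)
    refine hU _ (Or.inr ⟨A, s, ?_, hs, rfl, hle, hAle e' he' heR'⟩)
    refine htr.root_eq hA hact fun B hB hBact hBA => ?_
    suffices hbel : Below (lowerPoint n V L) N A B from ⟨hbel, hbel.not_below⟩
    refine h.below_of_essential hA hB hBA hess ?_ ?_
    · have := le_of_mem_insert hS he heR hBact.1
      rw [eventPoint_even] at this
      exact this.trans hle
    · have := hAle (2 * B + 1) (by omega) hBact.2
      rwa [eventPoint_odd] at this
  found x hx := by
    rcases hU' hx with hxU | hxP
    · obtain ⟨A, hA, s, hs, hxe, hAR, hAle⟩ := hS.found x hxU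
      exact ⟨A, hA, s, hs, hxe, Or.inr hAR, fun f hf hfR => hAle f hf fun hh => hfR (Or.inr hh)⟩
    · obtain ⟨t, s, hroot, hs, hxe, -, hle⟩ := hxP
      rcases htr.root_mem (by omega) with h₀ | ⟨t', ht, htl, h₀⟩
      · omega
      obtain rfl : t' = t := by omega
      exact ⟨t', ht, s, hs, hxe, htl.1, fun f hf hfR => hle.trans (le_of_not_mem hmin' hf hfR)⟩

end Next

-- After the last event no polygon is active, so every essential point was covered before.
include h hS he heR hmin in
theorem sweep_last (hall : ∀ f < 2 * k, f ∈ insert e R) :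
    Sweep k (lowerPoint n V L) N (insert e R) U where
  lt := by
    rintro f (rfl | hf)
    exacts [he, hS.lt f hf]
  down := down_insert hS he heR hmin
  covered A hA s hs hess hAR hAle := by
    rcases covered_or_active h hS he heR hmin hA hs hess hAR with hab | ⟨hact, -⟩
    · exact hab
    · exact absurd (hall _ (by omega)) hact.2
  found x hx := by
    obtain ⟨A, hA, s, hs, hxe, hAR, hAle⟩ := hS.found x hx
    exact ⟨A, hA, s, hs, hxe, Or.inr hAR, fun f hf hfR => hAle f hf fun hh => hfR (Or.inr hh)⟩

end Step

theorem chain_between (h : Scene k n V L N) {B j : ℕ} (hB : B < k) (hj : j < n B) :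
    key (lowerPoint n V L B 0) ≤ key (V B j) ∧ key (V B j) ≤ key (lowerPoint n V L B (N B)) := by
  obtain ⟨s, -, hs⟩ := (h.chain B hB).exists_chain hj
  rw [hs]
  exact ⟨h.left_le hB s, h.le_right hB s⟩

/-- When all events have happened, all vertices lie above the points found. -/
theorem above_of_sweep (h : Scene k n V L N) {R : Set ℕ} {U : Set Plane}
    (hS : Sweep k (lowerPoint n V L) N R U) (hall : ∀ f < 2 * k, f ∈ R) {i j : ℕ} (hi : i < k)
    (hj : j < n i) : Above U (V i j) := by
  have hcov : ∀ A < k, ∀ s ≤ N A, Essential k (lowerPoint n V L) N A (lowerPoint n V L A s) →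
      Above U (lowerPoint n V L A s) := fun A hA s hs hess =>
    hS.covered A hA s hs hess (hall _ (by omega)) fun f hf hfR => absurd (hall f hf) hfR
  set P : Set (ℕ × ℕ) := {q | q.1 < k ∧ q.2 < n q.1} with hP
  have hfin : P.Finite := by
    refine ((Set.finite_Iio k).biUnion fun a _ => (Set.finite_Iio (n a)).image (Prod.mk a)).subset ?_
    rintro ⟨a, b⟩ ⟨ha, hb⟩
    exact Set.mem_biUnion (x := a) ha ⟨b, hb, rfl⟩
  have hne : P.Nonempty := ⟨(i, j), hi, hj⟩
  refine ⟨fun a => ?_, ?_, ?_⟩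
  -- A vertex of least height for the slope `a` lies above no chord, not even that of its own
  -- polygon. So it belongs to the lower side and is essential, and the point of `U` that covers it
  -- is low enough for all vertices.
  · obtain ⟨⟨A, b⟩, ⟨hA, hb⟩, hmin⟩ := hfin.exists_minimalFor (fun q => height a (V q.1 q.2)) P hne
    have hmin' : ∀ B < k, ∀ b' < n B, height a (V A b) ≤ height a (V B b') := fun B hB b' hb' => by
      by_contra! hlt
      exact hlt.not_ge (hmin (j := (B, b')) ⟨hB, hb'⟩ hlt.le)
    have hno : ∀ B < k, key (lowerPoint n V L B 0) ≤ key (V A b) →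
        key (V A b) ≤ key (lowerPoint n V L B (N B)) →
        orient (lowerPoint n V L B 0) (lowerPoint n V L B (N B)) (V A b) ≤ 0 := by
      intro B hB h₁ h₂
      by_contra! ho
      rcases height_lt_of_orient h₁ h₂ ho a with hlt | hlt
      · exact hlt.not_ge (hmin' B hB _ (Nat.mod_lt _ (h.chain B hB).cycle.pos))
      · exact hlt.not_ge (hmin' B hB _ (Nat.mod_lt _ (h.chain B hB).cycle.pos))
    have hbet := h.chain_between hA hb
    rcases (h.chain A hA).upper hb with ⟨s, hs, hse⟩ | ho
    · have hse' : V A b = lowerPoint n V L A s := hse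
      obtain ⟨u, hu, hle⟩ := (hcov A hA s hs (hse' ▸ fun B hB _ h₁ h₂ => hno B hB h₁ h₂)).1 a
      exact ⟨u, hu, hle.trans (hse' ▸ hmin' i hi j hj)⟩
    · exact absurd ho (hno A hA hbet.1 hbet.2).not_gt
  · obtain ⟨⟨A, b⟩, ⟨hA, hb⟩, hmin⟩ := hfin.exists_minimalFor (fun q => key (V q.1 q.2)) P hne
    have hmin' : ∀ B < k, ∀ b' < n B, key (V A b) ≤ key (V B b') := fun B hB b' hb' => by
      by_contra! hlt
      exact hlt.not_ge (hmin (j := (B, b')) ⟨hB, hb'⟩ hlt.le)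
    have hle : ∀ B < k, ∀ s, key (lowerPoint n V L A 0) ≤ key (lowerPoint n V L B s) :=
      fun B hB s => (h.chain_between hA hb).1.trans
        (hmin' B hB _ (Nat.mod_lt _ (h.chain B hB).cycle.pos))
    -- The left end of the polygon with the least vertex is essential for a trivial reason: no other
    -- polygon begins that early.
    obtain ⟨u, hu, hu'⟩ := (hcov A hA 0 (Nat.zero_le _) fun B hB hBA h₁ _ =>
      absurd (h.poly_eq hB hA (h.mem_hull hB 0)
        (key_injective (le_antisymm h₁ (hle B hB 0)) ▸ h.mem_hull hA 0)) hBA).2.1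
    exact ⟨u, hu, hu'.trans ((h.chain_between hA hb).1.trans (hmin' i hi j hj))⟩
  · obtain ⟨⟨A, b⟩, ⟨hA, hb⟩, hmax⟩ := hfin.exists_maximalFor (fun q => key (V q.1 q.2)) P hne
    have hmax' : ∀ B < k, ∀ b' < n B, key (V B b') ≤ key (V A b) := fun B hB b' hb' => by
      by_contra! hlt
      exact hlt.not_ge (hmax (j := (B, b')) ⟨hB, hb'⟩ hlt.le)
    have hle : ∀ B < k, ∀ s, key (lowerPoint n V L B s) ≤ key (lowerPoint n V L A (N A)) :=
      fun B hB s => (hmax' B hB _ (Nat.mod_lt _ (h.chain B hB).cycle.pos)).trans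
        (h.chain_between hA hb).2
    obtain ⟨u, hu, hu'⟩ := (hcov A hA (N A) le_rfl fun B hB hBA _ h₂ =>
      absurd (h.poly_eq hB hA (h.mem_hull hB (N B))
        (key_injective (le_antisymm (hle B hB (N B)) h₂) ▸ h.mem_hull hA (N A))) hBA).2.2
    exact ⟨u, hu, ((hmax' i hi j hj).trans (h.chain_between hA hb).2).trans hu'⟩

end Scene


/-! ## Preparing the sweep: the lower sides -/

namespace RealRAM

open Prog

/-- Input and lower sides, as stored in the memory. -/
structure Env (σ : ℚ) (k : ℕ) (n : ℕ → ℕ) (V : ℕ → ℕ → Plane) (L N : ℕ → ℕ) (s : State) :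
    Prop where
  input : Input σ k n V s
  left : ∀ i < k, s.natArr 2 i = L i
  len : ∀ i < k, s.natArr 3 i = N i
  endX : ∀ e < 2 * k, s.realArr 3 e = eventPoint (lowerPoint n V L) N e 0
  endY : ∀ e < 2 * k, s.realArr 4 e = eventPoint (lowerPoint n V L) N e 1
  scene : Scene k n V L N

theorem Input.agree {σ : ℚ} {k : ℕ} {n : ℕ → ℕ} {V : ℕ → ℕ → Plane} {s s' : State} {p : Prog}
    (h : Input σ k n V s) (hA : Agree p s s') (h₀ : 0 ∉ p.natVars) (h₁ : ∀ a ≤ 1, a ∉ p.natArrs)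
    (h₂ : ∀ a ≤ 2, a ∉ p.realArrs) : Input σ k n V s' :=
  h.congr (hA.natVar 0 h₀) (hA.natArr 0 (h₁ 0 (by omega))) (hA.natArr 1 (h₁ 1 (by omega)))
    (hA.realArr 0 (h₂ 0 (by omega))) (hA.realArr 1 (h₂ 1 (by omega)))
    (hA.realArr 2 (h₂ 2 (by omega)))

namespace Env

variable {σ : ℚ} {k : ℕ} {n : ℕ → ℕ} {V : ℕ → ℕ → Plane} {L N : ℕ → ℕ} {s s' : State}

theorem congr (h : Env σ k n V L N s) (h₀ : s'.natVar 0 = s.natVar 0)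
    (h₁ : ∀ a ≤ 3, s'.natArr a = s.natArr a) (h₂ : ∀ a ≤ 4, s'.realArr a = s.realArr a) :
    Env σ k n V L N s' where
  input := h.input.congr h₀ (h₁ 0 (by omega)) (h₁ 1 (by omega)) (h₂ 0 (by omega))
    (h₂ 1 (by omega)) (h₂ 2 (by omega))
  left := by rw [h₁ 2 (by omega)]; exact h.left
  len := by rw [h₁ 3 (by omega)]; exact h.len
  endX := by rw [h₂ 3 (by omega)]; exact h.endX
  endY := by rw [h₂ 4 (by omega)]; exact h.endY
  scene := h.scene

theorem agree {p : Prog} (h : Env σ k n V L N s) (hA : Agree p s s') (h₀ : 0 ∉ p.natVars)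
    (h₁ : ∀ a ≤ 3, a ∉ p.natArrs) (h₂ : ∀ a ≤ 4, a ∉ p.realArrs) : Env σ k n V L N s' :=
  h.congr (hA.natVar 0 h₀) (fun a ha => hA.natArr a (h₁ a ha)) fun a ha => hA.realArr a (h₂ a ha)

end Env

/-- Stores the leftmost point, vertex `natVar 3`, of polygon `natVar 1`. -/
def saveLeft (σ : ℚ) : Prog :=
  block [.storeNat 2 (.var 1) (.var 3), readVertex σ 1 3 1 2,
    .storeReal 3 (.add (.var 1) (.var 1)) (.var 1), .storeReal 4 (.add (.var 1) (.var 1)) (.var 2)]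

/-- Stores the rightmost point, vertex `natVar 3`, of polygon `natVar 1`, and the number of edges of
the lower side; moves to the next polygon. -/
def saveRight (σ : ℚ) : Prog :=
  block [readVertex σ 1 3 1 2,
    .storeReal 3 (.add (.add (.var 1) (.var 1)) (.const 1)) (.var 1),
    .storeReal 4 (.add (.add (.var 1) (.var 1)) (.const 1)) (.var 2),
    .ite (.natLe (.arr 2 (.var 1)) (.var 3))
      (.storeNat 3 (.var 1) (.sub (.var 3) (.arr 2 (.var 1))))
      (.storeNat 3 (.var 1) (.sub (.add (.var 3) (.arr 0 (.var 1))) (.arr 2 (.var 1)))),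
    .setNat 1 (.add (.var 1) (.const 1))]

/-- Finds the lower side of one polygon. -/
def lowerSide (σ : ℚ) : Prog :=
  block [leastVertex σ, saveLeft σ, leastVertex (-σ), saveRight σ]

/-- Finds the lower sides of all polygons. -/
def lowerSides (σ : ℚ) : Prog :=
  block [.setNat 1 (.const 0), .loop (.not (.natLe (.var 0) (.var 1))) (lowerSide σ)]

section

variable {σ : ℚ} {k : ℕ} {n : ℕ → ℕ} {V : ℕ → ℕ → Plane} {s : State}

theorem saveLeft_spec (h : Input σ k n V s) {i l : ℕ} (h1 : s.natVar 1 = i) (hi : i < k)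
    (h3 : s.natVar 3 = l) (hl : l < n i) :
    Within (saveLeft σ) (saveLeft σ).time s fun s' =>
      s'.natArr 2 = Function.update (s.natArr 2) i l ∧
      s'.realArr 3 = Function.update (s.realArr 3) (i + i) (V i l 0) ∧
      s'.realArr 4 = Function.update (s.realArr 4) (i + i) (V i l 1) := by
  refine Within.of_vc ?_
  simp only [saveLeft, block, vc, NExp.eval]
  refine readVertex_vc (h.congr (by simp) (by simp) (by simp) (by simp) (by simp) (by simp))
    (by simp; omega) (by simp [h1, h3]; exact hl) fun a => ?_
  simp [h1, h3]

theorem saveRight_spec (h : Input σ k n V s) {i l r : ℕ} (h1 : s.natVar 1 = i) (hi : i < k)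
    (h3 : s.natVar 3 = r) (hr : r < n i) (hl : s.natArr 2 i = l) :
    Within (saveRight σ) (saveRight σ).time s fun s' =>
      s'.natVar 1 = i + 1 ∧
      s'.natArr 3 = Function.update (s.natArr 3) i (if l ≤ r then r - l else r + n i - l) ∧
      s'.realArr 3 = Function.update (s.realArr 3) (i + i + 1) (V i r 0) ∧
      s'.realArr 4 = Function.update (s.realArr 4) (i + i + 1) (V i r 1) := by
  refine Within.of_vc ?_
  simp only [saveRight, block, vc, NExp.eval]
  refine readVertex_vc h (by omega) (by rw [h1, h3]; exact hr) fun a => ?_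
  simp [h1, h3, hl, h.size i hi]
  constructor
  · intro hle; rw [if_pos hle]
  · intro hle; rw [if_neg (by omega)]

/-- The lower side of polygon `i` has been found and stored. -/
structure Ready (n : ℕ → ℕ) (V : ℕ → ℕ → Plane) (i : ℕ) (s : State) : Prop where
  chain : LowerChain (n i) (V i) (s.natArr 2 i) (s.natArr 3 i)
  leftX : s.realArr 3 (i + i) = V i (s.natArr 2 i) 0
  leftY : s.realArr 4 (i + i) = V i (s.natArr 2 i) 1
  rightX : s.realArr 3 (i + i + 1) = chainPoint (n i) (V i) (s.natArr 2 i) (s.natArr 3 i) 0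
  rightY : s.realArr 4 (i + i + 1) = chainPoint (n i) (V i) (s.natArr 2 i) (s.natArr 3 i) 1

end

theorem LowerChain.chainPoint_of_extremes {n : ℕ} (c : ℕ → Plane) {L R : ℕ} (hL : L < n)
    (hR : R < n) : chainPoint n c L (if L ≤ R then R - L else R + n - L) = c R := by
  rw [chainPoint]
  split_ifs with hle
  · rw [show L + (R - L) = R by omega, Nat.mod_eq_of_lt hR]
  · rw [show L + (R + n - L) = R + n by omega, Nat.add_mod_right, Nat.mod_eq_of_lt hR]

theorem lowerSide_spec (σ : ℚ) : ∃ K, ∀ (k : ℕ) (n : ℕ → ℕ) (V : ℕ → ℕ → Plane) (s : State),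
    Input σ k n V s → ∀ i, s.natVar 1 = i → i < k → (∀ j < i, Ready n V j s) →
    Within (lowerSide σ) (K * (Nat.size (n i) + 1)) s fun s' =>
      Input σ k n V s' ∧ s'.natVar 1 = i + 1 ∧ ∀ j < i + 1, Ready n V j s' := by
  obtain ⟨K₁, hK₁⟩ := leastVertex_spec σ
  obtain ⟨K₂, hK₂⟩ := leastVertex_spec (-σ)
  refine ⟨K₁ + K₂ + (saveLeft σ).time + (saveRight σ).time + 1, fun k n V s h i h1 hi hready => ?_⟩
  refine Within.mono (T := K₁ * (Nat.size (n i) + 1) + ((saveLeft σ).time +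
    (K₂ * (Nat.size (n i) + 1) + ((saveRight σ).time + 1)))) ?_ ?_ fun s' _ h => h
  swap
  · have h₁ := Nat.le_mul_of_pos_right (saveLeft σ).time (Nat.succ_pos (Nat.size (n i)))
    have h₂ := Nat.le_mul_of_pos_right (saveRight σ).time (Nat.succ_pos (Nat.size (n i)))
    simp only [Nat.succ_eq_add_one] at h₁ h₂
    simp only [Nat.add_mul] at h₁ h₂ ⊢
    omega
  refine .cons ((hK₁ k n V s h i h1 hi).imp fun s₁ hA₁ ⟨hl, hmin⟩ => ?_)
  obtain ⟨na₁, ra₁, nv₁⟩ := leastVertex_frame hA₁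
  have hI₁ : Input σ k n V s₁ := h.congr (nv₁ 0 (by omega)) (by rw [na₁]) (by rw [na₁])
    (by rw [ra₁]) (by rw [ra₁]) (by rw [ra₁])
  refine .cons ((saveLeft_spec hI₁ ((nv₁ 1 (by omega)).trans h1) hi rfl hl).imp
    fun s₂ hA₂ ⟨a₂, x₂, y₂⟩ => ?_)
  have hI₂ : Input σ k n V s₂ := hI₁.agree hA₂ (by simp [saveLeft, readVertex, block, natVars])
    (fun a ha => by simp [saveLeft, readVertex, block, natArrs]; omega)
    (fun a ha => by simp [saveLeft, readVertex, block, realArrs]; omega)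
  have n₂ : s₂.natVar 1 = i := (hA₂.natVar 1 (by simp [saveLeft, readVertex, block, natVars])).trans
    ((nv₁ 1 (by omega)).trans h1)
  have a₂' : s₂.natArr 3 = s₁.natArr 3 :=
    hA₂.natArr 3 (by simp [saveLeft, readVertex, block, natArrs])
  -- The greatest vertex is the least vertex of the reflected polygon.
  refine .cons ((hK₂ k n _ s₂ hI₂.neg i n₂ hi).imp fun s₃ hA₃ ⟨hr, hmax⟩ => ?_)
  obtain ⟨na₃, ra₃, nv₃⟩ := leastVertex_frame hA₃
  have hI₃ : Input σ k n V s₃ := hI₂.congr (nv₃ 0 (by omega)) (by rw [na₃]) (by rw [na₃])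
    (by rw [ra₃]) (by rw [ra₃]) (by rw [ra₃])
  have e₃ : s₃.natArr 2 i = s₁.natVar 3 := by rw [na₃, a₂, Function.update_self]
  refine .cons ((saveRight_spec hI₃ ((nv₃ 1 (by omega)).trans n₂) hi rfl hr e₃).imp
    fun s₄ hA₄ ⟨n₄, a₄, x₄, y₄⟩ => ?_)
  have a₄' : s₄.natArr 2 = s₃.natArr 2 :=
    hA₄.natArr 2 (by simp [saveRight, readVertex, block, natArrs])
  refine .nil ⟨hI₃.agree hA₄ (by simp [saveRight, readVertex, block, natVars])
    (fun a ha => by simp [saveRight, readVertex, block, natArrs]; omega)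
    (fun a ha => by simp [saveRight, readVertex, block, realArrs]; omega), n₄, fun j hj => ?_⟩
  have A2 : s₄.natArr 2 = Function.update (s.natArr 2) i (s₁.natVar 3) := by
    rw [a₄', na₃, a₂, na₁]
  have A3 : s₄.natArr 3 = Function.update (s.natArr 3) i (if s₁.natVar 3 ≤ s₃.natVar 3 then
      s₃.natVar 3 - s₁.natVar 3 else s₃.natVar 3 + n i - s₁.natVar 3) := by
    rw [a₄, na₃, a₂', na₁]
  rw [ra₃, x₂, ra₁] at x₄
  rw [ra₃, y₂, ra₁] at y₄
  rcases eq_or_ne j i with rfl | hji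
  · constructor
    · rw [A2, A3, Function.update_self, Function.update_self]
      refine .of_extremes (h.cycle j hi) hl hr hmin fun l hl => ?_
      exact key_neg_le_neg.1 (hmax l hl)
    · rw [x₄, A2, Function.update_of_ne (by omega), Function.update_self, Function.update_self]
    · rw [y₄, A2, Function.update_of_ne (by omega), Function.update_self, Function.update_self]
    · rw [x₄, A2, A3, Function.update_self, Function.update_self, Function.update_self,
        LowerChain.chainPoint_of_extremes _ hl hr]
    · rw [y₄, A2, A3, Function.update_self, Function.update_self, Function.update_self,
        LowerChain.chainPoint_of_extremes _ hl hr]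
  · have hr := hready j (by omega)
    constructor
    · rw [A2, A3, Function.update_of_ne hji, Function.update_of_ne hji]; exact hr.chain
    · rw [x₄, A2, Function.update_of_ne hji, Function.update_of_ne (by omega),
        Function.update_of_ne (by omega)]; exact hr.leftX
    · rw [y₄, A2, Function.update_of_ne hji, Function.update_of_ne (by omega),
        Function.update_of_ne (by omega)]; exact hr.leftY
    · rw [x₄, A2, A3, Function.update_of_ne hji, Function.update_of_ne hji,
        Function.update_of_ne (by omega), Function.update_of_ne (by omega)]; exact hr.rightX
    · rw [y₄, A2, A3, Function.update_of_ne hji, Function.update_of_ne hji,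
        Function.update_of_ne (by omega), Function.update_of_ne (by omega)]; exact hr.rightY

theorem lowerSides_spec (σ : ℚ) : ∃ K, ∀ (k : ℕ) (n : ℕ → ℕ) (V : ℕ → ℕ → Plane) (m : ℕ)
    (s : State), Input σ k n V s → (∀ i < k, Nat.size (n i) ≤ m) →
    (∀ i < k, ∀ j < k, i ≠ j →
      Disjoint (convexHull ℝ (V i '' Set.Iio (n i))) (convexHull ℝ (V j '' Set.Iio (n j)))) →
    Within (lowerSides σ) (K * ((k + 1) * (m + 1))) s fun s' =>
      Env σ k n V (s'.natArr 2) (s'.natArr 3) s' := by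
  obtain ⟨K, hK⟩ := lowerSide_spec σ
  refine ⟨K + 10, fun k n V m s h hm hd => ?_⟩
  have hloop := fun s₁ (hI : Input σ k n V s₁) (h1 : s₁.natVar 1 = 0) =>
    Within.loop_of_le (s := s₁) (b := .not (.natLe (.var 0) (.var 1))) (p := lowerSide σ)
    (fun s' => Input σ k n V s' ∧ s'.natVar 1 ≤ k ∧ ∀ j < s'.natVar 1, Ready n V j s')
    (fun s' => k - s'.natVar 1) (K * (m + 1)) ⟨hI, by omega, by omega⟩ (by
      rintro s₂ ⟨hI₂, hle, hr⟩ hb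
      simp only [BExp.eval, NExp.eval, hI₂.count, not_le] at hb
      refine (hK k n V s₂ hI₂ _ rfl hb hr).mono (Nat.mul_le_mul_left _ (Nat.succ_le_succ (hm _ hb)))
        ?_
      rintro s₃ - ⟨hI₃, e₃, hr₃⟩
      exact ⟨⟨hI₃, by omega, by rwa [e₃]⟩, by omega⟩)
  refine Within.mono (T := 2 + ((4 + K * (m + 1)) * (k - 0 + 1) + 1)) ?_ ?_ fun s' _ h => h
  · refine .cons ((Within.of_vc (p := .setNat 1 (.const 0)) (Q := fun s' => s' = s.setNat 1 0)
      rfl).imp fun s₁ _ e₁ => ?_)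
    subst e₁
    have h0 : (s.setNat 1 0).natVar 1 = 0 := by simp
    have hl := hloop (s.setNat 1 0) (h.congr (by simp) (by simp) (by simp) (by simp) (by simp)
      (by simp)) h0
    rw [h0] at hl
    refine .cons (hl.imp fun s₂ _ ⟨⟨hI₂, hle, hr⟩, hb⟩ => .nil ?_)
    simp only [BExp.eval, NExp.eval, hI₂.count, not_le, not_lt] at hb
    have he : s₂.natVar 1 = k := by omega
    rw [he] at hr
    have hev : ∀ e, e < 2 * k → ∃ i < k, e = 2 * i ∨ e = 2 * i + 1 := fun e he =>
      ⟨e / 2, by omega, by omega⟩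
    refine ⟨hI₂, fun _ _ => rfl, fun _ _ => rfl, fun e he => ?_, fun e he => ?_, ⟨fun i hi =>
      (hr i hi).chain, hd⟩⟩
    all_goals obtain ⟨i, hi, rfl | rfl⟩ := hev e he
    · rw [eventPoint_even, lowerPoint, (hr i hi).chain.chain_zero, ← (hr i hi).leftX, two_mul]
    · rw [eventPoint_odd, lowerPoint, ← (hr i hi).rightX, two_mul]
    · rw [eventPoint_even, lowerPoint, (hr i hi).chain.chain_zero, ← (hr i hi).leftY, two_mul]
    · rw [eventPoint_odd, lowerPoint, ← (hr i hi).rightY, two_mul]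
  · have h₁ : 1 ≤ (k + 1) * (m + 1) := Nat.mul_pos (by omega) (by omega)
    have h₂ : k + 1 ≤ (k + 1) * (m + 1) := Nat.le_mul_of_pos_right _ (by omega)
    have h₃ : K * (m + 1) * (k - 0 + 1) = K * ((k + 1) * (m + 1)) := by rw [Nat.sub_zero]; ring
    rw [Nat.add_mul, h₃, Nat.sub_zero, Nat.add_mul K 10]
    omega

end RealRAM


/-! ## The tournament trees of the sweep -/

/-- Only valid indices enter a match, so relations that agree on them have the same trees. This
passes between the relations read off the memory by `storedEnds`, which match the programs at all
indices, and the geometric ones. -/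
theorem RealRAM.IsTree.congr {M : ℕ} {B B' : ℕ → ℕ → Prop} [DecidableRel B] [DecidableRel B']
    {live live' : Set ℕ} {tr : ℕ → ℕ} (h : IsTree M B live tr)
    (hB : ∀ i < M, ∀ j < M, (B' i j ↔ B i j)) (hl : ∀ i < M, (i ∈ live' ↔ i ∈ live)) :
    IsTree M B' live' tr where
  leaf i hi := by rw [hl i hi]; exact h.leaf i hi
  node q hq hq' := by
    rw [h.node q hq hq', pick, pick]
    rcases h.mem_live (q := q + q) (by omega) (by omega) with h₁ | ⟨i, hi, -, h₁⟩
    · simp [h₁]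
    rcases h.mem_live (q := q + q + 1) (by omega) (by omega) with h₂ | ⟨j, hj, -, h₂⟩
    · simp [h₂]
    rw [h₁, h₂]
    simp [hB i hi j hj]

theorem eventLT_iff {c : ℕ → ℕ → Plane} {N : ℕ → ℕ} {e f : ℕ} :
    EventLT c N e f ↔ toLex (key (eventPoint c N e), e) < toLex (key (eventPoint c N f), f) := by
  rw [Prod.Lex.toLex_lt_toLex, EventLT]
  constructor
  · rintro (h | ⟨h, h'⟩)
    · exact Or.inl h
    · rcases eq_or_lt_of_le h with h | h
      exacts [Or.inr ⟨h, h'⟩, Or.inl h]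
  · rintro (h | ⟨h, h'⟩)
    exacts [Or.inl h, Or.inr ⟨le_of_eq h, h'⟩]

theorem eventLT_congr {c c' : ℕ → ℕ → Plane} {N N' : ℕ → ℕ} {e f : ℕ}
    (he : eventPoint c' N' e = eventPoint c N e) (hf : eventPoint c' N' f = eventPoint c N f) :
    EventLT c' N' e f ↔ EventLT c N e f := by
  rw [EventLT, EventLT, he, hf]

theorem below_congr {c c' : ℕ → ℕ → Plane} {N N' : ℕ → ℕ} {i j : ℕ}
    (h : ∀ e, e / 2 = i ∨ e / 2 = j → eventPoint c' N' e = eventPoint c N e) :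
    Below c' N' i j ↔ Below c N i j := by
  have h₁ := h (2 * i) (by omega)
  have h₂ := h (2 * i + 1) (by omega)
  have h₃ := h (2 * j) (by omega)
  have h₄ := h (2 * j + 1) (by omega)
  simp only [eventPoint_even, eventPoint_odd] at h₁ h₂ h₃ h₄
  rw [Below, Below, h₁, h₂, h₃, h₄]

/-- The root of the tree of events holds the first one. -/
theorem RealRAM.IsTree.root_first {k : ℕ} {c : ℕ → ℕ → Plane} {N : ℕ → ℕ} {R : Set ℕ} {tr : ℕ → ℕ}
    (h : IsTree (2 * k) (EventLT c N) Rᶜ tr) (hk : 0 < k) :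
    tr 1 = 0 ∧ (∀ f < 2 * k, f ∈ R) ∨ ∃ e < 2 * k, e ∉ R ∧ tr 1 = e + 1 ∧
      ∀ f < 2 * k, f ∉ R → f ≠ e → EventLT c N e f := by
  by_cases hall : ∀ f < 2 * k, f ∈ R
  · rcases h.root_mem (by omega) with h₀ | ⟨i, hi, hl, -⟩
    · exact Or.inl ⟨h₀, hall⟩
    · exact absurd (hall i hi) hl
  · right
    push Not at hall
    obtain ⟨e, ⟨he, heR⟩, hmin⟩ := ((Set.finite_Iio (2 * k)).subset
      (fun f (hf : f ∈ {f | f < 2 * k ∧ f ∉ R}) => hf.1)).exists_minimalFor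
      (fun e => toLex (key (eventPoint c N e), e)) _ hall
    have hlt : ∀ f < 2 * k, f ∉ R → f ≠ e → EventLT c N e f := fun f hf hfR hfe => by
      rcases EventLT.of_ne (c := c) (N := N) hfe with h' | h'
      · rw [eventLT_iff] at h'
        exact absurd (hmin (j := f) ⟨hf, hfR⟩ h'.le) h'.not_ge
      · exact h'
    exact ⟨e, he, heR, h.root_eq he heR fun f hf hfR hfe =>
      ⟨hlt f hf hfR hfe, (hlt f hf hfR hfe).not_lt⟩, hlt⟩

namespace RealRAM

open Prog

/-- Comparison of points given by their coordinates. -/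
def BExp.lexLt (x y x' y' : RExp) : BExp :=
  .and (.realLe x x') (.not (.and (.realLe x' x) (.realLe y' y)))

theorem BExp.lexLt_eval {s : State} {x y x' y' : RExp} {p q : Plane} (h₁ : x.eval s = p 0)
    (h₂ : y.eval s = p 1) (h₃ : x'.eval s = q 0) (h₄ : y'.eval s = q 1) :
    (BExp.lexLt x y x' y').eval s ↔ key p < key q := by
  rw [key_lt_iff_le]
  simp only [BExp.lexLt, BExp.eval, h₁, h₂, h₃, h₄]

/-- Orientation of points given by their coordinates. -/
def RExp.orient (ax ay bx bY cx cy : RExp) : RExp :=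
  .sub (.mul (.sub bx ax) (.sub cy ay)) (.mul (.sub bY ay) (.sub cx ax))

theorem RExp.orient_eval {s : State} {ax ay bx bY cx cy : RExp} {a b c : Plane}
    (h₁ : ax.eval s = a 0) (h₂ : ay.eval s = a 1) (h₃ : bx.eval s = b 0) (h₄ : bY.eval s = b 1)
    (h₅ : cx.eval s = c 0) (h₆ : cy.eval s = c 1) :
    (RExp.orient ax ay bx bY cx cy).eval s = _root_.orient a b c := by
  simp only [RExp.orient, RExp.eval, h₁, h₂, h₃, h₄, h₅, h₆, _root_.orient]

/-- Comparison of two events. -/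
def eventCond : BExp :=
  let x : NExp := .sub (.var 20) (.const 1)
  let y : NExp := .sub (.var 21) (.const 1)
  .or (.lexLt (.arr 3 x) (.arr 4 x) (.arr 3 y) (.arr 4 y))
    (.and (.not (.lexLt (.arr 3 y) (.arr 4 y) (.arr 3 x) (.arr 4 x))) (.not (.natLe y x)))

/-- Comparison of two polygons. -/
def belowCond : BExp :=
  let i : NExp := .sub (.var 20) (.const 1)
  let j : NExp := .sub (.var 21) (.const 1)
  let l : NExp := .add i i
  let r : NExp := .add l (.const 1)
  let l' : NExp := .add j j
  let r' : NExp := .add l' (.const 1)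
  .or (.and (.lexLt (.arr 3 l) (.arr 4 l) (.arr 3 l') (.arr 4 l'))
      (.not (.realLe (.orient (.arr 3 l) (.arr 4 l) (.arr 3 r) (.arr 4 r) (.arr 3 l') (.arr 4 l'))
        (.const 0))))
    (.and (.lexLt (.arr 3 l') (.arr 4 l') (.arr 3 l) (.arr 4 l))
      (.not (.realLe (.const 0)
        (.orient (.arr 3 l') (.arr 4 l') (.arr 3 r') (.arr 4 r') (.arr 3 l) (.arr 4 l)))))

/-- The end points of the lower sides, as given by their coordinates in the memory. -/
def storedEnds (r : ℕ → ℕ → ℝ) (i s : ℕ) : Plane := !₂[r 3 (2 * i + s), r 4 (2 * i + s)]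

theorem eventPoint_storedEnds (r : ℕ → ℕ → ℝ) (e : ℕ) :
    eventPoint (storedEnds r) (fun _ => 1) e = !₂[r 3 e, r 4 e] := by
  rw [eventPoint]
  split_ifs
  · rw [storedEnds, show 2 * (e / 2) + 0 = e by omega]
  · rw [storedEnds, show 2 * (e / 2) + 1 = e by omega]

theorem eventCond_eval (s : State) : eventCond.eval s ↔
    EventLT (storedEnds s.realArr) (fun _ => 1) (s.natVar 20 - 1) (s.natVar 21 - 1) := by
  rw [EventLT, eventPoint_storedEnds, eventPoint_storedEnds]
  simp only [eventCond, BExp.or_eval, BExp.eval, NExp.eval]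
  rw [BExp.lexLt_eval (p := !₂[s.realArr 3 (s.natVar 20 - 1), s.realArr 4 (s.natVar 20 - 1)])
      (q := !₂[s.realArr 3 (s.natVar 21 - 1), s.realArr 4 (s.natVar 21 - 1)])
      (by simp) (by simp) (by simp) (by simp),
    BExp.lexLt_eval (q := !₂[s.realArr 3 (s.natVar 20 - 1), s.realArr 4 (s.natVar 20 - 1)])
      (p := !₂[s.realArr 3 (s.natVar 21 - 1), s.realArr 4 (s.natVar 21 - 1)])
      (by simp) (by simp) (by simp) (by simp), not_lt, not_le]

theorem belowCond_eval (s : State) : belowCond.eval s ↔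
    Below (storedEnds s.realArr) (fun _ => 1) (s.natVar 20 - 1) (s.natVar 21 - 1) := by
  simp only [belowCond, BExp.or_eval, BExp.eval, Below]
  rw [BExp.lexLt_eval (p := storedEnds s.realArr (s.natVar 20 - 1) 0)
      (q := storedEnds s.realArr (s.natVar 21 - 1) 0)
      (by simp [storedEnds, two_mul]) (by simp [storedEnds, two_mul])
      (by simp [storedEnds, two_mul]) (by simp [storedEnds, two_mul]),
    BExp.lexLt_eval (p := storedEnds s.realArr (s.natVar 21 - 1) 0)
      (q := storedEnds s.realArr (s.natVar 20 - 1) 0)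
      (by simp [storedEnds, two_mul]) (by simp [storedEnds, two_mul])
      (by simp [storedEnds, two_mul]) (by simp [storedEnds, two_mul]),
    RExp.orient_eval (a := storedEnds s.realArr (s.natVar 20 - 1) 0)
      (b := storedEnds s.realArr (s.natVar 20 - 1) 1)
      (c := storedEnds s.realArr (s.natVar 21 - 1) 0)
      (by simp [storedEnds, two_mul]) (by simp [storedEnds, two_mul])
      (by simp [storedEnds, two_mul]) (by simp [storedEnds, two_mul])
      (by simp [storedEnds, two_mul]) (by simp [storedEnds, two_mul]),
    RExp.orient_eval (a := storedEnds s.realArr (s.natVar 21 - 1) 0)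
      (b := storedEnds s.realArr (s.natVar 21 - 1) 1)
      (c := storedEnds s.realArr (s.natVar 20 - 1) 0)
      (by simp [storedEnds, two_mul]) (by simp [storedEnds, two_mul])
      (by simp [storedEnds, two_mul]) (by simp [storedEnds, two_mul])
      (by simp [storedEnds, two_mul]) (by simp [storedEnds, two_mul])]
  simp only [RExp.eval, Rat.cast_zero, not_le]

section

variable {σ : ℚ} {k : ℕ} {n : ℕ → ℕ} {V : ℕ → ℕ → Plane} {L N : ℕ → ℕ} {s : State}

theorem Env.eventPoint_eq (h : Env σ k n V L N s) {e : ℕ} (he : e < 2 * k) :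
    eventPoint (storedEnds s.realArr) (fun _ => 1) e = eventPoint (lowerPoint n V L) N e := by
  rw [eventPoint_storedEnds]
  exact plane_ext (h.endX e he) (h.endY e he)

theorem Env.eventLT_iff (h : Env σ k n V L N s) {e f : ℕ} (he : e < 2 * k) (hf : f < 2 * k) :
    EventLT (storedEnds s.realArr) (fun _ => 1) e f ↔ EventLT (lowerPoint n V L) N e f :=
  eventLT_congr (h.eventPoint_eq he) (h.eventPoint_eq hf)

theorem Env.below_iff (h : Env σ k n V L N s) {i j : ℕ} (hi : i < k) (hj : j < k) :
    Below (storedEnds s.realArr) (fun _ => 1) i j ↔ Below (lowerPoint n V L) N i j :=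
  below_congr fun _ he => h.eventPoint_eq (by omega)

end

theorem setEvent_spec : ∃ K, ∀ (σ : ℚ) (k : ℕ) (n : ℕ → ℕ) (V : ℕ → ℕ → Plane) (L N : ℕ → ℕ)
    (s : State) (i : ℕ) (live live' : Set ℕ), Env σ k n V L N s →
    IsTree (2 * k) (EventLT (lowerPoint n V L) N) live (s.natArr 4) → s.natVar 30 = 2 * k →
    s.natVar 28 = i → i < 2 * k → (∀ j < 2 * k, j ≠ i → (j ∈ live' ↔ j ∈ live)) →
    (i ∈ live' → s.natVar 29 = i + 1) → (i ∉ live' → s.natVar 29 = 0) →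
    Within (setLeaf 4 eventCond) (K * (Nat.size (2 * k) + 1)) s
      fun s' => IsTree (2 * k) (EventLT (lowerPoint n V L) N) live' (s'.natArr 4) := by
  obtain ⟨K, hK⟩ := setLeaf_spec 4 eventCond
  refine ⟨K, fun σ k n V L N s i live live' h ht h30 h28 hi hl h₁ h₂ => ?_⟩
  -- `setLeaf_spec` compares the old and the new live set at all indices other than `i`;
  -- intersecting with the valid range makes them agree outside it.
  refine (hK s (2 * k) i (EventLT (storedEnds s.realArr) fun _ => 1) (live ∩ Set.Iio (2 * k))
    (live' ∩ Set.Iio (2 * k)) (fun s' hs' => hs' ▸ eventCond_eval s')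
    (ht.congr (fun e he f hf => h.eventLT_iff he hf) (fun j hj => by simp [hj])) h30 h28 hi
    (fun j hj => ?_) (fun hh => h₁ hh.1) (fun hh => h₂ fun h' => hh ⟨h', hi⟩)).imp
    fun s' _ ht' => ht'.congr (fun e he f hf => (h.eventLT_iff he hf).symm)
      (fun j hj => by simp [hj])
  by_cases hj' : j < 2 * k
  · simp [hj', hl j hj' hj]
  · simp [hj']

theorem setPoly_spec : ∃ K, ∀ (σ : ℚ) (k : ℕ) (n : ℕ → ℕ) (V : ℕ → ℕ → Plane) (L N : ℕ → ℕ)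
    (s : State) (i : ℕ) (live live' : Set ℕ), Env σ k n V L N s →
    IsTree k (Below (lowerPoint n V L) N) live (s.natArr 5) → s.natVar 30 = k →
    s.natVar 28 = i → i < k → (∀ j < k, j ≠ i → (j ∈ live' ↔ j ∈ live)) →
    (i ∈ live' → s.natVar 29 = i + 1) → (i ∉ live' → s.natVar 29 = 0) →
    Within (setLeaf 5 belowCond) (K * (Nat.size k + 1)) s
      fun s' => IsTree k (Below (lowerPoint n V L) N) live' (s'.natArr 5) := by
  obtain ⟨K, hK⟩ := setLeaf_spec 5 belowCond
  refine ⟨K, fun σ k n V L N s i live live' h ht h30 h28 hi hl h₁ h₂ => ?_⟩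
  refine (hK s k i (Below (storedEnds s.realArr) fun _ => 1) (live ∩ Set.Iio k)
    (live' ∩ Set.Iio k) (fun s' hs' => hs' ▸ belowCond_eval s')
    (ht.congr (fun e he f hf => h.below_iff he hf) (fun j hj => by simp [hj])) h30 h28 hi
    (fun j hj => ?_) (fun hh => h₁ hh.1) (fun hh => h₂ fun h' => hh ⟨h', hi⟩)).imp
    fun s' _ ht' => ht'.congr (fun e he f hf => (h.below_iff he hf).symm)
      (fun j hj => by simp [hj])
  by_cases hj' : j < k
  · simp [hj', hl j hj' hj]
  · simp [hj']

/-- The trees after the events in `R`. -/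
structure Trees (k : ℕ) (c : ℕ → ℕ → Plane) (N : ℕ → ℕ) (R : Set ℕ) (s : State) : Prop where
  events : IsTree (2 * k) (EventLT c N) Rᶜ (s.natArr 4)
  polys : IsTree k (Below c N) (active R) (s.natArr 5)

/-- Clears both trees. -/
def clearTrees : Prog :=
  block [.setNat 28 (.const 0),
    .loop (.not (.natLe (.add (.add (.var 0) (.var 0)) (.add (.var 0) (.var 0))) (.var 28)))
      (block [.storeNat 4 (.var 28) (.const 0), .storeNat 5 (.var 28) (.const 0),
        .setNat 28 (.add (.var 28) (.const 1))])]

/-- Inserts all events. -/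
def insertEvents : Prog :=
  block [.setNat 28 (.const 0), .setNat 30 (.add (.var 0) (.var 0)),
    .loop (.not (.natLe (.var 30) (.var 28)))
      (block [.setNat 29 (.add (.var 28) (.const 1)), setLeaf 4 eventCond,
        .setNat 28 (.add (.var 28) (.const 1))])]

theorem isTree_zero (M : ℕ) (B : ℕ → ℕ → Prop) [DecidableRel B] {tr : ℕ → ℕ}
    (h : ∀ i < 2 * M, tr i = 0) : IsTree M B ∅ tr where
  leaf i hi := ⟨False.elim, fun _ => h _ (by omega)⟩
  node q _ hq := by simp [h q (by omega), h (q + q) (by omega), h (q + q + 1) (by omega), pick]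

/-- The initial contents of the memory are arbitrary, so the trees have to be cleared. A tree with
`2 * k` leaves occupies cells below `4 * k`; the same range is more than enough for the tree of
polygons. -/
theorem clearTrees_spec {k : ℕ} {s : State} (h0 : s.natVar 0 = k) :
    Within clearTrees (40 * (4 * k + 1)) s fun s' =>
      (∀ i < 4 * k, s'.natArr 4 i = 0) ∧ ∀ i < 4 * k, s'.natArr 5 i = 0 := by
  have hloop := fun s₁ (hI : s₁.natVar 0 = k) (h1 : s₁.natVar 28 = 0) =>
    Within.loop_of_le (s := s₁)
    (b := .not (.natLe (.add (.add (.var 0) (.var 0)) (.add (.var 0) (.var 0))) (.var 28)))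
    (p := block [.storeNat 4 (.var 28) (.const 0), .storeNat 5 (.var 28) (.const 0),
        .setNat 28 (.add (.var 28) (.const 1))])
    (fun s' => s'.natVar 0 = k ∧ (∀ i < s'.natVar 28, s'.natArr 4 i = 0) ∧
      ∀ i < s'.natVar 28, s'.natArr 5 i = 0)
    (fun s' => 4 * k - s'.natVar 28) 20 ⟨hI, by omega, by omega⟩ (by
      rintro s₂ ⟨hI₂, h₁, h₂⟩ hb
      simp only [BExp.eval, NExp.eval, hI₂, not_le] at hb
      refine (Within.of_vc ?_).mono (by simp [block, time, NExp.cost]) fun s' _ h => h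
      simp [block, vc, hI₂]
      refine ⟨⟨fun i hi => ?_, fun i hi => ?_⟩, by omega⟩
      · rw [Function.update_apply]
        split_ifs
        exacts [rfl, h₁ i (by omega)]
      · rw [Function.update_apply]
        split_ifs
        exacts [rfl, h₂ i (by omega)])
  refine Within.mono (T := 2 + ((BExp.cost (.not (.natLe (.add (.add (.var 0) (.var 0))
    (.add (.var 0) (.var 0))) (.var 28))) + 20) * (4 * k - 0 + 1) + 1)) ?_
    (by simp [BExp.cost, NExp.cost]; omega) fun s' _ h => h
  refine .cons ((Within.of_vc (p := .setNat 28 (.const 0)) (Q := fun s' => s' = s.setNat 28 0)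
    rfl).imp fun s₁ _ e₁ => ?_)
  subst e₁
  have hl := hloop (s.setNat 28 0) (by simp [h0]) (by simp)
  rw [show (s.setNat 28 0).natVar 28 = 0 by simp] at hl
  refine .cons (hl.imp fun s₂ _ ⟨⟨hI₂, h₁, h₂⟩, hb⟩ => .nil ?_)
  simp only [BExp.eval, NExp.eval, hI₂, not_le, not_lt] at hb
  exact ⟨fun i hi => h₁ i (by omega), fun i hi => h₂ i (by omega)⟩

theorem insertEvents_spec : ∃ K, ∀ (σ : ℚ) (k : ℕ) (n : ℕ → ℕ) (V : ℕ → ℕ → Plane) (L N : ℕ → ℕ)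
    (s : State), Env σ k n V L N s → (∀ i < 4 * k, s.natArr 4 i = 0) →
    Within insertEvents (K * ((2 * k + 1) * (Nat.size (2 * k) + 1))) s
      fun s' => IsTree (2 * k) (EventLT (lowerPoint n V L) N) ∅ᶜ (s'.natArr 4) := by
  obtain ⟨K, hK⟩ := setEvent_spec
  refine ⟨K + 30, fun σ k n V L N s h hz => ?_⟩
  set p : Prog := block [.setNat 29 (.add (.var 28) (.const 1)), setLeaf 4 eventCond,
        .setNat 28 (.add (.var 28) (.const 1))] with hp
  have hloop := fun s₁ (hI : Env σ k n V L N s₁) (h1 : s₁.natVar 28 = 0)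
    (h30 : s₁.natVar 30 = 2 * k) (hz : ∀ i < 4 * k, s₁.natArr 4 i = 0) =>
    Within.loop_of_le (s := s₁) (b := .not (.natLe (.var 30) (.var 28))) (p := p)
    (fun s' => Env σ k n V L N s' ∧ s'.natVar 30 = 2 * k ∧
      IsTree (2 * k) (EventLT (lowerPoint n V L) N) {e | e < s'.natVar 28} (s'.natArr 4))
    (fun s' => 2 * k - s'.natVar 28) (4 + (K * (Nat.size (2 * k) + 1) + (4 + 1)))
    ⟨hI, h30, (isTree_zero _ _ (by intro i hi; exact hz i (by omega))).congr (fun _ _ _ _ => Iff.rfl)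
      (by simp [h1])⟩ (by
      rintro s₂ ⟨hI₂, h30, ht⟩ hb
      simp only [BExp.eval, NExp.eval, h30, not_le] at hb
      refine .cons ((Within.of_vc (p := .setNat 29 (.add (.var 28) (.const 1)))
        (Q := fun s' => s' = s₂.setNat 29 (s₂.natVar 28 + 1)) rfl).imp fun s₃ hA₃ e₃ => ?_)
      have hI₃ : Env σ k n V L N s₃ := hI₂.congr (by rw [e₃]; simp) (fun _ _ => by rw [e₃]; rfl)
        (fun _ _ => by rw [e₃]; rfl)
      have t₃ : s₃.natArr 4 = s₂.natArr 4 := by rw [e₃]; rfl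
      refine .cons ((hK σ k n V L N s₃ (s₂.natVar 28) {e | e < s₂.natVar 28}
        {e | e < s₂.natVar 28 + 1} hI₃ (t₃ ▸ ht) (by rw [e₃]; simp [h30]) (by rw [e₃]; simp) hb
        (fun j _ hj => by simp; omega) (fun _ => by rw [e₃]; simp) (fun hh => absurd (by simp) hh)).imp
        fun s₄ hA₄ t₄ => ?_)
      have e28 : s₄.natVar 28 = s₂.natVar 28 := by
        rw [hA₄.natVar 28 (by simp [setLeaf, climb, climbStep, block, natVars]), e₃]; simp
      have e30 : s₄.natVar 30 = 2 * k := by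
        rw [hA₄.natVar 30 (by simp [setLeaf, climb, climbStep, block, natVars]), e₃]; simp [h30]
      have hI₄ : Env σ k n V L N s₄ := hI₃.agree hA₄
        (by simp [setLeaf, climb, climbStep, block, natVars])
        (fun a ha => by simp [setLeaf, climb, climbStep, block, natArrs]; omega)
        (fun a ha => by simp [setLeaf, climb, climbStep, block, realArrs])
      refine .cons ((Within.of_vc (p := .setNat 28 (.add (.var 28) (.const 1)))
        (Q := fun s' => s' = s₄.setNat 28 (s₄.natVar 28 + 1)) rfl).imp fun s₅ hA₅ e₅ => .nil ?_)
      have e28' : s₅.natVar 28 = s₂.natVar 28 + 1 := by rw [e₅]; simp [e28]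
      refine ⟨⟨hI₄.congr (by rw [e₅]; simp) (fun _ _ => by rw [e₅]; rfl)
        (fun _ _ => by rw [e₅]; rfl), by rw [e₅]; simp [e30], ?_⟩, by omega⟩
      rw [e28', e₅]
      exact t₄)
  refine Within.mono (T := 2 + (4 + ((4 + (4 + (K * (Nat.size (2 * k) + 1) + (4 + 1)))) *
    (2 * k - 0 + 1) + 1))) ?_ ?_ fun s' _ h => h
  · refine .cons ((Within.of_vc (p := .setNat 28 (.const 0)) (Q := fun s' => s' = s.setNat 28 0)
      rfl).imp fun s₁ _ e₁ => ?_)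
    refine .cons ((Within.of_vc (p := .setNat 30 (.add (.var 0) (.var 0)))
      (Q := fun s' => s' = s₁.setNat 30 (s₁.natVar 0 + s₁.natVar 0)) rfl).imp fun s₂ _ e₂ => ?_)
    subst e₁
    have hk := h.input.count
    have e28 : s₂.natVar 28 = 0 := by rw [e₂]; simp
    have hl := hloop s₂ (h.congr (by rw [e₂]; simp) (fun _ _ => by rw [e₂]; rfl)
      (fun _ _ => by rw [e₂]; rfl)) e28 (by rw [e₂]; simp [hk]; omega)
      (by rw [e₂]; simpa using hz)
    rw [e28] at hl
    refine .cons (hl.imp fun s₃ _ ⟨⟨hI₃, h30, ht⟩, hb⟩ => .nil ?_)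
    simp only [BExp.eval, NExp.eval, h30, not_le, not_lt] at hb
    exact ht.congr (fun _ _ _ _ => Iff.rfl) (fun i hi => by simp; omega)
  · have h₁ : 1 ≤ (2 * k + 1) * (Nat.size (2 * k) + 1) := Nat.mul_pos (by omega) (by omega)
    have h₂ : 2 * k + 1 ≤ (2 * k + 1) * (Nat.size (2 * k) + 1) :=
      Nat.le_mul_of_pos_right _ (by omega)
    have h₃ : (4 + (4 + (K * (Nat.size (2 * k) + 1) + (4 + 1)))) * (2 * k + 1) =
      13 * (2 * k + 1) + K * ((2 * k + 1) * (Nat.size (2 * k) + 1)) := by ring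
    rw [Nat.sub_zero, h₃, Nat.add_mul K 30]
    omega

/-- Removes the first event, `natVar 10`, and updates the set of active polygons. -/
def nextEvent : Prog :=
  block [.setNat 10 (.sub (.arr 4 (.const 1)) (.const 1)), .setNat 28 (.var 10),
    .setNat 29 (.const 0), .setNat 30 (.add (.var 0) (.var 0)), setLeaf 4 eventCond,
    .setNat 28 (.half (.var 10)), .setNat 30 (.var 0),
    .ite (.natLe (.var 10) (.add (.var 28) (.var 28))) (.setNat 29 (.add (.var 28) (.const 1)))
      (.setNat 29 (.const 0)), setLeaf 5 belowCond]

theorem nextEvent_spec : ∃ K, ∀ (σ : ℚ) (k : ℕ) (n : ℕ → ℕ) (V : ℕ → ℕ → Plane) (L N : ℕ → ℕ)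
    (s : State) (R U e), Env σ k n V L N s → Trees k (lowerPoint n V L) N R s →
    Sweep k (lowerPoint n V L) N R U → s.natArr 4 1 = e + 1 → e < 2 * k → e ∉ R →
    Within nextEvent (K * (Nat.size (2 * k) + 1)) s
      fun s' => s'.natVar 10 = e ∧ Trees k (lowerPoint n V L) N (insert e R) s' := by
  obtain ⟨K, hK⟩ := setEvent_spec
  obtain ⟨K', hK'⟩ := setPoly_spec
  refine ⟨K + K' + 40, fun σ k n V L N s R U e h ht hS hroot he heR => ?_⟩
  refine Within.mono (T := 5 + (2 + (2 + (4 + (K * (Nat.size (2 * k) + 1) +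
    (3 + (2 + (9 + (K' * (Nat.size k + 1) + 1))))))))) ?_ ?_ fun s' _ h => h
  swap
  · have h₁ : K' * (Nat.size k + 1) ≤ K' * (Nat.size (2 * k) + 1) :=
      Nat.mul_le_mul_left _ (Nat.succ_le_succ (Nat.size_le_size (by omega)))
    have h₂ : 40 ≤ 40 * (Nat.size (2 * k) + 1) := by omega
    rw [Nat.add_mul, Nat.add_mul]
    omega
  have hset : ∀ (x : ℕ) (E : NExp) (s : State),
      Within (.setNat x E) (E.cost + 1) s fun s' => s' = s.setNat x (E.eval s) :=
    fun x E s => Within.of_vc (p := .setNat x E) rfl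
  refine .cons ((hset _ _ _).imp fun s₁ _ e₁ => .cons ((hset _ _ _).imp fun s₂ _ e₂ =>
    .cons ((hset _ _ _).imp fun s₃ _ e₃ => .cons ((hset _ _ _).imp fun s₄ _ e₄ => ?_))))
  have h10 : s₄.natVar 10 = e := by rw [e₄, e₃, e₂, e₁]; simp [hroot]
  have h28 : s₄.natVar 28 = e := by rw [e₄, e₃, e₂, e₁]; simp [hroot]
  have h29 : s₄.natVar 29 = 0 := by rw [e₄, e₃, e₂, e₁]; simp
  have h30 : s₄.natVar 30 = 2 * k := by
    rw [e₄, e₃, e₂, e₁]; simp [h.input.count]; omega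
  have ha₄ : s₄.natArr = s.natArr := by rw [e₄, e₃, e₂, e₁]; rfl
  have hI₄ : Env σ k n V L N s₄ := h.congr (by rw [e₄, e₃, e₂, e₁]; simp)
    (fun _ _ => by rw [ha₄]) (fun _ _ => by rw [e₄, e₃, e₂, e₁]; rfl)
  refine .cons ((hK σ k n V L N s₄ e Rᶜ (insert e R)ᶜ hI₄ (by rw [ha₄]; exact ht.events) h30 h28 he
    (fun j _ hj => by simp [hj]) (fun hh => absurd (Set.mem_insert e R) hh) (fun _ => h29)).imp
    fun s₅ hA₅ t₅ => ?_)
  have hI₅ : Env σ k n V L N s₅ := hI₄.agree hA₅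
    (by simp [setLeaf, climb, climbStep, block, natVars])
    (fun a ha => by simp [setLeaf, climb, climbStep, block, natArrs]; omega)
    (fun a ha => by simp [setLeaf, climb, climbStep, block, realArrs])
  have h10' : s₅.natVar 10 = e := by
    rw [hA₅.natVar 10 (by simp [setLeaf, climb, climbStep, block, natVars]), h10]
  have ha₅ : s₅.natArr 5 = s.natArr 5 := by
    rw [hA₅.natArr 5 (by simp [setLeaf, climb, climbStep, block, natArrs]), ha₄]
  refine .cons ((hset _ _ _).imp fun s₆ _ e₆ => .cons ((hset _ _ _).imp fun s₇ _ e₇ => .cons ?_))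
  have a10 : s₇.natVar 10 = e := by rw [e₇, e₆]; simp [h10']
  have a28 : s₇.natVar 28 = e / 2 := by rw [e₇, e₆]; simp [h10']
  have a30 : s₇.natVar 30 = k := by rw [e₇, e₆]; simp [hI₅.input.count]
  have aarr : s₇.natArr = s₅.natArr := by rw [e₇, e₆]; rfl
  have hI₇ : Env σ k n V L N s₇ := hI₅.congr (by rw [e₇, e₆]; simp)
    (fun _ _ => by rw [aarr]) (fun _ _ => by rw [e₇, e₆]; rfl)
  have hite : Within (.ite (.natLe (.var 10) (.add (.var 28) (.var 28)))
      (.setNat 29 (.add (.var 28) (.const 1))) (.setNat 29 (.const 0))) 9 s₇ fun s' =>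
      s' = s₇.setNat 29 (if e % 2 = 0 then e / 2 + 1 else 0) := by
    refine (Within.of_vc ?_).mono (by simp [time, BExp.cost, NExp.cost]) fun s' _ h => h
    simp only [vc, BExp.eval, NExp.eval, a10, a28]
    exact ⟨fun hle => by rw [if_pos (by omega)], fun hle => by rw [if_neg (by omega)]⟩
  refine hite.imp fun s₈ _ e₈ => ?_
  have hI₈ : Env σ k n V L N s₈ := hI₇.congr (by rw [e₈]; simp) (fun _ _ => by rw [e₈]; rfl)
    (fun _ _ => by rw [e₈]; rfl)
  -- A left end activates its polygon and a right end deactivates it. At a left end the right one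
  -- cannot have happened yet, as `R` is closed under earlier events.
  have hact : e / 2 ∈ active (insert e R) ↔ e % 2 = 0 := by
    constructor
    · intro hh
      by_contra hne
      exact hh.2 (Or.inl (by omega))
    · intro hh
      refine ⟨Or.inl (by omega), ?_⟩
      rintro (h' | h')
      · omega
      · refine heR ?_
        have := hS.down _ h' (2 * (e / 2)) (by omega) (h.scene.eventLT_pair (by omega))
        rwa [show 2 * (e / 2) = e by omega] at this
  refine .cons ((hK' σ k n V L N s₈ (e / 2) (active R) (active (insert e R)) hI₈
    (by rw [e₈]; simp only [setNat_natArr, aarr, ha₅]; exact ht.polys) (by rw [e₈]; simp [a30])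
    (by rw [e₈]; simp [a28]) (by omega) (fun j _ hj => ?_) (fun hh => ?_) (fun hh => ?_)).imp
    fun s₉ hA₉ t₉ => .nil ⟨?_, ?_, t₉⟩)
  · have n₁ : 2 * j ≠ e := by omega
    have n₂ : 2 * j + 1 ≠ e := by omega
    simp [active, n₁, n₂]
  · rw [hact] at hh; rw [e₈]; simp [hh]
  · rw [hact] at hh; rw [e₈]; simp [hh]
  · rw [hA₉.natVar 10 (by simp [setLeaf, climb, climbStep, block, natVars]), e₈]; simp [a10]
  · rw [hA₉.natArr 4 (by simp [setLeaf, climb, climbStep, block, natArrs]), e₈]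
    simp only [setNat_natArr, aarr]
    exact t₅

end RealRAM


/-! ## Computing bridges -/

namespace RealRAM

open Prog

/-- The point whose coordinates are in the real variables `2 * i + 1` and `2 * i + 2`. -/
def State.point (s : State) (i : ℕ) : Plane := !₂[s.realVar (2 * i + 1), s.realVar (2 * i + 2)]

/-- Writes the coordinates of a point to the real variables `2 * i + 1` and `2 * i + 2`. -/
noncomputable def State.setPoint (s : State) (i : ℕ) (p : Plane) : State :=
  (s.setReal (2 * i + 1) (p 0)).setReal (2 * i + 2) (p 1)

section

variable (s : State) (i : ℕ) (p : Plane)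

@[simp] theorem setPoint_natVar : (s.setPoint i p).natVar = s.natVar := rfl

@[simp] theorem setPoint_natArr : (s.setPoint i p).natArr = s.natArr := rfl

@[simp] theorem setPoint_realArr : (s.setPoint i p).realArr = s.realArr := rfl

@[simp] theorem setPoint_point (j : ℕ) :
    (s.setPoint i p).point j = if j = i then p else s.point j := by
  unfold State.point State.setPoint
  by_cases h : j = i
  · subst h
    refine plane_ext ?_ ?_ <;> simp
  · refine plane_ext ?_ ?_ <;>
      simp [h, show 2 * j ≠ 2 * i + 1 by omega, show 2 * j + 1 ≠ 2 * i by omega]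

theorem setPoint_realVar {x : ℕ} (h : 2 * i + 2 < x) :
    (s.setPoint i p).realVar x = s.realVar x := by
  have h₁ : x ≠ 2 * i + 1 := by omega
  have h₂ : x ≠ 2 * i + 2 := by omega
  simp [State.setPoint, h₁, h₂]

theorem setNat_point (x c : ℕ) : (s.setNat x c).point = s.point := rfl

theorem setNat_setNat (x a b : ℕ) : (s.setNat x a).setNat x b = s.setNat x b := by
  simp [State.setNat]

end

/-- Orientation of three points that are stored in variables. -/
def orientVars (i j l : ℕ) : RExp :=
  .orient (.var (2 * i + 1)) (.var (2 * i + 2)) (.var (2 * j + 1)) (.var (2 * j + 2))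
    (.var (2 * l + 1)) (.var (2 * l + 2))

theorem orientVars_eval (s : State) (i j l : ℕ) :
    (orientVars i j l).eval s = orient (s.point i) (s.point j) (s.point l) :=
  RExp.orient_eval (by simp [State.point]) (by simp [State.point]) (by simp [State.point])
    (by simp [State.point]) (by simp [State.point]) (by simp [State.point])

/-- The lines through the points `0`, `1` and through the points `2`, `3` are compared over
`realVar 9`. -/
def lineCond : BExp :=
  .realLe (.mul (.add (.mul (.var 2) (.sub (.var 3) (.var 1)))
      (.mul (.sub (.var 4) (.var 2)) (.sub (.var 9) (.var 1)))) (.sub (.var 7) (.var 5)))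
    (.mul (.add (.mul (.var 6) (.sub (.var 7) (.var 5)))
      (.mul (.sub (.var 8) (.var 6)) (.sub (.var 9) (.var 5)))) (.sub (.var 3) (.var 1)))

theorem lineCond_eval (s : State) : lineCond.eval s ↔
    LineLE (s.point 0) (s.point 1) (s.point 2) (s.point 3) (s.realVar 9) := by
  simp [lineCond, LineLE, State.point]

/-- Reads vertex number `natVar 7` of polygon `natVar t` as point `i`. -/
def loadPoint (σ : ℚ) (t i : ℕ) : Prog :=
  block [.setNat 7 (.add (.arr 1 (.var t)) (.var 7)),
    .setReal (2 * i + 1) (.mul (.const σ) (.arr 0 (.var 7))),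
    .setReal (2 * i + 2) (.mul (.const σ) (.arr 1 (.var 7)))]

/-- Reads position `j` of the lower side of polygon `natVar t` as point `i`. -/
def readChain (σ : ℚ) (t : ℕ) (j : NExp) (i : ℕ) : Prog :=
  block [.setNat 7 (.add (.arr 2 (.var t)) j),
    .ite (.natLe (.arr 0 (.var t)) (.var 7)) (.setNat 7 (.sub (.var 7) (.arr 0 (.var t)))) .skip,
    loadPoint σ t i]

section

variable {σ : ℚ} {k : ℕ} {n : ℕ → ℕ} {V : ℕ → ℕ → Plane} {L N : ℕ → ℕ} {s : State}

/-- The sum of the start and the position is below twice the number of vertices, so one conditional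
subtraction replaces the remainder that defines `chainPoint`. -/
theorem readChain_vc (h : Env σ k n V L N s) {t : ℕ} {j : NExp} {i : ℕ} (h7 : t ≠ 7)
    (ht : s.natVar t < k) (hj : j.eval s ≤ N (s.natVar t)) {Q : State → Prop}
    (hQ : ∀ a, Q ((s.setNat 7 a).setPoint i (lowerPoint n V L (s.natVar t) (j.eval s)))) :
    (readChain σ t j i).vc Q s := by
  have hc := h.scene.chain _ ht
  have hL := hc.left_lt
  have hN := hc.length_lt
  have e : lowerPoint n V L (s.natVar t) (j.eval s) =
      V (s.natVar t) (if L (s.natVar t) + j.eval s < n (s.natVar t) then L (s.natVar t) + j.eval s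
        else L (s.natVar t) + j.eval s - n (s.natVar t)) := by
    rw [lowerPoint, chainPoint, add_mod_eq hL (by omega)]
  have final : ∀ b, b < n (s.natVar t) →
      lowerPoint n V L (s.natVar t) (j.eval s) = V (s.natVar t) b →
      (loadPoint σ t i).vc Q (s.setNat 7 b) := by
    intro b hbn hV
    simp only [loadPoint, block, vc, NExp.eval, RExp.eval, setNat_setNat, setNat_natVar,
      setNat_natArr, if_neg h7, setNat_realArr, if_true, setReal_natVar, setReal_realArr,
      h.input.xCoord _ ht _ hbn, h.input.yCoord _ ht _ hbn]
    rw [← hV]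
    exact hQ _
  simp only [readChain, block, vc, NExp.eval, BExp.eval, setNat_natVar, if_neg h7, if_true,
    setNat_natArr, h.left _ ht, h.input.size _ ht]
  constructor
  · intro hle
    rw [setNat_setNat]
    exact final _ (by omega) (by rw [e, if_neg (by omega)])
  · intro hle
    exact final _ (by omega) (by rw [e, if_pos (by omega)])

end

/-- One step of the search for a bridge, both of whose ends are unknown. -/
def bridgeBoth (σ : ℚ) : Prog :=
  block [readChain σ 17 (.var 24) 0, readChain σ 17 (.add (.var 24) (.const 1)) 1,
    readChain σ 12 (.var 25) 2, readChain σ 12 (.add (.var 25) (.const 1)) 3,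
    .ite (.or (.realLe (orientVars 0 1 2) (.const 0)) (.realLe (orientVars 0 1 3) (.const 0)))
      (.setNat 19 (.var 24))
      (.ite (.or (.realLe (orientVars 2 3 0) (.const 0)) (.realLe (orientVars 2 3 1) (.const 0)))
        (.setNat 22 (.add (.var 25) (.const 1)))
        (.ite lineCond (.setNat 18 (.add (.var 24) (.const 1))) (.setNat 23 (.var 25))))]

/-- One step of the search for a bridge whose right end is known. -/
def bridgeLeft (σ : ℚ) : Prog :=
  block [readChain σ 17 (.var 24) 0, readChain σ 17 (.add (.var 24) (.const 1)) 1,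
    readChain σ 12 (.var 22) 2,
    .ite (.realLe (orientVars 0 1 2) (.const 0)) (.setNat 19 (.var 24))
      (.setNat 18 (.add (.var 24) (.const 1)))]

/-- One step of the search for a bridge whose left end is known. -/
def bridgeRight (σ : ℚ) : Prog :=
  block [readChain σ 17 (.var 18) 0, readChain σ 12 (.var 25) 2,
    readChain σ 12 (.add (.var 25) (.const 1)) 3,
    .ite (.realLe (orientVars 2 3 0) (.const 0)) (.setNat 22 (.add (.var 25) (.const 1)))
      (.setNat 23 (.var 25))]

/-- One step of the search for a bridge. -/
def bridgeStep (σ : ℚ) : Prog :=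
  block [.setNat 24 (.half (.add (.var 18) (.var 19))),
    .setNat 25 (.half (.add (.var 22) (.var 23))),
    .ite (.not (.natLe (.var 19) (.var 18)))
      (.ite (.not (.natLe (.var 23) (.var 22))) (bridgeBoth σ) (bridgeLeft σ)) (bridgeRight σ)]

/-- Some end of the bridge is not known. -/
def bridgeCond : BExp :=
  .or (.not (.natLe (.var 19) (.var 18))) (.not (.natLe (.var 23) (.var 22)))

/-- Search for the bridge from positions `natVar 18, …, natVar 19` of polygon `natVar 17` to positions
`natVar 22, …, natVar 23` of polygon `natVar 12`. -/
def bridgeSearch (σ : ℚ) : Prog := .loop bridgeCond (bridgeStep σ)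

theorem bridgeStep_frame {σ : ℚ} {s s' : State} (h : Agree (bridgeStep σ) s s') :
    s'.natArr = s.natArr ∧ s'.realArr = s.realArr ∧
      (∀ x, x ∉ [7, 18, 19, 22, 23, 24, 25] → s'.natVar x = s.natVar x) ∧
      ∀ x, 8 < x → s'.realVar x = s.realVar x := by
  refine ⟨funext fun a => h.natArr a ?_, funext fun a => h.realArr a ?_,
    fun x hx => h.natVar x ?_, fun x hx => h.realVar x ?_⟩
  · simp [bridgeStep, bridgeBoth, bridgeLeft, bridgeRight, readChain, loadPoint, block, natArrs]
  · simp [bridgeStep, bridgeBoth, bridgeLeft, bridgeRight, readChain, loadPoint, block, realArrs]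
  · simp [bridgeStep, bridgeBoth, bridgeLeft, bridgeRight, readChain, loadPoint, block, natVars] at hx ⊢
    tauto
  · simp [bridgeStep, bridgeBoth, bridgeLeft, bridgeRight, readChain, loadPoint, block, realVars]
    omega

/-- The state of the search for a bridge. -/
def BridgeState (p : ℕ → Plane) (lo hi : ℕ) (q : ℕ → Plane) (lo' hi' : ℕ) (s : State) : Prop :=
  BridgeRange p lo hi q lo' hi' (s.natVar 18) (s.natVar 19) (s.natVar 22) (s.natVar 23)

/-- The effort left in the search for a bridge. -/
def bridgeEffort (s : State) : ℕ :=
  Nat.size (s.natVar 19 - s.natVar 18) + Nat.size (s.natVar 23 - s.natVar 22)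

section

variable {σ : ℚ} {k : ℕ} {n : ℕ → ℕ} {V : ℕ → ℕ → Plane} {L N : ℕ → ℕ} {s : State}
  (h : Env σ k n V L N s) {t t' lo hi lo' hi' : ℕ} (ht : t < k) (ht' : t' < k)
  (h17 : s.natVar 17 = t) (h12 : s.natVar 12 = t') (hhi : hi ≤ N t) (hhi' : hi' ≤ N t')
  (hlt : key (lowerPoint n V L t hi) < key (lowerPoint n V L t' lo'))
  (hB : BridgeState (lowerPoint n V L t) lo hi (lowerPoint n V L t') lo' hi' s)

include h ht ht' h17 h12 hhi hhi' hlt hB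

theorem bridgeBoth_spec (h9 : s.realVar 9 = lowerPoint n V L t' lo' 0)
    (hlt₁ : s.natVar 18 < s.natVar 19) (hlt₂ : s.natVar 22 < s.natVar 23)
    (h24 : s.natVar 24 = (s.natVar 18 + s.natVar 19) / 2)
    (h25 : s.natVar 25 = (s.natVar 22 + s.natVar 23) / 2) :
    Within (bridgeBoth σ) (bridgeBoth σ).time s fun s' =>
      BridgeState (lowerPoint n V L t) lo hi (lowerPoint n V L t') lo' hi' s' ∧
      bridgeEffort s' < bridgeEffort s := by
  refine Within.of_vc ?_
  have hp : IsArc (lowerPoint n V L t) lo hi := (h.scene.isArc t ht).mono (Nat.zero_le _) hhi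
  have hq : IsArc (lowerPoint n V L t') lo' hi' := (h.scene.isArc t' ht').mono (Nat.zero_le _) hhi'
  generalize hcp : lowerPoint n V L t = p at *
  generalize hcq : lowerPoint n V L t' = q at *
  have b₁ := hB.lo_le
  have b₂ := hB.le_hi
  have b₃ := hB.lo_le'
  have b₄ := hB.le_hi'
  generalize hm₁ : s.natVar 24 = m₁ at *
  generalize hm₂ : s.natVar 25 = m₂ at *
  simp only [bridgeBoth, block, vc]
  have envc : ∀ s' : State, s'.natVar 0 = s.natVar 0 → s'.natArr = s.natArr →
      s'.realArr = s.realArr → Env σ k n V L N s' := fun s' e₁ e₂ e₃ =>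
    h.congr e₁ (fun _ _ => by rw [e₂]) (fun _ _ => by rw [e₃])
  refine readChain_vc h (by omega) (by omega) (by simp only [NExp.eval, hm₁, h17]; omega) fun a₁ => ?_
  refine readChain_vc (envc _ (by simp) (by simp) (by simp)) (by omega) (by simp; omega)
    (by simp [hm₁, h17]; omega) fun a₂ => ?_
  refine readChain_vc (envc _ (by simp) (by simp) (by simp)) (by omega) (by simp; omega)
    (by simp [hm₂, h12]; omega) fun a₃ => ?_
  refine readChain_vc (envc _ (by simp) (by simp) (by simp)) (by omega) (by simp; omega)
    (by simp [hm₂, h12]; omega) fun a₄ => ?_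
  simp only [NExp.eval, setPoint_natVar, setNat_natVar, h17, h12, hm₁, hm₂, hcp, hcq,
    Nat.reduceEqDiff, reduceIte]
  generalize hs' : ((((((((s.setNat 7 a₁).setPoint 0 (p m₁)).setNat 7 a₂).setPoint 1
    (p (m₁ + 1))).setNat 7 a₃).setPoint 2 (q m₂)).setNat 7 a₄).setPoint 3 (q (m₂ + 1))) = s'
  have nv : ∀ x, x ≠ 7 → s'.natVar x = s.natVar x := fun x hx => by
    rw [← hs']; simp [hx]
  have r9 : s'.realVar 9 = q lo' 0 := by
    rw [← hs', setPoint_realVar _ _ _ (by omega), setNat_realVar,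
      setPoint_realVar _ _ _ (by omega), setNat_realVar, setPoint_realVar _ _ _ (by omega),
      setNat_realVar, setPoint_realVar _ _ _ (by omega), setNat_realVar, h9]
  have p0 : s'.point 0 = p m₁ := by rw [← hs']; simp [setNat_point]
  have p1 : s'.point 1 = p (m₁ + 1) := by rw [← hs']; simp [setNat_point]
  have p2 : s'.point 2 = q m₂ := by rw [← hs']; simp [setNat_point]
  have p3 : s'.point 3 = q (m₂ + 1) := by rw [← hs']; simp
  simp only [BExp.or_eval, BExp.eval, orientVars_eval, lineCond_eval, p0, p1, p2, p3, r9, RExp.eval,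
    Rat.cast_zero]
  have hsz₁ := Nat.size_lt_size_of_le_half (a := m₁ - s.natVar 18) (b := s.natVar 19 - s.natVar 18)
    (by omega) (by omega)
  have hsz₂ := Nat.size_lt_size_of_le_half (a := s.natVar 19 - (m₁ + 1))
    (b := s.natVar 19 - s.natVar 18) (by omega) (by omega)
  have hsz₃ := Nat.size_lt_size_of_le_half (a := m₂ - s.natVar 22) (b := s.natVar 23 - s.natVar 22)
    (by omega) (by omega)
  have hsz₄ := Nat.size_lt_size_of_le_half (a := s.natVar 23 - (m₂ + 1))
    (b := s.natVar 23 - s.natVar 22) (by omega) (by omega)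
  have hpq : ∀ a ≤ hi, lo ≤ a → ∀ b ≥ lo', b ≤ hi' → key (p a) < key (q b) :=
    fun a ha ha' b hb hb' => (hp.le ha' ha le_rfl).trans_lt (hlt.trans_le (hq.le le_rfl hb hb'))
  unfold BridgeState at hB ⊢
  unfold bridgeEffort
  -- If an end of one middle edge is not strictly above the line of the other, it serves as witness
  -- for discarding a part. If both edges are strictly above each other's line, comparing the lines
  -- over the first point of the right arc, which separates the arcs, tells which part can go.
  refine ⟨fun c₁ => ?_, fun c₁ => ⟨fun c₂ => ?_, fun c₂ => ⟨fun c₃ => ?_, fun c₃ => ?_⟩⟩⟩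
  · simp [nv]
    refine ⟨hB.set_right (by omega) (by omega) ?_, hsz₁⟩
    rcases c₁ with c₁ | c₁
    · exact ⟨m₂, by omega, by omega, c₁⟩
    · exact ⟨m₂ + 1, by omega, by omega, c₁⟩
  · simp [nv]
    refine ⟨hB.set_left' (by omega) (by omega) ?_, hsz₄⟩
    rcases c₂ with c₂ | c₂
    · exact ⟨m₁, by omega, by omega, c₂⟩
    · exact ⟨m₁ + 1, by omega, by omega, c₂⟩
  · simp [nv]
    simp only [not_or, not_le] at c₁ c₂
    refine ⟨hB.set_left (by omega) (by omega) fun b hb hb' => ?_, hsz₂⟩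
    -- The ends of the middle edge lie on its line, not strictly above it; for them the claim is
    -- `c₁`.
    by_cases hb₁ : b = m₂
    · rw [hb₁]; exact c₁.1
    by_cases hb₂ : b = m₂ + 1
    · rw [hb₂]; exact c₁.2
    exact orient_pos_of_lineLE (hp.lt (by omega) (by omega) (by omega))
      (hpq _ (by omega) (by omega) _ (by omega) (by omega))
      (hq.lt (by omega) (by omega) (by omega)) c₁.1 c₂.2 c₃
      (fst_le_of_key_le (hq.le le_rfl (by omega) (by omega)))
      (hq.orient_edge (by omega) (by omega) (by omega) (by omega) hb₁ hb₂)
  · simp [nv]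
    simp only [not_or, not_le] at c₁ c₂
    refine ⟨hB.set_right' (by omega) (by omega) fun a ha ha' => ?_, hsz₃⟩
    exact orient_pos_of_not_lineLE (hp.lt (by omega) (by omega) (by omega))
      (hpq _ (by omega) (by omega) _ (by omega) (by omega))
      (hq.lt (by omega) (by omega) (by omega)) c₁.1 c₂.2 c₃
      (fst_le_of_key_le (hpq _ (by omega) (by omega) _ le_rfl (by omega)).le)
      (hp.orient_edge_nonneg (by omega) (by omega) (by omega) (by omega))

omit hlt in
theorem bridgeLeft_spec (hlt₁ : s.natVar 18 < s.natVar 19) (heq₂ : s.natVar 22 = s.natVar 23)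
    (h24 : s.natVar 24 = (s.natVar 18 + s.natVar 19) / 2) :
    Within (bridgeLeft σ) (bridgeLeft σ).time s fun s' =>
      BridgeState (lowerPoint n V L t) lo hi (lowerPoint n V L t') lo' hi' s' ∧
      bridgeEffort s' < bridgeEffort s := by
  refine Within.of_vc ?_
  generalize hcp : lowerPoint n V L t = p at *
  generalize hcq : lowerPoint n V L t' = q at *
  have b₁ := hB.lo_le
  have b₂ := hB.le_hi
  have b₃ := hB.lo_le'
  have b₄ := hB.le_hi'
  generalize hm₁ : s.natVar 24 = m₁ at *
  simp only [bridgeLeft, block, vc]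
  have envc : ∀ s' : State, s'.natVar 0 = s.natVar 0 → s'.natArr = s.natArr →
      s'.realArr = s.realArr → Env σ k n V L N s' := fun s' e₁ e₂ e₃ =>
    h.congr e₁ (fun _ _ => by rw [e₂]) (fun _ _ => by rw [e₃])
  refine readChain_vc h (by omega) (by omega) (by simp only [NExp.eval, hm₁, h17]; omega) fun a₁ => ?_
  refine readChain_vc (envc _ (by simp) (by simp) (by simp)) (by omega) (by simp; omega)
    (by simp [hm₁, h17]; omega) fun a₂ => ?_
  refine readChain_vc (envc _ (by simp) (by simp) (by simp)) (by omega) (by simp; omega)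
    (by simp [h12]; omega) fun a₃ => ?_
  simp only [NExp.eval, setPoint_natVar, setNat_natVar, h17, h12, hm₁, hcp, hcq,
    Nat.reduceEqDiff, reduceIte]
  generalize hs' : (((((s.setNat 7 a₁).setPoint 0 (p m₁)).setNat 7 a₂).setPoint 1
    (p (m₁ + 1))).setNat 7 a₃).setPoint 2 (q (s.natVar 22)) = s'
  have nv : ∀ x, x ≠ 7 → s'.natVar x = s.natVar x := fun x hx => by
    rw [← hs']; simp [hx]
  have p0 : s'.point 0 = p m₁ := by rw [← hs']; simp [setNat_point]
  have p1 : s'.point 1 = p (m₁ + 1) := by rw [← hs']; simp [setNat_point]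
  have p2 : s'.point 2 = q (s.natVar 22) := by rw [← hs']; simp
  simp only [BExp.eval, orientVars_eval, p0, p1, p2, RExp.eval, Rat.cast_zero]
  have hsz₁ := Nat.size_lt_size_of_le_half (a := m₁ - s.natVar 18) (b := s.natVar 19 - s.natVar 18)
    (by omega) (by omega)
  have hsz₂ := Nat.size_lt_size_of_le_half (a := s.natVar 19 - (m₁ + 1))
    (b := s.natVar 19 - s.natVar 18) (by omega) (by omega)
  unfold BridgeState at hB ⊢
  unfold bridgeEffort
  refine ⟨fun c₁ => ?_, fun c₁ => ?_⟩
  · simp [nv]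
    exact ⟨hB.set_right (by omega) (by omega) ⟨_, by omega, by omega, c₁⟩, hsz₁⟩
  · simp [nv]
    refine ⟨hB.set_left (by omega) (by omega) fun b hb hb' => ?_, hsz₂⟩
    obtain rfl : b = s.natVar 22 := by omega
    exact not_le.1 c₁

omit hlt in
theorem bridgeRight_spec (heq₁ : s.natVar 18 = s.natVar 19) (hlt₂ : s.natVar 22 < s.natVar 23)
    (h25 : s.natVar 25 = (s.natVar 22 + s.natVar 23) / 2) :
    Within (bridgeRight σ) (bridgeRight σ).time s fun s' =>
      BridgeState (lowerPoint n V L t) lo hi (lowerPoint n V L t') lo' hi' s' ∧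
      bridgeEffort s' < bridgeEffort s := by
  refine Within.of_vc ?_
  generalize hcp : lowerPoint n V L t = p at *
  generalize hcq : lowerPoint n V L t' = q at *
  have b₁ := hB.lo_le
  have b₂ := hB.le_hi
  have b₃ := hB.lo_le'
  have b₄ := hB.le_hi'
  generalize hm₂ : s.natVar 25 = m₂ at *
  simp only [bridgeRight, block, vc]
  have envc : ∀ s' : State, s'.natVar 0 = s.natVar 0 → s'.natArr = s.natArr →
      s'.realArr = s.realArr → Env σ k n V L N s' := fun s' e₁ e₂ e₃ =>
    h.congr e₁ (fun _ _ => by rw [e₂]) (fun _ _ => by rw [e₃])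
  refine readChain_vc h (by omega) (by omega) (by simp only [NExp.eval, h17]; omega) fun a₁ => ?_
  refine readChain_vc (envc _ (by simp) (by simp) (by simp)) (by omega) (by simp; omega)
    (by simp [hm₂, h12]; omega) fun a₂ => ?_
  refine readChain_vc (envc _ (by simp) (by simp) (by simp)) (by omega) (by simp; omega)
    (by simp [hm₂, h12]; omega) fun a₃ => ?_
  simp only [NExp.eval, setPoint_natVar, setNat_natVar, h17, h12, hm₂, hcp, hcq,
    Nat.reduceEqDiff, reduceIte]
  generalize hs' : (((((s.setNat 7 a₁).setPoint 0 (p (s.natVar 18))).setNat 7 a₂).setPoint 2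
    (q m₂)).setNat 7 a₃).setPoint 3 (q (m₂ + 1)) = s'
  have nv : ∀ x, x ≠ 7 → s'.natVar x = s.natVar x := fun x hx => by
    rw [← hs']; simp [hx]
  have p0 : s'.point 0 = p (s.natVar 18) := by rw [← hs']; simp [setNat_point]
  have p2 : s'.point 2 = q m₂ := by rw [← hs']; simp [setNat_point]
  have p3 : s'.point 3 = q (m₂ + 1) := by rw [← hs']; simp
  simp only [BExp.eval, orientVars_eval, p0, p2, p3, RExp.eval, Rat.cast_zero]
  have hsz₃ := Nat.size_lt_size_of_le_half (a := m₂ - s.natVar 22) (b := s.natVar 23 - s.natVar 22)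
    (by omega) (by omega)
  have hsz₄ := Nat.size_lt_size_of_le_half (a := s.natVar 23 - (m₂ + 1))
    (b := s.natVar 23 - s.natVar 22) (by omega) (by omega)
  unfold BridgeState at hB ⊢
  unfold bridgeEffort
  refine ⟨fun c₁ => ?_, fun c₁ => ?_⟩
  · simp [nv]
    exact ⟨hB.set_left' (by omega) (by omega) ⟨_, by omega, by omega, c₁⟩, hsz₄⟩
  · simp [nv]
    refine ⟨hB.set_right' (by omega) (by omega) fun a ha ha' => ?_, hsz₃⟩
    obtain rfl : a = s.natVar 18 := by omega
    exact not_le.1 c₁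

theorem bridgeStep_spec (h9 : s.realVar 9 = lowerPoint n V L t' lo' 0) (hc : bridgeCond.eval s) :
    Within (bridgeStep σ)
      (20 + (bridgeBoth σ).time + (bridgeLeft σ).time + (bridgeRight σ).time) s fun s' =>
      BridgeState (lowerPoint n V L t) lo hi (lowerPoint n V L t') lo' hi' s' ∧
      bridgeEffort s' < bridgeEffort s := by
  have b₁ := hB.l_le
  have b₂ := hB.l_le'
  simp only [bridgeCond, BExp.or_eval, BExp.eval, NExp.eval, not_le] at hc
  refine Within.mono (T := 5 + (5 + ((4 + (4 + ((bridgeBoth σ).time + (bridgeLeft σ).time +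
    (bridgeRight σ).time))) + 1))) ?_ (by omega) fun s' _ h => h
  refine .cons ((Within.of_vc (p := .setNat 24 (.half (.add (.var 18) (.var 19))))
    (Q := fun s' => s' = s.setNat 24 ((s.natVar 18 + s.natVar 19) / 2)) rfl).imp fun s₁ _ e₁ => ?_)
  refine .cons ((Within.of_vc (p := .setNat 25 (.half (.add (.var 22) (.var 23))))
    (Q := fun s' => s' = s₁.setNat 25 ((s₁.natVar 22 + s₁.natVar 23) / 2)) rfl).imp
    fun s₂ _ e₂ => ?_)
  have nv : ∀ x, x ≠ 24 → x ≠ 25 → s₂.natVar x = s.natVar x := fun x hx hx' => by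
    rw [e₂, e₁]; simp [hx, hx']
  have e24 : s₂.natVar 24 = (s.natVar 18 + s.natVar 19) / 2 := by rw [e₂, e₁]; simp
  have e25 : s₂.natVar 25 = (s.natVar 22 + s.natVar 23) / 2 := by rw [e₂, e₁]; simp
  have h' : Env σ k n V L N s₂ := h.congr (nv 0 (by omega) (by omega))
    (fun _ _ => by rw [e₂, e₁]; rfl) (fun _ _ => by rw [e₂, e₁]; rfl)
  have hB' : BridgeState (lowerPoint n V L t) lo hi (lowerPoint n V L t') lo' hi' s₂ := by
    unfold BridgeState
    rw [nv 18 (by omega) (by omega), nv 19 (by omega) (by omega), nv 22 (by omega) (by omega),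
      nv 23 (by omega) (by omega)]
    exact hB
  have heff : bridgeEffort s₂ = bridgeEffort s := by
    unfold bridgeEffort
    rw [nv 18 (by omega) (by omega), nv 19 (by omega) (by omega), nv 22 (by omega) (by omega),
      nv 23 (by omega) (by omega)]
  rw [← heff]
  have f18 := nv 18 (by omega) (by omega)
  have f19 := nv 19 (by omega) (by omega)
  have f22 := nv 22 (by omega) (by omega)
  have f23 := nv 23 (by omega) (by omega)
  have f17 : s₂.natVar 17 = t := (nv 17 (by omega) (by omega)).trans h17
  have f12 : s₂.natVar 12 = t' := (nv 12 (by omega) (by omega)).trans h12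
  refine .cons (Within.imp (Q := fun s' =>
      BridgeState (lowerPoint n V L t) lo hi (lowerPoint n V L t') lo' hi' s' ∧
      bridgeEffort s' < bridgeEffort s₂) ?_ fun s' _ h => .nil h)
  refine Within.ite (b := .not (.natLe (.var 19) (.var 18))) (fun c₁ => ?_) fun c₁ => ?_
  · simp only [BExp.eval, NExp.eval, not_le] at c₁
    refine Within.ite (b := .not (.natLe (.var 23) (.var 22))) (fun c₂ => ?_) fun c₂ => ?_
    · simp only [BExp.eval, NExp.eval, not_le] at c₂
      refine (bridgeBoth_spec h' ht ht' f17 f12 hhi hhi' hlt hB' ?_ c₁ c₂ (by omega)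
        (by omega)).mono (by omega) fun s' _ h => h
      rw [e₂, e₁]; exact h9
    · simp only [BExp.eval, NExp.eval, not_le, not_lt] at c₂
      exact (bridgeLeft_spec h' ht ht' f17 f12 hhi hhi' hB' c₁ (by omega)
        (by omega)).mono (by omega) fun s' _ h => h
  · simp only [BExp.eval, NExp.eval, not_le, not_lt] at c₁
    exact (bridgeRight_spec h' ht ht' f17 f12 hhi hhi' hB' (by omega) (by omega)
        (by omega)).mono (by omega) fun s' _ h => h

end

/-- Every step halves at least one of the two ranges, so the sum of their binary lengths bounds the
number of steps. -/
theorem bridgeSearch_spec (σ : ℚ) : ∃ K, ∀ (k : ℕ) (n : ℕ → ℕ) (V : ℕ → ℕ → Plane) (L N : ℕ → ℕ)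
    (s : State) (t t' lo hi lo' hi' : ℕ), Env σ k n V L N s → t < k → t' < k → s.natVar 17 = t →
    s.natVar 12 = t' → s.natVar 18 = lo → s.natVar 19 = hi → s.natVar 22 = lo' →
    s.natVar 23 = hi' → lo ≤ hi → hi ≤ N t → lo' ≤ hi' → hi' ≤ N t' →
    key (lowerPoint n V L t hi) < key (lowerPoint n V L t' lo') →
    s.realVar 9 = lowerPoint n V L t' lo' 0 →
    Within (bridgeSearch σ) (K * (Nat.size (N t) + Nat.size (N t') + 1)) s fun s' =>
      IsBridge (lowerPoint n V L t) lo hi (lowerPoint n V L t') lo' hi' (s'.natVar 18)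
        (s'.natVar 22) := by
  refine ⟨bridgeCond.cost +
    (20 + (bridgeBoth σ).time + (bridgeLeft σ).time + (bridgeRight σ).time),
    fun k n V L N s t t' lo hi lo' hi' h ht ht' h17 h12 h18 h19 h22 h23 hlo hhi hlo' hhi' hlt h9 => ?_⟩
  have hloop := Within.loop_of_le (s := s) (b := bridgeCond) (p := bridgeStep σ)
    (fun s' => Env σ k n V L N s' ∧ s'.natVar 17 = t ∧ s'.natVar 12 = t' ∧
      s'.realVar 9 = lowerPoint n V L t' lo' 0 ∧
      BridgeState (lowerPoint n V L t) lo hi (lowerPoint n V L t') lo' hi' s')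
    bridgeEffort _ ⟨h, h17, h12, h9, by
      rw [BridgeState, h18, h19, h22, h23]; exact .full hlo hlo'⟩
    (fun s₁ ⟨hI, i17, i12, i9, hB⟩ hc =>
      (bridgeStep_spec hI ht ht' i17 i12 hhi hhi' hlt hB i9 hc).imp fun s₂ hA ⟨hB', hlt'⟩ => by
        obtain ⟨na, ra, nv, rv⟩ := bridgeStep_frame hA
        exact ⟨⟨hI.congr (nv 0 (by simp)) (fun _ _ => by rw [na]) (fun _ _ => by rw [ra]),
          (nv 17 (by simp)).trans i17, (nv 12 (by simp)).trans i12,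
          (rv 9 (by omega)).trans i9, hB'⟩, hlt'⟩)
  refine hloop.mono (Nat.mul_le_mul_left _ (Nat.succ_le_succ ?_)) ?_
  · rw [bridgeEffort, h18, h19, h22, h23]
    exact Nat.add_le_add (Nat.size_le_size (by omega)) (Nat.size_le_size (by omega))
  · rintro s' - ⟨⟨hI, -, -, -, hB⟩, hc⟩
    simp only [bridgeCond, BExp.or_eval, BExp.eval, NExp.eval, not_le, not_or, not_lt] at hc
    have b₁ := hB.l_le
    have b₂ := hB.l_le'
    have hp : IsArc (lowerPoint n V L t) lo hi := (h.scene.isArc t ht).mono (Nat.zero_le _) hhi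
    have hq : IsArc (lowerPoint n V L t') lo' hi' :=
      (h.scene.isArc t' ht').mono (Nat.zero_le _) hhi'
    unfold BridgeState at hB
    rw [← show s'.natVar 18 = s'.natVar 19 by omega, ← show s'.natVar 22 = s'.natVar 23 by omega] at hB
    exact hB.isBridge hp hq hlt

end RealRAM


/-! ## Amortized running times, and locating events on a lower side -/

namespace RealRAM

/-- Started in state `s`, the program `p` halts in a state that satisfies `Q`, and its running time
together with the final potential is at most `X`. -/
def Spends (p : Prog) (s : State) (Q : State → Prop) (Φ : State → ℕ) (X : ℕ) : Prop :=
  ∃ t s', Exec p s t s' ∧ Q s' ∧ t + Φ s' ≤ X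

namespace Spends

variable {p q : Prog} {s : State} {Q Q' : State → Prop} {Φ Φ' : State → ℕ} {X X' T : ℕ}

theorem of_within (h : Within p T s fun s' => Q s' ∧ T + Φ s' ≤ X) : Spends p s Q Φ X := by
  obtain ⟨t, s', he, ht, hq, hX⟩ := h
  exact ⟨t, s', he, hq, by omega⟩

/-- The inequality compares the unused budgets `X - Φ` and `X' - Φ'` in a form free of truncated
subtraction. -/
theorem mono (h : Spends p s Q Φ X)
    (hQ : ∀ s', Agree p s s' → Q s' → Q' s' ∧ Φ' s' + X ≤ Φ s' + X') : Spends p s Q' Φ' X' := by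
  obtain ⟨t, s', he, hq, hX⟩ := h
  obtain ⟨hq', hX'⟩ := hQ s' he.agree hq
  exact ⟨t, s', he, hq', by omega⟩

theorem seq (h : Within p T s fun s' => Spends q s' Q Φ X) : Spends (.seq p q) s Q Φ (T + X) := by
  obtain ⟨t, s', he, ht, t', s'', he', hq, hX⟩ := h
  exact ⟨_, s'', .seq he he', hq, by omega⟩

theorem ite {b : BExp} (h : b.eval s → Spends p s Q Φ X) (h' : ¬ b.eval s → Spends q s Q Φ X) :
    Spends (.ite b p q) s Q Φ (b.cost + X) := by
  by_cases hb : b.eval s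
  · obtain ⟨t, s', he, hq, hX⟩ := h hb
    exact ⟨_, s', .iteTrue q hb he, hq, by omega⟩
  · obtain ⟨t, s', he, hq, hX⟩ := h' hb
    exact ⟨_, s', .iteFalse p hb he, hq, by omega⟩

/-- Each pass must leave enough for the next test; the first test is charged separately. As tests
have positive cost, the potential also proves termination. -/
theorem loop {b : BExp} (I : State → Prop) (Φ : State → ℕ) (hI : I s)
    (hbody : ∀ s, I s → b.eval s → Spends p s I (fun s' => b.cost + Φ s') (Φ s)) :
    Spends (.loop b p) s (fun s' => I s' ∧ ¬ b.eval s') Φ (b.cost + Φ s) := by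
  suffices H : ∀ M, ∀ s, I s → Φ s ≤ M →
      Spends (.loop b p) s (fun s' => I s' ∧ ¬ b.eval s') Φ (b.cost + Φ s) from H _ s hI le_rfl
  intro M
  induction M using Nat.strong_induction_on with
  | _ M ih =>
    intro s hs hM
    by_cases hb : b.eval s
    · obtain ⟨t, s', he, hs', hΦ⟩ := hbody s hs hb
      have hpos : 0 < b.cost := by cases b <;> simp [BExp.cost]
      simp only at hΦ
      obtain ⟨t', s'', he', hq, hX⟩ := ih (Φ s') (by omega) s' hs' le_rfl
      exact ⟨_, s'', .loopTrue hb he he', hq, by omega⟩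
    · exact ⟨_, s, .loopFalse p hb, ⟨hs, hb⟩, by omega⟩

end Spends

open Prog

theorem exists_threshold (F : ℕ → Prop) (M : ℕ) (hF : ∀ i j, i ≤ j → j < M → F j → F i) :
    ∃ m ≤ M, ∀ j < M, (F j ↔ j < m) := by
  classical
  by_cases h : ∃ j, j < M ∧ ¬ F j
  · refine ⟨Nat.find h, (Nat.find_spec h).1.le, fun j hj => ⟨fun hFj => ?_, fun hlt => ?_⟩⟩
    · by_contra! hle
      exact (Nat.find_spec h).2 (hF _ _ hle hj hFj)
    · by_contra hn
      exact Nat.find_min h hlt ⟨hj, hn⟩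
  · push Not at h
    exact ⟨M, le_rfl, fun j hj => ⟨fun _ => hj, fun _ => h j hj⟩⟩

/-- Counts in `natVar 3` the points of the lower side of polygon `natVar 12` for which `b` holds. -/
def chainSearch (σ : ℚ) (b : BExp) : Prog :=
  block [.setNat 3 (.const 0), .setNat 4 (.add (.arr 3 (.var 12)) (.const 1)),
    bsearch (readChain σ 12 (.var 5) 0) b]

theorem chainSearch_frame {σ : ℚ} {b : BExp} {s s' : State} (h : Agree (chainSearch σ b) s s') :
    s'.natArr = s.natArr ∧ s'.realArr = s.realArr ∧
      ∀ x, x < 3 ∨ 7 < x → s'.natVar x = s.natVar x := by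
  refine ⟨funext fun a => h.natArr a ?_, funext fun a => h.realArr a ?_,
    fun x hx => h.natVar x ?_⟩
  · simp [chainSearch, bsearch, readChain, loadPoint, block, natArrs]
  · simp [chainSearch, bsearch, readChain, loadPoint, block, realArrs]
  · simp [chainSearch, bsearch, readChain, loadPoint, block, natVars]
    omega

/-- The keys increase along the lower side, so a condition closed under smaller keys holds on an
initial segment. The search extends to `N t + 1`, because all `N t + 1` points may satisfy it. -/
theorem chainSearch_spec (σ : ℚ) (b : BExp) : ∃ K, ∀ (k : ℕ) (n : ℕ → ℕ) (V : ℕ → ℕ → Plane)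
    (L N : ℕ → ℕ) (s : State) (t : ℕ) (F : Plane → Prop), Env σ k n V L N s → s.natVar 12 = t →
    t < k → (∀ s' : State, s'.realArr = s.realArr → s'.natVar 10 = s.natVar 10 →
      s'.natVar 11 = s.natVar 11 → (b.eval s' ↔ F (s'.point 0))) →
    (∀ p q, key p ≤ key q → F q → F p) →
    Within (chainSearch σ b) (K * (Nat.size (n t) + 1)) s fun s' =>
      s'.natVar 3 ≤ N t + 1 ∧ ∀ j ≤ N t, (F (lowerPoint n V L t j) ↔ j < s'.natVar 3) := by
  refine ⟨b.cost + (readChain σ 12 (.var 5) 0).time + 20 + 10,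
    fun k n V L N s t F h h12 ht hb hF => ?_⟩
  have hc := h.scene.chain t ht
  obtain ⟨m, hm, hmF⟩ := exists_threshold (fun j => F (lowerPoint n V L t j)) (N t + 1)
    fun i j hij hj => hF _ _ ((h.scene.isArc t ht).le (Nat.zero_le i) hij (by omega))
  refine Within.mono (T := 2 + (5 + ((b.cost + (readChain σ 12 (.var 5) 0).time + 20) *
    (Nat.size (n t) + 1) + 1))) ?_ ?_ fun s' _ h => h
  swap
  · rw [Nat.add_mul (b.cost + (readChain σ 12 (.var 5) 0).time + 20) 10]; omega
  refine .cons ((Within.of_vc (p := .setNat 3 (.const 0)) (Q := fun s' => s' = s.setNat 3 0)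
    rfl).imp fun s₁ _ e₁ => ?_)
  refine .cons ((Within.of_vc (p := .setNat 4 (.add (.arr 3 (.var 12)) (.const 1)))
    (Q := fun s' => s' = s₁.setNat 4 (N t + 1)) (by
      simp [vc, e₁, h12, h.len t ht])).mono (by simp [time, NExp.cost]) fun s₂ _ e₂ => ?_)
  have nv : ∀ x, x ≠ 3 → x ≠ 4 → s₂.natVar x = s.natVar x := fun x hx hx' => by
    rw [e₂, e₁]; simp [hx, hx']
  have e3 : s₂.natVar 3 = 0 := by rw [e₂, e₁]; simp
  have e4 : s₂.natVar 4 = N t + 1 := by rw [e₂]; simp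
  have ra : s₂.realArr = s.realArr := by rw [e₂, e₁]; rfl
  have h' : Env σ k n V L N s₂ := h.congr (nv 0 (by omega) (by omega))
    (fun _ _ => by rw [e₂, e₁]; rfl) (fun _ _ => by rw [ra])
  have hs := bsearch_spec (pre := readChain σ 12 (.var 5) 0) (b := b) (s := s₂) (m := m)
    (R := fun j => F (lowerPoint n V L t j)) (Tp := (readChain σ 12 (.var 5) 0).time)
    (by simp [readChain, loadPoint, block, natVars]) (fun s' hA _ h₂ => by
      have h'' : Env σ k n V L N s' := h'.agree hA
        (by simp [bsearch, readChain, loadPoint, block, natVars])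
        (fun a ha => by simp [bsearch, readChain, loadPoint, block, natArrs])
        (fun a ha => by simp [bsearch, readChain, loadPoint, block, realArrs])
      have n12 : s'.natVar 12 = t := by
        rw [hA.natVar 12 (by simp [bsearch, readChain, loadPoint, block, natVars]),
          nv 12 (by omega) (by omega), h12]
      have n10 : s'.natVar 10 = s.natVar 10 := by
        rw [hA.natVar 10 (by simp [bsearch, readChain, loadPoint, block, natVars]),
          nv 10 (by omega) (by omega)]
      have n11 : s'.natVar 11 = s.natVar 11 := by
        rw [hA.natVar 11 (by simp [bsearch, readChain, loadPoint, block, natVars]),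
          nv 11 (by omega) (by omega)]
      have ra' : s'.realArr = s.realArr := by
        rw [← ra]
        exact funext fun a => hA.realArr a (by
          simp [bsearch, readChain, loadPoint, block, realArrs])
      refine Within.of_vc (readChain_vc h'' (by omega) (by omega)
        (by simp only [NExp.eval, n12]; omega) fun a => ?_)
      rw [hb _ (by simp [ra']) (by simp [n10]) (by simp [n11])]
      simp [n12])
    (fun j _ hj' => hmF j (by omega)) (by omega) (by omega)
  refine .cons (hs.mono (Nat.mul_le_mul_left _ (Nat.succ_le_succ (Nat.size_le_size ?_)))
    fun s₃ _ h3 => .nil ?_)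
  · have := hc.length_lt; omega
  · rw [h3]
    exact ⟨hm, fun j hj => hmF j (by omega)⟩

/-- The point found comes before event `natVar 10`. -/
def beforeEvent : BExp := .lexLt (.var 1) (.var 2) (.arr 3 (.var 10)) (.arr 4 (.var 10))

/-- The point found does not come after event `natVar 11`. -/
def notAfterEvent : BExp :=
  .not (.lexLt (.arr 3 (.var 11)) (.arr 4 (.var 11)) (.var 1) (.var 2))

/-- Determines the positions of the lower side of polygon `natVar 12` between the events `natVar 10` and
`natVar 11`; they are `natVar 13, …, natVar 14 - 1`. -/
def locate (σ : ℚ) : Prog :=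
  block [chainSearch σ beforeEvent, .setNat 13 (.var 3), chainSearch σ notAfterEvent,
    .setNat 14 (.var 3)]

theorem locate_frame {σ : ℚ} {s s' : State} (h : Agree (locate σ) s s') :
    s'.natArr = s.natArr ∧ s'.realArr = s.realArr ∧
      ∀ x, x < 3 ∨ 7 < x ∧ x < 13 ∨ 14 < x → s'.natVar x = s.natVar x := by
  refine ⟨funext fun a => h.natArr a ?_, funext fun a => h.realArr a ?_,
    fun x hx => h.natVar x ?_⟩
  · simp [locate, chainSearch, bsearch, readChain, loadPoint, block, natArrs]
  · simp [locate, chainSearch, bsearch, readChain, loadPoint, block, realArrs]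
  · simp [locate, chainSearch, bsearch, readChain, loadPoint, block, natVars]
    omega

/-- The first search tests strictly and the second weakly, so points at either event belong to the
piece; the ends of the lower sides are not lost. -/
theorem locate_spec (σ : ℚ) : ∃ K, ∀ (k : ℕ) (n : ℕ → ℕ) (V : ℕ → ℕ → Plane)
    (L N : ℕ → ℕ) (s : State) (t e e' : ℕ), Env σ k n V L N s → s.natVar 12 = t → t < k →
    s.natVar 10 = e → e < 2 * k → s.natVar 11 = e' → e' < 2 * k →
    Within (locate σ) (K * (Nat.size (n t) + 1)) s fun s' => s'.natVar 14 ≤ N t + 1 ∧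
      ∀ j ≤ N t, (s'.natVar 13 ≤ j ↔ key (eventPoint (lowerPoint n V L) N e) ≤
        key (lowerPoint n V L t j)) ∧ (j < s'.natVar 14 ↔ key (lowerPoint n V L t j) ≤
        key (eventPoint (lowerPoint n V L) N e')) := by
  obtain ⟨K₁, hK₁⟩ := chainSearch_spec σ beforeEvent
  obtain ⟨K₂, hK₂⟩ := chainSearch_spec σ notAfterEvent
  refine ⟨K₁ + K₂ + 10, fun k n V L N s t e e' h h12 ht h10 he h11 he' => ?_⟩
  set P := eventPoint (lowerPoint n V L) N with hP
  refine Within.mono (T := K₁ * (Nat.size (n t) + 1) + (2 + (K₂ * (Nat.size (n t) + 1) +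
    (2 + 1)))) ?_ (by simp only [Nat.add_mul]; omega) fun s' _ h => h
  refine .cons ((hK₁ k n V L N s t (fun p => key p < key (P e)) h h12 ht (fun s' ra n₁ _ => by
    rw [beforeEvent, BExp.lexLt_eval (p := s'.point 0) (q := P e) (by simp [State.point])
      (by simp [State.point]) (by simp [ra, n₁, h10, h.endX e he, hP])
      (by simp [ra, n₁, h10, h.endY e he, hP])]) fun p q hpq hq => hpq.trans_lt hq).imp
    fun s₁ hA₁ ⟨hm₁, hF₁⟩ => ?_)
  obtain ⟨na₁, ra₁, nv₁⟩ := chainSearch_frame hA₁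
  refine .cons ((Within.of_vc (p := .setNat 13 (.var 3))
    (Q := fun s' => s' = s₁.setNat 13 (s₁.natVar 3)) rfl).imp fun s₂ _ e₂ => ?_)
  have nv₂ : ∀ x, x < 3 ∨ 7 < x → x ≠ 13 → s₂.natVar x = s.natVar x := fun x hx hx' => by
    rw [e₂, ← nv₁ x hx]; simp [hx']
  have na₂ : s₂.natArr = s.natArr := by rw [e₂, ← na₁]; rfl
  have ra₂ : s₂.realArr = s.realArr := by rw [e₂, ← ra₁]; rfl
  have h₂ : Env σ k n V L N s₂ := h.congr (nv₂ 0 (by omega) (by omega)) (fun _ _ => by rw [na₂])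
    (fun _ _ => by rw [ra₂])
  have e11 : s₂.natVar 11 = e' := (nv₂ 11 (by omega) (by omega)).trans h11
  refine .cons ((hK₂ k n V L N s₂ t (fun p => ¬ key (P e') < key p) h₂
    ((nv₂ 12 (by omega) (by omega)).trans h12) ht (fun s' ra _ n₂ => by
    rw [notAfterEvent, BExp.eval, BExp.lexLt_eval (q := s'.point 0) (p := P e')
      (by simp [ra, n₂, e11, h₂.endX e' he', hP]) (by simp [ra, n₂, e11, h₂.endY e' he', hP])
      (by simp [State.point]) (by simp [State.point])])
      fun p q hpq hq hp => hq (hp.trans_le hpq)).imp fun s₃ hA₃ ⟨hm₃, hF₃⟩ => ?_)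
  obtain ⟨na₃, ra₃, nv₃⟩ := chainSearch_frame hA₃
  refine .cons ((Within.of_vc (p := .setNat 14 (.var 3))
    (Q := fun s' => s' = s₃.setNat 14 (s₃.natVar 3)) rfl).imp fun s₄ _ e₄ => .nil ?_)
  have e13 : s₄.natVar 13 = s₁.natVar 3 := by
    rw [e₄]; simp [nv₃, e₂]
  have e14 : s₄.natVar 14 = s₃.natVar 3 := by rw [e₄]; simp
  rw [e13, e14]
  refine ⟨hm₃, fun j hj => ⟨?_, ?_⟩⟩
  · rw [← not_lt, ← hF₁ j hj, not_lt]
  · rw [← hF₃ j hj, not_lt]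

end RealRAM


/-! ## Adding an arc to the stack -/

namespace RealRAM

open Prog

/-- The stack in the memory. -/
def Stack (k : ℕ) (N : ℕ → ℕ) (c : ℕ → ℕ → Plane) (s : State) : Prop :=
  HullStack k N c (s.natArr 6) (s.natArr 7) (s.natArr 8) (s.natVar 15)

/-- The points on the stack in the memory. -/
def stackSet (c : ℕ → ℕ → Plane) (s : State) : Set Plane :=
  stackPoints c (s.natArr 6) (s.natArr 7) (s.natArr 8) (s.natVar 15)

/-- Puts an arc on the empty stack. -/
def pushFirst : Prog :=
  block [.storeNat 6 (.var 15) (.var 12), .storeNat 7 (.var 15) (.var 13),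
    .storeNat 8 (.var 15) (.var 14), .setNat 15 (.add (.var 15) (.const 1)), .setNat 16 (.const 1)]

/-- Prepares the search for the bridge from the top of the stack to the new arc. -/
def pushInit : Prog :=
  block [.setNat 33 (.sub (.var 15) (.const 1)), .setNat 17 (.arr 6 (.var 33)),
    .setNat 18 (.arr 7 (.var 33)), .setNat 19 (.arr 8 (.var 33)), .setNat 22 (.var 13),
    .setNat 23 (.var 14)]

/-- Reads the bridge and the point before the top of the stack. -/
def pushRead (σ : ℚ) : Prog :=
  block [readChain σ 17 (.var 18) 1, readChain σ 12 (.var 22) 2,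
    .setNat 31 (.arr 6 (.sub (.var 33) (.const 1))),
    .ite (.natLe (.const 1) (.var 33)) (readChain σ 31 (.arr 8 (.sub (.var 33) (.const 1))) 0) .skip]

/-- Removes the top of the stack or adds the new arc. -/
def pushEnd : Prog :=
  .ite (.and (.natLe (.const 1) (.var 33)) (.and (.natLe (.var 18) (.arr 7 (.var 33)))
      (.realLe (orientVars 0 1 2) (.const 0)))) (.setNat 15 (.var 33))
    (block [.storeNat 8 (.var 33) (.var 18), .storeNat 6 (.var 15) (.var 12),
      .storeNat 7 (.var 15) (.var 22), .storeNat 8 (.var 15) (.var 14),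
      .setNat 15 (.add (.var 15) (.const 1)), .setNat 16 (.const 1)])

/-- Compares the top of a nonempty stack with the new arc. -/
def pushNext (σ : ℚ) : Prog := block [pushInit, bridgeSearch σ, pushRead σ, pushEnd]

/-- Removes the top of the stack or adds the new arc. -/
def pushStep (σ : ℚ) : Prog := .ite (.natLe (.var 15) (.const 0)) pushFirst (pushNext σ)

/-- Adds positions `natVar 13, …, natVar 14` of polygon `natVar 12` to the hull. -/
def pushLoop (σ : ℚ) : Prog := .loop (.natLe (.var 16) (.const 0)) (pushStep σ)

theorem bridgeSearch_frame {σ : ℚ} {s s' : State} (h : Agree (bridgeSearch σ) s s') :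
    s'.natArr = s.natArr ∧ s'.realArr = s.realArr ∧
      (∀ x, x ∉ [7, 18, 19, 22, 23, 24, 25] → s'.natVar x = s.natVar x) ∧
      ∀ x, 8 < x → s'.realVar x = s.realVar x :=
  bridgeStep_frame (h.mono (fun _ h => h) (fun _ h => h) (fun _ h => h) fun _ h => h)

theorem pushStep_frame {σ : ℚ} {s s' : State} (h : Agree (pushStep σ) s s') :
    (∀ a, a ≤ 5 → s'.natArr a = s.natArr a) ∧ s'.realArr = s.realArr ∧
      (∀ x, x ≤ 6 ∨ 8 ≤ x ∧ x ≤ 14 → s'.natVar x = s.natVar x) ∧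
      ∀ x, 8 < x → s'.realVar x = s.realVar x := by
  refine ⟨fun a ha => h.natArr a ?_, funext fun a => h.realArr a ?_,
    fun x hx => h.natVar x ?_, fun x hx => h.realVar x ?_⟩
  · simp [pushStep, pushFirst, pushNext, pushInit, bridgeSearch, pushRead, pushEnd, bridgeStep,
      bridgeBoth, bridgeLeft, bridgeRight, readChain, loadPoint, block, natArrs]
    omega
  · simp [pushStep, pushFirst, pushNext, pushInit, bridgeSearch, pushRead, pushEnd, bridgeStep,
      bridgeBoth, bridgeLeft, bridgeRight, readChain, loadPoint, block, realArrs]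
  · simp [pushStep, pushFirst, pushNext, pushInit, bridgeSearch, pushRead, pushEnd, bridgeStep,
      bridgeBoth, bridgeLeft, bridgeRight, readChain, loadPoint, block, natVars]
    omega
  · simp [pushStep, pushFirst, pushNext, pushInit, bridgeSearch, pushRead, pushEnd, bridgeStep,
      bridgeBoth, bridgeLeft, bridgeRight, readChain, loadPoint, block, realVars]
    omega

section

variable {σ : ℚ} {k : ℕ} {n : ℕ → ℕ} {V : ℕ → ℕ → Plane} {L N : ℕ → ℕ} {s : State}

theorem pushFirst_spec (h : Env σ k n V L N s) {t l r : ℕ} (ht : t < k) (h12 : s.natVar 12 = t)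
    (h13 : s.natVar 13 = l) (h14 : s.natVar 14 = r) (hlr : l ≤ r) (hr : r ≤ N t)
    (hsp : s.natVar 15 = 0) :
    Within pushFirst pushFirst.time s fun s' => s'.natVar 16 = 1 ∧ s'.natVar 15 = 1 ∧
      Stack k N (lowerPoint n V L) s' ∧
      stackSet (lowerPoint n V L) s' = arcPoints (lowerPoint n V L t) l r := by
  refine Within.of_vc ?_
  simp [pushFirst, block, vc, hsp, h12, h13, h14, Stack, stackSet]
  exact HullStack.push_first ht hlr hr h.scene.isArc (by simp) (by simp) (by simp)

theorem pushRead_spec (h : Env σ k n V L N s) {t t' u w j : ℕ} (ht : t < k) (ht' : t' < k)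
    (h17 : s.natVar 17 = t) (h12 : s.natVar 12 = t') (h18 : s.natVar 18 = u)
    (h22 : s.natVar 22 = w) (hu : u ≤ N t) (hw : w ≤ N t') (h33 : s.natVar 33 = j)
    (hprev : 0 < j → s.natArr 6 (j - 1) < k ∧ s.natArr 8 (j - 1) ≤ N (s.natArr 6 (j - 1))) :
    Within (pushRead σ) (pushRead σ).time s fun s' => s'.point 1 = lowerPoint n V L t u ∧
      s'.point 2 = lowerPoint n V L t' w ∧ (0 < j → s'.point 0 =
        lowerPoint n V L (s.natArr 6 (j - 1)) (s.natArr 8 (j - 1))) := by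
  refine Within.of_vc ?_
  have envc : ∀ s' : State, s'.natVar 0 = s.natVar 0 → s'.natArr = s.natArr →
      s'.realArr = s.realArr → Env σ k n V L N s' := fun s' e₁ e₂ e₃ =>
    h.congr e₁ (fun _ _ => by rw [e₂]) (fun _ _ => by rw [e₃])
  simp only [pushRead, block, vc]
  refine readChain_vc h (by omega) (by omega) (by simp only [NExp.eval, h18, h17]; omega)
    fun a₁ => ?_
  refine readChain_vc (envc _ (by simp) (by simp) (by simp)) (by omega) (by simp; omega)
    (by simp [h22, h12]; omega) fun a₂ => ?_
  refine ⟨fun hc => ?_, fun hc => ?_⟩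
  · simp [h33] at hc
    obtain ⟨hp₁, hp₂⟩ := hprev (by omega)
    refine readChain_vc (envc _ (by simp) (by simp) (by simp)) (by omega) (by simpa [h33])
      (by simpa [h33]) fun a₃ => ?_
    simp [setNat_point, h17, h18, h12, h22, h33]
  · simp [h33] at hc
    simp [setNat_point, h17, h18, h12, h22, hc]

/-- There are two outcomes. After a removal, the old points are covered by the remaining stack
together with the arc still to be added; after an insertion, by the stack alone. -/
theorem pushNext_spec (σ : ℚ) : ∃ K, ∀ (k : ℕ) (n : ℕ → ℕ) (V : ℕ → ℕ → Plane) (L N : ℕ → ℕ)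
    (s : State) (t l r j m : ℕ), Env σ k n V L N s → (∀ i < k, Nat.size (n i) ≤ m) →
    Stack k N (lowerPoint n V L) s → s.natVar 15 = j + 1 → t < k → s.natVar 12 = t →
    s.natVar 13 = l → s.natVar 14 = r → l ≤ r → r ≤ N t → s.natVar 16 = 0 →
    s.realVar 9 = lowerPoint n V L t l 0 →
    (∀ x ∈ stackSet (lowerPoint n V L) s, key x < key (lowerPoint n V L t l)) →
    Within (pushNext σ) (K * (m + 1)) s fun s' => Stack k N (lowerPoint n V L) s' ∧
      (s'.natVar 16 = 0 ∧ s'.natVar 15 = j ∧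
        stackSet (lowerPoint n V L) s' ⊆ stackSet (lowerPoint n V L) s ∧
        (∀ x ∈ stackSet (lowerPoint n V L) s, Above (stackSet (lowerPoint n V L) s' ∪
          arcPoints (lowerPoint n V L t) l r) x) ∨
      s'.natVar 16 = 1 ∧ s'.natVar 15 = j + 2 ∧
        stackSet (lowerPoint n V L) s' ⊆ stackSet (lowerPoint n V L) s ∪
          arcPoints (lowerPoint n V L t) l r ∧
        ∀ x ∈ stackSet (lowerPoint n V L) s ∪ arcPoints (lowerPoint n V L t) l r,
          Above (stackSet (lowerPoint n V L) s') x) := by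
  obtain ⟨K, hK⟩ := bridgeSearch_spec σ
  refine ⟨2 * K + pushInit.time + (pushRead σ).time + pushEnd.time + 1,
    fun k n V L N s t l r j m h hm hS hsp ht h12 h13 h14 hlr hr h16 h9 hlt => ?_⟩
  set c := lowerPoint n V L with hc
  have harc := h.scene.isArc
  rw [← hc] at harc
  unfold Stack at hS
  rw [hsp] at hS
  set T := s.natArr 6 with hT
  set lo := s.natArr 7 with hlo
  set hi := s.natArr 8 with hhi
  have hTj := hS.poly_lt j (by omega)
  have hloj := hS.lo_le j (by omega)
  have hhij := hS.hi_le j (by omega)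
  have hlt' : key (c (T j) (hi j)) < key (c t l) := hlt _ (by
    unfold stackSet
    rw [hsp]
    exact ⟨j, by omega, hi j, hloj, le_rfl, rfl⟩)
  refine Within.mono (T := pushInit.time + (K * (2 * m + 1) + ((pushRead σ).time +
    (pushEnd.time + 1)))) ?_ ?_ fun s' _ h => h
  swap
  · have h₁ : pushInit.time + (pushRead σ).time + pushEnd.time + 1 ≤
        (pushInit.time + (pushRead σ).time + pushEnd.time + 1) * (m + 1) :=
      Nat.le_mul_of_pos_right _ (by omega)
    have h₂ : K * (2 * m + 1) ≤ 2 * K * (m + 1) := by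
      rw [mul_comm 2 K, mul_assoc]; exact Nat.mul_le_mul_left _ (by omega)
    have h₃ : (2 * K + pushInit.time + (pushRead σ).time + pushEnd.time + 1) * (m + 1) =
      2 * K * (m + 1) + (pushInit.time + (pushRead σ).time + pushEnd.time + 1) * (m + 1) := by ring
    omega
  have hinit : Within pushInit pushInit.time s fun s' => s'.natVar 33 = j ∧ s'.natVar 17 = T j ∧
      s'.natVar 18 = lo j ∧ s'.natVar 19 = hi j ∧ s'.natVar 22 = l ∧ s'.natVar 23 = r := by
    refine Within.of_vc ?_
    simp [pushInit, block, vc, hsp, h13, h14, hT, hlo, hhi]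
  refine .cons (hinit.imp fun s₁ hA₁ ⟨i33, i17, i18, i19, i22, i23⟩ => ?_)
  have na₁ : s₁.natArr = s.natArr := funext fun a => hA₁.natArr a (by simp [pushInit, block, natArrs])
  have ra₁ : s₁.realArr = s.realArr :=
    funext fun a => hA₁.realArr a (by simp [pushInit, block, realArrs])
  have rv₁ : s₁.realVar = s.realVar :=
    funext fun a => hA₁.realVar a (by simp [pushInit, block, realVars])
  have nv₁ : ∀ x, x < 17 → s₁.natVar x = s.natVar x := fun x hx => hA₁.natVar x (by
    simp [pushInit, block, natVars]; omega)
  have h₁ : Env σ k n V L N s₁ := h.congr (nv₁ 0 (by omega)) (fun _ _ => by rw [na₁])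
    (fun _ _ => by rw [ra₁])
  have hsz : ∀ i < k, Nat.size (N i) ≤ m := fun i hi =>
    (Nat.size_le_size (h.scene.chain i hi).length_lt.le).trans (hm i hi)
  refine .cons ((hK k n V L N s₁ (T j) t (lo j) (hi j) l r h₁ hTj ht i17
    ((nv₁ 12 (by omega)).trans h12) i18 i19 i22 i23 hloj hhij hlr hr hlt' (by rw [rv₁, h9])).mono
    (Nat.mul_le_mul_left _ (by have := hsz _ hTj; have := hsz _ ht; omega)) fun s₂ hA₂ hb => ?_)
  obtain ⟨na₂, ra₂, nv₂, rv₂⟩ := bridgeSearch_frame hA₂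
  have h₂ : Env σ k n V L N s₂ := h₁.congr (nv₂ 0 (by simp)) (fun _ _ => by rw [na₂])
    (fun _ _ => by rw [ra₂])
  rw [← hc] at hb
  generalize hu : s₂.natVar 18 = u at hb
  generalize hw : s₂.natVar 22 = w at hb
  have na₂' : s₂.natArr = s.natArr := na₂.trans na₁
  have k12 : s₂.natVar 12 = t := by rw [nv₂ 12 (by simp), nv₁ 12 (by omega), h12]
  have k14 : s₂.natVar 14 = r := by rw [nv₂ 14 (by simp), nv₁ 14 (by omega), h14]
  have k15 : s₂.natVar 15 = j + 1 := by rw [nv₂ 15 (by simp), nv₁ 15 (by omega), hsp]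
  have k16 : s₂.natVar 16 = 0 := by rw [nv₂ 16 (by simp), nv₁ 16 (by omega), h16]
  have k33 : s₂.natVar 33 = j := by rw [nv₂ 33 (by simp), i33]
  have k17 : s₂.natVar 17 = T j := by rw [nv₂ 17 (by simp), i17]
  refine .cons ((pushRead_spec (j := j) h₂ hTj ht k17 k12 hu hw (hb.u_le.trans hhij)
    (hb.w_le.trans hr) k33 (fun hj => by
      rw [na₂']; exact ⟨hS.poly_lt _ (by omega), hS.hi_le _ (by omega)⟩)).imp
    fun s₃ hA₃ ⟨p1, p2, p0⟩ => ?_)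
  have na₃ : s₃.natArr = s.natArr := by
    rw [← na₂']
    exact funext fun a => hA₃.natArr a (by simp [pushRead, readChain, loadPoint, block, natArrs])
  have nv₃ : ∀ x, x ≠ 7 → x ≠ 31 → s₃.natVar x = s₂.natVar x := fun x hx hx' =>
    hA₃.natVar x (by simp [pushRead, readChain, loadPoint, block, natVars, hx, hx'])
  rw [na₂', ← hc] at p0
  rw [← hc] at p1 p2
  have k₁ := nv₃ 12 (by omega) (by omega)
  have k₂ := nv₃ 14 (by omega) (by omega)
  have k₃ := nv₃ 15 (by omega) (by omega)
  have k₄ := nv₃ 16 (by omega) (by omega)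
  have k₅ := nv₃ 33 (by omega) (by omega)
  have k₆ := nv₃ 18 (by omega) (by omega)
  have k₇ := nv₃ 22 (by omega) (by omega)
  have hset : stackSet c s = stackPoints c T lo hi (j + 1) := by rw [stackSet, hsp]
  refine .cons (Within.imp (Within.of_vc (p := pushEnd) ?_) fun s' _ h => .nil h)
  simp only [pushEnd, vc, BExp.eval, NExp.eval, orientVars_eval, RExp.eval, Rat.cast_zero, k₅, k33,
    k₆, hu, p1, p2, na₃, ← hlo]
  refine ⟨fun ⟨c₁, c₂, c₃⟩ => ?_, fun hneg => ?_⟩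
  · obtain ⟨j', rfl⟩ : ∃ j', j = j' + 1 := ⟨j - 1, by omega⟩
    rw [p0 (by omega), Nat.add_sub_cancel] at c₃
    simp only [Stack, stackSet, setNat_natArr, setNat_natVar, na₃, if_true, k₄, k16, ← hT, ← hlo,
      ← hhi, hsp]
    refine ⟨hS.pop, Or.inl ⟨by simp, trivial, ?_, fun x hx => ?_⟩⟩
    · rw [stackPoints_succ c T lo hi (j' + 1)]
      exact Set.subset_union_left
    · have hu' : u = lo (j' + 1) := le_antisymm c₂ hb.le_u
      exact hS.above_of_pop harc hb hlt' ((harc t ht).mono (Nat.zero_le _) hr) hu' c₃ hx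
  · simp only [block, vc, NExp.eval, Stack, stackSet, setNat_natArr, setNat_natVar,
      storeNat_natVar, storeNat_natArr, na₃, k₁, k₂, k₃, k₄, k₆, k₇, k₅, k33, k16, k15, hu, hw, k12,
      k14, hsp, ← hT, ← hlo, ← hhi, Nat.reduceEqDiff, reduceIte]
    -- When the test for removal fails although `u` is first and there is an entry before, what
    -- failed is the turn condition; this is the strict left turn that `push` asks for.
    obtain ⟨r₁, r₂, r₃⟩ := hS.push harc ht hr hb hlt' (fun hu' hj => by
        by_contra! ho
        refine hneg ⟨hj, hu'.le, ?_⟩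
        rw [p0 hj]
        exact ho)
      (T' := Function.update T (j + 1) t) (lo' := Function.update lo (j + 1) w)
      (hi' := Function.update (Function.update hi j u) (j + 1) r)
      (fun i hi => Function.update_of_ne (by omega) _ _)
      (fun i hi => Function.update_of_ne (by omega) _ _)
      (fun i hi => by
        rw [Function.update_of_ne (by omega), Function.update_of_ne (by omega)])
      (by rw [Function.update_of_ne (by omega), Function.update_self])
      (Function.update_self _ _ _) (Function.update_self _ _ _) (Function.update_self _ _ _)
    exact ⟨r₁, Or.inr ⟨by simp, by simp, r₂, r₃⟩⟩

end

/-- Amortization: each entry of the stack carries a credit of `K * (m + 1)`. A removal is paid for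
by the credit of the removed entry. The surplus of three covers the insertion, the credit of the new
entry, and the remaining test. -/
theorem pushLoop_spec (σ : ℚ) : ∃ K, 0 < K ∧ ∀ (k : ℕ) (n : ℕ → ℕ) (V : ℕ → ℕ → Plane) (L N : ℕ → ℕ)
    (s : State) (t l r m : ℕ), Env σ k n V L N s → (∀ i < k, Nat.size (n i) ≤ m) →
    Stack k N (lowerPoint n V L) s → t < k → s.natVar 12 = t →
    s.natVar 13 = l → s.natVar 14 = r → l ≤ r → r ≤ N t → s.natVar 16 = 0 →
    s.realVar 9 = lowerPoint n V L t l 0 →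
    (∀ x ∈ stackSet (lowerPoint n V L) s, key x < key (lowerPoint n V L t l)) →
    Spends (pushLoop σ) s (fun s' => Stack k N (lowerPoint n V L) s' ∧
      stackSet (lowerPoint n V L) s' ⊆ stackSet (lowerPoint n V L) s ∪
          arcPoints (lowerPoint n V L t) l r ∧
        ∀ x ∈ stackSet (lowerPoint n V L) s ∪ arcPoints (lowerPoint n V L t) l r,
          Above (stackSet (lowerPoint n V L) s') x)
      (fun s' => K * (m + 1) * s'.natVar 15) (K * (m + 1) * (s.natVar 15 + 3)) := by
  obtain ⟨K, hK⟩ := pushNext_spec σ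
  refine ⟨K + pushFirst.time + 6, by omega,
    fun k n V L N s t l r m h hm hS ht h12 h13 h14 hlr hr h16 h9 hlt => ?_⟩
  set c := lowerPoint n V L with hc
  set P := arcPoints (c t) l r with hP
  set B := (K + pushFirst.time + 6) * (m + 1) with hB
  have hB₁ : K * (m + 1) + 6 ≤ B := by
    have : 6 ≤ 6 * (m + 1) := by omega
    rw [hB, Nat.add_mul, Nat.add_mul]; omega
  have hB₂ : pushFirst.time + 6 ≤ B := by
    have h₁ : 6 ≤ 6 * (m + 1) := by omega
    have h₂ : pushFirst.time ≤ pushFirst.time * (m + 1) := Nat.le_mul_of_pos_right _ (by omega)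
    rw [hB, Nat.add_mul, Nat.add_mul]; omega
  refine (Spends.loop (s := s) (p := pushStep σ) (b := .natLe (.var 16) (.const 0))
    (fun s' => Env σ k n V L N s' ∧ s'.natVar 12 = t ∧ s'.natVar 13 = l ∧ s'.natVar 14 = r ∧
      s'.realVar 9 = c t l 0 ∧ Stack k N c s' ∧
      -- As long as the new arc has not been added, coverage is claimed only together with the
      -- points of that arc, which may already be what lies below removed entries.
      (s'.natVar 16 = 0 ∧ stackSet c s' ⊆ stackSet c s ∧
        (∀ x ∈ stackSet c s ∪ P, Above (stackSet c s' ∪ P) x) ∨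
      s'.natVar 16 = 1 ∧ stackSet c s' ⊆ stackSet c s ∪ P ∧
        ∀ x ∈ stackSet c s ∪ P, Above (stackSet c s') x))
    (fun s' => B * (s'.natVar 15 + if s'.natVar 16 = 0 then 2 else 0))
    ⟨h, h12, h13, h14, h9, hS, Or.inl ⟨h16, subset_rfl, fun x hx => .of_mem hx⟩⟩ ?_).mono ?_
  · rintro s₁ ⟨hI, i12, i13, i14, i9, iS, hor⟩ hb
    simp only [BExp.eval, NExp.eval, Nat.le_zero] at hb
    rcases hor with ⟨-, hsub, hab⟩ | ⟨h1, -⟩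
    swap
    · omega
    have hcost : BExp.cost (.natLe (.var 16) (.const 0)) = 3 := rfl
    have hstep : Spends (pushStep σ) s₁ (fun s' => Stack k N c s' ∧
        (s'.natVar 16 = 0 ∧ stackSet c s' ⊆ stackSet c s ∧
          (∀ x ∈ stackSet c s ∪ P, Above (stackSet c s' ∪ P) x) ∨
        s'.natVar 16 = 1 ∧ stackSet c s' ⊆ stackSet c s ∪ P ∧
          ∀ x ∈ stackSet c s ∪ P, Above (stackSet c s') x))
        (fun s' => 3 + B * (s'.natVar 15 + if s'.natVar 16 = 0 then 2 else 0))
        (3 + (B * (s₁.natVar 15 + 2) - 3)) := by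
      have hBm : B * (s₁.natVar 15 + 2) = B * (s₁.natVar 15 + 1) + B := by ring
      refine Spends.ite (b := .natLe (.var 15) (.const 0)) (fun hc₁ => ?_) fun hc₁ => ?_
      · simp only [BExp.eval, NExp.eval, Nat.le_zero] at hc₁
        refine .of_within ((pushFirst_spec hI ht i12 i13 i14 hlr hr hc₁).imp
          fun s' _ ⟨q₁, q₂, q₃, q₄⟩ => ⟨⟨q₃, Or.inr ⟨q₁, ?_, fun x hx => ?_⟩⟩, ?_⟩)
        · rw [← hc] at q₄; rw [q₄]; exact Set.subset_union_right
        · rw [← hc] at q₄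
          rw [q₄]
          have h₀ : stackSet c s₁ = ∅ := by
            rw [stackSet, hc₁]; simp [stackPoints]
          have := hab x hx
          rwa [h₀, Set.empty_union] at this
        · rw [q₁, q₂, hBm, hc₁]
          simp
          omega
      · simp only [BExp.eval, NExp.eval, Nat.le_zero] at hc₁
        obtain ⟨j, hj⟩ : ∃ j, s₁.natVar 15 = j + 1 := ⟨s₁.natVar 15 - 1, by omega⟩
        refine .of_within ((hK k n V L N s₁ t l r j m hI hm iS hj ht i12 i13 i14 hlr hr hb i9
          (fun x hx => hlt x (hsub hx))).imp fun s' _ ⟨q₀, q⟩ => ?_)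
        rw [← hc, ← hP] at q
        rcases q with ⟨q₁, q₂, q₃, q₄⟩ | ⟨q₁, q₂, q₃, q₄⟩
        · refine ⟨⟨q₀, Or.inl ⟨q₁, q₃.trans hsub, fun x hx => (hab x hx).trans ?_⟩⟩, ?_⟩
          · rintro u (hu | hu)
            exacts [q₄ u hu, .of_mem (Or.inr hu)]
          · rw [q₁, q₂, hBm, hj]
            simp only [if_true]
            have : B * (j + 2) = B * (j + 1 + 1) := by ring
            omega
        · refine ⟨⟨q₀, Or.inr ⟨q₁, q₃.trans (Set.union_subset_union_left _ hsub),
            fun x hx => (hab x hx).trans q₄⟩⟩, ?_⟩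
          rw [q₁, q₂, hBm, hj]
          simp only [one_ne_zero, if_false]
          have : B * (j + 2 + 0) = B * (j + 1 + 1) := by ring
          omega
    refine hstep.mono fun s' hA ⟨q₁, q₂⟩ => ?_
    obtain ⟨na, ra, nv, rv⟩ := pushStep_frame hA
    refine ⟨⟨hI.congr (nv 0 (by omega)) (fun a ha => na a (by omega)) (fun _ _ => by rw [ra]),
      (nv 12 (by omega)).trans i12, (nv 13 (by omega)).trans i13, (nv 14 (by omega)).trans i14,
      (rv 9 (by omega)).trans i9, q₁, q₂⟩, ?_⟩
    rw [hcost, hb]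
    simp only [if_true]
    have : 6 ≤ B * (s₁.natVar 15 + 2) := by
      have : B * 1 ≤ B * (s₁.natVar 15 + 2) := Nat.mul_le_mul_left _ (by omega)
      omega
    omega
  · rintro s' - ⟨⟨-, -, -, -, -, q₁, q₂⟩, hb⟩
    simp only [BExp.eval, NExp.eval, Nat.le_zero] at hb
    rcases q₂ with ⟨q₂, -⟩ | ⟨-, q₂, q₃⟩
    · exact absurd q₂ hb
    refine ⟨⟨q₁, q₂, q₃⟩, ?_⟩
    rw [if_neg hb, if_pos h16]
    have hcost : BExp.cost (.natLe (.var 16) (.const 0)) = 3 := rfl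
    rw [hcost]
    simp only [Nat.add_zero]
    have : B * (s.natVar 15 + 3) = B * (s.natVar 15 + 2) + B := by ring
    omega

end RealRAM


/-! ## The sweep -/

namespace RealRAM

open Prog

/-- Finds the part of the lowest active polygon between the last event and the next one. -/
def sweepPrep (σ : ℚ) : Prog :=
  block [.setNat 11 (.sub (.arr 4 (.const 1)) (.const 1)),
    .setNat 12 (.sub (.arr 5 (.const 1)) (.const 1)), locate σ]

/-- Prepares the new arc. -/
def pushPrep (σ : ℚ) : Prog :=
  block [readChain σ 12 (.var 13) 0, .setReal 9 (.var 1), .setNat 14 (.sub (.var 14) (.const 1)),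
    .setNat 16 (.const 0)]

/-- Adds the arc found to the hull, unless it is empty. -/
def sweepPush (σ : ℚ) : Prog :=
  .ite (.natLe (.var 14) (.var 13)) .skip (.seq (pushPrep σ) (pushLoop σ))

/-- Processes the part between the last event and the next one. -/
def sweepPiece (σ : ℚ) : Prog :=
  .ite (.or (.natLe (.arr 4 (.const 1)) (.const 0)) (.natLe (.arr 5 (.const 1)) (.const 0))) .skip
    (.seq (sweepPrep σ) (sweepPush σ))

/-- Processes one event. -/
def sweepStep (σ : ℚ) : Prog := .seq nextEvent (sweepPiece σ)

/-- The invariant of the sweep. -/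
structure SweepState (σ : ℚ) (k : ℕ) (n : ℕ → ℕ) (V : ℕ → ℕ → Plane) (L N : ℕ → ℕ) (R : Set ℕ)
    (s : State) : Prop where
  env : Env σ k n V L N s
  trees : Trees k (lowerPoint n V L) N R s
  stack : Stack k N (lowerPoint n V L) s
  sweep : Sweep k (lowerPoint n V L) N R (stackSet (lowerPoint n V L) s)

theorem sweepPiece_frame {σ : ℚ} {s s' : State} (h : Agree (sweepPiece σ) s s') :
    (∀ a, a ≤ 5 → s'.natArr a = s.natArr a) ∧ s'.realArr = s.realArr ∧
      s'.natVar 0 = s.natVar 0 := by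
  refine ⟨fun a ha => h.natArr a ?_, funext fun a => h.realArr a ?_, h.natVar 0 ?_⟩
  · simp [sweepPiece, sweepPrep, sweepPush, pushPrep, locate, chainSearch, bsearch, pushLoop,
      pushStep, pushFirst, pushNext, pushInit, bridgeSearch, pushRead, pushEnd, bridgeStep,
      bridgeBoth, bridgeLeft, bridgeRight, readChain, loadPoint, block, natArrs]
    omega
  · simp [sweepPiece, sweepPrep, sweepPush, pushPrep, locate, chainSearch, bsearch, pushLoop,
      pushStep, pushFirst, pushNext, pushInit, bridgeSearch, pushRead, pushEnd, bridgeStep,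
      bridgeBoth, bridgeLeft, bridgeRight, readChain, loadPoint, block, realArrs]
  · simp [sweepPiece, sweepPrep, sweepPush, pushPrep, locate, chainSearch, bsearch, pushLoop,
      pushStep, pushFirst, pushNext, pushInit, bridgeSearch, pushRead, pushEnd, bridgeStep,
      bridgeBoth, bridgeLeft, bridgeRight, readChain, loadPoint, block, natVars]

theorem nextEvent_frame {s s' : State} (h : Agree nextEvent s s') :
    (∀ a, a ≠ 4 → a ≠ 5 → s'.natArr a = s.natArr a) ∧ s'.realArr = s.realArr ∧
      s'.natVar 0 = s.natVar 0 ∧ s'.natVar 15 = s.natVar 15 := by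
  refine ⟨fun a ha ha' => h.natArr a ?_, funext fun a => h.realArr a ?_, h.natVar 0 ?_,
    h.natVar 15 ?_⟩
  · simp [nextEvent, setLeaf, climb, climbStep, block, natArrs, ha, ha']
  · simp [nextEvent, setLeaf, climb, climbStep, block, realArrs]
  · simp [nextEvent, setLeaf, climb, climbStep, block, natVars]
  · simp [nextEvent, setLeaf, climb, climbStep, block, natVars]

theorem sweepPush_spec (σ : ℚ) : ∃ K K', 0 < K ∧ ∀ (k : ℕ) (n : ℕ → ℕ) (V : ℕ → ℕ → Plane) (L N : ℕ → ℕ)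
    (s : State) (t e e' m : ℕ), Env σ k n V L N s → (∀ i < k, Nat.size (n i) ≤ m) →
    Stack k N (lowerPoint n V L) s → t < k → s.natVar 12 = t → s.natVar 14 ≤ N t + 1 →
    (∀ j ≤ N t, (s.natVar 13 ≤ j ↔ key (eventPoint (lowerPoint n V L) N e) ≤
        key (lowerPoint n V L t j)) ∧ (j < s.natVar 14 ↔ key (lowerPoint n V L t j) ≤
        key (eventPoint (lowerPoint n V L) N e'))) →
    (∀ x ∈ stackSet (lowerPoint n V L) s, ∀ y ∈ Scene.piece (lowerPoint n V L) N (t + 1) e e',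
      key x < key y) →
    Spends (sweepPush σ) s (fun s' => Stack k N (lowerPoint n V L) s' ∧
      stackSet (lowerPoint n V L) s' ⊆ stackSet (lowerPoint n V L) s ∪
        Scene.piece (lowerPoint n V L) N (t + 1) e e' ∧
      ∀ x ∈ stackSet (lowerPoint n V L) s ∪ Scene.piece (lowerPoint n V L) N (t + 1) e e',
        Above (stackSet (lowerPoint n V L) s') x)
      (fun s' => K * (m + 1) * s'.natVar 15) (K * (m + 1) * s.natVar 15 + K' * (m + 1)) := by
  obtain ⟨K, hK₀, hK⟩ := pushLoop_spec σ
  refine ⟨K, 3 * K + (pushPrep σ).time + 10, hK₀,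
    fun k n V L N s t e e' m h hm hS ht h12 h14 hpos hlt => ?_⟩
  set c := lowerPoint n V L with hc
  have hB₁ : (3 * K + (pushPrep σ).time + 10) * (m + 1) =
      3 * K * (m + 1) + (pushPrep σ).time * (m + 1) + 10 * (m + 1) := by ring
  have hB₂ : (pushPrep σ).time ≤ (pushPrep σ).time * (m + 1) :=
    Nat.le_mul_of_pos_right _ (by omega)
  have hB₃ : K * (m + 1) * (s.natVar 15 + 3) = K * (m + 1) * s.natVar 15 + 3 * K * (m + 1) := by
    ring
  set B := (3 * K + (pushPrep σ).time + 10) * (m + 1) with hB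
  have hpiece : Scene.piece c N (t + 1) e e' =
      {x | ∃ j ≤ N t, s.natVar 13 ≤ j ∧ j < s.natVar 14 ∧ x = c t j} := by
    ext x
    constructor
    · rintro ⟨t', j, ht', hj, rfl, h₁, h₂⟩
      obtain rfl : t' = t := by omega
      exact ⟨j, hj, (hpos j hj).1.2 h₁, (hpos j hj).2.2 h₂, rfl⟩
    · rintro ⟨j, hj, h₁, h₂, rfl⟩
      exact ⟨t, j, rfl, hj, rfl, (hpos j hj).1.1 h₁, (hpos j hj).2.1 h₂⟩
  have hcost : BExp.cost (.natLe (.var 14) (.var 13)) = 3 := rfl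
  rw [show K * (m + 1) * s.natVar 15 + B = 3 + (K * (m + 1) * s.natVar 15 + (B - 3)) by omega]
  refine Spends.ite (b := .natLe (.var 14) (.var 13)) (fun hc₁ => ?_) fun hc₁ => ?_
  · simp only [BExp.eval, NExp.eval] at hc₁
    have hempty : Scene.piece c N (t + 1) e e' = ∅ := by
      rw [hpiece, Set.eq_empty_iff_forall_notMem]
      rintro x ⟨j, -, h₁, h₂, -⟩
      omega
    refine .of_within (Within.of_vc (p := .skip) ⟨⟨hS, Set.subset_union_left, ?_⟩, ?_⟩)
    · rw [hempty, Set.union_empty]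
      exact fun x hx => .of_mem hx
    · simp only [time]; omega
  · simp only [BExp.eval, NExp.eval, not_le] at hc₁
    have harc : Scene.piece c N (t + 1) e e' =
        arcPoints (c t) (s.natVar 13) (s.natVar 14 - 1) := by
      rw [hpiece]
      ext x
      constructor
      · rintro ⟨j, -, h₁, h₂, rfl⟩
        exact ⟨j, h₁, by omega, rfl⟩
      · rintro ⟨j, h₁, h₂, rfl⟩
        exact ⟨j, by omega, h₁, by omega, rfl⟩
    have hprep : Within (pushPrep σ) (pushPrep σ).time s fun s' =>
        s'.realVar 9 = c t (s.natVar 13) 0 ∧ s'.natVar 14 = s.natVar 14 - 1 ∧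
        s'.natVar 16 = 0 := by
      refine Within.of_vc ?_
      simp only [pushPrep, block, vc]
      refine readChain_vc h (by omega) (by omega) (by simp only [NExp.eval, h12]; omega)
        fun a => ?_
      simp [State.setPoint, h12, hc]
    refine Spends.mono (Spends.seq (hprep.imp fun s₁ hA₁ ⟨r9, e14, e16⟩ => ?_)
      (Q := fun s' => Stack k N c s' ∧ stackSet c s' ⊆ stackSet c s ∪
        arcPoints (c t) (s.natVar 13) (s.natVar 14 - 1) ∧
        ∀ x ∈ stackSet c s ∪ arcPoints (c t) (s.natVar 13) (s.natVar 14 - 1),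
          Above (stackSet c s') x) (Φ := fun s' => K * (m + 1) * s'.natVar 15)
      (X := K * (m + 1) * (s.natVar 15 + 3))) (fun s' _ q => ⟨by rwa [harc], ?_⟩)
    · have na : s₁.natArr = s.natArr := funext fun a => hA₁.natArr a (by
        simp [pushPrep, readChain, loadPoint, block, natArrs])
      have ra : s₁.realArr = s.realArr := funext fun a => hA₁.realArr a (by
        simp [pushPrep, readChain, loadPoint, block, realArrs])
      have nv : ∀ x, x ≠ 7 → x ≠ 14 → x ≠ 16 → s₁.natVar x = s.natVar x := fun x h₁ h₂ h₃ =>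
        hA₁.natVar x (by simp [pushPrep, readChain, loadPoint, block, natVars, h₁, h₂, h₃])
      have n15 := nv 15 (by omega) (by omega) (by omega)
      have hset : stackSet c s₁ = stackSet c s := by rw [stackSet, stackSet, na, n15]
      have hst : Stack k N c s₁ := by rw [Stack, na, n15]; exact hS
      have := hK k n V L N s₁ t (s.natVar 13) (s.natVar 14 - 1) m
        (h.congr (nv 0 (by omega) (by omega) (by omega)) (fun _ _ => by rw [na])
          (fun _ _ => by rw [ra])) hm hst ht
        ((nv 12 (by omega) (by omega) (by omega)).trans h12) (nv 13 (by omega) (by omega)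
        (by omega)) e14 (by omega) (by omega) e16 r9 (fun x hx => hlt x (hset ▸ hx) _ (by
          rw [harc]; exact ⟨s.natVar 13, le_rfl, by omega, rfl⟩))
      rw [n15, ← hc, hset] at this
      exact this
    · omega

theorem sweepStep_spec (σ : ℚ) : ∃ K K', 0 < K ∧ ∀ (k : ℕ) (n : ℕ → ℕ) (V : ℕ → ℕ → Plane) (L N : ℕ → ℕ)
    (s : State) (R : Set ℕ) (m : ℕ), SweepState σ k n V L N R s → (∀ i < k, Nat.size (n i) ≤ m) →
    Nat.size (2 * k) ≤ m → 0 < k → s.natArr 4 1 ≠ 0 →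
    Spends (sweepStep σ) s (fun s' => ∃ e < 2 * k, e ∉ R ∧ SweepState σ k n V L N (insert e R) s')
      (fun s' => K * (m + 1) * s'.natVar 15) (K * (m + 1) * s.natVar 15 + K' * (m + 1)) := by
  obtain ⟨K, K', hK₀, hK⟩ := sweepPush_spec σ
  obtain ⟨K₁, hK₁⟩ := nextEvent_spec
  obtain ⟨K₂, hK₂⟩ := locate_spec σ
  refine ⟨K, K' + K₁ + K₂ + 40, hK₀, fun k n V L N s R m hs hm hm' hk hne => ?_⟩
  set c := lowerPoint n V L with hc
  have harith : K₁ * (m + 1) + (12 + (5 + (5 + (K₂ * (m + 1) + 1)) +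
      (K * (m + 1) * s.natVar 15 + K' * (m + 1)))) ≤
      K * (m + 1) * s.natVar 15 + (K' + K₁ + K₂ + 40) * (m + 1) := by
    simp only [Nat.add_mul]; omega
  rcases hs.trees.events.root_first hk with ⟨h₀, -⟩ | ⟨e, he, heR, hroot, hmin⟩
  · exact absurd h₀ hne
  suffices H : Spends (sweepStep σ) s (SweepState σ k n V L N (insert e R))
      (fun s' => K * (m + 1) * s'.natVar 15) (K₁ * (m + 1) + (12 + (5 + (5 + (K₂ * (m + 1) + 1)) +
      (K * (m + 1) * s.natVar 15 + K' * (m + 1))))) from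
    H.mono fun s' _ q => ⟨⟨e, he, heR, q⟩, Nat.add_le_add_left harith _⟩
  refine Spends.seq ?_
  refine (hK₁ σ k n V L N s R _ e hs.env hs.trees hs.sweep hroot he heR).mono
    (Nat.mul_le_mul_left _ (Nat.succ_le_succ hm')) fun s₁ hA₁ ⟨n10, ht₁⟩ => ?_
  rw [← hc] at ht₁
  obtain ⟨na₁, ra₁, nz₁, n15₁⟩ := nextEvent_frame hA₁
  have hE₁ : Env σ k n V L N s₁ := hs.env.congr nz₁ (fun a ha => na₁ a (by omega) (by omega))
    (fun _ _ => by rw [ra₁])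
  have hst₁ : Stack k N c s₁ := by
    rw [Stack, na₁ 6 (by omega) (by omega), na₁ 7 (by omega) (by omega),
      na₁ 8 (by omega) (by omega), n15₁]
    exact hs.stack
  have hset₁ : stackSet c s₁ = stackSet c s := by
    rw [stackSet, stackSet, na₁ 6 (by omega) (by omega), na₁ 7 (by omega) (by omega),
      na₁ 8 (by omega) (by omega), n15₁]
  have hS := hs.sweep
  rw [← hc, ← hset₁] at hS
  have hmain : Spends (sweepPiece σ) s₁ (fun s' => Stack k N c s' ∧
      Sweep k c N (insert e R) (stackSet c s')) (fun s' => K * (m + 1) * s'.natVar 15)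
      (12 + (5 + (5 + (K₂ * (m + 1) + 1)) + (K * (m + 1) * s.natVar 15 + K' * (m + 1)))) := by
    refine Spends.ite (b := .or (.natLe (.arr 4 (.const 1)) (.const 0))
      (.natLe (.arr 5 (.const 1)) (.const 0))) (fun hb => ?_) fun hb => ?_
    · simp only [BExp.or_eval, BExp.eval, NExp.eval, Nat.le_zero] at hb
      refine .of_within (Within.of_vc (p := .skip) ⟨⟨hst₁, ?_⟩, ?_⟩)
      -- Nothing is to be added when no event is left, or when no polygon is active; in the latter
      -- case the root is `0` and the piece is empty.
      · rcases ht₁.events.root_first hk with ⟨-, hall⟩ | ⟨e', he', heR', hroot', hmin'⟩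
        · exact hs.env.scene.sweep_last hS he heR hmin hall
        · have h5 : s₁.natArr 5 1 = 0 := hb.resolve_left (by omega)
          have hpe : Scene.piece c N (s₁.natArr 5 1) e e' = ∅ := by
            rw [Set.eq_empty_iff_forall_notMem]
            rintro x ⟨t, j, ht, -⟩
            omega
          refine hs.env.scene.sweep_step hS he heR hmin he' heR' hmin' ht₁.polys
            Set.subset_union_left fun x hx => ?_
          rw [← hc, hpe, Set.union_empty] at hx
          exact .of_mem hx
      · rw [n15₁]; simp only [time]; omega
    · simp only [BExp.or_eval, BExp.eval, NExp.eval, Nat.le_zero, not_or] at hb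
      rcases ht₁.events.root_first hk with ⟨h₀, -⟩ | ⟨e', he', heR', hroot', hmin'⟩
      · exact absurd h₀ hb.1
      rcases ht₁.polys.root_mem hk with h₀ | ⟨t, ht, -, hrt⟩
      · exact absurd h₀ hb.2
      refine Spends.seq ?_
      refine .cons ((Within.of_vc (p := .setNat 11 (.sub (.arr 4 (.const 1)) (.const 1)))
        (Q := fun s' => s' = s₁.setNat 11 e') (by simp [vc, hroot'])).imp fun s₂ _ e₂ => ?_)
      refine .cons ((Within.of_vc (p := .setNat 12 (.sub (.arr 5 (.const 1)) (.const 1)))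
        (Q := fun s' => s' = s₂.setNat 12 t) (by simp [vc, e₂, hrt])).imp fun s₃ _ e₃ => ?_)
      have nv₃ : ∀ x, x ≠ 11 → x ≠ 12 → s₃.natVar x = s₁.natVar x := fun x hx hx' => by
        rw [e₃, e₂]; simp [hx, hx']
      have e11 : s₃.natVar 11 = e' := by rw [e₃, e₂]; simp
      have e12 : s₃.natVar 12 = t := by rw [e₃]; simp
      have hE₃ : Env σ k n V L N s₃ := hE₁.congr (nv₃ 0 (by omega) (by omega))
        (fun _ _ => by rw [e₃, e₂]; rfl) (fun _ _ => by rw [e₃, e₂]; rfl)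
      refine .cons ((hK₂ k n V L N s₃ t e e' hE₃ e12 ht
        ((nv₃ 10 (by omega) (by omega)).trans n10) he e11 he').mono
        (Nat.mul_le_mul_left _ (Nat.succ_le_succ (hm t ht))) fun s₄ hA₄ ⟨h14, hpos⟩ => .nil ?_)
      obtain ⟨na₄, ra₄, nv₄⟩ := locate_frame hA₄
      have hE₄ : Env σ k n V L N s₄ := hE₃.congr (nv₄ 0 (by omega)) (fun _ _ => by rw [na₄])
        (fun _ _ => by rw [ra₄])
      have na₄' : s₄.natArr = s₁.natArr := by rw [na₄, e₃, e₂]; rfl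
      have n15₄ : s₄.natVar 15 = s₁.natVar 15 := by
        rw [nv₄ 15 (by omega), nv₃ 15 (by omega) (by omega)]
      have hst₄ : Stack k N c s₄ := by rw [Stack, na₄', n15₄]; exact hst₁
      have hset₄ : stackSet c s₄ = stackSet c s₁ := by rw [stackSet, stackSet, na₄', n15₄]
      have hpush := hK k n V L N s₄ t e e' m hE₄ hm hst₄ ht ((nv₄ 12 (by omega)).trans e12) h14
        hpos (by
          rw [← hc, hset₄, ← hrt]
          exact fun x hx y hy =>
            hs.env.scene.lt_of_mem_piece hS he heR ht₁.polys hx hy)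
      rw [n15₄, n15₁, ← hc, hset₄, ← hrt] at hpush
      exact hpush.mono fun s' _ ⟨q₁, q₂, q₃⟩ => ⟨⟨q₁, hs.env.scene.sweep_step hS he heR hmin he'
        heR' hmin' ht₁.polys q₂ q₃⟩, le_rfl⟩
  refine hmain.mono fun s' hA ⟨q₁, q₂⟩ => ⟨?_, le_rfl⟩
  obtain ⟨na, ra, nz⟩ := sweepPiece_frame hA
  refine ⟨hE₁.congr nz (fun a ha => na a (by omega)) (fun _ _ => by rw [ra]), ⟨?_, ?_⟩, q₁, q₂⟩
  · rw [na 4 (by omega)]; exact ht₁.events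
  · rw [na 5 (by omega)]; exact ht₁.polys

/-- The number of events that are still in the tree of events. -/
def eventsLeft (k : ℕ) (s : State) : ℕ :=
  ((Finset.range (2 * k)).filter fun i => s.natArr 4 (2 * k + i) ≠ 0).card

/-- The loop invariant hides the set `R`, so progress is measured by the leaves in the memory. -/
theorem eventsLeft_lt {k : ℕ} {c : ℕ → ℕ → Plane} {N : ℕ → ℕ} {R : Set ℕ} {s s' : State} {e : ℕ}
    (h : Trees k c N R s) (h' : Trees k c N (insert e R) s') (he : e < 2 * k) (heR : e ∉ R) :
    eventsLeft k s' < eventsLeft k s := by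
  refine Finset.card_lt_card (Finset.ssubset_iff_of_subset ?_ |>.2 ⟨e, ?_, ?_⟩)
  · intro i hi
    simp only [Finset.mem_filter, Finset.mem_range] at hi ⊢
    refine ⟨hi.1, ?_⟩
    by_cases hiR : i ∈ R
    · exact absurd ((h'.events.leaf i hi.1).2 fun hh => hh (Or.inr hiR)) hi.2
    · rw [(h.events.leaf i hi.1).1 hiR]; omega
  · simp only [Finset.mem_filter, Finset.mem_range]
    exact ⟨he, by rw [(h.events.leaf e he).1 heR]; omega⟩
  · simp only [Finset.mem_filter, Finset.mem_range, not_and, not_not]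
    exact fun _ => (h'.events.leaf e he).2 fun hh => hh (Set.mem_insert e R)

/-- Computes the lower hull. -/
def sweep (σ : ℚ) : Prog :=
  block [lowerSides σ, clearTrees, insertEvents, .setNat 15 (.const 0),
    .loop (.natLe (.const 1) (.arr 4 (.const 1))) (sweepStep σ)]

/-- The lower hull of all polygons is on the stack. -/
structure LowerHull (σ : ℚ) (k : ℕ) (n : ℕ → ℕ) (V : ℕ → ℕ → Plane) (L N : ℕ → ℕ) (s : State) :
    Prop where
  env : Env σ k n V L N s
  stack : Stack k N (lowerPoint n V L) s
  above : ∀ i < k, ∀ j < n i, Above (stackSet (lowerPoint n V L) s) (V i j)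
  mem : ∀ x ∈ stackSet (lowerPoint n V L) s, ∃ i < k, ∃ j < n i, x = V i j

/-- The height of the stack is bounded as well, because the summation of lengths takes time
proportional to it. -/
theorem sweep_spec (σ : ℚ) : ∃ K, ∀ (k : ℕ) (n : ℕ → ℕ) (V : ℕ → ℕ → Plane) (m : ℕ) (s : State),
    Input σ k n V s → (∀ i < k, Nat.size (n i) ≤ m) → Nat.size (2 * k) ≤ m → 0 < k →
    (∀ i < k, ∀ j < k, i ≠ j →
      Disjoint (convexHull ℝ (V i '' Set.Iio (n i))) (convexHull ℝ (V j '' Set.Iio (n j)))) →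
    Within (sweep σ) (K * ((k + 1) * (m + 1))) s fun s' =>
      ∃ L N, LowerHull σ k n V L N s' ∧ s'.natVar 15 ≤ K * ((k + 1) * (m + 1)) := by
  obtain ⟨K₁, hK₁⟩ := lowerSides_spec σ
  obtain ⟨K₂, hK₂⟩ := insertEvents_spec
  obtain ⟨K, K', hK₀, hK⟩ := sweepStep_spec σ
  refine ⟨K₁ + 160 + 2 * K₂ + 20 + 2 * (K' + 10), fun k n V m s h hm hm' hk hd => ?_⟩
  set X := (k + 1) * (m + 1) with hX
  have hX₁ : k + 1 ≤ X := Nat.le_mul_of_pos_right _ (by omega)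
  have hX₂ : (2 * k + 1) * (Nat.size (2 * k) + 1) ≤ 2 * X := by
    rw [hX, ← mul_assoc]; exact Nat.mul_le_mul (by omega) (by omega)
  have hX₃ : (K' + 10) * (m + 1) * (2 * k) ≤ 2 * (K' + 10) * X := by
    have : (K' + 10) * (m + 1) * (2 * k) ≤ (K' + 10) * (m + 1) * (2 * (k + 1)) :=
      Nat.mul_le_mul_left _ (by omega)
    refine this.trans (le_of_eq ?_)
    rw [hX]; ring
  suffices H : Within (sweep σ) (K₁ * X + (40 * (4 * k + 1) + (2 * K₂ * X + (2 +
      ((5 + (K' + 10) * (m + 1) * (2 * k)) + 1))))) s fun s' =>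
      ∃ L N, LowerHull σ k n V L N s' ∧ s'.natVar 15 ≤ 5 + (K' + 10) * (m + 1) * (2 * k) by
    refine H.mono ?_ fun s' _ ⟨L, N, h₁, h₂⟩ => ⟨L, N, h₁, h₂.trans ?_⟩ <;>
    · simp only [Nat.add_mul _ _ X]
      omega
  refine .cons ((hK₁ k n V m s h hm hd).imp fun s₁ _ hE₁ => ?_)
  generalize s₁.natArr 2 = L at hE₁
  generalize s₁.natArr 3 = N at hE₁
  refine .cons ((clearTrees_spec hE₁.input.count).imp fun s₂ hA₂ ⟨h4, h5⟩ => ?_)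
  have hE₂ : Env σ k n V L N s₂ := hE₁.agree hA₂ (by simp [clearTrees, block, natVars])
    (fun a ha => by simp [clearTrees, block, natArrs]; omega)
    (fun a ha => by simp [clearTrees, block, realArrs])
  refine .cons ((hK₂ σ k n V L N s₂ hE₂ h4).mono
    ((Nat.mul_le_mul_left _ hX₂).trans (le_of_eq (by ring))) fun s₃ hA₃ ht₃ => ?_)
  have hE₃ : Env σ k n V L N s₃ := hE₂.agree hA₃
    (by simp [insertEvents, setLeaf, climb, climbStep, block, natVars])
    (fun a ha => by simp [insertEvents, setLeaf, climb, climbStep, block, natArrs]; omega)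
    (fun a ha => by simp [insertEvents, setLeaf, climb, climbStep, block, realArrs])
  have h5' : s₃.natArr 5 = s₂.natArr 5 :=
    hA₃.natArr 5 (by simp [insertEvents, setLeaf, climb, climbStep, block, natArrs])
  refine .cons ((Within.of_vc (p := .setNat 15 (.const 0)) (Q := fun s' => s' = s₃.setNat 15 0)
    rfl).imp fun s₄ _ e₄ => ?_)
  have h15 : s₄.natVar 15 = 0 := by rw [e₄]; simp
  have hst : SweepState σ k n V L N ∅ s₄ := by
    refine ⟨hE₃.congr (by rw [e₄]; simp) (fun _ _ => by rw [e₄]; rfl) (fun _ _ => by rw [e₄]; rfl),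
      ⟨?_, ?_⟩, ?_, ?_⟩
    · rw [e₄]; exact ht₃
    · rw [e₄, setNat_natArr, h5']
      exact (isTree_zero _ _ (by intro i hi; exact h5 i (by omega))).congr (fun _ _ _ _ => Iff.rfl)
        (by simp [active])
    · rw [Stack, h15]
      exact ⟨by simp, by simp, by simp, by omega, by simp [ConvexChain, stackPoints]⟩
    · have : stackSet (lowerPoint n V L) s₄ = ∅ := by
        rw [stackSet, h15]; simp [stackPoints]
      rw [this]
      exact .empty _ _ _
  have hleft : eventsLeft k s₄ ≤ 2 * k := by
    refine (Finset.card_filter_le _ _).trans (by simp)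
  have hloop := Spends.loop (s := s₄) (b := .natLe (.const 1) (.arr 4 (.const 1)))
    (p := sweepStep σ) (fun s' => ∃ R, SweepState σ k n V L N R s')
    -- Each outstanding event holds the cost of its own step, with a surplus for the loop test, and
    -- each entry of the stack holds the credit for its removal.
    (fun s' => (K' + 10) * (m + 1) * eventsLeft k s' + K * (m + 1) * s'.natVar 15) ⟨_, hst⟩ (by
      rintro s' ⟨R, hs⟩ hb
      simp only [BExp.eval, NExp.eval] at hb
      have hcost : BExp.cost (.natLe (.const 1) (.arr 4 (.const 1))) = 4 := rfl
      refine (hK k n V L N s' R m hs hm hm' hk (by omega)).mono fun s'' _ ⟨e, he, heR, hs'⟩ =>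
        ⟨⟨_, hs'⟩, ?_⟩
      have hlt := eventsLeft_lt hs.trees hs'.trees he heR
      have h₁ : (K' + 10) * (m + 1) * (eventsLeft k s'' + 1) ≤
        (K' + 10) * (m + 1) * eventsLeft k s' := Nat.mul_le_mul_left _ hlt
      have h₂ : (K' + 10) * (m + 1) * (eventsLeft k s'' + 1) =
        (K' + 10) * (m + 1) * eventsLeft k s'' + K' * (m + 1) + 10 * (m + 1) := by ring
      rw [hcost]
      omega)
  have hΦ : (K' + 10) * (m + 1) * eventsLeft k s₄ + K * (m + 1) * s₄.natVar 15 ≤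
      (K' + 10) * (m + 1) * (2 * k) := by
    rw [h15, Nat.mul_zero, Nat.add_zero]; exact Nat.mul_le_mul_left _ hleft
  obtain ⟨t, s₅, he, ⟨⟨R, hs⟩, hb⟩, hle⟩ := hloop
  have hcost : BExp.cost (.natLe (.const 1) (.arr 4 (.const 1))) = 4 := rfl
  simp only [hcost] at hle
  refine .cons ⟨t, s₅, he, by omega, .nil ⟨L, N, ⟨hs.env, hs.stack, ?_, ?_⟩, ?_⟩⟩
  · simp only [BExp.eval, NExp.eval] at hb
    rcases hs.trees.events.root_first hk with ⟨-, hall⟩ | ⟨e, he, heR, hroot, -⟩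
    · exact fun i hi j hj => hs.env.scene.above_of_sweep hs.sweep hall hi hj
    · omega
  · intro x hx
    obtain ⟨A, hA, j, hj, rfl, -⟩ := hs.sweep.found x hx
    exact ⟨A, hA, _, Nat.mod_lt _ (hs.env.scene.chain A hA).cycle.pos, rfl⟩
  -- The potential that remains at the end is part of the time bound and dominates the height of the
  -- stack.
  · have : s₅.natVar 15 ≤ K * (m + 1) * s₅.natVar 15 :=
      Nat.le_mul_of_pos_left _ (Nat.mul_pos hK₀ (by omega))
    omega

end RealRAM


/-! ## The length of the lower hull -/

namespace RealRAM

open Prog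

/-- Distance of two points that are stored in variables. -/
def distVars (i j : ℕ) : RExp :=
  .sqrt (.add (.mul (.sub (.var (2 * i + 1)) (.var (2 * j + 1)))
      (.sub (.var (2 * i + 1)) (.var (2 * j + 1))))
    (.mul (.sub (.var (2 * i + 2)) (.var (2 * j + 2)))
      (.sub (.var (2 * i + 2)) (.var (2 * j + 2)))))

theorem distVars_eval (s : State) (i j : ℕ) :
    (distVars i j).eval s = dist (s.point i) (s.point j) := by
  simp [distVars, RExp.eval, EuclideanSpace.dist_eq, State.point, Real.dist_eq, sq]

/-- Computes in `realVar x` the length of the first `j` edges of the lower side of polygon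
`natVar t`, plus a constant. -/
def loadLength (σ : ℚ) (t : ℕ) (j : NExp) (x : ℕ) : Prog :=
  block [.setNat 37 (.add (.arr 2 (.var t)) j),
    .ite (.natLe (.arr 0 (.var t)) (.var 37))
      (block [.setNat 7 (.sub (.arr 0 (.var t)) (.const 1)), loadPoint σ t 0,
        .setNat 7 (.const 0), loadPoint σ t 1,
        .setReal x (.add (.arr 2 (.sub (.add (.arr 1 (.var t)) (.var 37)) (.arr 0 (.var t))))
          (.add (.arr 2 (.add (.arr 1 (.var t)) (.sub (.arr 0 (.var t)) (.const 1))))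
            (distVars 0 1)))])
      (.setReal x (.arr 2 (.add (.arr 1 (.var t)) (.var 37))))]

/-- Computes in `realVar 13` the length of the bridge that ends at entry `natVar 34` of the stack. -/
def loadBridge (σ : ℚ) : Prog :=
  .ite (.natLe (.const 1) (.var 34))
    (block [.setNat 36 (.arr 6 (.sub (.var 34) (.const 1))),
      readChain σ 36 (.arr 8 (.sub (.var 34) (.const 1))) 0,
      readChain σ 35 (.arr 7 (.var 34)) 1, .setReal 13 (distVars 0 1)])
    (.setReal 13 (.const 0))

/-- Adds the lengths of the arc in entry `natVar 34` of the stack and of the bridge to it. -/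
def sumStep (σ : ℚ) : Prog :=
  block [.setNat 35 (.arr 6 (.var 34)), loadLength σ 35 (.arr 8 (.var 34)) 11,
    loadLength σ 35 (.arr 7 (.var 34)) 12, loadBridge σ,
    .setReal 10 (.add (.add (.var 10) (.sub (.var 11) (.var 12))) (.var 13)),
    .setNat 34 (.add (.var 34) (.const 1))]

/-- Computes in `realVar 10` the length of the lower hull. -/
def sumLoop (σ : ℚ) : Prog :=
  block [.setNat 34 (.const 0), .setReal 10 (.const 0),
    .loop (.not (.natLe (.var 15) (.var 34))) (sumStep σ)]

section

variable {σ : ℚ} {k : ℕ} {n : ℕ → ℕ} {V : ℕ → ℕ → Plane} {L N : ℕ → ℕ} {s s' : State}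

theorem loadPoint_vc (h : Input σ k n V s) {t i j : ℕ} (ht : s.natVar t < k)
    (hj : s.natVar 7 = j) (hjn : j < n (s.natVar t)) {Q : State → Prop}
    (hQ : ∀ a, Q ((s.setNat 7 a).setPoint i (V (s.natVar t) j))) :
    (loadPoint σ t i).vc Q s := by
  simp only [loadPoint, block, vc, NExp.eval, RExp.eval, setNat_natVar, hj,
    setNat_realArr, if_true, setReal_natVar, setReal_realArr, h.xCoord _ ht _ hjn,
    h.yCoord _ ht _ hjn]
  exact hQ _

/-- Beyond the end of the array the perimeter is added. It is not stored as such, so it is obtained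
from the length up to the last vertex and the closing edge, at the price of one square root. -/
theorem loadLength_spec (h : Env σ k n V L N s) {t x : ℕ} {j : NExp} (h7 : t ≠ 7) (h37 : t ≠ 37)
    (ht : s.natVar t < k) (hj : j.eval s ≤ N (s.natVar t)) :
    Within (loadLength σ t j x) (loadLength σ t j x).time s fun s' => s'.realVar x =
      chainLength (n (s.natVar t)) (V (s.natVar t)) (L (s.natVar t)) (j.eval s) := by
  refine Within.of_vc ?_
  have hc := h.scene.chain _ ht
  have hL := hc.left_lt
  have hN := hc.length_lt
  simp only [loadLength, block, vc, NExp.eval, BExp.eval, setNat_natVar, setNat_natArr, if_neg h37,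
    if_true, h.left _ ht, h.input.size _ ht, chainLength]
  constructor
  · intro hle
    refine loadPoint_vc (j := n (s.natVar t) - 1) (h.input.congr (by simp) (by simp) (by simp)
      (by simp) (by simp) (by simp)) (by simpa [h7, h37]) (by simp)
      (by simp [h7, h37]; omega) fun a => ?_
    refine loadPoint_vc (j := 0) (h.input.congr (by simp) (by simp) (by simp)
      (by simp) (by simp) (by simp)) (by simpa [h7, h37]) (by simp)
      (by simp [h7, h37]; omega) fun a' => ?_
    have e : s.natArr 1 (s.natVar t) + (L (s.natVar t) + j.eval s) - n (s.natVar t) =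
      s.natArr 1 (s.natVar t) + (L (s.natVar t) + j.eval s - n (s.natVar t)) := by omega
    rw [if_neg (by omega)]
    simp [RExp.eval, NExp.eval, distVars_eval, setNat_point, h7, h37, h.input.size _ ht, e,
      h.input.boundary _ ht _ (show L (s.natVar t) + j.eval s - n (s.natVar t) < _ by omega),
      h.input.boundary _ ht _ (show n (s.natVar t) - 1 < _ by omega)]
  · intro hle
    rw [if_pos (by omega)]
    simp [RExp.eval, NExp.eval, h37, h.input.boundary _ ht _ (not_le.1 hle)]

theorem loadBridge_spec (h : Env σ k n V L N s) {j : ℕ} (h34 : s.natVar 34 = j)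
    (h35 : s.natVar 35 = s.natArr 6 j) (ht : s.natArr 6 j < k)
    (hlo : s.natArr 7 j ≤ N (s.natArr 6 j))
    (hprev : 0 < j → s.natArr 6 (j - 1) < k ∧ s.natArr 8 (j - 1) ≤ N (s.natArr 6 (j - 1))) :
    Within (loadBridge σ) (loadBridge σ).time s fun s' => s'.realVar 13 = if j = 0 then 0 else
      dist (lowerPoint n V L (s.natArr 6 (j - 1)) (s.natArr 8 (j - 1)))
        (lowerPoint n V L (s.natArr 6 j) (s.natArr 7 j)) := by
  refine Within.of_vc ?_
  simp only [loadBridge, block, vc, BExp.eval, NExp.eval, h34]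
  refine ⟨fun hj => ?_, fun hj => ?_⟩
  · obtain ⟨hp₁, hp₂⟩ := hprev (by omega)
    have envc : ∀ s' : State, s'.natVar 0 = s.natVar 0 → s'.natArr = s.natArr →
        s'.realArr = s.realArr → Env σ k n V L N s' := fun s' e₁ e₂ e₃ =>
      h.congr e₁ (fun _ _ => by rw [e₂]) (fun _ _ => by rw [e₃])
    refine readChain_vc (envc _ (by simp) (by simp) (by simp)) (by omega) (by simpa [h34])
      (by simpa [h34, NExp.eval]) fun a₁ => ?_
    refine readChain_vc (envc _ (by simp) (by simp) (by simp)) (by omega)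
      (by simpa [h34, h35]) (by simpa [h34, h35, NExp.eval]) fun a₂ => ?_
    simp [distVars_eval, setNat_point, NExp.eval, h34, h35, show j ≠ 0 by omega]
  · simp [RExp.eval, show j = 0 by omega]

theorem sumStep_frame (h : Agree (sumStep σ) s s') :
    s'.natArr = s.natArr ∧ s'.realArr = s.realArr ∧
      (∀ x, x < 34 → x ≠ 7 → s'.natVar x = s.natVar x) := by
  refine ⟨funext fun a => h.natArr a ?_, funext fun a => h.realArr a ?_,
    fun x hx hx' => h.natVar x ?_⟩
  · simp [sumStep, loadLength, loadBridge, readChain, loadPoint, block, natArrs]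
  · simp [sumStep, loadLength, loadBridge, readChain, loadPoint, block, realArrs]
  · simp [sumStep, loadLength, loadBridge, readChain, loadPoint, block, natVars]
    omega

/-- The length of the part of the lower hull in the first `j` entries of the stack. -/
noncomputable def hullLength (n : ℕ → ℕ) (V : ℕ → ℕ → Plane) (L : ℕ → ℕ) (s : State) (j : ℕ) : ℝ :=
  stackLength (lowerPoint n V L) (fun t i => chainLength (n t) (V t) (L t) i) (s.natArr 6)
    (s.natArr 7) (s.natArr 8) j

theorem sumStep_spec (h : Env σ k n V L N s) (hS : Stack k N (lowerPoint n V L) s) {j : ℕ}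
    (hj : s.natVar 34 = j) (hjs : j < s.natVar 15) (hsum : s.realVar 10 = hullLength n V L s j) :
    Within (sumStep σ) ((sumStep σ).time + 6) s fun s' => s'.natVar 34 = j + 1 ∧
      s'.realVar 10 = hullLength n V L s (j + 1) := by
  have hT := hS.poly_lt j hjs
  have hlo := (hS.lo_le j hjs).trans (hS.hi_le j hjs)
  have hhi := hS.hi_le j hjs
  refine Within.mono (T := 3 + ((loadLength σ 35 (.arr 8 (.var 34)) 11).time +
    ((loadLength σ 35 (.arr 7 (.var 34)) 12).time + ((loadBridge σ).time + (8 + (4 + 1)))))) ?_ ?_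
    fun s' _ h => h
  swap
  · simp [sumStep, block, time, NExp.cost, RExp.cost]
  refine .cons ((Within.of_vc (p := .setNat 35 (.arr 6 (.var 34)))
    (Q := fun s' => s' = s.setNat 35 (s.natArr 6 j)) (by simp [vc, NExp.eval, hj])).imp
    fun s₁ _ e₁ => ?_)
  have hE₁ : Env σ k n V L N s₁ :=
    h.congr (by rw [e₁]; simp) (fun _ _ => by rw [e₁]; rfl) (fun _ _ => by rw [e₁]; rfl)
  have na₁ : s₁.natArr = s.natArr := by rw [e₁]; rfl
  have h35 : s₁.natVar 35 = s.natArr 6 j := by rw [e₁]; simp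
  have h34 : s₁.natVar 34 = j := by rw [e₁]; simp [hj]
  have h10 : s₁.realVar 10 = s.realVar 10 := by rw [e₁]; simp
  refine .cons ((loadLength_spec hE₁ (by omega) (by omega) (by rw [h35]; exact hT)
    (by simpa [NExp.eval, h34, h35, na₁])).imp fun s₂ hA₂ e₂ => ?_)
  simp only [NExp.eval, h34, h35, na₁] at e₂
  have na₂ : s₂.natArr = s.natArr := by
    rw [← na₁]
    exact funext fun a => hA₂.natArr a (by simp [loadLength, loadPoint, block, natArrs])
  have ra₂ : s₂.realArr = s₁.realArr :=
    funext fun a => hA₂.realArr a (by simp [loadLength, loadPoint, block, realArrs])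
  have nv₂ : ∀ x, x ≠ 7 → x ≠ 37 → s₂.natVar x = s₁.natVar x := fun x h₁ h₂ =>
    hA₂.natVar x (by simp [loadLength, loadPoint, block, natVars]; omega)
  have hE₂ : Env σ k n V L N s₂ :=
    hE₁.congr (nv₂ 0 (by omega) (by omega)) (fun _ _ => by rw [na₂, na₁]) (fun _ _ => by rw [ra₂])
  have h35' : s₂.natVar 35 = s.natArr 6 j := by rw [nv₂ 35 (by omega) (by omega), h35]
  have h34' : s₂.natVar 34 = j := by rw [nv₂ 34 (by omega) (by omega), h34]
  have h10' : s₂.realVar 10 = s.realVar 10 := by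
    rw [hA₂.realVar 10 (by simp [loadLength, loadPoint, block, realVars]), h10]
  refine .cons ((loadLength_spec hE₂ (by omega) (by omega) (by rw [h35']; exact hT)
    (by simpa [NExp.eval, h34', h35', na₂])).imp fun s₃ hA₃ e₃ => ?_)
  simp only [NExp.eval, h34', h35', na₂] at e₃
  have na₃ : s₃.natArr = s.natArr := by
    rw [← na₂]
    exact funext fun a => hA₃.natArr a (by simp [loadLength, loadPoint, block, natArrs])
  have ra₃ : s₃.realArr = s₂.realArr :=
    funext fun a => hA₃.realArr a (by simp [loadLength, loadPoint, block, realArrs])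
  have nv₃ : ∀ x, x ≠ 7 → x ≠ 37 → s₃.natVar x = s₂.natVar x := fun x h₁ h₂ =>
    hA₃.natVar x (by simp [loadLength, loadPoint, block, natVars]; omega)
  have hE₃ : Env σ k n V L N s₃ :=
    hE₂.congr (nv₃ 0 (by omega) (by omega)) (fun _ _ => by rw [na₃, na₂]) (fun _ _ => by rw [ra₃])
  have h35'' : s₃.natVar 35 = s.natArr 6 j := by rw [nv₃ 35 (by omega) (by omega), h35']
  have h34'' : s₃.natVar 34 = j := by rw [nv₃ 34 (by omega) (by omega), h34']
  have h10'' : s₃.realVar 10 = s.realVar 10 := by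
    rw [hA₃.realVar 10 (by simp [loadLength, loadPoint, block, realVars]), h10']
  have h11 : s₃.realVar 11 = s₂.realVar 11 :=
    hA₃.realVar 11 (by simp [loadLength, loadPoint, block, realVars])
  refine .cons ((loadBridge_spec hE₃ h34'' (by rw [h35'', na₃]) (by rw [na₃]; exact hT)
    (by rw [na₃]; exact hlo) (fun hj₀ => by
      rw [na₃]
      exact ⟨hS.poly_lt _ (by omega), hS.hi_le _ (by omega)⟩)).imp fun s₄ hA₄ e₄ => ?_)
  rw [na₃] at e₄
  have h34₄ : s₄.natVar 34 = j := by
    rw [hA₄.natVar 34 (by simp [loadBridge, readChain, loadPoint, block, natVars]), h34'']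
  have rv₄ : ∀ x, 9 < x → x < 13 → s₄.realVar x = s₃.realVar x := fun x h₁ h₂ =>
    hA₄.realVar x (by simp [loadBridge, readChain, loadPoint, block, realVars]; omega)
  refine .of_vc (p := block [_, _]) ?_
  simp only [block, vc, RExp.eval, NExp.eval, rv₄ 10 (by omega) (by omega),
    rv₄ 11 (by omega) (by omega), rv₄ 12 (by omega) (by omega), e₄, e₃, h11, e₂, h10'', hsum]
  simp [h34₄, hullLength, stackLength]

theorem sumLoop_spec (σ : ℚ) : ∃ K, ∀ (k : ℕ) (n : ℕ → ℕ) (V : ℕ → ℕ → Plane) (L N : ℕ → ℕ)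
    (s : State), Env σ k n V L N s → Stack k N (lowerPoint n V L) s →
    Within (sumLoop σ) (K * (s.natVar 15 + 1)) s fun s' =>
      s'.realVar 10 = hullLength n V L s (s.natVar 15) := by
  refine ⟨(sumStep σ).time + 20, fun k n V L N s h hS => ?_⟩
  have hcost : BExp.cost (.not (.natLe (.var 15) (.var 34))) = 4 := rfl
  refine Within.mono (T := 2 + (2 + ((4 + ((sumStep σ).time + 6)) * (s.natVar 15 + 1) + 1))) ?_ ?_
    fun s' _ h => h
  swap
  · simp only [Nat.add_mul, Nat.mul_add]; omega
  refine .cons ((Within.of_vc (p := .setNat 34 (.const 0)) (Q := fun s' => s' = s.setNat 34 0)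
    rfl).imp fun s₁ _ e₁ => ?_)
  refine .cons ((Within.of_vc (p := .setReal 10 (.const 0)) (Q := fun s' => s' = s₁.setReal 10 0)
    (by simp [vc, RExp.eval])).imp fun s₂ _ e₂ => ?_)
  have h34 : s₂.natVar 34 = 0 := by rw [e₂, e₁]; simp
  have h15 : s₂.natVar 15 = s.natVar 15 := by rw [e₂, e₁]; simp
  have hloop := Within.loop_of_le (b := .not (.natLe (.var 15) (.var 34))) (p := sumStep σ) (s := s₂)
    (fun s' => s'.natArr = s.natArr ∧ s'.realArr = s.realArr ∧ s'.natVar 0 = s.natVar 0 ∧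
      s'.natVar 15 = s.natVar 15 ∧ s'.natVar 34 ≤ s.natVar 15 ∧
      s'.realVar 10 = hullLength n V L s (s'.natVar 34))
    (fun s' => s'.natVar 15 - s'.natVar 34) ((sumStep σ).time + 6)
    ⟨by rw [e₂, e₁]; rfl, by rw [e₂, e₁]; rfl, by rw [e₂, e₁]; simp, h15, by omega, by
      rw [h34, e₂]; simp [hullLength, stackLength]⟩ (by
      rintro s' ⟨i₁, i₂, i₃, i₄, i₅, i₆⟩ hb
      simp only [BExp.eval, NExp.eval, not_le] at hb
      have hE : Env σ k n V L N s' :=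
        h.congr i₃ (fun _ _ => by rw [i₁]) (fun _ _ => by rw [i₂])
      have hS' : Stack k N (lowerPoint n V L) s' := by unfold Stack; rw [i₁, i₄]; exact hS
      have e : ∀ j, hullLength n V L s' j = hullLength n V L s j := fun j => by
        unfold hullLength; rw [i₁]
      refine (sumStep_spec hE hS' rfl hb (by rw [e, i₆])).imp fun s'' hA ⟨q₁, q₂⟩ => ?_
      obtain ⟨f₁, f₂, f₃⟩ := sumStep_frame hA
      have := f₃ 15 (by omega) (by omega)
      refine ⟨⟨f₁.trans i₁, f₂.trans i₂, (f₃ 0 (by omega) (by omega)).trans i₃, by omega, by omega,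
        by rw [q₂, q₁, e]⟩, by omega⟩)
  rw [hcost, h15, h34, Nat.sub_zero] at hloop
  refine .cons (hloop.imp fun s₃ _ ⟨⟨_, _, _, i₄, i₅, i₆⟩, hb⟩ => .nil ?_)
  simp only [BExp.eval, NExp.eval, not_not] at hb
  rw [i₆, show s₃.natVar 34 = s.natVar 15 by omega]

end

/-- Computes in `realVar 10` the length of the lower hull of the polygons. -/
def lowerLength (σ : ℚ) : Prog := block [sweep σ, sumLoop σ]

/-- The result is phrased by an abstract arc, free of memory layout, so that the runs for both
scales can be combined geometrically. -/
theorem lowerLength_spec (σ : ℚ) : ∃ K, ∀ (k : ℕ) (n : ℕ → ℕ) (V : ℕ → ℕ → Plane) (m : ℕ)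
    (s : State), Input σ k n V s → (∀ i < k, Nat.size (n i) ≤ m) → Nat.size (2 * k) ≤ m → 0 < k →
    (∀ i < k, ∀ j < k, i ≠ j →
      Disjoint (convexHull ℝ (V i '' Set.Iio (n i))) (convexHull ℝ (V j '' Set.Iio (n j)))) →
    Within (lowerLength σ) (K * ((k + 1) * (m + 1))) s fun s' => ∃ (a : ℕ → Plane) (p : ℕ),
      IsArc a 0 p ∧ (∀ i ≤ p, ∃ t < k, ∃ j < n t, a i = V t j) ∧
      (∀ t < k, ∀ j < n t, Above (arcPoints a 0 p) (V t j)) ∧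
      s'.realVar 10 = ∑ i ∈ Finset.range p, dist (a i) (a (i + 1)) := by
  obtain ⟨K₁, hK₁⟩ := sweep_spec σ
  obtain ⟨K₂, hK₂⟩ := sumLoop_spec σ
  refine ⟨K₁ + K₂ * (K₁ + 1) + 1, fun k n V m s h hm hm' hk hd => ?_⟩
  set X := (k + 1) * (m + 1) with hX
  have hX₁ : 1 ≤ X := Nat.mul_pos (by omega) (by omega)
  have hX₂ : K₂ * (K₁ * X + 1) ≤ K₂ * ((K₁ + 1) * X) := by
    refine Nat.mul_le_mul_left _ ?_
    rw [Nat.add_mul]; omega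
  refine Within.mono (T := K₁ * X + (K₂ * (K₁ * X + 1) + 1)) ?_ ?_ fun s' _ h => h
  swap
  · rw [Nat.add_mul, Nat.add_mul, mul_assoc]; omega
  refine .cons ((hK₁ k n V m s h hm hm' hk hd).imp fun s₁ _ ⟨L, N, hH, hsp⟩ => ?_)
  refine .cons ((hK₂ k n V L N s₁ hH.env hH.stack).mono
    (Nat.mul_le_mul_left _ (Nat.add_le_add_right hsp 1)) fun s₂ _ e₂ => .nil ?_)
  have hn := (h.cycle 0 hk).pos
  -- Vertex `0` of polygon `0` lies above the points on the stack, so there are such points.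
  obtain ⟨sp, hsp₁⟩ : ∃ sp, s₁.natVar 15 = sp + 1 := by
    refine Nat.exists_eq_succ_of_ne_zero fun h₀ => ?_
    have := hH.above 0 hk 0 hn
    rw [stackSet, h₀] at this
    simp [stackPoints, Above] at this
  have hS := hH.stack
  have hmem := hH.mem
  have habove := hH.above
  unfold Stack at hS
  unfold stackSet at hmem habove
  rw [hsp₁] at hS hmem habove
  obtain ⟨a, p, ha, hp, hl⟩ := hS.exists_arc
    (len := fun t i => chainLength (n t) (V t) (L t) i) hH.env.scene.isArc (fun t ht i hi => by
      have hc := hH.env.scene.chain t ht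
      exact chainLength_succ hc.left_lt (by have := hc.length_lt; omega))
  refine ⟨a, p, ha, fun i hi => hmem _ ?_, fun t ht j hj => ?_, ?_⟩
  · rw [← hp]
    exact ⟨i, Nat.zero_le _, hi, rfl⟩
  · rw [hp]; exact habove t ht j hj
  · rw [e₂, hsp₁, hullLength, hl]

set_option maxRecDepth 4000 in
theorem lowerLength_frame {σ : ℚ} {s s' : State} (h : Agree (lowerLength σ) s s') :
    s'.natVar 0 = s.natVar 0 ∧ (∀ a ≤ 1, s'.natArr a = s.natArr a) ∧
      (∀ a ≤ 2, s'.realArr a = s.realArr a) ∧ s'.realVar 14 = s.realVar 14 := by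
  refine ⟨h.natVar 0 ?_, fun a ha => h.natArr a ?_, fun a ha => h.realArr a ?_, h.realVar 14 ?_⟩
  · simp [lowerLength, sweep, lowerSides, lowerSide, leastVertex, leastInit, leastPre, saveLeft,
      saveRight, readVertex, clearTrees, insertEvents, sweepStep, nextEvent, setLeaf, climb, climbStep,
      sweepPiece, sweepPrep, sweepPush, pushPrep, locate, chainSearch, bsearch, pushLoop,
      pushStep, pushFirst, pushNext, pushInit, bridgeSearch, pushRead, pushEnd, bridgeStep,
      bridgeBoth, bridgeLeft, bridgeRight, sumLoop, sumStep, loadLength, loadBridge, readChain,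
      loadPoint, block, natVars]
  · simp [lowerLength, sweep, lowerSides, lowerSide, leastVertex, leastInit, leastPre, saveLeft,
      saveRight, readVertex, clearTrees, insertEvents, sweepStep, nextEvent, setLeaf, climb, climbStep,
      sweepPiece, sweepPrep, sweepPush, pushPrep, locate, chainSearch, bsearch, pushLoop,
      pushStep, pushFirst, pushNext, pushInit, bridgeSearch, pushRead, pushEnd, bridgeStep,
      bridgeBoth, bridgeLeft, bridgeRight, sumLoop, sumStep, loadLength, loadBridge, readChain,
      loadPoint, block, natArrs]
    omega
  · simp [lowerLength, sweep, lowerSides, lowerSide, leastVertex, leastInit, leastPre, saveLeft,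
      saveRight, readVertex, clearTrees, insertEvents, sweepStep, nextEvent, setLeaf, climb, climbStep,
      sweepPiece, sweepPrep, sweepPush, pushPrep, locate, chainSearch, bsearch, pushLoop,
      pushStep, pushFirst, pushNext, pushInit, bridgeSearch, pushRead, pushEnd, bridgeStep,
      bridgeBoth, bridgeLeft, bridgeRight, sumLoop, sumStep, loadLength, loadBridge, readChain,
      loadPoint, block, realArrs]
    omega
  · simp [lowerLength, sweep, lowerSides, lowerSide, leastVertex, leastInit, leastPre, saveLeft,
      saveRight, readVertex, clearTrees, insertEvents, sweepStep, nextEvent, setLeaf, climb, climbStep,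
      sweepPiece, sweepPrep, sweepPush, pushPrep, locate, chainSearch, bsearch, pushLoop,
      pushStep, pushFirst, pushNext, pushInit, bridgeSearch, pushRead, pushEnd, bridgeStep,
      bridgeBoth, bridgeLeft, bridgeRight, sumLoop, sumStep, loadLength, loadBridge, readChain,
      loadPoint, block, realVars]

end RealRAM


/-! ## The perimeter of the convex hull -/

theorem prefixLength_eq {n : ℕ} {v : Fin n → Plane} {c : ℕ → Plane} (h : ∀ j : Fin n, c j = v j)
    (i : Fin n) : prefixLength v i = boundaryLength n c i := by
  refine Finset.sum_nbij (fun j => (j : ℕ)) (fun j hj => ?_) (fun _ _ _ _ e => Fin.ext e)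
    (fun j hj => ?_) fun j _ => ?_
  · simpa using hj
  · have hj' : j < i := by simpa using hj
    exact ⟨⟨j, hj'.trans i.2⟩, by simpa [Fin.lt_def] using hj', rfl⟩
  · rw [edgeLength, ← h, ← h, val_finRotate]

theorem IsConvexPolygon.convexCycle {n : ℕ} {v : Fin n → Plane} (hv : IsConvexPolygon v)
    {c : ℕ → Plane} (h : ∀ j : Fin n, c j = v j) : ConvexCycle n c where
  pos := hv.pos
  inj {i j} hi hj e := by
    rw [h ⟨i, hi⟩, h ⟨j, hj⟩] at e
    exact congrArg Fin.val (hv.injective e)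
  ccw {i j l} hij hjl hl := by
    have := hv.ccw ⟨i, by omega⟩ ⟨j, by omega⟩ ⟨l, hl⟩ hij hjl
    rwa [← h, ← h, ← h] at this

theorem region_eq {n : ℕ} {v : Fin n → Plane} {c : ℕ → Plane} (h : ∀ j : Fin n, c j = v j) :
    region v = convexHull ℝ (c '' Set.Iio n) := by
  rw [region]
  congr 1
  ext x
  constructor
  · rintro ⟨j, rfl⟩
    exact ⟨j, j.2, h j⟩
  · rintro ⟨j, hj, rfl⟩
    exact ⟨⟨j, hj⟩, (h ⟨j, hj⟩).symm⟩

/-- A dependent family of finite sequences, as a family of infinite sequences. -/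
theorem exists_extension {k : ℕ} {n : Fin k → ℕ} (v : (i : Fin k) → Fin (n i) → Plane) :
    ∃ (n' : ℕ → ℕ) (V : ℕ → ℕ → Plane),
      (∀ i : Fin k, n' i = n i) ∧ ∀ (i : Fin k) (j : Fin (n i)), V i j = v i j :=
  ⟨fun i => if h : i < k then n ⟨i, h⟩ else 0,
    fun i j => if h : i < k then if h' : j < n ⟨i, h⟩ then v ⟨i, h⟩ ⟨j, h'⟩ else 0 else 0,
    fun i => by simp, fun i j => by simp⟩

theorem Stores.input {s : RealRAM.State} {k : ℕ} {n : Fin k → ℕ} {v : (i : Fin k) → Fin (n i) → Plane}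
    (h : Stores s v) (hv : ∀ i, IsConvexPolygon (v i)) {n' : ℕ → ℕ} {V : ℕ → ℕ → Plane}
    (hn : ∀ i : Fin k, n' i = n i) (hV : ∀ (i : Fin k) (j : Fin (n i)), V i j = v i j) :
    RealRAM.Input 1 k n' V s where
  count := h.count
  size i hi := (h.size ⟨i, hi⟩).trans (hn ⟨i, hi⟩).symm
  xCoord i hi j hj := by
    have e := hn ⟨i, hi⟩
    rw [Rat.cast_one, one_mul, hV ⟨i, hi⟩ ⟨j, e ▸ hj⟩]
    exact h.xCoord ⟨i, hi⟩ ⟨j, e ▸ hj⟩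
  yCoord i hi j hj := by
    have e := hn ⟨i, hi⟩
    rw [Rat.cast_one, one_mul, hV ⟨i, hi⟩ ⟨j, e ▸ hj⟩]
    exact h.yCoord ⟨i, hi⟩ ⟨j, e ▸ hj⟩
  boundary i hi j hj := by
    have e := hn ⟨i, hi⟩
    rw [show n' i = n ⟨i, hi⟩ from e, ← prefixLength_eq (hV ⟨i, hi⟩) ⟨j, e ▸ hj⟩]
    exact h.boundary ⟨i, hi⟩ ⟨j, e ▸ hj⟩
  cycle i hi := by
    rw [show n' i = n ⟨i, hi⟩ from hn ⟨i, hi⟩]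
    exact (hv ⟨i, hi⟩).convexCycle (hV ⟨i, hi⟩)

/-- If `2 * m` has `a + 1` binary digits, then `(a + 2) * log 2 ≤ 3 * log 2 + log m`, which is at
most `4 * log m` because `m ≥ 2`. -/
theorem size_two_mul_le {m : ℕ} (hm : 2 ≤ m) :
    ((Nat.size (2 * m) + 1 : ℕ) : ℝ) ≤ 4 / Real.log 2 * Real.log m := by
  have h2 : 0 < Real.log 2 := Real.log_pos one_lt_two
  have hlog : Real.log 2 ≤ Real.log m := Real.log_le_log two_pos (by exact_mod_cast hm)
  obtain ⟨a, ha⟩ : ∃ a, Nat.size (2 * m) = a + 1 :=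
    Nat.exists_eq_succ_of_ne_zero (by rw [Ne, Nat.size_eq_zero]; omega)
  have hpow : 2 ^ a ≤ 2 * m := Nat.lt_size.1 (by omega)
  have h : a * Real.log 2 ≤ Real.log 2 + Real.log m := by
    rw [← Real.log_pow, ← Real.log_mul (by norm_num) (by positivity)]
    exact Real.log_le_log (by positivity) (by exact_mod_cast hpow)
  rw [div_mul_eq_mul_div, le_div_iff₀ h2, ha]
  push_cast
  linarith

namespace RealRAM

open Prog

/-- Computes in `realVar 0` the perimeter of the convex hull of the polygons. -/
def hullPerimeter : Prog :=
  block [lowerLength 1, .setReal 14 (.var 10), lowerLength (-1), .setReal 0 (.add (.var 14) (.var 10))]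

theorem hullPerimeter_spec : ∃ K, ∀ (k : ℕ) (n : ℕ → ℕ) (V : ℕ → ℕ → Plane) (m : ℕ)
    (s : State), Input 1 k n V s → (∀ i < k, Nat.size (n i) ≤ m) → Nat.size (2 * k) ≤ m → 0 < k →
    (∀ i < k, ∀ j < k, i ≠ j →
      Disjoint (convexHull ℝ (V i '' Set.Iio (n i))) (convexHull ℝ (V j '' Set.Iio (n j)))) →
    {x | ∃ t < k, ∃ j < n t, x = V t j}.Nontrivial →
    Within hullPerimeter (K * ((k + 1) * (m + 1))) s fun s' =>
      IsPerimeter (convexHull ℝ {x | ∃ t < k, ∃ j < n t, x = V t j}) (s'.realVar 0) := by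
  obtain ⟨K₁, hK₁⟩ := lowerLength_spec 1
  obtain ⟨K₂, hK₂⟩ := lowerLength_spec (-1)
  refine ⟨K₁ + K₂ + 8, fun k n V m s h hm hm' hk hd hV => ?_⟩
  set X := (k + 1) * (m + 1) with hX
  have hX₁ : 1 ≤ X := Nat.mul_pos (by omega) (by omega)
  refine Within.mono (T := K₁ * X + (2 + (K₂ * X + (4 + 1)))) ?_ ?_ fun s' _ h => h
  swap
  · rw [Nat.add_mul, Nat.add_mul]; omega
  refine .cons ((hK₁ k n V m s h hm hm' hk hd).imp fun s₁ hA₁ ⟨a, p, ha, haV, hVa, e₁⟩ => ?_)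
  obtain ⟨f₁, f₂, f₃, -⟩ := lowerLength_frame hA₁
  have h₁ : Input 1 k n V s₁ := h.congr f₁ (f₂ 0 (by omega)) (f₂ 1 (by omega)) (f₃ 0 (by omega))
    (f₃ 1 (by omega)) (f₃ 2 (by omega))
  refine .cons ((Within.of_vc (p := .setReal 14 (.var 10))
    (Q := fun s' => s' = s₁.setReal 14 (s₁.realVar 10)) rfl).imp fun s₂ _ e₂ => ?_)
  have h₂ : Input 1 k n V s₂ := by
    rw [e₂]; exact h₁.congr rfl rfl rfl rfl rfl rfl
  have h14 : s₂.realVar 14 = s₁.realVar 10 := by rw [e₂]; simp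
  refine .cons ((hK₂ k n _ m s₂ h₂.neg hm hm' hk ?_).imp
    fun s₃ hA₃ ⟨b, q, hb, hbV, hVb, e₃⟩ => ?_)
  · intro i hi j hj hij
    have e : ∀ i, (fun j => -V i j) '' Set.Iio (n i) = -(V i '' Set.Iio (n i)) := fun i => by
      rw [← Set.image_neg_eq_neg, Set.image_image]
    rw [e, e, convexHull_neg, convexHull_neg, ← Set.image_neg_eq_neg, ← Set.image_neg_eq_neg]
    exact (Set.disjoint_image_iff neg_injective).2 (hd i hi j hj hij)
  · refine .of_vc (p := block [_]) ?_
    -- The length of the lower hull waits in `realVar 14`, which the second run does not touch.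
    simp only [block, vc, RExp.eval, (lowerLength_frame hA₃).2.2.2, h14, e₁, e₃,
      setReal_realVar, if_true]
    refine isPerimeter_of_arcs hV ha hb haV (fun j hj => ?_) ?_ ?_
    · obtain ⟨t, ht, i, hi, e⟩ := hbV j hj
      exact ⟨t, ht, i, hi, by rw [e, neg_neg]⟩
    · rintro _ ⟨t, ht, j, hj, rfl⟩
      exact hVa t ht j hj
    · rintro _ ⟨t, ht, j, hj, rfl⟩
      exact hVb t ht j hj

end RealRAM

/-- Two vertices belong either to one polygon, whose vertices are distinct, or to two disjoint
polygons. This excludes the one-point hull, for which gluing the two chains would give an empty list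
of vertices. -/
theorem nontrivial_vertices {k : ℕ} {n : ℕ → ℕ} {V : ℕ → ℕ → Plane}
    (hV : ∀ i < k, ConvexCycle (n i) (V i))
    (hd : ∀ i < k, ∀ j < k, i ≠ j →
      Disjoint (convexHull ℝ (V i '' Set.Iio (n i))) (convexHull ℝ (V j '' Set.Iio (n j))))
    (hm : 2 ≤ ∑ i ∈ Finset.range k, n i) : {x | ∃ t < k, ∃ j < n t, x = V t j}.Nontrivial := by
  by_cases h : ∃ i < k, 2 ≤ n i
  · obtain ⟨i, hi, hn⟩ := h
    exact ⟨V i 0, ⟨i, hi, 0, by omega, rfl⟩, V i 1, ⟨i, hi, 1, by omega, rfl⟩, fun e =>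
      zero_ne_one ((hV i hi).inj (by omega) (by omega) e)⟩
  · push Not at h
    have hk : 2 ≤ k := hm.trans ((Finset.sum_le_card_nsmul _ _ 1 fun i hi => by
      have := h i (Finset.mem_range.1 hi)
      omega).trans (by simp))
    have h₀ := (hV 0 (by omega)).pos
    have h₁ := (hV 1 (by omega)).pos
    refine ⟨V 0 0, ⟨0, by omega, 0, h₀, rfl⟩, V 1 0, ⟨1, by omega, 0, h₁, rfl⟩, fun e => ?_⟩
    exact Set.disjoint_left.1 (hd 0 (by omega) 1 (by omega) (by omega))
      (subset_convexHull ℝ _ ⟨0, h₀, rfl⟩) (e ▸ subset_convexHull ℝ _ ⟨0, h₁, rfl⟩)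

theorem convexHull_iUnion_region {k : ℕ} {n : Fin k → ℕ} {v : (i : Fin k) → Fin (n i) → Plane}
    {n' : ℕ → ℕ} {V : ℕ → ℕ → Plane} (hn : ∀ i : Fin k, n' i = n i)
    (hV : ∀ (i : Fin k) (j : Fin (n i)), V i j = v i j) :
    convexHull ℝ (⋃ i, region (v i)) = convexHull ℝ {x | ∃ t < k, ∃ j < n' t, x = V t j} := by
  refine subset_antisymm (convexHull_min (Set.iUnion_subset fun i => convexHull_mono ?_)
    (convex_convexHull ℝ _)) (convexHull_mono ?_)
  · rintro _ ⟨j, rfl⟩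
    exact ⟨i, i.2, j, by rw [hn]; exact j.2, (hV i j).symm⟩
  · rintro _ ⟨t, ht, j, hj, rfl⟩
    have hj' : j < n ⟨t, ht⟩ := by rw [← hn]; exact hj
    exact Set.mem_iUnion.2 ⟨⟨t, ht⟩, subset_convexHull ℝ _ ⟨⟨j, hj'⟩, (hV ⟨t, ht⟩ ⟨j, hj'⟩).symm⟩⟩

theorem mainTheorem4 :
    ∃ (P : RealRAM.Prog) (C : ℝ),
      ∀ (k : ℕ) (n : Fin k → ℕ) (v : (i : Fin k) → Fin (n i) → Plane) (m : ℕ)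
        (s : RealRAM.State),
        (∀ i, IsConvexPolygon (v i)) →
        Pairwise (fun i j => Disjoint (region (v i)) (region (v j))) →
        m = ∑ i, n i →
        2 ≤ m →
        Stores s v →
        ∃ (t : ℕ) (s' : RealRAM.State),
          RealRAM.Exec P s t s' ∧
          (t : ℝ) ≤ C * k * Real.log m ∧
          IsPerimeter (convexHull ℝ (⋃ i, region (v i))) (s'.realVar 0) := by
  obtain ⟨K, hK⟩ := RealRAM.hullPerimeter_spec
  -- The factor `2` comes from `k + 1 ≤ 2 * k`, and `4 / log 2` from `size_two_mul_le`.
  refine ⟨RealRAM.hullPerimeter, K * 2 * (4 / Real.log 2), fun k n v m s hv hd hm hm₂ hs => ?_⟩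
  obtain ⟨n', V, hn, hV⟩ := exists_extension v
  have hI := hs.input hv hn hV
  have hd' : ∀ i < k, ∀ j < k, i ≠ j →
      Disjoint (convexHull ℝ (V i '' Set.Iio (n' i))) (convexHull ℝ (V j '' Set.Iio (n' j))) := by
    intro i hi j hj hij
    have : Disjoint (region (v ⟨i, hi⟩)) (region (v ⟨j, hj⟩)) :=
      hd (i := ⟨i, hi⟩) (j := ⟨j, hj⟩) (by simpa using hij)
    rw [region_eq (hV ⟨i, hi⟩), region_eq (hV ⟨j, hj⟩), ← hn, ← hn] at this
    exact this
  have hsum : ∑ i ∈ Finset.range k, n' i = m := by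
    rw [hm, Finset.sum_range]
    exact Finset.sum_congr rfl fun i _ => hn i
  have hle : ∀ i < k, n' i ≤ m := fun i hi => by
    rw [← hsum]
    exact Finset.single_le_sum (fun _ _ => Nat.zero_le _) (Finset.mem_range.2 hi)
  have hkm : k ≤ m := by
    rw [← hsum]
    simpa using Finset.card_nsmul_le_sum (Finset.range k) n' 1
      fun i hi => (hI.cycle i (Finset.mem_range.1 hi)).pos
  have hk : 0 < k := by
    rcases Nat.eq_zero_or_pos k with rfl | h
    · simp at hsum; omega
    · exact h
  -- Since `k ≤ m` and every polygon has at most `m` vertices, the binary length of `2 * m` bounds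
  -- the depth of the tree with `2 * k` leaves and all binary searches.
  obtain ⟨t, s', he, ht, hp⟩ := hK k n' V (Nat.size (2 * m)) s hI
    (fun i hi => Nat.size_le_size ((hle i hi).trans (by omega))) (Nat.size_le_size (by omega)) hk hd'
    (nontrivial_vertices hI.cycle hd' (by omega))
  refine ⟨t, s', he, ?_, by rw [convexHull_iUnion_region hn hV]; exact hp⟩
  have hk' : ((k + 1 : ℕ) : ℝ) ≤ 2 * k := by exact_mod_cast (by omega : k + 1 ≤ 2 * k)
  calc (t : ℝ) ≤ K * (((k + 1 : ℕ) : ℝ) * ((Nat.size (2 * m) + 1 : ℕ) : ℝ)) := by exact_mod_cast ht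
    _ ≤ K * (2 * k * (4 / Real.log 2 * Real.log m)) := by
      gcongr
      exact size_two_mul_le hm₂
    _ = K * 2 * (4 / Real.log 2) * k * Real.log m := by ring
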